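/- **Setting.** Let $Z\in\{0,1\}$ be a treatment, $X$ covariates (in a standard Borel space), $S_1,S_0,Y_1,Y_0$ real potential values of a post-treatment variable $S$ and an outcome $Y$ with $Y_1,Y_0$ integrable; $V=(Y,S,Z,X)$ with $S=S_Z$, $Y=Y_Z$ is observed. Assume treatment ignorability $Z\perp (S_0,S_1,Y_0,Y_1)\mid X$, principal ignorability ($\mathbb E(Y_1\mid S_1=s_1,S_0=s_0,X)$ does not depend on $s_0$, and $\mathbb E(Y_0\mid S_1=s_1,S_0=s_0,X)$ does not depend on $s_1$), and $\mathbb P(S_1\le s_1,S_0\le s_0\mid X)=\mathbb C\{\mathbb P(S_1\le s_1\mid X),\mathbb P(S_0\le s_0\mid X)\}$ for a known copula $\mathbb C$ with density $c=\partial^2\mathbb C/\partial u\partial v$. Let $\pi(x)=\mathbb P(Z=1\mid X=x)\in(0,1)$; let $p_z(\cdot,x)$ be the density and $\mathbb F_z(\cdot,x)$ the distribution function of $S$ given $Z=z,X=x$; let $\mu_1(s,x)=\mathbb E(Y\mid Z=1,S=s,X=x)$ and $e(s_1,s_0,x)=c(\mathbb F_1(s_1,x),\mathbb F_0(s_0,x))\,p_1(s_1,x)\,p_0(s_0,x)$;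 let $\dot c_u,\dot c_v$ be the partial derivatives of $c$ and write $c,\dot c_u,\dot c_v(s_1,s_0,x)$ for their values at $(\mathbb F_1(s_1,x),\mathbb F_0(s_0,x))$. Let $m_1(s_1,s_0)=\mathbb E(Y_1\mid S_1=s_1,S_0=s_0)$, let $w_1\ge 0$ be a measurable weight function, $f_1(s_1,s_0;\eta)$, $\eta\in\mathbb R^q$, a working model, measurable in $(s_1,s_0)$, with gradient $\dot f_1$ and Hessian $\ddot f_1$ in $\eta$, and let $$\eta_1=\arg\min_{\eta\in\mathbb R^q}\mathbb E\big[w_1(S_1,S_0)\{m_1(S_1,S_0)-f_1(S_1,S_0;\eta)\}^2\big]$$ be the unique minimizer. **Regularity.** There are $r>0$, $\delta\in(0,1)$ and measurable $b,\bar c$ such that: $f_1(s_1,s_0;\cdot)$ is $C^2$ on the ball of radius $r$ around $\eta_1$, where it and its first two derivatives are bounded by $b(s_1,s_0)$; $c$ is $C^1$ on $(0,1)^2$; whenever $u,v\in(0,1)$, $|u'-u|\le\delta u(1-u)$, $|v'-v|\le\delta v(1-v)$, the numbers $c(u',v')$, $u(1-u)|\dot c_u(u',v')|$, $v(1-v)|\dot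 c_v(u',v')|$ are at most $\bar c(u,v)$; and $$\mathbb E\iint w_1(s_1,s_0)\{b(s_1,s_0)+\mathbb E(|Y|\mid Z=1,S=s_1,X)\}^2\,\bar c(\mathbb F_1(s_1,X),\mathbb F_0(s_0,X))\,p_1(s_1,X)\,p_0(s_0,X)\,ds_1ds_0<\infty .$$ The matrix $H_1$ below is invertible and $\ell_1+\ell_2+\ell_3$ below is square integrable. **Terms.** Put $$\nu_1(s_1,s_0,x)=w_1(s_1,s_0)\dot f_1(s_1,s_0;\eta_1)e(s_1,s_0,x)\{\mu_1(s_1,x)-f_1(s_1,s_0;\eta_1)\},$$ $$r_u(s_1,s_0,S,x)=1-\tfrac{\dot c_u(s_1,s_0,x)}{c(s_1,s_0,x)}\{1(S\le s_1)-\mathbb F_1(s_1,x)\},\qquad r_v(s_1,s_0,S,x)=1-\tfrac{\dot c_v(s_1,s_0,x)}{c(s_1,s_0,x)}\{1(S\le s_0)-\mathbb F_0(s_0,x)\},$$ $$H_1=\mathbb E\big(w_1(S_1,S_0)[\dot f_1\dot f_1^{\,T}-\{m_1(S_1,S_0)-f_1\}\ddot f_1](S_1,S_0;\eta_1)\big),\qquad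 \ell_1(X)=\iint\nu_1(s_1,s_0,X)\,ds_1ds_0,$$ $$\ell_2(S,Z,X)=\frac{Z}{\pi(X)}\Big\{\frac{\int\nu_1(S,s_0,X)ds_0}{p_1(S,X)}-\iint\nu_1(s_1,s_0,X)r_u(s_1,s_0,S,X)ds_1ds_0\Big\}+\frac{1-Z}{1-\pi(X)}\Big\{\frac{\int\nu_1(s_1,S,X)ds_1}{p_0(S,X)}-\iint\nu_1(s_1,s_0,X)r_v(s_1,s_0,S,X)ds_1ds_0\Big\},$$ $$\ell_3(Y,S,Z,X)=\frac{Z}{\pi(X)}\,\frac{\int w_1(S,s_0)\dot f_1(S,s_0;\eta_1)e(S,s_0,X)ds_0}{p_1(S,X)}\{Y-\mu_1(S,X)\}.$$ **Claim.** (a) The objective is $C^2$ near $\eta_1$ and its Hessian at $\eta_1$ is $2H_1$. (b) Under the nonparametric model for the law $P$ of $V$, the efficient influence function of $\eta_1$ is $$\varphi_1(V)=H_1^{-1}\{\ell_1(X)+\ell_2(S,Z,X)+\ell_3(Y,S,Z,X)\}.$$ Here a regular submodel is a family of laws $P_\theta$ which near $\theta=0$ are $P_\theta=L_\theta P$ with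 $\sup_v|L_\theta(v)-1|\le B|\theta|$ for some constant $B$ and $L_\theta(v)$ differentiable at $\theta=0$ for every $v$; its score is $\mathfrak s(v)=\partial_\theta L_\theta(v)|_{\theta=0}$; the tangent space is the closed linear span in $L^2(P)$ of all these scores. That $\varphi_1$ is the efficient influence function means: $\varphi_1$ is square integrable with mean zero, its coordinates lie in the tangent space, and for every regular submodel along which the parameter $\eta_{1,\theta}$ exists for $\theta$ near $0$ and is continuous at $0$, $\theta\mapsto\eta_{1,\theta}$ is differentiable at $0$ with derivative $\mathbb E\{\varphi_1(V)\mathfrak s(V)\}$. (c) For all sufficiently small $\rho>0$ the same holds when the minimization is over the closed ball of radius $\rho$ around $\eta_1$, and this local parameter exists uniquely, for $\theta$ near $0$ and continuously at $0$, along every family of full-data laws that satisfy the assumptions above and whose observed-data laws form a regular submodel. -/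

import Mathlib

open MeasureTheory ProbabilityTheory Filter Topology Set
open scoped ENNReal

noncomputable section

namespace ProjEIF

/-! ### Data spaces -/

/-- The observed data `V = (Y, S, Z, X)`; the binary treatment is `Z : Bool`, `true` meaning `1`. -/
abbrev Obs (𝒳 : Type*) := ℝ × ℝ × Bool × 𝒳

/-- The full data `(Y₁, Y₀, S₁, S₀, Z, X)`. -/
abbrev FullData (𝒳 : Type*) := ℝ × ℝ × ℝ × ℝ × Bool × 𝒳

section coordinates

variable {𝒳 : Type*}

def Y1 (ω : FullData 𝒳) : ℝ := ω.1
def Y0 (ω : FullData 𝒳) : ℝ := ω.2.1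
def S1 (ω : FullData 𝒳) : ℝ := ω.2.2.1
def S0 (ω : FullData 𝒳) : ℝ := ω.2.2.2.1
def Zv (ω : FullData 𝒳) : Bool := ω.2.2.2.2.1
def Xv (ω : FullData 𝒳) : 𝒳 := ω.2.2.2.2.2

/-- What is observed: `(Y_Z, S_Z, Z, X)`. -/
def observe (ω : FullData 𝒳) : Obs 𝒳 :=
  (if Zv ω = true then Y1 ω else Y0 ω, if Zv ω = true then S1 ω else S0 ω, Zv ω, Xv ω)

variable [MeasurableSpace 𝒳]

theorem measurable_Xv : Measurable (Xv (𝒳 := 𝒳)) :=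
  measurable_snd.comp (measurable_snd.comp (measurable_snd.comp
    (measurable_snd.comp measurable_snd)))

/-- The σ-algebra of the covariates `X`. -/
abbrev sigmaX : MeasurableSpace (FullData 𝒳) := MeasurableSpace.comap Xv inferInstance

theorem sigmaX_le :
    sigmaX (𝒳 := 𝒳) ≤ (inferInstance : MeasurableSpace (FullData 𝒳)) := measurable_Xv.comap_le

/-- The σ-algebra of the principal stratum `U = (S₁, S₀)`. -/
abbrev sigmaU : MeasurableSpace (FullData 𝒳) :=
  MeasurableSpace.comap (fun ω => (S1 ω, S0 ω)) inferInstance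

/-- The σ-algebra of `(U, X)`. -/
abbrev sigmaUX : MeasurableSpace (FullData 𝒳) :=
  MeasurableSpace.comap (fun ω => (S1 ω, S0 ω, Xv ω)) inferInstance

end coordinates

/-! ### Copulas -/

/-- A bivariate copula (only its values on `[0,1]²` matter). -/
structure Copula where
  toFun : ℝ → ℝ → ℝ
  zero_left : ∀ v ∈ Icc (0 : ℝ) 1, toFun 0 v = 0
  zero_right : ∀ u ∈ Icc (0 : ℝ) 1, toFun u 0 = 0
  one_left : ∀ v ∈ Icc (0 : ℝ) 1, toFun 1 v = v
  one_right : ∀ u ∈ Icc (0 : ℝ) 1, toFun u 1 = u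
  two_increasing : ∀ u ∈ Icc (0 : ℝ) 1, ∀ u' ∈ Icc (0 : ℝ) 1, ∀ v ∈ Icc (0 : ℝ) 1,
    ∀ v' ∈ Icc (0 : ℝ) 1, u ≤ u' → v ≤ v' →
      0 ≤ toFun u' v' - toFun u v' - toFun u' v + toFun u v

/-- `c` is the density of the copula `C`, i.e. `c = ∂²C/∂u∂v`, with `C` recovered from `c` by
integration. -/
structure IsCopulaDensity (C : Copula) (c : ℝ → ℝ → ℝ) : Prop where
  measurable : Measurable (Function.uncurry c)
  nonneg : ∀ u ∈ Ioo (0 : ℝ) 1, ∀ v ∈ Ioo (0 : ℝ) 1, 0 ≤ c u v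
  integral_eq : ∀ u ∈ Icc (0 : ℝ) 1, ∀ v ∈ Icc (0 : ℝ) 1,
    ENNReal.ofReal (C.toFun u v) = ∫⁻ s in Ioo 0 u, ∫⁻ t in Ioo 0 v, ENNReal.ofReal (c s t)

/-! ### The law of the observed data, factorized as `p(X) p(Z ∣ X) p(S ∣ Z, X) p(Y ∣ S, Z, X)` -/

/-- The components of an observed-data law with overlap and a continuous post-treatment
variable. -/
structure ObsModel (𝒳 : Type*) [MeasurableSpace 𝒳] where
  /-- the law of `X` -/
  PX : Measure 𝒳
  isProb : IsProbabilityMeasure PX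
  /-- the treatment probability `π(x) = P(Z = 1 ∣ X = x)` -/
  prop : 𝒳 → ℝ
  prop_meas : Measurable prop
  prop_pos : ∀ x, 0 < prop x
  prop_lt_one : ∀ x, prop x < 1
  /-- `p z s x` is the density of `S` given `Z = z`, `X = x`, at `s` -/
  p : Bool → ℝ → 𝒳 → ℝ
  p_meas : ∀ z, Measurable (Function.uncurry (p z))
  p_nonneg : ∀ z s x, 0 ≤ p z s x
  p_lintegral : ∀ z x, ∫⁻ s, ENNReal.ofReal (p z s x) = 1
  /-- the conditional law of `Y` given `(S, Z, X)` -/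
  κ : Kernel (ℝ × Bool × 𝒳) ℝ
  isMarkov : IsMarkovKernel κ

attribute [instance] ObsModel.isProb ObsModel.isMarkov

namespace ObsModel

variable {𝒳 : Type*} [MeasurableSpace 𝒳] (M : ObsModel 𝒳)

/-- `P(Z = z ∣ X = x)`. -/
def propZ (z : Bool) (x : 𝒳) : ℝ := if z = true then M.prop x else 1 - M.prop x

/-- The law of `(S, Z, X)`. -/
def lawSZX : Measure (ℝ × Bool × 𝒳) :=
  ((volume : Measure ℝ).prod ((Measure.count : Measure Bool).prod M.PX)).withDensity
    fun t => ENNReal.ofReal (M.propZ t.2.1 t.2.2 * M.p t.2.1 t.1 t.2.2)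

/-- The law of `V = (Y, S, Z, X)`. -/
def law : Measure (Obs 𝒳) := (M.lawSZX ⊗ₘ M.κ).map Prod.swap

/-- The conditional distribution function `F_z(s, x) = P(S ≤ s ∣ Z = z, X = x)`. -/
def F (z : Bool) (s : ℝ) (x : 𝒳) : ℝ := ∫ t in Iic s, M.p z t x

/-- The outcome mean `μ₁(s, x) = E(Y ∣ Z = 1, S = s, X = x)`. -/
def mu1 (s : ℝ) (x : 𝒳) : ℝ := ∫ y, y ∂(M.κ (s, true, x))

/-- `E(|Y| ∣ Z = 1, S = s, X = x)`. -/
def absMean1 (s : ℝ) (x : 𝒳) : ℝ≥0∞ := ∫⁻ y, ‖y‖ₑ ∂(M.κ (s, true, x))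

/-- The principal density `e(s₁, s₀, x) = c(F₁(s₁, x), F₀(s₀, x)) p₁(s₁, x) p₀(s₀, x)`. -/
def e (c : ℝ → ℝ → ℝ) (s1 s0 : ℝ) (x : 𝒳) : ℝ :=
  c (M.F true s1 x) (M.F false s0 x) * M.p true s1 x * M.p false s0 x

/-- `r_u(s₁, s₀, S, x)`. -/
def ru (c : ℝ → ℝ → ℝ) (s1 s0 S : ℝ) (x : 𝒳) : ℝ :=
  1 - deriv (fun u => c u (M.F false s0 x)) (M.F true s1 x)
        / c (M.F true s1 x) (M.F false s0 x)
      * ((if S ≤ s1 then 1 else 0) - M.F true s1 x)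

/-- `r_v(s₁, s₀, S, x)`. -/
def rv (c : ℝ → ℝ → ℝ) (s1 s0 S : ℝ) (x : 𝒳) : ℝ :=
  1 - deriv (fun v => c (M.F true s1 x) v) (M.F false s0 x)
        / c (M.F true s1 x) (M.F false s0 x)
      * ((if S ≤ s0 then 1 else 0) - M.F false s0 x)

end ObsModel

/-! ### The causal model -/

section causal

variable {𝒳 : Type*} [MeasurableSpace 𝒳] [StandardBorelSpace 𝒳]

/-- The full-data law `Q` satisfies treatment ignorability, the copula specification of the joint
law of `(S₁, S₀)` given `X`, and principal ignorability. -/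
structure IsCausalModel (C : Copula) (Q : Measure (FullData 𝒳)) [IsProbabilityMeasure Q] :
    Prop where
  integrable_Y1 : Integrable Y1 Q
  integrable_Y0 : Integrable Y0 Q
  /-- `Z ⫫ (S₀, S₁, Y₀, Y₁) ∣ X` -/
  treatment_ignorability :
    CondIndepFun sigmaX sigmaX_le Zv (fun ω => (S0 ω, S1 ω, Y0 ω, Y1 ω)) Q
  /-- `P(S₁ ≤ s₁, S₀ ≤ s₀ ∣ X) = C(P(S₁ ≤ s₁ ∣ X), P(S₀ ≤ s₀ ∣ X))` -/
  copula : ∀ s1 s0 : ℝ,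
    Q[({ω | S1 ω ≤ s1 ∧ S0 ω ≤ s0}.indicator fun _ => (1 : ℝ)) | sigmaX] =ᵐ[Q]
      fun ω => C.toFun (Q[({ω | S1 ω ≤ s1}.indicator fun _ => (1 : ℝ)) | sigmaX] ω)
        (Q[({ω | S0 ω ≤ s0}.indicator fun _ => (1 : ℝ)) | sigmaX] ω)
  /-- `E(Y₁ ∣ S₁ = s₁, S₀ = s₀, X)` does not depend on `s₀` -/
  principal_ignorability1 : ∃ g : ℝ × 𝒳 → ℝ, Measurable g ∧
    Q[Y1 | sigmaUX] =ᵐ[Q] fun ω => g (S1 ω, Xv ω)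
  /-- `E(Y₀ ∣ S₁ = s₁, S₀ = s₀, X)` does not depend on `s₁` -/
  principal_ignorability0 : ∃ g : ℝ × 𝒳 → ℝ, Measurable g ∧
    Q[Y0 | sigmaUX] =ᵐ[Q] fun ω => g (S0 ω, Xv ω)

variable {q : ℕ}

/-- The potential outcome surface at the principal stratum, `m₁(S₁, S₀) = E(Y₁ ∣ U)`. -/
def m1 (Q : Measure (FullData 𝒳)) : FullData 𝒳 → ℝ := Q[Y1 | sigmaU]

/-- The projection objective `E[w₁(S₁, S₀) {m₁(S₁, S₀) - f₁(S₁, S₀; η)}²]`. -/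
def objective (Q : Measure (FullData 𝒳)) (w : ℝ → ℝ → ℝ)
    (f : ℝ → ℝ → EuclideanSpace ℝ (Fin q) → ℝ) (η : EuclideanSpace ℝ (Fin q)) : ℝ≥0∞ :=
  ∫⁻ ω, ENNReal.ofReal (w (S1 ω) (S0 ω) * (m1 Q ω - f (S1 ω) (S0 ω) η) ^ 2) ∂Q

/-- `η` is the unique minimizer over `K` of the projection objective. -/
def IsProjection (Q : Measure (FullData 𝒳)) (w : ℝ → ℝ → ℝ)
    (f : ℝ → ℝ → EuclideanSpace ℝ (Fin q) → ℝ) (K : Set (EuclideanSpace ℝ (Fin q)))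
    (η : EuclideanSpace ℝ (Fin q)) : Prop :=
  η ∈ K ∧ ∀ η' ∈ K, η' ≠ η → objective Q w f η < objective Q w f η'

/-- `η` is the value, at the observed-data law `P`, of the projection parameter with parameter
space `K`: some full-data law in the causal model induces `P`, and `η` is its projection
parameter. -/
def IsProjectionParameter (C : Copula) (w : ℝ → ℝ → ℝ)
    (f : ℝ → ℝ → EuclideanSpace ℝ (Fin q) → ℝ) (K : Set (EuclideanSpace ℝ (Fin q)))
    (P : Measure (Obs 𝒳)) (η : EuclideanSpace ℝ (Fin q)) : Prop :=
  ∃ Q : ProbabilityMeasure (FullData 𝒳), IsCausalModel C (Q : Measure (FullData 𝒳)) ∧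
    (Q : Measure (FullData 𝒳)).map observe = P ∧
      IsProjection (Q : Measure (FullData 𝒳)) w f K η

end causal

/-! ### Efficient influence functions in the nonparametric model -/

section eif

variable {V : Type*} [MeasurableSpace V]

/-- `P_θ` is a one-dimensional regular submodel of the nonparametric model through `P` at `θ = 0`,
with score `s`: near `θ = 0` it has a likelihood ratio `L_θ = dP_θ/dP` whose difference quotients
at `0` are uniformly bounded, with derivative `s` at `θ = 0`. -/
def IsRegularSubmodel (P : Measure V) (Pθ : ℝ → Measure V) (s : V → ℝ) : Prop :=
  ∃ (L : ℝ → V → ℝ) (δ B : ℝ), 0 < δ ∧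
    (∀ θ, |θ| < δ → IsProbabilityMeasure (Pθ θ) ∧ Measurable (L θ) ∧ (∀ v, 0 ≤ L θ v) ∧
      Pθ θ = P.withDensity (fun v => ENNReal.ofReal (L θ v)) ∧ ∀ v, |L θ v - 1| ≤ B * |θ|) ∧
    ∀ v, HasDerivAt (fun θ => L θ v) (s v) 0

/-- The tangent space of the nonparametric model at `P`: the closed linear span in `L²(P)` of the
scores of the regular submodels. -/
def tangentSpace (P : Measure V) : Submodule ℝ (Lp ℝ 2 P) :=
  (Submodule.span ℝ {g : Lp ℝ 2 P | ∃ (Pθ : ℝ → Measure V) (s : V → ℝ),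
    IsRegularSubmodel P Pθ s ∧ g =ᵐ[P] s}).topologicalClosure

/-- `φ` is the efficient influence function at `P`, under the nonparametric model, of the parameter
`ψ` (`ψ P' η` says that the parameter takes the value `η` at `P'`), which has the value `η₀` at
`P`. -/
structure IsEIF {q : ℕ} (ψ : Measure V → EuclideanSpace ℝ (Fin q) → Prop) (P : Measure V)
    (η₀ : EuclideanSpace ℝ (Fin q)) (φ : V → EuclideanSpace ℝ (Fin q)) : Prop where
  value : ψ P η₀
  memLp : MemLp φ 2 P
  mean_zero : ∫ v, φ v ∂P = 0
  mem_tangentSpace : ∀ i, ∃ g ∈ tangentSpace P, g =ᵐ[P] fun v => φ v i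
  pathwise_derivative : ∀ (Pθ : ℝ → Measure V) (s : V → ℝ), IsRegularSubmodel P Pθ s →
    ∀ ηθ : ℝ → EuclideanSpace ℝ (Fin q), ηθ 0 = η₀ → ContinuousAt ηθ 0 →
      (∀ᶠ θ in 𝓝 0, ψ (Pθ θ) (ηθ θ)) → HasDerivAt ηθ (∫ v, s v • φ v ∂P) 0

end eif

/-! ### The components of the influence function -/

section formula

variable {q : ℕ}

/-- The Hessian matrix of a function of `η`. -/
def hessian (g : EuclideanSpace ℝ (Fin q) → ℝ) (η : EuclideanSpace ℝ (Fin q)) :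
    Matrix (Fin q) (Fin q) ℝ :=
  Matrix.of fun i j =>
    iteratedFDeriv ℝ 2 g η ![EuclideanSpace.single i 1, EuclideanSpace.single j 1]

variable {𝒳 : Type*} [MeasurableSpace 𝒳]

/-- `H₁ = E(w₁ [ḟ₁ ḟ₁ᵀ - {m₁ - f₁} f̈₁])`, at `(S₁, S₀)` and `η`. -/
def H1 (Q : Measure (FullData 𝒳)) (w : ℝ → ℝ → ℝ)
    (f : ℝ → ℝ → EuclideanSpace ℝ (Fin q) → ℝ) (η : EuclideanSpace ℝ (Fin q)) :
    Matrix (Fin q) (Fin q) ℝ :=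
  Matrix.of fun i j => ∫ ω, w (S1 ω) (S0 ω) *
    (gradient (f (S1 ω) (S0 ω)) η i * gradient (f (S1 ω) (S0 ω)) η j
      - (m1 Q ω - f (S1 ω) (S0 ω) η) * hessian (f (S1 ω) (S0 ω)) η i j) ∂Q

variable (M : ObsModel 𝒳) (c : ℝ → ℝ → ℝ) (w : ℝ → ℝ → ℝ)
  (f : ℝ → ℝ → EuclideanSpace ℝ (Fin q) → ℝ) (η : EuclideanSpace ℝ (Fin q))

/-- `ν₁(s₁, s₀, x) = w₁ ḟ₁ e {μ₁ - f₁}`. -/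
def nu1 (s1 s0 : ℝ) (x : 𝒳) : EuclideanSpace ℝ (Fin q) :=
  (w s1 s0 * M.e c s1 s0 x * (M.mu1 s1 x - f s1 s0 η)) • gradient (f s1 s0) η

/-- `ℓ₁(X)`. -/
def ell1 (x : 𝒳) : EuclideanSpace ℝ (Fin q) := ∫ s1, ∫ s0, nu1 M c w f η s1 s0 x

/-- `ℓ₂(S, Z, X)`. -/
def ell2 (S : ℝ) (Z : Bool) (x : 𝒳) : EuclideanSpace ℝ (Fin q) :=
  ((if Z = true then 1 else 0) / M.prop x) •
      ((M.p true S x)⁻¹ • (∫ s0, nu1 M c w f η S s0 x)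
        - ∫ s1, ∫ s0, M.ru c s1 s0 S x • nu1 M c w f η s1 s0 x)
    + ((if Z = true then 0 else 1) / (1 - M.prop x)) •
      ((M.p false S x)⁻¹ • (∫ s1, nu1 M c w f η s1 S x)
        - ∫ s1, ∫ s0, M.rv c s1 s0 S x • nu1 M c w f η s1 s0 x)

/-- `ℓ₃(Y, S, Z, X)`. -/
def ell3 (Y S : ℝ) (Z : Bool) (x : 𝒳) : EuclideanSpace ℝ (Fin q) :=
  ((if Z = true then 1 else 0) / M.prop x * (Y - M.mu1 S x)) •
    (M.p true S x)⁻¹ • ∫ s0, (w S s0 * M.e c S s0 x) • gradient (f S s0) η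

/-- `D = ℓ₁(X) + ℓ₂(S, Z, X) + ℓ₃(Y, S, Z, X)`. -/
def D (v : Obs 𝒳) : EuclideanSpace ℝ (Fin q) :=
  ell1 M c w f η v.2.2.2 + ell2 M c w f η v.2.1 v.2.2.1 v.2.2.2
    + ell3 M c w f η v.1 v.2.1 v.2.2.1 v.2.2.2

/-- Smoothness and domination: the working model is twice continuously differentiable in a ball
around `η` with envelope `b`, the copula density is continuously differentiable on the open unit
square, and the products of the envelopes are integrable. -/
def RegularityConditions : Prop :=
  ∃ (r δ : ℝ) (b cbar : ℝ → ℝ → ℝ), 0 < r ∧ 0 < δ ∧ δ < 1 ∧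
    Measurable (Function.uncurry b) ∧ Measurable (Function.uncurry cbar) ∧
    -- the working model
    (∀ s1 s0, ContDiffOn ℝ 2 (f s1 s0) (Metric.ball η r)) ∧
    (∀ s1 s0, ∀ η' ∈ Metric.ball η r, ∀ k ≤ 2, ‖iteratedFDeriv ℝ k (f s1 s0) η'‖ ≤ b s1 s0) ∧
    -- the copula density, on boxes around `(u, v)` that shrink towards the boundary of the square
    ContDiffOn ℝ 1 (Function.uncurry c) (Ioo 0 1 ×ˢ Ioo 0 1) ∧
    (∀ u ∈ Ioo (0 : ℝ) 1, ∀ v ∈ Ioo (0 : ℝ) 1, ∀ u' v' : ℝ,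
      |u' - u| ≤ δ * (u * (1 - u)) → |v' - v| ≤ δ * (v * (1 - v)) →
        c u' v' ≤ cbar u v ∧
        u * (1 - u) * |deriv (fun t => c t v') u'| ≤ cbar u v ∧
        v * (1 - v) * |deriv (fun t => c u' t) v'| ≤ cbar u v) ∧
    -- integrability
    ∫⁻ x, (∫⁻ s1, ∫⁻ s0, ENNReal.ofReal (w s1 s0)
        * (ENNReal.ofReal (b s1 s0) + M.absMean1 s1 x) ^ 2
        * ENNReal.ofReal (cbar (M.F true s1 x) (M.F false s0 x))
        * ENNReal.ofReal (M.p true s1 x * M.p false s0 x)) ∂M.PX < ∞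

end formula

end ProjEIF

end

/-! The parameter solves a normal equation that depends on the observed-data law alone, so its
influence function comes from implicit differentiation.

Identification. Treatment ignorability and overlap recover the law of `((X, S_z), Y_z)` by inverse
probability weighting (`map_armData_eq`). The copula then gives `(X, S₁, S₀)` the density `e`
(`map_strataData_eq`), and principal ignorability gives `E(Y₁ ∣ S₁, S₀, X) = μ₁(S₁, X)`
(`condExp_Y1_sigmaUX`). The loss is quadratic in `m₁ = E(μ₁(S₁, X) ∣ S₁, S₀)`, but its gradient and
Hessian in `η` are affine in `m₁`, so their expectations do not change when `m₁` is replaced by `μ₁`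
(`integral_affine_m1`). The first order condition becomes `Φ(P, η) = E ∬ w ḟ e (μ₁ - f) = 0`.

Differentiation. A law `L P` with `L` uniformly close to `1` factorizes like `P`, each factor being
multiplied by a ratio of conditional averages of `L` (`tilt_law`). If `|L - 1| ≤ ε`, each
conditional distribution function `F` moves by at most `4 ε F (1 - F)` (`abs_tiltF_sub_le`); this is
the shape of the boxes on which the copula density is dominated. A single integrable envelope then
makes `(θ, η) ↦ Φ(L_θ P, η)` differentiable at `(0, η₁)`, with derivative `(τ, v) ↦ τ d(s) - H₁ v`
(`hasFDerivAt_expected_score`), where `d(s)` is linear in the score `s`. A root that is continuous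
in `θ` therefore has derivative `H₁⁻¹ d(s)` (`hasDerivAt_of_implicit`).

Representation. The product rule splits `d(s)` into contributions of the covariate law, the two
conditional densities, the two distribution functions inside the copula, and the outcome mean.
Fubini's theorem matches them with `ℓ₁`, `ℓ₂` and `ℓ₃`, giving `d(s) = E(s D)` (`integral_smul_D`).
The same identity with the constant function `1` yields `E(D) = Φ(P, η₁) = 0`, so the influence
function has mean zero. Bounded mean-zero functions are scores of the submodels `1 + θ g` and are
dense among the square integrable mean-zero functions, so the tangent space imposes no further
condition (`mem_tangentSpace_of_integral_eq_zero`).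

Local parameter. At the minimizer `H₁` is positive semidefinite; being invertible it is coercive.
The second derivative is continuous in the law and in `η`, so the objective stays uniformly strongly
convex on a small ball for `θ` near `0`. A unique minimizer then exists, at distance at most a
multiple of `‖Φ(L_θ P, η₁)‖`, which tends to zero (`exists_unique_minimizer`). -/

noncomputable section

namespace ProjEIF

/-! ### Disintegration of the observed-data law by treatment arm -/

namespace ObsModel

variable {𝒳 : Type*} [MeasurableSpace 𝒳] (M : ObsModel 𝒳)

/-- The law of `(X, S_z)`: the covariate law times the conditional density in arm `z`. -/
def jointXS (z : Bool) : Measure (𝒳 × ℝ) :=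
  (M.PX.prod volume).withDensity fun t => ENNReal.ofReal (M.p z t.2 t.1)

/-- The conditional law of the outcome in arm `z`. -/
def outcome (z : Bool) : Kernel (𝒳 × ℝ) ℝ :=
  M.κ.comap (fun t => (t.2, z, t.1)) (by fun_prop)

instance (z : Bool) : IsMarkovKernel (M.outcome z) := by unfold outcome; infer_instance

/-- The law of `((X, S_z), Y_z)`. -/
def full (z : Bool) : Measure ((𝒳 × ℝ) × ℝ) := M.jointXS z ⊗ₘ M.outcome z

/-- The observation with `((X, S), Y)` prescribed, in arm `z`. -/
def obsOf (z : Bool) (u : (𝒳 × ℝ) × ℝ) : Obs 𝒳 := (u.2, u.1.2, z, u.1.1)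

theorem measurable_obsOf (z : Bool) : Measurable (obsOf (𝒳 := 𝒳) z) := by
  unfold obsOf; fun_prop

theorem measurable_p_swap (z : Bool) : Measurable fun t : 𝒳 × ℝ => M.p z t.2 t.1 :=
  (M.p_meas z).comp measurable_swap

theorem measurable_p_left (z : Bool) (x : 𝒳) : Measurable fun s => M.p z s x :=
  (M.p_meas z).comp measurable_prodMk_right

theorem measurable_propZ (z : Bool) : Measurable (M.propZ z) := by
  unfold propZ
  have := M.prop_meas
  cases z <;> simp <;> fun_prop

theorem propZ_pos (z : Bool) (x : 𝒳) : 0 < M.propZ z x := by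
  unfold propZ
  have h1 := M.prop_pos x
  have h2 := M.prop_lt_one x
  cases z
  · simp; linarith
  · simpa

theorem propZ_le_one (z : Bool) (x : 𝒳) : M.propZ z x ≤ 1 := by
  unfold propZ
  have h1 := M.prop_pos x
  have h2 := M.prop_lt_one x
  cases z
  · simp; linarith
  · simp; linarith

theorem lintegral_jointXS (z : Bool) {k : 𝒳 × ℝ → ℝ≥0∞} (hk : Measurable k) :
    ∫⁻ t, k t ∂(M.jointXS z)
      = ∫⁻ x, (∫⁻ s, ENNReal.ofReal (M.p z s x) * k (x, s)) ∂M.PX := by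
  have hp := (M.measurable_p_swap z).ennreal_ofReal
  rw [jointXS, lintegral_withDensity_eq_lintegral_mul _ hp hk, lintegral_prod]
  · rfl
  · exact (hp.mul hk).aemeasurable

instance (z : Bool) : IsProbabilityMeasure (M.jointXS z) := by
  constructor
  rw [← lintegral_one, M.lintegral_jointXS z measurable_const]
  simp [M.p_lintegral]

instance (z : Bool) : IsProbabilityMeasure (M.full z) := by
  unfold full; infer_instance

theorem lintegral_full (z : Bool) {k : (𝒳 × ℝ) × ℝ → ℝ≥0∞} (hk : Measurable k) :
    ∫⁻ u, k u ∂(M.full z)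
      = ∫⁻ x, (∫⁻ s, ENNReal.ofReal (M.p z s x) * ∫⁻ y, k ((x, s), y) ∂(M.κ (s, z, x))) ∂M.PX := by
  rw [full, Measure.lintegral_compProd hk,
    M.lintegral_jointXS z (Measurable.lintegral_kernel_prod_right' hk)]
  rfl

/-- Fubini's theorem with counting measure on the two arms: arm `z` enters with weight `propZ z`.
Later computations with the observed law go through this split. -/
theorem lintegral_law {k : Obs 𝒳 → ℝ≥0∞} (hk : Measurable k) :
    ∫⁻ v, k v ∂M.law
      = ∑ z : Bool, ∫⁻ u, ENNReal.ofReal (M.propZ z u.1.1) * k (obsOf z u) ∂(M.full z) := by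
  have hprop : Measurable fun t : ℝ × Bool × 𝒳 => M.propZ t.2.1 t.2.2 := by
    have h : Measurable fun t : Bool × 𝒳 => M.propZ t.1 t.2 :=
      measurable_from_prod_countable_right fun z => M.measurable_propZ z
    exact h.comp measurable_snd
  have hp : Measurable fun t : ℝ × Bool × 𝒳 => M.p t.2.1 t.1 t.2.2 := by
    have h : Measurable fun t : Bool × (ℝ × 𝒳) => M.p t.1 t.2.1 t.2.2 :=
      measurable_from_prod_countable_right fun z => M.p_meas z
    have h' : Measurable fun t : ℝ × Bool × 𝒳 => (t.2.1, (t.1, t.2.2)) := by fun_prop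
    exact h.comp h'
  have hd : Measurable fun t : ℝ × Bool × 𝒳 =>
      ENNReal.ofReal (M.propZ t.2.1 t.2.2 * M.p t.2.1 t.1 t.2.2) := (hprop.mul hp).ennreal_ofReal
  have hk' : Measurable fun t : (ℝ × Bool × 𝒳) × ℝ => k t.swap := hk.comp measurable_swap
  have hk3 : Measurable fun t : ℝ × Bool × 𝒳 => ∫⁻ y, k (y, t) ∂(M.κ t) :=
    Measurable.lintegral_kernel_prod_right' hk'
  have : SFinite (M.lawSZX) := by unfold lawSZX; infer_instance
  rw [law, lintegral_map hk measurable_swap, Measure.lintegral_compProd hk', lawSZX]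
  simp only [Prod.swap_prod_mk]
  rw [lintegral_withDensity_eq_lintegral_mul _ hd hk3, ← lintegral_prod_swap,
    lintegral_prod]
  swap
  · exact ((hd.mul hk3).comp measurable_swap).aemeasurable
  have hd' := (hd.mul hk3)
  rw [lintegral_prod, lintegral_count, tsum_fintype]
  swap
  · exact (Measurable.lintegral_prod_right' (hd'.comp measurable_swap)).aemeasurable
  refine Finset.sum_congr rfl fun z _ => ?_
  have hkz : Measurable fun u : (𝒳 × ℝ) × ℝ =>
      ENNReal.ofReal (M.propZ z u.1.1) * k (obsOf z u) :=
    ((M.measurable_propZ z).comp (measurable_fst.comp measurable_fst)).ennreal_ofReal.mul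
      (hk.comp (measurable_obsOf z))
  rw [M.lintegral_full z hkz]
  refine lintegral_congr fun x => lintegral_congr fun s => ?_
  simp only [Prod.swap, Pi.mul_apply, obsOf]
  have hky : Measurable fun y => k (y, s, z, x) := hk.comp measurable_prodMk_right
  rw [lintegral_const_mul _ hky,
    ENNReal.ofReal_mul (M.propZ_pos z x).le]
  ring

/-- Stated for measures, the split by arm also applies to vector-valued Bochner integrals. -/
theorem law_eq_sum :
    M.law = ∑ z : Bool,
      ((M.full z).withDensity fun u => ENNReal.ofReal (M.propZ z u.1.1)).map (obsOf z) := by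
  ext A hA
  have hm : ∀ z, Measurable fun u : (𝒳 × ℝ) × ℝ => ENNReal.ofReal (M.propZ z u.1.1) := fun z =>
    ((M.measurable_propZ z).comp (by fun_prop)).ennreal_ofReal
  rw [← lintegral_indicator_one hA, M.lintegral_law (measurable_one.indicator hA)]
  simp only [Fintype.sum_bool, Measure.add_apply]
  have : ∀ z, ∫⁻ u, ENNReal.ofReal (M.propZ z u.1.1) * A.indicator 1 (obsOf z u) ∂(M.full z)
      = (((M.full z).withDensity fun u => ENNReal.ofReal (M.propZ z u.1.1)).map (obsOf z)) A := by
    intro z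
    rw [← lintegral_indicator_one hA,
      lintegral_map (measurable_one.indicator hA) (measurable_obsOf z)]
    exact (lintegral_withDensity_eq_lintegral_mul _ (hm z)
        ((measurable_one.indicator hA).comp (measurable_obsOf z))).symm
  rw [this, this]

instance : IsProbabilityMeasure M.law := by
  constructor
  rw [← lintegral_one, M.lintegral_law measurable_const]
  have h : ∀ z, ∫⁻ u, ENNReal.ofReal (M.propZ z u.1.1) * 1 ∂(M.full z)
      = ∫⁻ x, ENNReal.ofReal (M.propZ z x) ∂M.PX := by
    intro z
    have hm : Measurable fun u : (𝒳 × ℝ) × ℝ => ENNReal.ofReal (M.propZ z u.1.1) * 1 :=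
      (((M.measurable_propZ z).comp (by fun_prop)).ennreal_ofReal).mul_const _
    rw [M.lintegral_full z hm]
    refine lintegral_congr fun x => ?_
    simp only [mul_one, lintegral_const, measure_univ]
    rw [lintegral_mul_const _ (M.measurable_p_left z x).ennreal_ofReal, M.p_lintegral]
    simp
  rw [Fintype.sum_bool, h, h,
    ← lintegral_add_left (M.measurable_propZ true).ennreal_ofReal]
  have : ∀ x, ENNReal.ofReal (M.propZ true x) + ENNReal.ofReal (M.propZ false x) = 1 := by
    intro x
    rw [← ENNReal.ofReal_add (M.propZ_pos _ x).le (M.propZ_pos _ x).le]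
    simp [propZ]
  simp [this]

end ObsModel

/-! ### Potential data in each arm and the observation map -/

section

variable {𝒳 : Type*}

/-- The potential post-treatment value `S_z`. -/
def Spot (z : Bool) (ω : FullData 𝒳) : ℝ := if z = true then S1 ω else S0 ω

/-- The potential outcome `Y_z`. -/
def Ypot (z : Bool) (ω : FullData 𝒳) : ℝ := if z = true then Y1 ω else Y0 ω

/-- `((X, S_z), Y_z)`. -/
def armData (z : Bool) (ω : FullData 𝒳) : (𝒳 × ℝ) × ℝ := ((Xv ω, Spot z ω), Ypot z ω)

theorem observe_of_Zv {z : Bool} {ω : FullData 𝒳} (h : Zv ω = z) :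
    observe ω = ObsModel.obsOf z (armData z ω) := by
  subst h; rfl

variable [MeasurableSpace 𝒳]

theorem measurable_Y1 : Measurable (Y1 (𝒳 := 𝒳)) := by unfold Y1; fun_prop
theorem measurable_Y0 : Measurable (Y0 (𝒳 := 𝒳)) := by unfold Y0; fun_prop
theorem measurable_S1 : Measurable (S1 (𝒳 := 𝒳)) := by unfold S1; fun_prop
theorem measurable_S0 : Measurable (S0 (𝒳 := 𝒳)) := by unfold S0; fun_prop
theorem measurable_Zv : Measurable (Zv (𝒳 := 𝒳)) := by unfold Zv; fun_prop

theorem measurable_Spot (z : Bool) : Measurable (Spot (𝒳 := 𝒳) z) := by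
  cases z
  · exact measurable_S0
  · exact measurable_S1

theorem measurable_Ypot (z : Bool) : Measurable (Ypot (𝒳 := 𝒳) z) := by
  cases z
  · exact measurable_Y0
  · exact measurable_Y1

theorem measurable_armData (z : Bool) : Measurable (armData (𝒳 := 𝒳) z) :=
  (measurable_Xv.prodMk (measurable_Spot z)).prodMk (measurable_Ypot z)

theorem measurableSet_Zv_eq (z : Bool) : MeasurableSet {ω : FullData 𝒳 | Zv ω = z} :=
  measurable_Zv (measurableSet_singleton z)

theorem measurable_observe : Measurable (observe (𝒳 := 𝒳)) := by
  unfold observe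
  refine Measurable.prodMk ?_ (Measurable.prodMk ?_ (measurable_Zv.prodMk measurable_Xv))
  · exact Measurable.ite (measurableSet_Zv_eq true) measurable_Y1 measurable_Y0
  · exact Measurable.ite (measurableSet_Zv_eq true) measurable_S1 measurable_S0

namespace ObsModel
variable (M : ObsModel 𝒳)

theorem map_X_law : M.law.map (fun v => v.2.2.2) = M.PX := by
  ext A hA
  have hX : Measurable fun v : Obs 𝒳 => v.2.2.2 := by fun_prop
  have hA' : Measurable (A.indicator (1 : 𝒳 → ℝ≥0∞)) := measurable_one.indicator hA
  have hAX : Measurable fun v : Obs 𝒳 => A.indicator (1 : 𝒳 → ℝ≥0∞) v.2.2.2 := hA'.comp hX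
  rw [← lintegral_indicator_one hA, lintegral_map hA' hX, M.lintegral_law hAX]
  have h : ∀ z, ∫⁻ u, ENNReal.ofReal (M.propZ z u.1.1) * A.indicator 1 (obsOf z u).2.2.2
      ∂(M.full z) = ∫⁻ x, ENNReal.ofReal (M.propZ z x) * A.indicator 1 x ∂M.PX := by
    intro z
    have hm : Measurable fun u : (𝒳 × ℝ) × ℝ =>
        ENNReal.ofReal (M.propZ z u.1.1) * A.indicator 1 (obsOf z u).2.2.2 :=
      (((M.measurable_propZ z).comp (by fun_prop)).ennreal_ofReal).mul
        (hA'.comp (hX.comp (measurable_obsOf z)))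
    rw [M.lintegral_full z hm]
    refine lintegral_congr fun x => ?_
    simp only [obsOf, lintegral_const, measure_univ, mul_one]
    rw [lintegral_mul_const _ (M.measurable_p_left z x).ennreal_ofReal, M.p_lintegral, one_mul]
  have hpA : Measurable fun x => ENNReal.ofReal (M.propZ true x) * A.indicator 1 x :=
    (M.measurable_propZ true).ennreal_ofReal.mul hA'
  rw [Fintype.sum_bool, h, h, ← lintegral_add_left hpA]
  rw [← lintegral_indicator_one hA]
  refine lintegral_congr fun x => ?_
  have : ENNReal.ofReal (M.propZ true x) + ENNReal.ofReal (M.propZ false x) = 1 := by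
    rw [← ENNReal.ofReal_add (M.propZ_pos _ x).le (M.propZ_pos _ x).le]
    simp [propZ]
  rw [← add_mul, this, one_mul]

end ObsModel

/-! ### Identification of each arm under treatment ignorability -/

section identification

variable {Q : Measure (FullData 𝒳)} {M : ObsModel 𝒳}

theorem map_Xv_eq (hM : Q.map observe = M.law) : Q.map Xv = M.PX := by
  rw [← M.map_X_law, ← hM, Measure.map_map (by fun_prop) measurable_observe]
  rfl

/-- On the event `Zv = z` the data of arm `z` are what is observed. Testing the observed law with a
function extended by zero to the other arm therefore reads off this integral, without any causal
assumption. -/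
theorem setLIntegral_armData (hM : Q.map observe = M.law) (z : Bool)
    {k : (𝒳 × ℝ) × ℝ → ℝ≥0∞} (hk : Measurable k) :
    ∫⁻ ω in {ω | Zv ω = z}, k (armData z ω) ∂Q
      = ∫⁻ u, ENNReal.ofReal (M.propZ z u.1.1) * k u ∂(M.full z) := by
  have hK : Measurable fun v : Obs 𝒳 =>
      if v.2.2.1 = z then k ((v.2.2.2, v.2.1), v.1) else 0 := by
    refine Measurable.ite ?_ (hk.comp (by fun_prop)) measurable_const
    exact (measurable_fst.comp (measurable_snd.comp measurable_snd)) (measurableSet_singleton z)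
  have h1 := M.lintegral_law hK
  rw [← hM, lintegral_map hK measurable_observe, Finset.sum_eq_single z] at h1
  · simp only [ObsModel.obsOf, if_true] at h1
    rw [← h1, ← lintegral_indicator (measurableSet_Zv_eq z)]
    refine lintegral_congr fun ω => ?_
    by_cases h : Zv ω = z
    · rw [indicator_of_mem (by exact h), observe_of_Zv h]
      simp [ObsModel.obsOf]
    · rw [indicator_of_notMem (by exact h), if_neg]
      exact h
  · intro b _ hb
    simp [ObsModel.obsOf, hb]
  · simp

variable [IsProbabilityMeasure Q]

/-- The pair `(Z, X)` is always observed, so the treatment probability is determined by the observed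
law without ignorability. -/
theorem condExp_Zv_eq (hM : Q.map observe = M.law) (z : Bool) :
    (Q⟦Zv ⁻¹' {z} | sigmaX⟧) =ᵐ[Q] fun ω => M.propZ z (Xv ω) := by
  have hint : Integrable (fun ω => M.propZ z (Xv ω)) Q := by
    refine Integrable.of_bound (C := 1)
      ((M.measurable_propZ z).comp measurable_Xv).aestronglyMeasurable (ae_of_all _ fun ω => ?_)
    rw [Real.norm_of_nonneg (M.propZ_pos _ _).le]
    exact M.propZ_le_one _ _
  have hZm : MeasurableSet (Zv (𝒳 := 𝒳) ⁻¹' {z}) := measurableSet_Zv_eq z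
  refine (ae_eq_condExp_of_forall_setIntegral_eq sigmaX_le
    ((integrable_const (1 : ℝ)).indicator hZm) (fun _ _ _ => hint.integrableOn) ?_ ?_).symm
  · rintro s ⟨A, hA, rfl⟩ -
    have hXA : MeasurableSet (Xv (𝒳 := 𝒳) ⁻¹' A) := measurable_Xv hA
    have hk : Measurable fun u : (𝒳 × ℝ) × ℝ => A.indicator (1 : 𝒳 → ℝ≥0∞) u.1.1 :=
      (measurable_one.indicator hA).comp (by fun_prop)
    have h1 := setLIntegral_armData hM z hk
    have hm : Measurable fun u : (𝒳 × ℝ) × ℝ =>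
        ENNReal.ofReal (M.propZ z u.1.1) * A.indicator 1 u.1.1 :=
      (((M.measurable_propZ z).comp (by fun_prop)).ennreal_ofReal).mul hk
    rw [M.lintegral_full z hm] at h1
    have h2 : ∀ x, ∫⁻ s, ENNReal.ofReal (M.p z s x)
        * ∫⁻ y, ENNReal.ofReal (M.propZ z x) * A.indicator 1 x ∂(M.κ (s, z, x))
        = A.indicator (fun x => ENNReal.ofReal (M.propZ z x)) x := by
      intro x
      simp only [lintegral_const, measure_univ, mul_one]
      rw [lintegral_mul_const _ (M.measurable_p_left z x).ennreal_ofReal, M.p_lintegral, one_mul]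
      by_cases hx : x ∈ A <;> simp [hx]
    simp only [h2] at h1
    rw [← map_Xv_eq hM, lintegral_map ((M.measurable_propZ z).ennreal_ofReal.indicator hA)
      measurable_Xv] at h1
    have h3 : ∫⁻ ω in Xv ⁻¹' A, ENNReal.ofReal (M.propZ z (Xv ω)) ∂Q
        = Q (Zv ⁻¹' {z} ∩ Xv ⁻¹' A) := by
      rw [← lintegral_indicator hXA]
      refine Eq.trans ?_ (h1.symm.trans ?_)
      · rfl
      · have : ∀ ω : FullData 𝒳, A.indicator (1 : 𝒳 → ℝ≥0∞) (armData z ω).1.1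
          = (Xv ⁻¹' A).indicator 1 ω := fun ω => rfl
        simp only [this]
        rw [lintegral_indicator_one hXA, Measure.restrict_apply hXA, inter_comm]
        rfl
    rw [integral_eq_lintegral_of_nonneg_ae (ae_of_all _ fun ω => (M.propZ_pos _ _).le)
      hint.aestronglyMeasurable.restrict, h3, integral_indicator hZm]
    simp [Measure.restrict_restrict hZm, Measure.real]
  · exact ((M.measurable_propZ z).comp (comap_measurable Xv)).stronglyMeasurable.aestronglyMeasurable

variable [StandardBorelSpace 𝒳] {C : Copula}

/-- This is where conditional independence enters: restricting to an arm acts on the potential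
variables in the same way as reweighting by the treatment probability. -/
theorem setLIntegral_potential (hQ : IsCausalModel C Q) (hM : Q.map observe = M.law) (z : Bool)
    {k : 𝒳 × (ℝ × ℝ × ℝ × ℝ) → ℝ≥0∞} (hk : Measurable k) :
    ∫⁻ ω in {ω | Zv ω = z}, k (Xv ω, (S0 ω, S1 ω, Y0 ω, Y1 ω)) ∂Q
      = ∫⁻ ω, ENNReal.ofReal (M.propZ z (Xv ω)) * k (Xv ω, (S0 ω, S1 ω, Y0 ω, Y1 ω)) ∂Q := by
  have hW : Measurable fun ω : FullData 𝒳 => (S0 ω, S1 ω, Y0 ω, Y1 ω) :=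
    measurable_S0.prodMk (measurable_S1.prodMk (measurable_Y0.prodMk measurable_Y1))
  have hXW := (measurable_Xv (𝒳 := 𝒳)).prodMk hW
  have hpr : Measurable fun ω : FullData 𝒳 => ENNReal.ofReal (M.propZ z (Xv ω)) :=
    ((M.measurable_propZ z).comp measurable_Xv).ennreal_ofReal
  have key : (Q.restrict {ω | Zv ω = z}).map (fun ω => (Xv ω, (S0 ω, S1 ω, Y0 ω, Y1 ω)))
      = (Q.withDensity fun ω => ENNReal.ofReal (M.propZ z (Xv ω))).map
        (fun ω => (Xv ω, (S0 ω, S1 ω, Y0 ω, Y1 ω))) := by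
    have : IsFiniteMeasure ((Q.restrict {ω | Zv ω = z}).map
      (fun ω => (Xv ω, (S0 ω, S1 ω, Y0 ω, Y1 ω)))) := by infer_instance
    -- Rectangles suffice, because both measures are determined by them. On `A ×ˢ T` the conditional
    -- probability of the intersection factorizes and the treatment probability is pulled out as a
    -- function of `X`.
    refine Measure.ext_prod fun {A T} hA hT => ?_
    rw [Measure.map_apply hXW (hA.prod hT), Measure.map_apply hXW (hA.prod hT)]
    have hpre : (fun ω : FullData 𝒳 => (Xv ω, (S0 ω, S1 ω, Y0 ω, Y1 ω))) ⁻¹' (A ×ˢ T)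
      = Xv ⁻¹' A ∩ (fun ω => (S0 ω, S1 ω, Y0 ω, Y1 ω)) ⁻¹' T := rfl
    have hXA : MeasurableSet (Xv (𝒳 := 𝒳) ⁻¹' A) := measurable_Xv hA
    have hXA' : MeasurableSet[sigmaX] (Xv (𝒳 := 𝒳) ⁻¹' A) := ⟨A, hA, rfl⟩
    have hWT := hW hT
    have hZm : MeasurableSet (Zv (𝒳 := 𝒳) ⁻¹' {z}) := measurableSet_Zv_eq z
    rw [hpre, Measure.restrict_apply (hXA.inter hWT), withDensity_apply _ (hXA.inter hWT)]
    have hci := (condIndepFun_iff_condExp_inter_preimage_eq_mul measurable_Zv hW).1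
      hQ.treatment_ignorability {z} T (measurableSet_singleton z) hT
    set WT := (fun ω : FullData 𝒳 => (S0 ω, S1 ω, Y0 ω, Y1 ω)) ⁻¹' T with hWTdef
    have hpm : StronglyMeasurable[sigmaX] fun ω : FullData 𝒳 => M.propZ z (Xv ω) :=
      ((M.measurable_propZ z).comp (comap_measurable Xv)).stronglyMeasurable
    have hi1 : Integrable (WT.indicator fun _ => (1 : ℝ)) Q :=
      (integrable_const (1 : ℝ)).indicator hWT
    have hi0 : Integrable (fun ω => M.propZ z (Xv ω) * WT.indicator (fun _ => (1 : ℝ)) ω) Q := by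
      refine hi1.bdd_mul (c := 1) (hpm.mono sigmaX_le).aestronglyMeasurable
        (ae_of_all _ fun ω => ?_)
      rw [Real.norm_of_nonneg (M.propZ_pos _ _).le]
      exact M.propZ_le_one _ _
    have hpull := condExp_mul_of_stronglyMeasurable_left (μ := Q) hpm hi0 hi1
    have hce : (Q⟦Zv ⁻¹' {z} ∩ WT | sigmaX⟧)
        =ᵐ[Q] Q[(fun ω => M.propZ z (Xv ω)) * WT.indicator fun _ => (1 : ℝ) | sigmaX] := by
      filter_upwards [hci, hpull, condExp_Zv_eq hM z] with ω h1 h2 h3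
      rw [h1, h2, h3]; rfl
    have hint := setIntegral_condExp (μ := Q) sigmaX_le (f := (Zv ⁻¹' {z} ∩ WT).indicator
      fun _ => (1 : ℝ)) ((integrable_const (1 : ℝ)).indicator (hZm.inter hWT)) hXA'
    have hint2 := setIntegral_condExp (μ := Q) sigmaX_le hi0 hXA'
    rw [setIntegral_congr_ae hXA (hce.mono fun ω h _ => h)] at hint
    have hfin := hint.symm.trans hint2
    rw [integral_indicator (hZm.inter hWT), Measure.restrict_restrict (hZm.inter hWT)] at hfin
    simp only [integral_const, smul_eq_mul, mul_one] at hfin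
    rw [measureReal_restrict_apply_univ] at hfin
    have hset : Xv ⁻¹' A ∩ WT ∩ {ω | Zv ω = z} = Zv ⁻¹' {z} ∩ WT ∩ Xv ⁻¹' A := by
      ext ω; simp only [mem_inter_iff, mem_preimage, mem_ofPred_eq, mem_singleton_iff]; tauto
    rw [hset, ← ENNReal.ofReal_toReal (measure_ne_top Q _)]
    change ENNReal.ofReal (Q.real _) = _
    rw [hfin, ofReal_integral_eq_lintegral_ofReal hi0.integrableOn
      (ae_of_all _ fun ω => mul_nonneg (M.propZ_pos _ _).le (indicator_nonneg (by simp) _)),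
      inter_comm, ← Measure.restrict_restrict hWT, ← lintegral_indicator hWT]
    refine lintegral_congr fun ω => ?_
    by_cases h : ω ∈ WT <;> simp [h]
  rw [← lintegral_map (μ := Q.restrict _) hk hXW, key, lintegral_map hk hXW]
  exact lintegral_withDensity_eq_lintegral_mul _ hpr (hk.comp hXW)

/-- Under treatment ignorability the law of `((X, S_z), Y_z)` is identified. -/
theorem map_armData_eq (hQ : IsCausalModel C Q) (hM : Q.map observe = M.law) (z : Bool) :
    Q.map (armData z) = M.full z := by
  ext A hA
  have hpm : Measurable fun u : (𝒳 × ℝ) × ℝ => ENNReal.ofReal (M.propZ z u.1.1) :=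
    ((M.measurable_propZ z).comp (by fun_prop)).ennreal_ofReal
  have hAm : Measurable (A.indicator (1 : (𝒳 × ℝ) × ℝ → ℝ≥0∞)) := measurable_one.indicator hA
  -- Inverse probability weighting: dividing the test function by `propZ` cancels the weight on the
  -- observed side and on the potential side at once.
  have hk : Measurable fun u : (𝒳 × ℝ) × ℝ =>
      (ENNReal.ofReal (M.propZ z u.1.1))⁻¹ * A.indicator 1 u := hpm.inv.mul hAm
  have hcancel : ∀ (x : 𝒳) (t : ℝ≥0∞),
      ENNReal.ofReal (M.propZ z x) * ((ENNReal.ofReal (M.propZ z x))⁻¹ * t) = t := by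
    intro x t
    rw [← mul_assoc, ENNReal.mul_inv_cancel _ ENNReal.ofReal_ne_top, one_mul]
    simpa using M.propZ_pos z x
  have h1 := setLIntegral_armData hM z hk
  simp only [hcancel] at h1
  have hg : Measurable fun t : 𝒳 × (ℝ × ℝ × ℝ × ℝ) =>
      ((t.1, if z = true then t.2.2.1 else t.2.1), if z = true then t.2.2.2.2 else t.2.2.2.1) := by
    cases z <;> simp <;> fun_prop
  have h2 := setLIntegral_potential hQ hM z (hk.comp hg)
  have h3 := h2.symm.trans (Eq.trans ?_ h1)
  · rw [lintegral_indicator_one hA] at h3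
    rw [← h3, ← lintegral_indicator_one hA, lintegral_map hAm (measurable_armData z)]
    refine lintegral_congr fun ω => ?_
    exact (hcancel _ _).symm
  · rfl

end identification

end

/-! ### The probability integral transform for an atomless law -/

section integralTransform

variable (ν : Measure ℝ) [IsProbabilityMeasure ν] [NullSingletonClass ν]

theorem continuous_cdf_of_noAtoms : Continuous (cdf ν) := by
  rw [continuous_iff_continuousAt]
  intro a
  rw [(monotone_cdf ν).continuousAt_iff_leftLim_eq_rightLim]
  have h := (cdf ν).measure_singleton a
  rw [measure_cdf, measure_singleton] at h
  have h1 : cdf ν a - Function.leftLim (cdf ν) a ≤ 0 := ENNReal.ofReal_eq_zero.1 h.symm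
  have h2 := (monotone_cdf ν).leftLim_le (le_refl a)
  rw [(cdf ν).rightLim_eq]
  linarith

/-- The distribution function may have flat pieces. Its sublevel set is the half-line up to the
largest solution of `F = u`, and continuity makes the value there exactly `u`. -/
theorem measure_cdf_le_of_mem_Ioo {u : ℝ} (hu : u ∈ Ioo (0 : ℝ) 1) :
    ν {s | cdf ν s ≤ u} = ENNReal.ofReal u := by
  have hc := continuous_cdf_of_noAtoms ν
  obtain ⟨a, ha⟩ := ((tendsto_cdf_atBot ν).eventually_lt_const hu.1).exists
  obtain ⟨b, hb⟩ := ((tendsto_cdf_atTop ν).eventually_const_lt hu.2).exists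
  obtain ⟨s0, hs0⟩ := mem_range_of_exists_le_of_exists_ge hc ⟨a, ha.le⟩ ⟨b, hb.le⟩
  have hbdd : BddAbove {s | cdf ν s ≤ u} := by
    refine ⟨b, fun s hs => ?_⟩
    by_contra h
    exact absurd ((monotone_cdf ν) (not_le.1 h).le) (not_le.2 (lt_of_le_of_lt hs hb))
  have hcl : IsClosed {s | cdf ν s ≤ u} := isClosed_le hc continuous_const
  have hmem := hcl.csSup_mem ⟨s0, hs0.le⟩ hbdd
  set t := sSup {s | cdf ν s ≤ u}
  have hset : {s | cdf ν s ≤ u} = Iic t := by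
    ext s
    exact ⟨fun h => le_csSup hbdd h, fun h => ((monotone_cdf ν) h).trans hmem⟩
  have ht : cdf ν t = u :=
    le_antisymm hmem (hs0 ▸ (monotone_cdf ν) (le_csSup hbdd hs0.le))
  rw [hset, ← ht, ofReal_cdf]

/-- The probability integral transform: `F(S)` is uniform on `(0, 1)`. -/
theorem map_cdf_eq_uniform : ν.map (cdf ν) = volume.restrict (Ioo 0 1) := by
  have hc := (continuous_cdf_of_noAtoms ν).measurable
  have : IsProbabilityMeasure (ν.map (cdf ν)) := Measure.isProbabilityMeasure_map hc.aemeasurable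
  refine Measure.ext_of_Iic _ _ fun u => ?_
  rw [Measure.map_apply hc measurableSet_Iic, Measure.restrict_apply measurableSet_Iic]
  change ν {s | cdf ν s ≤ u} = _
  rcases le_or_gt u 0 with h0 | h0
  · have h1 : Iic u ∩ Ioo (0 : ℝ) 1 = ∅ := by
      ext s; simp only [mem_inter_iff, mem_Iic, mem_Ioo, mem_empty_iff_false, iff_false]
      rintro ⟨h, h', -⟩; linarith
    rw [h1, measure_empty]
    -- No mass sits at levels `u ≤ 0`: such a sublevel set lies inside those of arbitrarily small
    -- positive levels, whose mass is already known.
    refine le_antisymm (ENNReal.le_of_forall_pos_le_add fun ε hε _ => ?_) zero_le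
    have hε' : (0 : ℝ) < ε := hε
    have hm : min (ε : ℝ) (1 / 2) ∈ Ioo (0 : ℝ) 1 :=
      ⟨lt_min hε' (by norm_num), (min_le_right _ _).trans_lt (by norm_num)⟩
    rw [zero_add]
    calc ν {s | cdf ν s ≤ u} ≤ ν {s | cdf ν s ≤ min (ε : ℝ) (1 / 2)} :=
          measure_mono fun s hs => (hs.trans h0).trans hm.1.le
      _ = ENNReal.ofReal (min (ε : ℝ) (1 / 2)) := measure_cdf_le_of_mem_Ioo ν hm
      _ ≤ ENNReal.ofReal ε := ENNReal.ofReal_le_ofReal (min_le_left _ _)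
      _ = ε := ENNReal.ofReal_coe_nnreal
  rcases lt_or_ge u 1 with h1 | h1
  · rw [measure_cdf_le_of_mem_Ioo ν ⟨h0, h1⟩]
    have : Iic u ∩ Ioo (0 : ℝ) 1 = Ioc 0 u := by
      ext s; simp only [mem_inter_iff, mem_Iic, mem_Ioo, mem_Ioc]
      exact ⟨fun h => ⟨h.2.1, h.1⟩, fun h => ⟨h.2, h.1, h.2.trans_lt h1⟩⟩
    rw [this, Real.volume_Ioc, sub_zero]
  · have : Iic u ∩ Ioo (0 : ℝ) 1 = Ioo 0 1 :=
      inter_eq_right.2 fun s hs => hs.2.le.trans h1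
    rw [this, Real.volume_Ioo]
    have : {s | cdf ν s ≤ u} = univ := eq_univ_of_forall fun s => (cdf_le_one ν s).trans h1
    simp [this]

theorem ae_cdf_mem_Ioo : ∀ᵐ s ∂ν, cdf ν s ∈ Ioo (0 : ℝ) 1 := by
  have hc := (continuous_cdf_of_noAtoms ν).measurable
  have h : ∀ᵐ u ∂(ν.map (cdf ν)), u ∈ Ioo (0 : ℝ) 1 := by
    rw [map_cdf_eq_uniform]
    exact ae_restrict_mem measurableSet_Ioo
  exact ae_of_ae_map hc.aemeasurable h

/-- The half-line below `a` and the set `F ≤ F a` can differ, by a flat piece to the right of `a`,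
but that piece is null. -/
theorem setLIntegral_cdf {g : ℝ → ℝ≥0∞} (hg : Measurable g) (a : ℝ) :
    ∫⁻ s in Iic a, g (cdf ν s) ∂ν = ∫⁻ u in Ioo 0 (cdf ν a), g u := by
  have hc := (continuous_cdf_of_noAtoms ν).measurable
  have hset : (Iic (cdf ν a) ∩ Ioo (0 : ℝ) 1 : Set ℝ) =ᵐ[volume] (Ioo 0 (cdf ν a) : Set ℝ) := by
    have h1 : Ioo 0 (cdf ν a) ⊆ Iic (cdf ν a) ∩ Ioo (0 : ℝ) 1 := fun s hs =>
      ⟨hs.2.le, hs.1, hs.2.trans_le (cdf_le_one ν a)⟩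
    have h2 : Iic (cdf ν a) ∩ Ioo (0 : ℝ) 1 ⊆ Ioc 0 (cdf ν a) := fun s hs => ⟨hs.2.1, hs.1⟩
    exact (h2.eventuallyLE.trans Ioo_ae_eq_Ioc.symm.le).antisymm h1.eventuallyLE
  have hm : ν (cdf ν ⁻¹' Iic (cdf ν a)) = ν (Iic a) := by
    rw [← Measure.map_apply hc measurableSet_Iic, map_cdf_eq_uniform,
      Measure.restrict_apply measurableSet_Iic, measure_congr hset, Real.volume_Ioo, sub_zero,
      ofReal_cdf]
  have hae : Iic a =ᵐ[ν] cdf ν ⁻¹' Iic (cdf ν a) :=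
    ae_eq_of_subset_of_measure_ge (fun s hs => (monotone_cdf ν) hs) hm.le
      measurableSet_Iic.nullMeasurableSet (measure_ne_top _ _)
  rw [setLIntegral_congr hae, ← setLIntegral_map measurableSet_Iic hg hc, map_cdf_eq_uniform,
    Measure.restrict_restrict measurableSet_Iic, setLIntegral_congr hset]

end integralTransform

/-! ### Conditional distribution functions and the principal density -/

namespace ObsModel
variable {𝒳 : Type*} [MeasurableSpace 𝒳] (M : ObsModel 𝒳)

/-- The conditional law of `S` given `Z = z`, `X = x`. -/
def lawS (z : Bool) (x : 𝒳) : Measure ℝ := volume.withDensity fun s => ENNReal.ofReal (M.p z s x)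

instance (z : Bool) (x : 𝒳) : IsProbabilityMeasure (M.lawS z x) := by
  constructor
  rw [lawS, withDensity_apply _ MeasurableSet.univ, Measure.restrict_univ, M.p_lintegral]

instance (z : Bool) (x : 𝒳) : NullSingletonClass (M.lawS z x) := by unfold lawS; infer_instance

theorem integrable_p (z : Bool) (x : 𝒳) : Integrable fun s => M.p z s x := by
  refine ⟨(M.measurable_p_left z x).aestronglyMeasurable, ?_⟩
  rw [hasFiniteIntegral_iff_ofReal (ae_of_all _ fun s => M.p_nonneg z s x), M.p_lintegral]
  exact ENNReal.one_lt_top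

theorem integral_p (z : Bool) (x : 𝒳) : ∫ s, M.p z s x = 1 := by
  rw [integral_eq_lintegral_of_nonneg_ae (ae_of_all _ fun s => M.p_nonneg z s x)
    (M.measurable_p_left z x).aestronglyMeasurable, M.p_lintegral, ENNReal.toReal_one]

theorem F_eq_cdf (z : Bool) (s : ℝ) (x : 𝒳) : M.F z s x = cdf (M.lawS z x) s := by
  rw [cdf_eq_real, Measure.real, lawS, withDensity_apply _ measurableSet_Iic, F,
    integral_eq_lintegral_of_nonneg_ae (ae_of_all _ fun s => M.p_nonneg z s x)
      (M.measurable_p_left z x).aestronglyMeasurable.restrict]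

theorem F_nonneg (z : Bool) (s : ℝ) (x : 𝒳) : 0 ≤ M.F z s x := by
  rw [F_eq_cdf]; exact cdf_nonneg _ _

theorem F_le_one (z : Bool) (s : ℝ) (x : 𝒳) : M.F z s x ≤ 1 := by
  rw [F_eq_cdf]; exact cdf_le_one _ _

theorem measurable_F (z : Bool) : Measurable fun t : 𝒳 × ℝ => M.F z t.2 t.1 := by
  have h : StronglyMeasurable fun u : (𝒳 × ℝ) × ℝ =>
      {u : (𝒳 × ℝ) × ℝ | u.2 ≤ u.1.2}.indicator (fun u => M.p z u.2 u.1.1) u := by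
    refine (Measurable.indicator ?_ ?_).stronglyMeasurable
    · exact (M.p_meas z).comp (measurable_snd.prodMk (measurable_fst.comp measurable_fst))
    · exact measurableSet_le measurable_snd (measurable_snd.comp measurable_fst)
  have heq : (fun t : 𝒳 × ℝ => M.F z t.2 t.1) = fun t => ∫ s,
      {u : (𝒳 × ℝ) × ℝ | u.2 ≤ u.1.2}.indicator (fun u => M.p z u.2 u.1.1) (t, s) := by
    ext t
    rw [F, ← integral_indicator measurableSet_Iic]
    rfl
  rw [heq]
  exact (h.integral_prod_right' (ν := volume)).measurable

/-- The copula density is controlled only on the open square. Points where the density `p` vanishes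
need no control, since `p` is a factor of every integrand involved. -/
theorem ae_F_mem_Ioo (z : Bool) (x : 𝒳) :
    ∀ᵐ s : ℝ, M.p z s x ≠ 0 → M.F z s x ∈ Ioo (0 : ℝ) 1 := by
  have h := ae_cdf_mem_Ioo (M.lawS z x)
  rw [lawS, ae_withDensity_iff (M.measurable_p_left z x).ennreal_ofReal] at h
  filter_upwards [h] with s hs hp
  rw [F_eq_cdf]
  refine hs ?_
  simpa using lt_of_le_of_ne (M.p_nonneg z s x) hp.symm

theorem setLIntegral_F (z : Bool) (x : 𝒳) {g : ℝ → ℝ≥0∞} (hg : Measurable g) (a : ℝ) :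
    ∫⁻ s in Iic a, g (M.F z s x) * ENNReal.ofReal (M.p z s x)
      = ∫⁻ u in Ioo 0 (M.F z a x), g u := by
  have hF : Measurable fun s => M.F z s x := (M.measurable_F z).comp measurable_prodMk_left
  have h := setLIntegral_cdf (M.lawS z x) hg a
  rw [← F_eq_cdf] at h
  rw [← h]
  simp only [← F_eq_cdf]
  rw [lawS, restrict_withDensity measurableSet_Iic,
    lintegral_withDensity_eq_lintegral_mul _ (M.measurable_p_left z x).ennreal_ofReal
      (show Measurable fun s => g (M.F z s x) from hg.comp hF)]
  refine lintegral_congr fun s => ?_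
  simp [mul_comm]

/-- The base measure for `(X, S₁, S₀)`: the covariate law times Lebesgue measure. -/
abbrev base : Measure (𝒳 × ℝ × ℝ) := M.PX.prod (volume.prod volume)

variable {C : Copula} {c : ℝ → ℝ → ℝ}

theorem measurable_e (hc : IsCopulaDensity C c) :
    Measurable fun t : 𝒳 × ℝ × ℝ => M.e c t.2.1 t.2.2 t.1 := by
  have h1 : Measurable fun t : 𝒳 × ℝ × ℝ => M.F true t.2.1 t.1 :=
    (M.measurable_F true).comp (measurable_fst.prodMk (measurable_fst.comp measurable_snd))
  have h0 : Measurable fun t : 𝒳 × ℝ × ℝ => M.F false t.2.2 t.1 :=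
    (M.measurable_F false).comp (measurable_fst.prodMk (measurable_snd.comp measurable_snd))
  have p1 : Measurable fun t : 𝒳 × ℝ × ℝ => M.p true t.2.1 t.1 :=
    (M.measurable_p_swap true).comp (measurable_fst.prodMk (measurable_fst.comp measurable_snd))
  have p0 : Measurable fun t : 𝒳 × ℝ × ℝ => M.p false t.2.2 t.1 :=
    (M.measurable_p_swap false).comp (measurable_fst.prodMk (measurable_snd.comp measurable_snd))
  exact ((hc.measurable.comp (h1.prodMk h0)).mul p1).mul p0

/-- Substituting `u = F₁(s₁)` and `v = F₀(s₀)` turns the integral of `e` over a quadrant into that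
of the copula density over a rectangle. -/
theorem setLIntegral_e (hc : IsCopulaDensity C c) (x : 𝒳) (a b : ℝ) :
    ∫⁻ s1 in Iic a, ∫⁻ s0 in Iic b, ENNReal.ofReal (M.e c s1 s0 x)
      = ENNReal.ofReal (C.toFun (M.F true a x) (M.F false b x)) := by
  have hcm : Measurable (Function.uncurry fun u v => ENNReal.ofReal (c u v)) :=
    hc.measurable.ennreal_ofReal
  rw [hc.integral_eq _ ⟨M.F_nonneg _ _ _, M.F_le_one _ _ _⟩ _ ⟨M.F_nonneg _ _ _, M.F_le_one _ _ _⟩]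
  have hin : Measurable fun u => ∫⁻ v in Ioo 0 (M.F false b x), ENNReal.ofReal (c u v) :=
    Measurable.lintegral_prod_right' hcm
  rw [← M.setLIntegral_F true x hin a]
  refine lintegral_congr fun s1 => ?_
  have hcu : Measurable fun v => ENNReal.ofReal (c (M.F true s1 x) v) :=
    hcm.comp measurable_prodMk_left
  rw [← M.setLIntegral_F false x hcu b, ← lintegral_mul_const']
  · refine lintegral_congr fun s0 => ?_
    rw [e, ENNReal.ofReal_mul' (M.p_nonneg _ _ _), ENNReal.ofReal_mul' (M.p_nonneg _ _ _)]
    ring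
  · exact ENNReal.ofReal_ne_top

end ObsModel

/-! ### Identification of the law of the strata and of the outcome surface -/

section

variable {𝒳 : Type*} [MeasurableSpace 𝒳]

/-- `(X, S₁, S₀)`. -/
def strataData (ω : FullData 𝒳) : 𝒳 × ℝ × ℝ := (Xv ω, S1 ω, S0 ω)

theorem measurable_strataData : Measurable (strataData (𝒳 := 𝒳)) :=
  measurable_Xv.prodMk (measurable_S1.prodMk measurable_S0)

/-- Two measures on `𝒳 × ℝ × ℝ`, the first finite, that agree on products of measurable sets with
lower quadrants are equal. -/
theorem ext_of_prod_Iic_Iic {μ ν : Measure (𝒳 × ℝ × ℝ)} [IsFiniteMeasure μ]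
    (h : ∀ {A : Set 𝒳}, MeasurableSet A → ∀ a b : ℝ,
      μ (A ×ˢ Iic a ×ˢ Iic b) = ν (A ×ˢ Iic a ×ˢ Iic b)) : μ = ν := by
  -- The second measure inherits finiteness: the space is an increasing union of sets on which it
  -- agrees with the first.
  have hfin : IsFiniteMeasure ν := by
    constructor
    have hmono : Monotone fun n : ℕ =>
        ((univ : Set 𝒳) ×ˢ Iic (n : ℝ) ×ˢ Iic (n : ℝ) : Set (𝒳 × ℝ × ℝ)) := by
      intro m n hmn
      have : (m : ℝ) ≤ n := by exact_mod_cast hmn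
      exact prod_mono le_rfl (prod_mono (Iic_subset_Iic.2 this) (Iic_subset_Iic.2 this))
    have huniv : (univ : Set (𝒳 × ℝ × ℝ))
        = ⋃ n : ℕ, ((univ : Set 𝒳) ×ˢ Iic (n : ℝ) ×ˢ Iic (n : ℝ)) := by
      symm
      refine eq_univ_of_forall fun t => mem_iUnion.2 ?_
      obtain ⟨n, hn⟩ := exists_nat_ge (max t.2.1 t.2.2)
      exact ⟨n, mem_univ _, (le_max_left _ _).trans hn, (le_max_right _ _).trans hn⟩
    rw [huniv, hmono.measure_iUnion]
    refine (iSup_le fun n => ?_).trans_lt (measure_lt_top μ univ)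
    rw [← h MeasurableSet.univ]
    exact measure_mono (subset_univ _)
  -- Half-lines determine finite measures on the line, so half-lines are upgraded to measurable sets
  -- one coordinate at a time, with the other coordinates frozen by restriction.
  have h1 : ∀ {A : Set 𝒳} {B : Set ℝ}, MeasurableSet A → MeasurableSet B → ∀ b : ℝ,
      μ (A ×ˢ B ×ˢ Iic b) = ν (A ×ˢ B ×ˢ Iic b) := by
    intro A B hA hB b
    have hm : Measurable fun t : 𝒳 × ℝ × ℝ => t.2.1 := by fun_prop
    have hap : ∀ (ρ : Measure (𝒳 × ℝ × ℝ)) {T : Set ℝ}, MeasurableSet T →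
        (ρ.restrict (A ×ˢ univ ×ˢ Iic b)).map (fun t => t.2.1) T = ρ (A ×ˢ T ×ˢ Iic b) := by
      intro ρ T hT
      rw [Measure.map_apply hm hT, Measure.restrict_apply (hm hT)]
      congr 1
      ext t
      simp only [mem_inter_iff, mem_preimage, mem_prod, mem_univ, true_and]
      tauto
    have heq : (μ.restrict (A ×ˢ univ ×ˢ Iic b)).map (fun t => t.2.1)
        = (ν.restrict (A ×ˢ univ ×ˢ Iic b)).map (fun t => t.2.1) := by
      refine Measure.ext_of_Iic _ _ fun a => ?_
      rw [hap μ measurableSet_Iic, hap ν measurableSet_Iic, h hA]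
    rw [← hap μ hB, heq, hap ν hB]
  refine Measure.ext_prod₃ fun {A B D} hA hB hD => ?_
  have hm : Measurable fun t : 𝒳 × ℝ × ℝ => t.2.2 := by fun_prop
  have hap : ∀ (ρ : Measure (𝒳 × ℝ × ℝ)) {T : Set ℝ}, MeasurableSet T →
      (ρ.restrict (A ×ˢ B ×ˢ univ)).map (fun t => t.2.2) T = ρ (A ×ˢ B ×ˢ T) := by
    intro ρ T hT
    rw [Measure.map_apply hm hT, Measure.restrict_apply (hm hT)]
    congr 1
    ext t
    simp only [mem_inter_iff, mem_preimage, mem_prod, mem_univ, and_true]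
    tauto
  have heq : (μ.restrict (A ×ˢ B ×ˢ univ)).map (fun t => t.2.2)
      = (ν.restrict (A ×ˢ B ×ˢ univ)).map (fun t => t.2.2) := by
    refine Measure.ext_of_Iic _ _ fun a => ?_
    rw [hap μ measurableSet_Iic, hap ν measurableSet_Iic, h1 hA hB]
  rw [← hap μ hD, heq, hap ν hD]

theorem measurable_mu1 (M : ObsModel 𝒳) : Measurable fun t : 𝒳 × ℝ => M.mu1 t.2 t.1 := by
  have h : StronglyMeasurable fun u : (𝒳 × ℝ) × ℝ => u.2 := measurable_snd.stronglyMeasurable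
  exact (h.integral_kernel_prod_right' (κ := M.outcome true)).measurable

theorem sigmaUX_le :
    sigmaUX (𝒳 := 𝒳) ≤ (inferInstance : MeasurableSpace (FullData 𝒳)) :=
  (measurable_S1.prodMk (measurable_S0.prodMk measurable_Xv)).comap_le

theorem sigmaU_le :
    sigmaU (𝒳 := 𝒳) ≤ (inferInstance : MeasurableSpace (FullData 𝒳)) :=
  (measurable_S1.prodMk measurable_S0).comap_le

theorem sigmaU_le_sigmaUX : sigmaU (𝒳 := 𝒳) ≤ sigmaUX := by
  have h : (fun ω : FullData 𝒳 => (S1 ω, S0 ω))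
      = (fun t : ℝ × ℝ × 𝒳 => (t.1, t.2.1)) ∘ fun ω => (S1 ω, S0 ω, Xv ω) := rfl
  rw [sigmaU, h, ← MeasurableSpace.comap_comp]
  exact MeasurableSpace.comap_mono (Measurable.comap_le (by fun_prop))

section identification

variable {Q : Measure (FullData 𝒳)} {M : ObsModel 𝒳} [IsProbabilityMeasure Q]
  [StandardBorelSpace 𝒳] {C : Copula} {c : ℝ → ℝ → ℝ}

theorem map_Xv_Spot_eq (hQ : IsCausalModel C Q) (hM : Q.map observe = M.law) (z : Bool) :
    Q.map (fun ω => (Xv ω, Spot z ω)) = M.jointXS z := by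
  have h := congrArg Measure.fst (map_armData_eq hQ hM z)
  rw [ObsModel.full, Measure.fst_compProd, Measure.fst, Measure.map_map measurable_fst
    (measurable_armData z)] at h
  exact h

/-- It allows the copula assumption, which speaks of conditional probabilities under `Q`, to be read
in terms of the observed-data functions `F`. -/
theorem condExp_Spot_eq (hQ : IsCausalModel C Q) (hM : Q.map observe = M.law) (z : Bool) (s : ℝ) :
    Q[({ω | Spot z ω ≤ s}.indicator fun _ => (1 : ℝ)) | sigmaX] =ᵐ[Q]
      fun ω => M.F z s (Xv ω) := by
  have hFm : Measurable fun x => M.F z s x := (M.measurable_F z).comp measurable_prodMk_right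
  have hint : Integrable (fun ω => M.F z s (Xv ω)) Q := by
    refine Integrable.of_bound (C := 1)
      (hFm.comp measurable_Xv).aestronglyMeasurable (ae_of_all _ fun ω => ?_)
    rw [Real.norm_of_nonneg (M.F_nonneg _ _ _)]
    exact M.F_le_one _ _ _
  have hSm : MeasurableSet {ω : FullData 𝒳 | Spot z ω ≤ s} :=
    measurableSet_le (measurable_Spot z) measurable_const
  refine (ae_eq_condExp_of_forall_setIntegral_eq sigmaX_le
    ((integrable_const (1 : ℝ)).indicator hSm) (fun _ _ _ => hint.integrableOn) ?_ ?_).symm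
  · rintro _ ⟨A, hA, rfl⟩ -
    have hXA : MeasurableSet (Xv (𝒳 := 𝒳) ⁻¹' A) := measurable_Xv hA
    have hrect : MeasurableSet (A ×ˢ Iic s) := hA.prod measurableSet_Iic
    have h1 : Q ({ω | Spot z ω ≤ s} ∩ Xv ⁻¹' A) = M.jointXS z (A ×ˢ Iic s) := by
      rw [← map_Xv_Spot_eq hQ hM z,
        Measure.map_apply (measurable_Xv.prodMk (measurable_Spot z)) hrect, inter_comm]
      rfl
    have h2 : M.jointXS z (A ×ˢ Iic s) = ∫⁻ x in A, ENNReal.ofReal (M.F z s x) ∂M.PX := by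
      rw [← lintegral_indicator_one hrect,
        M.lintegral_jointXS z (measurable_one.indicator hrect), ← lintegral_indicator hA]
      refine lintegral_congr fun x => ?_
      by_cases hx : x ∈ A
      · rw [indicator_of_mem hx, ObsModel.F, ofReal_integral_eq_lintegral_ofReal
          (M.integrable_p z x).integrableOn (ae_of_all _ fun s => M.p_nonneg _ _ _),
          ← lintegral_indicator measurableSet_Iic]
        refine lintegral_congr fun t => ?_
        by_cases ht : t ≤ s <;> simp [indicator, hx, ht]
      · rw [indicator_of_notMem hx]
        simp [indicator, hx]
    rw [integral_eq_lintegral_of_nonneg_ae (ae_of_all _ fun ω => M.F_nonneg _ _ _)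
      hint.aestronglyMeasurable.restrict, integral_indicator hSm,
      Measure.restrict_restrict hSm]
    simp only [integral_const, smul_eq_mul, mul_one, measureReal_restrict_apply_univ]
    rw [Measure.real, h1, h2, ← map_Xv_eq hM, setLIntegral_map hA hFm.ennreal_ofReal measurable_Xv]
  · exact (hFm.comp (comap_measurable Xv)).stronglyMeasurable.aestronglyMeasurable

/-- The copula assumption identifies the law of `(X, S₁, S₀)`: its density is `e`. -/
theorem map_strataData_eq (hc : IsCopulaDensity C c) (hQ : IsCausalModel C Q)
    (hM : Q.map observe = M.law) :
    Q.map strataData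
      = M.base.withDensity fun t => ENNReal.ofReal (M.e c t.2.1 t.2.2 t.1) := by
  have he := (M.measurable_e hc).ennreal_ofReal
  have hrect : ∀ {A : Set 𝒳} {B D : Set ℝ}, MeasurableSet A → MeasurableSet B → MeasurableSet D →
      (M.base.withDensity fun t => ENNReal.ofReal (M.e c t.2.1 t.2.2 t.1)) (A ×ˢ B ×ˢ D)
        = ∫⁻ x in A, (∫⁻ s1 in B, ∫⁻ s0 in D, ENNReal.ofReal (M.e c s1 s0 x)) ∂M.PX := by
    intro A B D hA hB hD
    rw [withDensity_apply _ (hA.prod (hB.prod hD)), ← Measure.prod_restrict,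
      ← Measure.prod_restrict, lintegral_prod _ he.aemeasurable]
    refine lintegral_congr fun x => ?_
    have hex : Measurable fun t : ℝ × ℝ => ENNReal.ofReal (M.e c t.1 t.2 x) :=
      he.comp measurable_prodMk_left
    exact lintegral_prod _ hex.aemeasurable
  have hIic : ∀ {A : Set 𝒳}, MeasurableSet A → ∀ a b : ℝ,
      Q.map strataData (A ×ˢ Iic a ×ˢ Iic b)
      = (M.base.withDensity fun t => ENNReal.ofReal (M.e c t.2.1 t.2.2 t.1))
        (A ×ˢ Iic a ×ˢ Iic b) := by
    intro A hA a b
    have hXA : MeasurableSet (Xv (𝒳 := 𝒳) ⁻¹' A) := measurable_Xv hA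
    have hXA' : MeasurableSet[sigmaX] (Xv (𝒳 := 𝒳) ⁻¹' A) := ⟨A, hA, rfl⟩
    have hS : MeasurableSet {ω : FullData 𝒳 | S1 ω ≤ a ∧ S0 ω ≤ b} :=
      (measurableSet_le measurable_S1 measurable_const).inter
        (measurableSet_le measurable_S0 measurable_const)
    rw [hrect hA measurableSet_Iic measurableSet_Iic]
    simp only [M.setLIntegral_e hc]
    rw [Measure.map_apply measurable_strataData
      (hA.prod (measurableSet_Iic.prod measurableSet_Iic))]
    have hset : strataData ⁻¹' (A ×ˢ Iic a ×ˢ Iic b)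
        = {ω | S1 ω ≤ a ∧ S0 ω ≤ b} ∩ Xv (𝒳 := 𝒳) ⁻¹' A := by
      ext ω
      simp only [strataData, mem_preimage, mem_prod, mem_Iic, mem_inter_iff, mem_ofPred_eq]
      tauto
    have hint := setIntegral_condExp (μ := Q) sigmaX_le
      (f := {ω | S1 ω ≤ a ∧ S0 ω ≤ b}.indicator fun _ => (1 : ℝ))
      ((integrable_const (1 : ℝ)).indicator hS) hXA'
    have hcop : Q[({ω | S1 ω ≤ a ∧ S0 ω ≤ b}.indicator fun _ => (1 : ℝ)) | sigmaX] =ᵐ[Q]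
        fun ω => C.toFun (M.F true a (Xv ω)) (M.F false b (Xv ω)) := by
      have h1 := condExp_Spot_eq hQ hM true a
      have h0 := condExp_Spot_eq hQ hM false b
      filter_upwards [hQ.copula a b, h1, h0] with ω h h1 h0
      rw [h]
      congr 1
    have hmeas : AEStronglyMeasurable
        (fun ω => C.toFun (M.F true a (Xv ω)) (M.F false b (Xv ω))) Q :=
      (stronglyMeasurable_condExp.mono sigmaX_le).aestronglyMeasurable.congr hcop
    have hnn : ∀ x, 0 ≤ C.toFun (M.F true a x) (M.F false b x) := by
      intro x
      have h1 : M.F true a x ∈ Icc (0 : ℝ) 1 := ⟨M.F_nonneg _ _ _, M.F_le_one _ _ _⟩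
      have h0 : M.F false b x ∈ Icc (0 : ℝ) 1 := ⟨M.F_nonneg _ _ _, M.F_le_one _ _ _⟩
      have hz : (0 : ℝ) ∈ Icc (0 : ℝ) 1 := ⟨le_refl _, zero_le_one⟩
      have := C.two_increasing 0 hz _ h1 0 hz _ h0 h1.1 h0.1
      rw [C.zero_left _ h0, C.zero_right _ h1, C.zero_left _ hz] at this
      linarith
    rw [setIntegral_congr_ae hXA (hcop.mono fun ω h _ => h), integral_indicator hS,
      Measure.restrict_restrict hS] at hint
    simp only [integral_const, smul_eq_mul, mul_one, measureReal_restrict_apply_univ] at hint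
    rw [hset, ← ENNReal.ofReal_toReal (measure_ne_top Q _)]
    change ENNReal.ofReal (Q.real _) = _
    have hi : Integrable (fun ω => C.toFun (M.F true a (Xv ω)) (M.F false b (Xv ω))) Q :=
      integrable_condExp.congr hcop
    rw [← hint, ofReal_integral_eq_lintegral_ofReal hi.integrableOn (ae_of_all _ fun ω => hnn _),
      ← map_Xv_eq hM]
    -- A `Copula` carries no measurability. It is recovered here by writing the copula along the
    -- margins as an integral of the measurable function `e`.
    have hCm : Measurable fun x =>
        ENNReal.ofReal (C.toFun (M.F true a x) (M.F false b x)) := by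
      simp only [← M.setLIntegral_e hc]
      refine Measurable.lintegral_prod_right' (ν := volume.restrict (Iic a))
        (f := fun u : 𝒳 × ℝ => ∫⁻ s0 in Iic b, ENNReal.ofReal (M.e c u.2 s0 u.1)) ?_
      refine Measurable.lintegral_prod_right' (ν := volume.restrict (Iic b))
        (f := fun u : (𝒳 × ℝ) × ℝ => ENNReal.ofReal (M.e c u.1.2 u.2 u.1.1)) ?_
      exact he.comp (f := fun u : (𝒳 × ℝ) × ℝ => (u.1.1, u.1.2, u.2)) (by fun_prop)
    rw [setLIntegral_map hA hCm measurable_Xv]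
  exact ext_of_prod_Iic_Iic hIic

theorem integrable_full_snd (hQ : IsCausalModel C Q) (hM : Q.map observe = M.law) :
    Integrable (fun u : (𝒳 × ℝ) × ℝ => u.2) (M.full true) := by
  rw [← map_armData_eq hQ hM true, integrable_map_measure (by fun_prop)
    (measurable_armData true).aemeasurable]
  exact hQ.integrable_Y1

theorem integrable_mu1 (hQ : IsCausalModel C Q) (hM : Q.map observe = M.law) :
    Integrable (fun t : 𝒳 × ℝ => M.mu1 t.2 t.1) (M.jointXS true) :=
  (integrable_full_snd hQ hM).integral_compProd

theorem ae_integrable_outcome (hQ : IsCausalModel C Q) (hM : Q.map observe = M.law) :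
    ∀ᵐ t ∂(M.jointXS true), Integrable (fun y : ℝ => y) (M.outcome true t) :=
  ((Measure.integrable_compProd_iff
    (integrable_full_snd hQ hM).aestronglyMeasurable).1 (integrable_full_snd hQ hM)).1

/-- Principal and treatment ignorability: `E(Y₁ ∣ S₁, S₀, X) = μ₁(S₁, X)`. -/
theorem condExp_Y1_sigmaUX (hQ : IsCausalModel C Q) (hM : Q.map observe = M.law) :
    Q[Y1 | sigmaUX] =ᵐ[Q] fun ω => M.mu1 (S1 ω) (Xv ω) := by
  obtain ⟨g, hg, hgeq⟩ := hQ.principal_ignorability1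
  have hXS : Measurable fun ω : FullData 𝒳 => (Xv ω, S1 ω) := measurable_Xv.prodMk measurable_S1
  have hmap : Q.map (fun ω => (Xv ω, S1 ω)) = M.jointXS true := map_Xv_Spot_eq hQ hM true
  have hgm : Measurable fun t : 𝒳 × ℝ => g (t.2, t.1) := hg.comp measurable_swap
  have hgi : Integrable (fun t : 𝒳 × ℝ => g (t.2, t.1)) (M.jointXS true) := by
    rw [← hmap, integrable_map_measure hgm.aestronglyMeasurable
      hXS.aemeasurable]
    exact integrable_condExp.congr hgeq
  -- Principal ignorability supplies some function of `(S₁, X)`. Its integrals over events in `(X,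
  -- S₁)` are those of `Y₁`, which the identified law of `((X, S₁), Y₁)` computes through `mu1`.
  have hae : (fun t : 𝒳 × ℝ => g (t.2, t.1)) =ᵐ[M.jointXS true] fun t => M.mu1 t.2 t.1 := by
    refine Integrable.ae_eq_of_forall_setIntegral_eq _ _ hgi (integrable_mu1 hQ hM)
      fun B hB _ => ?_
    have hB' : MeasurableSet ((fun ω : FullData 𝒳 => (Xv ω, S1 ω)) ⁻¹' B) := hXS hB
    have hB'' : MeasurableSet[sigmaUX] ((fun ω : FullData 𝒳 => (Xv ω, S1 ω)) ⁻¹' B) := by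
      have hp : Measurable fun t : ℝ × ℝ × 𝒳 => (t.2.2, t.1) := by fun_prop
      exact ⟨_, hp hB, rfl⟩
    have h1 : ∫ t in B, g (t.2, t.1) ∂(M.jointXS true)
        = ∫ ω in (fun ω : FullData 𝒳 => (Xv ω, S1 ω)) ⁻¹' B, Y1 ω ∂Q := by
      rw [← setIntegral_condExp sigmaUX_le hQ.integrable_Y1 hB'',
        setIntegral_congr_ae hB' (hgeq.mono fun ω h _ => h), ← hmap,
        setIntegral_map hB hgm.aestronglyMeasurable hXS.aemeasurable]
    have hBu : MeasurableSet (B ×ˢ (univ : Set ℝ)) := hB.prod MeasurableSet.univ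
    have h2 : ∫ ω in (fun ω : FullData 𝒳 => (Xv ω, S1 ω)) ⁻¹' B, Y1 ω ∂Q
        = ∫ u in B ×ˢ univ, u.2 ∂(M.full true) := by
      rw [← map_armData_eq hQ hM true,
        setIntegral_map hBu (by fun_prop) (measurable_armData true).aemeasurable]
      have : armData true ⁻¹' (B ×ˢ univ) = (fun ω : FullData 𝒳 => (Xv ω, S1 ω)) ⁻¹' B := by
        ext ω; simp [armData, Spot]
      rw [this]
      rfl
    rw [h1, h2, ObsModel.full, Measure.setIntegral_compProd hB MeasurableSet.univ
      (integrable_full_snd hQ hM).integrableOn]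
    simp only [Measure.restrict_univ]
    rfl
  have hae' := ae_of_ae_map hXS.aemeasurable (hmap ▸ hae)
  filter_upwards [hgeq, hae'] with ω h1 h2
  rw [h1]; exact h2

end identification

end

/-! ### Conditional expectation given the stratum: from `mu1` to `m1` -/

section condExp

variable {Ω : Type*} {m m0 : MeasurableSpace Ω} {Q : Measure Ω} {g h b : Ω → ℝ}

theorem integrable_mul_condExp (hh : StronglyMeasurable[m] h) (hg : Integrable g Q)
    (hhg : Integrable (fun ω => h ω * g ω) Q) : Integrable (fun ω => h ω * (Q[g | m]) ω) Q :=
  integrable_condExp.congr (condExp_mul_of_stronglyMeasurable_left (m := m) hh hhg hg)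

variable [IsFiniteMeasure Q]

theorem integral_mul_condExp (hm : m ≤ m0) (hh : StronglyMeasurable[m] h) (hg : Integrable g Q)
    (hhg : Integrable (fun ω => h ω * g ω) Q) :
    ∫ ω, h ω * (Q[g | m]) ω ∂Q = ∫ ω, h ω * g ω ∂Q := by
  rw [← integral_condExp hm (f := fun ω => h ω * g ω)]
  exact integral_congr_ae (condExp_mul_of_stronglyMeasurable_left (m := m) hh hhg hg).symm

/-- Weighted second moments of a conditional expectation are finite when those of the variable
are, for a weight measurable with respect to the conditioning σ-algebra. -/
theorem integrable_mul_sq_condExp (hm : m ≤ m0) (hh : StronglyMeasurable[m] h)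
    (hb : StronglyMeasurable[m] b) (hh0 : ∀ ω, 0 ≤ h ω) (hb0 : ∀ ω, 0 ≤ b ω)
    (hg : Integrable g Q) (hi : Integrable (fun ω => h ω * (b ω + |g ω|) ^ 2) Q) :
    Integrable (fun ω => h ω * (b ω + |(Q[g | m]) ω|) ^ 2) Q := by
  -- The square root of the weight is measurable for the conditioning σ-algebra, so it can be
  -- carried through the conditional expectation; contraction in `L²` then applies to the product.
  have hs : StronglyMeasurable[m] fun ω => Real.sqrt (h ω) :=
    Real.continuous_sqrt.comp_stronglyMeasurable hh
  have hs0 := hs.mono hm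
  have hsg2 : MemLp (fun ω => Real.sqrt (h ω) * g ω) 2 Q := by
    have hsg : AEStronglyMeasurable (fun ω => Real.sqrt (h ω) * g ω) Q :=
      hs0.aestronglyMeasurable.mul hg.aestronglyMeasurable
    rw [memLp_two_iff_integrable_sq hsg]
    refine hi.mono' (hsg.pow 2)
      (ae_of_all _ fun ω => ?_)
    rw [Real.norm_of_nonneg (sq_nonneg _), mul_pow, Real.sq_sqrt (hh0 ω), ← sq_abs (g ω)]
    have := hb0 ω
    have := abs_nonneg (g ω)
    have := hh0 ω
    gcongr
    linarith
  have hsc : MemLp (fun ω => Real.sqrt (h ω) * (Q[g | m]) ω) 2 Q :=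
    (MemLp.condExp (m := m) (by norm_num) hsg2).ae_eq (condExp_mul_of_stronglyMeasurable_left
      (m := m) hs (hsg2.integrable (by norm_num)) hg)
  have hb2 : Integrable (fun ω => h ω * b ω ^ 2) Q := by
    refine hi.mono' ((hh.mono hm).aestronglyMeasurable.mul
      ((hb.mono hm).aestronglyMeasurable.pow 2)) (ae_of_all _ fun ω => ?_)
    rw [Real.norm_of_nonneg (mul_nonneg (hh0 ω) (sq_nonneg _))]
    have := hb0 ω
    have := abs_nonneg (g ω)
    have := hh0 ω
    gcongr
    linarith
  have hc2 := hsc.integrable_sq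
  refine ((hb2.const_mul 2).add (hc2.const_mul 2)).mono' ?_ (ae_of_all _ fun ω => ?_)
  · have hc := (stronglyMeasurable_condExp (f := g) (m := m) (μ := Q)).mono hm
    exact (hh.mono hm).aestronglyMeasurable.mul
      (((hb.mono hm).aestronglyMeasurable.add hc.norm.aestronglyMeasurable).pow 2)
  · rw [Real.norm_of_nonneg (mul_nonneg (hh0 ω) (sq_nonneg _))]
    simp only [Pi.add_apply, mul_pow, Real.sq_sqrt (hh0 ω)]
    have h2 := mul_nonneg (hh0 ω) (sq_nonneg (b ω - |(Q[g | m]) ω|))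
    have h3 : h ω * (b ω + |(Q[g | m]) ω|) ^ 2 = 2 * (h ω * b ω ^ 2)
        + 2 * (h ω * |(Q[g | m]) ω| ^ 2) - h ω * (b ω - |(Q[g | m]) ω|) ^ 2 := by ring
    rw [h3, sq_abs]
    linarith

end condExp

section m1

variable {𝒳 : Type*} [MeasurableSpace 𝒳] [StandardBorelSpace 𝒳] {Q : Measure (FullData 𝒳)}
  {M : ObsModel 𝒳} [IsProbabilityMeasure Q] {C : Copula}

theorem integrable_mu1_comp (hQ : IsCausalModel C Q) (hM : Q.map observe = M.law) :
    Integrable (fun ω => M.mu1 (S1 ω) (Xv ω)) Q :=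
  integrable_condExp.congr (condExp_Y1_sigmaUX hQ hM)

/-- Tower property through `(S₁, S₀, X)`. The averaging over `X` within a stratum remains, so `m1`
is in general not `mu1`. -/
theorem m1_ae_eq (hQ : IsCausalModel C Q) (hM : Q.map observe = M.law) :
    m1 Q =ᵐ[Q] Q[fun ω => M.mu1 (S1 ω) (Xv ω) | sigmaU] :=
  (condExp_condExp_of_le sigmaU_le_sigmaUX sigmaUX_le).symm.trans
    (condExp_congr_ae (condExp_Y1_sigmaUX hQ hM))

theorem integrable_sq_m1 (hQ : IsCausalModel C Q) (hM : Q.map observe = M.law) {w b : ℝ → ℝ → ℝ}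
    (hw : Measurable (Function.uncurry w)) (hb : Measurable (Function.uncurry b))
    (hw0 : ∀ s1 s0, 0 ≤ w s1 s0) (hb0 : ∀ s1 s0, 0 ≤ b s1 s0)
    (hi : Integrable
      (fun ω => w (S1 ω) (S0 ω) * (b (S1 ω) (S0 ω) + |M.mu1 (S1 ω) (Xv ω)|) ^ 2) Q) :
    Integrable (fun ω => w (S1 ω) (S0 ω) * (b (S1 ω) (S0 ω) + |m1 Q ω|) ^ 2) Q := by
  have hU : Measurable[sigmaU] fun ω : FullData 𝒳 => (S1 ω, S0 ω) := comap_measurable _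
  have h := integrable_mul_sq_condExp sigmaU_le (hw.comp hU).stronglyMeasurable
    (hb.comp hU).stronglyMeasurable (fun ω => hw0 _ _) (fun ω => hb0 _ _)
    (integrable_mu1_comp hQ hM) hi
  refine h.congr ?_
  filter_upwards [m1_ae_eq hQ hM] with ω hω
  rw [hω]
  rfl

/-- In integrals against functions of the stratum, `m₁` may be replaced by `μ₁(S₁, X)`. -/
theorem integral_m1_smul (hQ : IsCausalModel C Q) (hM : Q.map observe = M.law)
    {F : Type*} [NormedAddCommGroup F] [NormedSpace ℝ F] [FiniteDimensional ℝ F]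
    {h : ℝ × ℝ → F} (hh : StronglyMeasurable h)
    (hi : Integrable (fun ω => M.mu1 (S1 ω) (Xv ω) • h (S1 ω, S0 ω)) Q) :
    Integrable (fun ω => m1 Q ω • h (S1 ω, S0 ω)) Q ∧
    ∫ ω, m1 Q ω • h (S1 ω, S0 ω) ∂Q = ∫ ω, M.mu1 (S1 ω) (Xv ω) • h (S1 ω, S0 ω) ∂Q := by
  have hU : Measurable[sigmaU] fun ω : FullData 𝒳 => (S1 ω, S0 ω) := comap_measurable _
  -- Coordinates reduce the vector-valued identity to the scalar pull-out property.
  let B := Module.finBasis ℝ F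
  have key : ∀ i, Integrable (fun ω => m1 Q ω * B.coord i (h (S1 ω, S0 ω))) Q ∧
      ∫ ω, m1 Q ω * B.coord i (h (S1 ω, S0 ω)) ∂Q
        = ∫ ω, M.mu1 (S1 ω) (Xv ω) * B.coord i (h (S1 ω, S0 ω)) ∂Q := by
    intro i
    have hci : Continuous (B.coord i) := LinearMap.continuous_of_finiteDimensional _
    have hm : StronglyMeasurable[sigmaU] fun ω : FullData 𝒳 => B.coord i (h (S1 ω, S0 ω)) :=
      (hci.comp_stronglyMeasurable hh).comp_measurable hU
    have hig : Integrable (fun ω => B.coord i (h (S1 ω, S0 ω)) * M.mu1 (S1 ω) (Xv ω)) Q := by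
      have := (LinearMap.toContinuousLinearMap (B.coord i)).integrable_comp hi
      simpa [mul_comm] using this
    have h1 := integrable_mul_condExp hm (integrable_mu1_comp hQ hM) hig
    have h2 := integral_mul_condExp sigmaU_le hm (integrable_mu1_comp hQ hM) hig
    have hae : (fun ω => B.coord i (h (S1 ω, S0 ω)) *
        (Q[fun ω => M.mu1 (S1 ω) (Xv ω) | sigmaU]) ω)
        =ᵐ[Q] fun ω => m1 Q ω * B.coord i (h (S1 ω, S0 ω)) := by
      filter_upwards [m1_ae_eq hQ hM] with ω hω
      rw [hω, mul_comm]
    refine ⟨h1.congr hae, ?_⟩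
    rw [← integral_congr_ae hae, h2]
    simp only [mul_comm]
  have hsum : ∀ (a : ℝ) (v : F), a • v = ∑ i, (a * B.coord i v) • B i := by
    intro a v
    conv_lhs => rw [← B.sum_repr v, Finset.smul_sum]
    simp [smul_smul]
  have hL : Integrable (fun ω => m1 Q ω • h (S1 ω, S0 ω)) Q := by
    simp only [fun ω => hsum (m1 Q ω) (h (S1 ω, S0 ω))]
    exact integrable_finsetSum _ fun i _ => (key i).1.smul_const _
  refine ⟨hL, ?_⟩
  refine B.ext_elem fun i => ?_
  have e1 := (LinearMap.toContinuousLinearMap (B.coord i)).integral_comp_comm hL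
  have e2 := (LinearMap.toContinuousLinearMap (B.coord i)).integral_comp_comm hi
  simp only [LinearMap.coe_toContinuousLinearMap', map_smul, smul_eq_mul] at e1 e2
  have := (key i).2
  rw [e1, e2] at this
  exact this

end m1

/-! ### Second order calculus of the working model at a fixed stratum -/

section pointwise

variable {q : ℕ} {g : EuclideanSpace ℝ (Fin q) → ℝ} {U : Set (EuclideanSpace ℝ (Fin q))}
  {η : EuclideanSpace ℝ (Fin q)} {B : ℝ}

theorem hasGradientAt_of_contDiffOn (hg : ContDiffOn ℝ 2 g U) (hU : IsOpen U) (hη : η ∈ U) :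
    HasGradientAt g (gradient g η) η :=
  ((hg.contDiffAt (hU.mem_nhds hη)).differentiableAt (by norm_num)).hasGradientAt

theorem contDiffOn_gradient (hg : ContDiffOn ℝ 2 g U) (hU : IsOpen U) :
    ContDiffOn ℝ 1 (gradient g) U :=
  (InnerProductSpace.toDual ℝ (EuclideanSpace ℝ (Fin q))).symm.toContinuousLinearEquiv.contDiff
    |>.comp_contDiffOn (hg.fderiv_of_isOpen hU (by norm_num))

theorem hasFDerivAt_gradient (hg : ContDiffOn ℝ 2 g U) (hU : IsOpen U) (hη : η ∈ U) :
    HasFDerivAt (gradient g) (fderiv ℝ (gradient g) η) η :=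
  (((contDiffOn_gradient hg hU).contDiffAt (hU.mem_nhds hη)).differentiableAt
    (by norm_num)).hasFDerivAt

theorem continuousAt_fderiv_gradient (hg : ContDiffOn ℝ 2 g U) (hU : IsOpen U) (hη : η ∈ U) :
    ContinuousAt (fderiv ℝ (gradient g)) η :=
  (((contDiffOn_gradient hg hU).continuousOn_fderiv_of_isOpen hU (by norm_num)).continuousAt
    (hU.mem_nhds hη))

theorem abs_le_of_iteratedFDeriv (hB : ∀ k ≤ 2, ‖iteratedFDeriv ℝ k g η‖ ≤ B) : |g η| ≤ B := by
  simpa using hB 0 (by norm_num)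

theorem norm_gradient_le (hB : ∀ k ≤ 2, ‖iteratedFDeriv ℝ k g η‖ ≤ B) : ‖gradient g η‖ ≤ B := by
  have h := hB 1 (by norm_num)
  rw [← norm_iteratedFDeriv_fderiv, norm_iteratedFDeriv_zero] at h
  rwa [gradient, LinearIsometryEquiv.norm_map]

/-- The gradient is the Riesz representative of the derivative; differentiating its inner product
with a fixed vector in two ways transports this to second order. -/
theorem fderiv_gradient_eq (hg : ContDiffOn ℝ 2 g U) (hU : IsOpen U) (hη : η ∈ U)
    (v v' : EuclideanSpace ℝ (Fin q)) :
    inner ℝ (fderiv ℝ (gradient g) η v) v' = fderiv ℝ (fderiv ℝ g) η v v' := by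
  have hd : DifferentiableAt ℝ (fderiv ℝ g) η :=
    ((hg.fderiv_of_isOpen hU (m := 1) (by norm_num)).contDiffAt
      (hU.mem_nhds hη)).differentiableAt (by norm_num)
  have h1 : HasFDerivAt (fun η' => inner ℝ (gradient g η') v')
      ((innerSL ℝ v').comp (fderiv ℝ (gradient g) η)) η := by
    have := ((innerSL ℝ v').hasFDerivAt).comp η (hasFDerivAt_gradient hg hU hη)
    refine this.congr_of_eventuallyEq (Eventually.of_forall fun η' => ?_)
    simp
  have h2 : HasFDerivAt (fun η' => inner ℝ (gradient g η') v')
      ((ContinuousLinearMap.apply ℝ ℝ v').comp (fderiv ℝ (fderiv ℝ g) η)) η := by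
    have := ((ContinuousLinearMap.apply ℝ ℝ v').hasFDerivAt).comp η hd.hasFDerivAt
    refine this.congr_of_eventuallyEq (Eventually.of_forall fun η' => ?_)
    simp [gradient]
  have h3 := congrArg (fun T => T v) (h1.unique h2)
  simpa [real_inner_comm] using h3

theorem norm_fderiv_gradient_le (hg : ContDiffOn ℝ 2 g U) (hU : IsOpen U) (hη : η ∈ U)
    (hB : ∀ k ≤ 2, ‖iteratedFDeriv ℝ k g η‖ ≤ B) : ‖fderiv ℝ (gradient g) η‖ ≤ B := by
  have h := hB 2 (by norm_num)
  rw [← norm_iteratedFDeriv_fderiv, ← norm_iteratedFDeriv_fderiv, norm_iteratedFDeriv_zero] at h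
  have hB0 : 0 ≤ B := (norm_nonneg _).trans h
  refine ContinuousLinearMap.opNorm_le_bound _ hB0 fun v => ?_
  by_cases hz : fderiv ℝ (gradient g) η v = 0
  · rw [hz, norm_zero]; positivity
  have hpos : 0 < ‖fderiv ℝ (gradient g) η v‖ := norm_pos_iff.2 hz
  -- Testing with the image vector itself gives the operator norm bound with the same constant `B`.
  have h1 := fderiv_gradient_eq hg hU hη v (fderiv ℝ (gradient g) η v)
  rw [real_inner_self_eq_norm_sq] at h1
  have h2 : ‖fderiv ℝ (fderiv ℝ g) η v (fderiv ℝ (gradient g) η v)‖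
      ≤ B * ‖v‖ * ‖fderiv ℝ (gradient g) η v‖ := by
    refine (ContinuousLinearMap.le_opNorm _ _).trans ?_
    gcongr
    exact (ContinuousLinearMap.le_opNorm _ _).trans (by gcongr)
  rw [← h1, Real.norm_of_nonneg (sq_nonneg _), sq] at h2
  exact le_of_mul_le_mul_right h2 hpos

theorem hessian_eq (i j : Fin q) :
    hessian g η i j = fderiv ℝ (fderiv ℝ g) η (EuclideanSpace.single i 1)
      (EuclideanSpace.single j 1) := by
  simp [hessian, iteratedFDeriv_two_apply]

theorem fderiv_gradient_apply (hg : ContDiffOn ℝ 2 g U) (hU : IsOpen U) (hη : η ∈ U)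
    (i j : Fin q) : fderiv ℝ (gradient g) η (EuclideanSpace.single i 1) j = hessian g η i j := by
  have h := fderiv_gradient_eq hg hU hη (EuclideanSpace.single i 1) (EuclideanSpace.single j 1)
  rw [hessian_eq, ← h, EuclideanSpace.inner_single_right]
  simp

theorem hessian_symm (hg : ContDiffOn ℝ 2 g U) (hU : IsOpen U) (hη : η ∈ U)
    (i j : Fin q) : hessian g η i j = hessian g η j i := by
  rw [hessian_eq, hessian_eq]
  exact ((hg.contDiffAt (hU.mem_nhds hη)).isSymmSndFDerivAt (by simp)).eq _ _

end pointwise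

/-! ### Measurability of parameter derivatives in the data -/

section measurability

variable {Ω : Type*} [MeasurableSpace Ω] {q : ℕ} {F : Type*} [NormedAddCommGroup F]
  [NormedSpace ℝ F]

/-- The derivative is a pointwise limit of difference quotients along `v / n`. The shift of the
index by `N` keeps all base points where measurability is available. -/
theorem stronglyMeasurable_fderiv_apply {E : Type*} [NormedAddCommGroup E] [NormedSpace ℝ E]
    {g : Ω → E → F} {η : E} (hg : ∀ᶠ η' in 𝓝 η, StronglyMeasurable fun ω => g ω η')
    (hd : ∀ ω, DifferentiableAt ℝ (g ω) η) (v : E) :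
    StronglyMeasurable fun ω => fderiv ℝ (g ω) η v := by
  have hlim : Tendsto (fun n : ℕ => η + (n : ℝ)⁻¹ • v) atTop (𝓝 η) := by
    have h1 : Tendsto (fun n : ℕ => (n : ℝ)⁻¹) atTop (𝓝 0) := tendsto_inv_atTop_nhds_zero_nat
    simpa using (h1.smul_const v).const_add η
  obtain ⟨N, hN⟩ := eventually_atTop.1 (hlim.eventually hg)
  refine stronglyMeasurable_of_tendsto atTop
    (f := fun (n : ℕ) ω => ((n + N : ℕ) : ℝ) • (g ω (η + ((n + N : ℕ) : ℝ)⁻¹ • v) - g ω η))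
    (fun n => ((hN _ (Nat.le_add_left _ _)).sub hg.self_of_nhds).const_smul _) ?_
  rw [tendsto_pi_nhds]
  intro ω
  have := ((hd ω).hasFDerivAt.lim_real v).comp (tendsto_natCast_atTop_atTop (R := ℝ))
  exact this.comp (tendsto_add_atTop_nat N)

/-- In finite dimension an operator is a finite sum of rank-one terms built from its values on a
basis. -/
theorem stronglyMeasurable_clm {A : Ω → EuclideanSpace ℝ (Fin q) →L[ℝ] F}
    (hA : ∀ v, StronglyMeasurable fun ω => A ω v) : StronglyMeasurable A := by
  have h : A = fun ω => ∑ i, ContinuousLinearMap.smulRightL ℝ (EuclideanSpace ℝ (Fin q)) F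
      (EuclideanSpace.proj i) (A ω (EuclideanSpace.single i 1)) := by
    ext ω v
    have hv : v = ∑ i, v i • EuclideanSpace.single i (1 : ℝ) := by
      simpa using ((EuclideanSpace.basisFun (Fin q) ℝ).sum_repr v).symm
    conv_lhs => rw [hv, map_sum]
    simp [ContinuousLinearMap.smulRightL]
  rw [h]
  exact Finset.stronglyMeasurable_fun_sum _ fun i _ =>
    (ContinuousLinearMap.continuous _).comp_stronglyMeasurable (hA _)

theorem stronglyMeasurable_fderiv {g : Ω → EuclideanSpace ℝ (Fin q) → F}
    {η : EuclideanSpace ℝ (Fin q)} (hg : ∀ᶠ η' in 𝓝 η, StronglyMeasurable fun ω => g ω η')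
    (hd : ∀ ω, DifferentiableAt ℝ (g ω) η) : StronglyMeasurable fun ω => fderiv ℝ (g ω) η :=
  stronglyMeasurable_clm fun v => stronglyMeasurable_fderiv_apply hg hd v

end measurability

/-! ### Differentiating an expected least squares loss twice -/

/-- A family of least squares losses `k (m - f(η))²`, dominated near `η₁`. -/
structure LeastSquaresData {Ω : Type*} [MeasurableSpace Ω] {q : ℕ} (Q : Measure Ω)
    (k m b : Ω → ℝ) (f : Ω → EuclideanSpace ℝ (Fin q) → ℝ) (η₁ : EuclideanSpace ℝ (Fin q))
    (r : ℝ) : Prop where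
  k_meas : Measurable k
  m_meas : AEStronglyMeasurable m Q
  f_meas : ∀ η, Measurable fun ω => f ω η
  smooth : ∀ ω, ContDiffOn ℝ 2 (f ω) (Metric.ball η₁ r)
  bound : ∀ ω, ∀ η ∈ Metric.ball η₁ r, ∀ k ≤ 2, ‖iteratedFDeriv ℝ k (f ω) η‖ ≤ b ω
  integrable : Integrable (fun ω => |k ω| * (b ω + |m ω|) ^ 2) Q

/-- The Gauss–Newton form of the second derivative of half the squared residual. -/
def residualHess {q : ℕ} (y : ℝ) (g : EuclideanSpace ℝ (Fin q) → ℝ)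
    (η : EuclideanSpace ℝ (Fin q)) : EuclideanSpace ℝ (Fin q) →L[ℝ] EuclideanSpace ℝ (Fin q) :=
  (innerSL ℝ (gradient g η)).smulRight (gradient g η) - (y - g η) • fderiv ℝ (gradient g) η

namespace LeastSquaresData

variable {Ω : Type*} [MeasurableSpace Ω] {q : ℕ} {Q : Measure Ω} {k m b : Ω → ℝ}
  {f : Ω → EuclideanSpace ℝ (Fin q) → ℝ} {η₁ η : EuclideanSpace ℝ (Fin q)} {r : ℝ}

theorem differentiableAt (h : LeastSquaresData Q k m b f η₁ r) (hη : η ∈ Metric.ball η₁ r) (ω : Ω) :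
    DifferentiableAt ℝ (f ω) η :=
  ((h.smooth ω).contDiffAt (Metric.isOpen_ball.mem_nhds hη)).differentiableAt (by norm_num)

theorem stronglyMeasurable_gradient (h : LeastSquaresData Q k m b f η₁ r)
    (hη : η ∈ Metric.ball η₁ r) : StronglyMeasurable fun ω => gradient (f ω) η :=
  (LinearIsometryEquiv.continuous _).comp_stronglyMeasurable
    (stronglyMeasurable_fderiv (Eventually.of_forall fun η' => (h.f_meas η').stronglyMeasurable)
      fun ω => h.differentiableAt hη ω)

theorem stronglyMeasurable_fderiv_gradient (h : LeastSquaresData Q k m b f η₁ r)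
    (hη : η ∈ Metric.ball η₁ r) : StronglyMeasurable fun ω => fderiv ℝ (gradient (f ω)) η := by
  refine stronglyMeasurable_fderiv ?_ fun ω =>
    (hasFDerivAt_gradient (h.smooth ω) Metric.isOpen_ball hη).differentiableAt
  filter_upwards [Metric.isOpen_ball.mem_nhds hη] with η' hη'
  exact h.stronglyMeasurable_gradient hη'

theorem b_nonneg (h : LeastSquaresData Q k m b f η₁ r) (hη : η ∈ Metric.ball η₁ r) (ω : Ω) :
    0 ≤ b ω := (abs_nonneg _).trans (abs_le_of_iteratedFDeriv (h.bound ω η hη))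

theorem abs_residual_le (h : LeastSquaresData Q k m b f η₁ r) (hη : η ∈ Metric.ball η₁ r) (ω : Ω) :
    |m ω - f ω η| ≤ b ω + |m ω| := by
  have := abs_le_of_iteratedFDeriv (h.bound ω η hη)
  have h2 := abs_sub (m ω) (f ω η)
  linarith

/-- The envelope `|k| (b + |m|)²` dominates the loss and the score, and twice it dominates the
second derivative; a single integrability condition therefore serves all differentiations under the
integral. -/
theorem norm_score_le (h : LeastSquaresData Q k m b f η₁ r) (hη : η ∈ Metric.ball η₁ r) (ω : Ω) :
    ‖(k ω * (m ω - f ω η)) • gradient (f ω) η‖ ≤ |k ω| * (b ω + |m ω|) ^ 2 := by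
  have h1 := h.abs_residual_le hη ω
  have h2 := norm_gradient_le (h.bound ω η hη)
  have h4 := abs_nonneg (m ω)
  have h5 := h.b_nonneg hη ω
  rw [norm_smul, norm_mul, Real.norm_eq_abs, Real.norm_eq_abs, sq, mul_assoc]
  gcongr
  linarith

end LeastSquaresData

theorem norm_residualHess_le {q : ℕ} {y B : ℝ} {g : EuclideanSpace ℝ (Fin q) → ℝ}
    {η : EuclideanSpace ℝ (Fin q)} {U : Set (EuclideanSpace ℝ (Fin q))}
    (hg : ContDiffOn ℝ 2 g U) (hU : IsOpen U) (hη : η ∈ U)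
    (hB : ∀ k ≤ 2, ‖iteratedFDeriv ℝ k g η‖ ≤ B) :
    ‖residualHess y g η‖ ≤ 2 * (B + |y|) ^ 2 := by
  have h1 := abs_le_of_iteratedFDeriv hB
  have h2 := norm_gradient_le hB
  have h3 := norm_fderiv_gradient_le hg hU hη hB
  have h4 := abs_nonneg y
  have h5 : 0 ≤ B := (abs_nonneg _).trans h1
  have h6 : |y - g η| ≤ B + |y| := (abs_sub _ _).trans (by linarith)
  have h7 : ‖(innerSL ℝ (gradient g η)).smulRight (gradient g η)‖ ≤ B * B := by
    rw [ContinuousLinearMap.norm_smulRight_apply, innerSL_apply_norm]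
    gcongr
  have h8 : ‖(y - g η) • fderiv ℝ (gradient g) η‖ ≤ (B + |y|) * B := by
    rw [norm_smul, Real.norm_eq_abs]
    gcongr
  calc ‖residualHess y g η‖ ≤ B * B + (B + |y|) * B := (norm_sub_le _ _).trans (add_le_add h7 h8)
    _ ≤ 2 * (B + |y|) ^ 2 := by nlinarith

theorem hasFDerivAt_score {q : ℕ} {a y : ℝ} {g : EuclideanSpace ℝ (Fin q) → ℝ}
    {η : EuclideanSpace ℝ (Fin q)} {U : Set (EuclideanSpace ℝ (Fin q))}
    (hg : ContDiffOn ℝ 2 g U) (hU : IsOpen U) (hη : η ∈ U) :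
    HasFDerivAt (fun η' => (a * (y - g η')) • gradient g η') (-(a • residualHess y g η)) η := by
  have h1 := (hasGradientAt_of_contDiffOn hg hU hη).hasFDerivAt
  have h2 := hasFDerivAt_gradient hg hU hη
  have h3 := ((h1.const_sub y).const_mul a).smul h2
  refine h3.congr_fderiv ?_
  ext v
  simp [residualHess, mul_comm]
  ring

/-- Joint continuity is needed because the outcome mean, in the place of `y`, moves with the law
while `η` moves as well. -/
theorem continuousAt_residualHess {q : ℕ} {y : ℝ} {g : EuclideanSpace ℝ (Fin q) → ℝ}
    {η : EuclideanSpace ℝ (Fin q)} {U : Set (EuclideanSpace ℝ (Fin q))}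
    (hg : ContDiffOn ℝ 2 g U) (hU : IsOpen U) (hη : η ∈ U) :
    ContinuousAt (fun t : ℝ × EuclideanSpace ℝ (Fin q) => residualHess t.1 g t.2) (y, η) := by
  have h0 : ContinuousAt (fun t : ℝ × EuclideanSpace ℝ (Fin q) => t.2) (y, η) := continuousAt_snd
  have h1 : ContinuousAt (fun t : ℝ × EuclideanSpace ℝ (Fin q) => g t.2) (y, η) :=
    ContinuousAt.comp' (hg.continuousOn.continuousAt (hU.mem_nhds hη)) h0
  have h2 : ContinuousAt (fun t : ℝ × EuclideanSpace ℝ (Fin q) => gradient g t.2) (y, η) :=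
    ContinuousAt.comp' ((contDiffOn_gradient hg hU).continuousOn.continuousAt (hU.mem_nhds hη)) h0
  have h3 : ContinuousAt (fun t : ℝ × EuclideanSpace ℝ (Fin q) =>
      fderiv ℝ (gradient g) t.2) (y, η) :=
    ContinuousAt.comp' (continuousAt_fderiv_gradient hg hU hη) h0
  refine ContinuousAt.sub ?_ ((continuousAt_fst.sub h1).smul h3)
  have h4 : ContinuousAt (fun t : ℝ × EuclideanSpace ℝ (Fin q) =>
      innerSL ℝ (gradient g t.2)) (y, η) := (innerSL ℝ).continuous.continuousAt.comp' h2
  exact ((ContinuousLinearMap.smulRightL ℝ (EuclideanSpace ℝ (Fin q))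
    (EuclideanSpace ℝ (Fin q))).continuous.continuousAt.comp' h4).clm_apply h2

namespace LeastSquaresData

variable {Ω : Type*} [MeasurableSpace Ω] {q : ℕ} {Q : Measure Ω} {k m b : Ω → ℝ}
  {f : Ω → EuclideanSpace ℝ (Fin q) → ℝ} {η₁ η : EuclideanSpace ℝ (Fin q)} {r : ℝ}

theorem aestronglyMeasurable_score (h : LeastSquaresData Q k m b f η₁ r)
    (hη : η ∈ Metric.ball η₁ r) :
    AEStronglyMeasurable (fun ω => (k ω * (m ω - f ω η)) • gradient (f ω) η) Q :=
  (h.k_meas.aestronglyMeasurable.mul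
    (h.m_meas.sub (h.f_meas η).aestronglyMeasurable)).smul
      (h.stronglyMeasurable_gradient hη).aestronglyMeasurable

theorem integrable_score (h : LeastSquaresData Q k m b f η₁ r)
    (hη : η ∈ Metric.ball η₁ r) :
    Integrable (fun ω => (k ω * (m ω - f ω η)) • gradient (f ω) η) Q :=
  h.integrable.mono' (h.aestronglyMeasurable_score hη) (ae_of_all _ fun ω => h.norm_score_le hη ω)

theorem aestronglyMeasurable_hess (h : LeastSquaresData Q k m b f η₁ r)
    (hη : η ∈ Metric.ball η₁ r) :
    AEStronglyMeasurable (fun ω => k ω • residualHess (m ω) (f ω) η) Q := by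
  refine h.k_meas.aestronglyMeasurable.smul (AEStronglyMeasurable.sub ?_ ?_)
  · have hg := h.stronglyMeasurable_gradient hη
    have := stronglyMeasurable_clm (A := fun ω =>
      (innerSL ℝ (gradient (f ω) η)).smulRight (gradient (f ω) η)) fun v => by
        exact (hg.inner (𝕜 := ℝ) (stronglyMeasurable_const (b := v))).smul hg
    exact this.aestronglyMeasurable
  · exact (h.m_meas.sub (h.f_meas η).aestronglyMeasurable).smul
      (h.stronglyMeasurable_fderiv_gradient hη).aestronglyMeasurable

theorem norm_hess_le (h : LeastSquaresData Q k m b f η₁ r) (hη : η ∈ Metric.ball η₁ r) (ω : Ω) :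
    ‖k ω • residualHess (m ω) (f ω) η‖ ≤ 2 * (|k ω| * (b ω + |m ω|) ^ 2) := by
  rw [norm_smul, Real.norm_eq_abs, mul_left_comm]
  exact mul_le_mul_of_nonneg_left
    (norm_residualHess_le (h.smooth ω) Metric.isOpen_ball hη (h.bound ω η hη)) (abs_nonneg _)

theorem integrable_hess (h : LeastSquaresData Q k m b f η₁ r) (hη : η ∈ Metric.ball η₁ r) :
    Integrable (fun ω => k ω • residualHess (m ω) (f ω) η) Q :=
  (h.integrable.const_mul 2).mono' (h.aestronglyMeasurable_hess hη)
    (ae_of_all _ fun ω => h.norm_hess_le hη ω)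

theorem aestronglyMeasurable_loss (h : LeastSquaresData Q k m b f η₁ r)
    (η : EuclideanSpace ℝ (Fin q)) :
    AEStronglyMeasurable (fun ω => k ω * (m ω - f ω η) ^ 2) Q :=
  h.k_meas.aestronglyMeasurable.mul
    ((h.m_meas.sub (h.f_meas η).aestronglyMeasurable).pow 2)

theorem integrable_loss (h : LeastSquaresData Q k m b f η₁ r) (hη : η ∈ Metric.ball η₁ r) :
    Integrable (fun ω => k ω * (m ω - f ω η) ^ 2) Q := by
  refine h.integrable.mono' (h.aestronglyMeasurable_loss η) (ae_of_all _ fun ω => ?_)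
  have h1 := h.abs_residual_le hη ω
  rw [norm_mul, Real.norm_eq_abs, Real.norm_of_nonneg (sq_nonneg _), ← sq_abs (m ω - f ω η)]
  gcongr

/-- The gradient of the expected loss. -/
theorem hasGradientAt_integral_loss (h : LeastSquaresData Q k m b f η₁ r)
    (hη : η ∈ Metric.ball η₁ r) :
    HasGradientAt (fun η => ∫ ω, k ω * (m ω - f ω η) ^ 2 ∂Q)
      ((-2 : ℝ) • ∫ ω, (k ω * (m ω - f ω η)) • gradient (f ω) η ∂Q) η := by
  have hs := Metric.isOpen_ball.mem_nhds hη
  let T' : EuclideanSpace ℝ (Fin q) →L[ℝ] (EuclideanSpace ℝ (Fin q) →L[ℝ] ℝ) := innerSL ℝ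
  have hmain := hasFDerivAt_integral_of_dominated_of_fderiv_le (μ := Q)
    (F := fun η ω => k ω * (m ω - f ω η) ^ 2)
    (F' := fun η ω => T' ((-2 : ℝ) • ((k ω * (m ω - f ω η)) • gradient (f ω) η)))
    (bound := fun ω => 2 * (|k ω| * (b ω + |m ω|) ^ 2)) hs
    (Eventually.of_forall fun η => h.aestronglyMeasurable_loss η) (h.integrable_loss hη)
    (T'.continuous.comp_aestronglyMeasurable
      ((h.integrable_score hη).smul (-2 : ℝ)).aestronglyMeasurable)
    (ae_of_all _ fun ω η hη => ?_) (h.integrable.const_mul 2) (ae_of_all _ fun ω η hη => ?_)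
  · rw [hasGradientAt_iff_hasFDerivAt]
    refine hmain.congr_fderiv ?_
    have h1 := T'.integral_comp_comm ((h.integrable_score hη).smul (-2 : ℝ))
    simp only [Pi.smul_apply] at h1
    rw [h1, integral_smul]
    rfl
  · rw [innerSL_apply_norm, norm_smul]
    have := h.norm_score_le hη ω
    norm_num
    exact this
  · have h1 := (hasGradientAt_of_contDiffOn (h.smooth ω) Metric.isOpen_ball hη).hasFDerivAt
    refine (((h1.const_sub (m ω)).pow 2).const_mul (k ω)).congr_fderiv ?_
    ext v
    have h2 : innerSL ℝ (gradient (f ω) η) v = fderiv ℝ (f ω) η v := by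
      rw [innerSL_apply_apply, inner_gradient_left]
    simp [T', h2]
    ring

/-- The derivative of the expected score. -/
theorem hasFDerivAt_integral_score (h : LeastSquaresData Q k m b f η₁ r)
    (hη : η ∈ Metric.ball η₁ r) :
    HasFDerivAt (fun η => ∫ ω, (k ω * (m ω - f ω η)) • gradient (f ω) η ∂Q)
      (-∫ ω, k ω • residualHess (m ω) (f ω) η ∂Q) η := by
  have hs := Metric.isOpen_ball.mem_nhds hη
  rw [← integral_neg]
  refine hasFDerivAt_integral_of_dominated_of_fderiv_le (μ := Q)
    (F := fun η ω => (k ω * (m ω - f ω η)) • gradient (f ω) η)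
    (F' := fun η ω => -(k ω • residualHess (m ω) (f ω) η))
    (bound := fun ω => 2 * (|k ω| * (b ω + |m ω|) ^ 2)) hs ?_ (h.integrable_score hη)
    (h.aestronglyMeasurable_hess hη).neg
    (ae_of_all _ fun ω η hη => ?_) (h.integrable.const_mul 2) (ae_of_all _ fun ω η hη => ?_)
  · filter_upwards [hs] with η hη
    exact h.aestronglyMeasurable_score hη
  · rw [norm_neg]
    exact h.norm_hess_le hη ω
  · exact hasFDerivAt_score (h.smooth ω) Metric.isOpen_ball hη

theorem continuousAt_integral_hess (h : LeastSquaresData Q k m b f η₁ r)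
    (hη : η ∈ Metric.ball η₁ r) :
    ContinuousAt (fun η => ∫ ω, k ω • residualHess (m ω) (f ω) η ∂Q) η := by
  have hs := Metric.isOpen_ball.mem_nhds hη
  refine continuousAt_of_dominated (bound := fun ω => 2 * (|k ω| * (b ω + |m ω|) ^ 2)) ?_ ?_
    (h.integrable.const_mul 2) (ae_of_all _ fun ω => ?_)
  · filter_upwards [hs] with η hη
    exact h.aestronglyMeasurable_hess hη
  · filter_upwards [hs] with η hη
    exact ae_of_all _ fun ω => h.norm_hess_le hη ω
  · have h1 := continuousAt_residualHess (y := m ω) (h.smooth ω) Metric.isOpen_ball hη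
    have h2 : ContinuousAt (fun η => residualHess (m ω) (f ω) η) η :=
      ContinuousAt.comp' (f := fun η => (m ω, η)) h1 (by fun_prop)
    exact h2.const_smul (k ω)

/-- The gradient is `-2` times the expected score. The score has derivative minus the expected
`residualHess`, which dominated convergence makes continuous. -/
theorem contDiffOn_integral_loss (h : LeastSquaresData Q k m b f η₁ r) :
    ContDiffOn ℝ 2 (fun η => ∫ ω, k ω * (m ω - f ω η) ^ 2 ∂Q) (Metric.ball η₁ r) := by
  have hscore : ContDiffOn ℝ 1 (fun η => ∫ ω, (k ω * (m ω - f ω η)) • gradient (f ω) η ∂Q)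
      (Metric.ball η₁ r) := by
    rw [show (1 : WithTop ℕ∞) = 0 + 1 from rfl,
      contDiffOn_succ_iff_fderiv_of_isOpen Metric.isOpen_ball]
    refine ⟨fun η hη => (h.hasFDerivAt_integral_score hη).differentiableAt.differentiableWithinAt,
      by simp, ?_⟩
    rw [contDiffOn_zero]
    refine ContinuousOn.congr (f := fun η => -∫ ω, k ω • residualHess (m ω) (f ω) η ∂Q)
      (fun η hη => ((h.continuousAt_integral_hess hη).neg).continuousWithinAt)
      fun η hη => (h.hasFDerivAt_integral_score hη).fderiv
  rw [show (2 : WithTop ℕ∞) = 1 + 1 from rfl,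
    contDiffOn_succ_iff_fderiv_of_isOpen Metric.isOpen_ball]
  refine ⟨fun η hη => (h.hasGradientAt_integral_loss hη).differentiableAt.differentiableWithinAt,
    by simp, ?_⟩
  have h1 : ContDiffOn ℝ 1 (fun η => innerSL ℝ ((-2 : ℝ) •
      ∫ ω, (k ω * (m ω - f ω η)) • gradient (f ω) η ∂Q)) (Metric.ball η₁ r) :=
    (innerSL ℝ).contDiff.comp_contDiffOn (hscore.const_smul _)
  exact h1.congr fun η hη => (h.hasGradientAt_integral_loss hη).hasFDerivAt.fderiv

theorem hessian_integral_loss (h : LeastSquaresData Q k m b f η₁ r) (hη : η ∈ Metric.ball η₁ r)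
    (i j : Fin q) :
    hessian (fun η => ∫ ω, k ω * (m ω - f ω η) ^ 2 ∂Q) η i j
      = 2 * (∫ ω, k ω • residualHess (m ω) (f ω) η ∂Q) (EuclideanSpace.single i 1) j := by
  have h2 := fderiv_gradient_apply h.contDiffOn_integral_loss Metric.isOpen_ball hη i j
  rw [← h2]
  have h3 : gradient (fun η => ∫ ω, k ω * (m ω - f ω η) ^ 2 ∂Q) =ᶠ[𝓝 η]
      fun η => (-2 : ℝ) • ∫ ω, (k ω * (m ω - f ω η)) • gradient (f ω) η ∂Q := by
    filter_upwards [Metric.isOpen_ball.mem_nhds hη] with η hη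
    exact (h.hasGradientAt_integral_loss hη).gradient
  have h4 : HasFDerivAt
      (fun η => (-2 : ℝ) • ∫ ω, (k ω * (m ω - f ω η)) • gradient (f ω) η ∂Q)
      ((-2 : ℝ) • -∫ ω, k ω • residualHess (m ω) (f ω) η ∂Q) η :=
    (h.hasFDerivAt_integral_score hη).const_smul (-2 : ℝ)
  rw [h3.fderiv_eq, h4.fderiv]
  simp

theorem integral_hess_apply (h : LeastSquaresData Q k m b f η₁ r) (hη : η ∈ Metric.ball η₁ r)
    (i j : Fin q) :
    (∫ ω, k ω • residualHess (m ω) (f ω) η ∂Q) (EuclideanSpace.single i 1) j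
      = ∫ ω, k ω * (gradient (f ω) η i * gradient (f ω) η j
          - (m ω - f ω η) * hessian (f ω) η i j) ∂Q := by
  rw [ContinuousLinearMap.integral_apply (h.integrable_hess hη)]
  have hi := (h.integrable_hess hη).apply_continuousLinearMap (EuclideanSpace.single i 1)
  have hp := (EuclideanSpace.proj j : EuclideanSpace ℝ (Fin q) →L[ℝ] ℝ).integral_comp_comm hi
  refine Eq.trans hp.symm (integral_congr_ae (ae_of_all _ fun ω => ?_))
  have h1 := fderiv_gradient_apply (h.smooth ω) Metric.isOpen_ball hη i j
  have h2 : inner ℝ (gradient (f ω) η) (EuclideanSpace.single i 1) = gradient (f ω) η i := by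
    rw [EuclideanSpace.inner_single_right]
    simp
  have h3 : residualHess (m ω) (f ω) η (EuclideanSpace.single i 1)
      = inner ℝ (gradient (f ω) η) (EuclideanSpace.single i 1) • gradient (f ω) η
        - (m ω - f ω η) • fderiv ℝ (gradient (f ω)) η (EuclideanSpace.single i 1) := rfl
  change k ω * (residualHess (m ω) (f ω) η (EuclideanSpace.single i 1)) j = _
  rw [h3, h2]
  simp [h1]

end LeastSquaresData

/-! ### Averages against a likelihood ratio and the tilted law -/

section weighted

variable {α : Type*} [MeasurableSpace α] {ν : Measure α} {k φ : α → ℝ} {a ε : ℝ}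

theorem integrable_mul_of_close (hk : Integrable k ν) (hφ : AEStronglyMeasurable φ ν)
    (hb : ∀ t, |φ t - a| ≤ ε) : Integrable (fun t => k t * φ t) ν := by
  refine hk.mul_bdd (c := |a| + ε) hφ (ae_of_all _ fun t => ?_)
  have h := hb t
  have h2 := abs_sub_abs_le_abs_sub (φ t) a
  rw [Real.norm_eq_abs]
  linarith

/-- Used with `a = 1` for likelihood ratios and with `a = 0` for bounded scores. -/
theorem abs_integral_mul_sub_le (hk : Integrable k ν) (hφ : AEStronglyMeasurable φ ν)
    (hb : ∀ t, |φ t - a| ≤ ε) : |∫ t, k t * φ t ∂ν - a * ∫ t, k t ∂ν| ≤ ε * ∫ t, |k t| ∂ν := by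
  rw [← integral_const_mul, ← integral_sub (integrable_mul_of_close hk hφ hb) (hk.const_mul a),
    ← integral_const_mul, ← Real.norm_eq_abs]
  refine norm_integral_le_of_norm_le (hk.abs.const_mul ε) (ae_of_all _ fun t => ?_)
  rw [mul_comm a, ← mul_sub, Real.norm_eq_abs, abs_mul, mul_comm]
  gcongr
  exact hb t

end weighted

namespace ObsModel

variable {𝒳 : Type*} [MeasurableSpace 𝒳] (M : ObsModel 𝒳) (L : Obs 𝒳 → ℝ)

/-- `E(L(V) ∣ S, Z, X)`. -/
def avgS (t : ℝ × Bool × 𝒳) : ℝ := ∫ y, L (y, t) ∂(M.κ t)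

/-- `E(L(V) ∣ Z, X)`. -/
def avgZ (z : Bool) (x : 𝒳) : ℝ := ∫ s, M.p z s x * M.avgS L (s, z, x)

/-- `E(L(V) ∣ X)`. -/
def avgX (x : 𝒳) : ℝ :=
  M.propZ true x * M.avgZ L true x + M.propZ false x * M.avgZ L false x

variable {L}

theorem measurable_avgS (hL : Measurable L) : Measurable (M.avgS L) := by
  have h : StronglyMeasurable fun u : (ℝ × Bool × 𝒳) × ℝ => L (u.2, u.1) :=
    (hL.comp measurable_swap).stronglyMeasurable
  exact (h.integral_kernel_prod_right' (κ := M.κ)).measurable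

theorem measurable_p_mul_avgS (hL : Measurable L) (z : Bool) :
    Measurable fun u : 𝒳 × ℝ => M.p z u.2 u.1 * M.avgS L (u.2, z, u.1) :=
  (M.measurable_p_swap z).mul ((M.measurable_avgS hL).comp (by fun_prop))

theorem measurable_avgZ (hL : Measurable L) (z : Bool) : Measurable (M.avgZ L z) :=
  ((M.measurable_p_mul_avgS hL z).stronglyMeasurable.integral_prod_right' (ν := volume)).measurable

theorem measurable_avgX (hL : Measurable L) : Measurable (M.avgX L) :=
  ((M.measurable_propZ _).mul (M.measurable_avgZ hL _)).add
    ((M.measurable_propZ _).mul (M.measurable_avgZ hL _))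

theorem propZ_add (x : 𝒳) : M.propZ true x + M.propZ false x = 1 := by simp [propZ]

variable {a ε : ℝ}

/-- Averaging does not enlarge the distance to a constant, so `ε` survives each successive
conditioning, on `(S, Z, X)`, on `(Z, X)` and on `X`. -/
theorem abs_avgS_sub_le (hL : Measurable L) (hb : ∀ v, |L v - a| ≤ ε) (t : ℝ × Bool × 𝒳) :
    |M.avgS L t - a| ≤ ε := by
  have h := abs_integral_mul_sub_le (ν := M.κ t) (k := fun _ => (1 : ℝ)) (φ := fun y => L (y, t))
    (integrable_const 1) (hL.comp measurable_prodMk_right).aestronglyMeasurable (fun y => hb _)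
  simpa [avgS] using h

theorem measurable_avgS_left (hL : Measurable L) (z : Bool) (x : 𝒳) :
    Measurable fun s => M.avgS L (s, z, x) := (M.measurable_avgS hL).comp (by fun_prop)

theorem integrable_p_mul_avgS (hL : Measurable L) (hb : ∀ v, |L v - a| ≤ ε) (z : Bool) (x : 𝒳) :
    Integrable fun s => M.p z s x * M.avgS L (s, z, x) :=
  integrable_mul_of_close (M.integrable_p z x) (M.measurable_avgS_left hL z x).aestronglyMeasurable
    fun _ => M.abs_avgS_sub_le hL hb _

theorem abs_avgZ_sub_le (hL : Measurable L) (hb : ∀ v, |L v - a| ≤ ε) (z : Bool) (x : 𝒳) :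
    |M.avgZ L z x - a| ≤ ε := by
  have h := abs_integral_mul_sub_le (M.integrable_p z x)
    (M.measurable_avgS_left hL z x).aestronglyMeasurable fun _ => M.abs_avgS_sub_le hL hb _
  simpa [avgZ, abs_of_nonneg (M.p_nonneg _ _ _), M.integral_p] using h

theorem abs_avgX_sub_le (hL : Measurable L) (hb : ∀ v, |L v - a| ≤ ε) (x : 𝒳) :
    |M.avgX L x - a| ≤ ε := by
  have h1 := M.abs_avgZ_sub_le hL hb true x
  have h0 := M.abs_avgZ_sub_le hL hb false x
  have p1 := (M.propZ_pos true x).le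
  have p0 := (M.propZ_pos false x).le
  have hs := M.propZ_add x
  have : M.avgX L x - a = M.propZ true x * (M.avgZ L true x - a)
      + M.propZ false x * (M.avgZ L false x - a) := by
    rw [avgX]; linear_combination a * hs
  rw [this]
  refine (abs_add_le _ _).trans ?_
  rw [abs_mul, abs_mul, abs_of_nonneg p1, abs_of_nonneg p0]
  calc _ ≤ M.propZ true x * ε + M.propZ false x * ε := by gcongr
    _ = ε := by rw [← add_mul, hs, one_mul]

section tilt

theorem ofReal_avgS (hL : Measurable L) (hb : ∀ v, |L v - a| ≤ ε) (hpos : ∀ v, 0 ≤ L v)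
    (t : ℝ × Bool × 𝒳) : ENNReal.ofReal (M.avgS L t) = ∫⁻ y, ENNReal.ofReal (L (y, t)) ∂(M.κ t) := by
  rw [avgS, ofReal_integral_eq_lintegral_ofReal _ (ae_of_all _ fun y => hpos _)]
  have h := integrable_mul_of_close (ν := M.κ t) (k := fun _ => (1 : ℝ)) (φ := fun y => L (y, t))
    (integrable_const 1) (hL.comp measurable_prodMk_right).aestronglyMeasurable (fun y => hb _)
  simpa using h

theorem avgS_nonneg (hpos : ∀ v, 0 ≤ L v) (t : ℝ × Bool × 𝒳) : 0 ≤ M.avgS L t :=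
  integral_nonneg fun _ => hpos _

theorem ofReal_avgZ (hL : Measurable L) (hb : ∀ v, |L v - a| ≤ ε) (hpos : ∀ v, 0 ≤ L v)
    (z : Bool) (x : 𝒳) : ENNReal.ofReal (M.avgZ L z x)
      = ∫⁻ s, ENNReal.ofReal (M.p z s x) * ENNReal.ofReal (M.avgS L (s, z, x)) := by
  rw [avgZ, ofReal_integral_eq_lintegral_ofReal (M.integrable_p_mul_avgS hL hb z x)
    (ae_of_all _ fun s => mul_nonneg (M.p_nonneg _ _ _) (M.avgS_nonneg hpos _))]
  exact lintegral_congr fun s => ENNReal.ofReal_mul (M.p_nonneg _ _ _)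

theorem avgZ_nonneg (hpos : ∀ v, 0 ≤ L v) (z : Bool) (x : 𝒳) : 0 ≤ M.avgZ L z x :=
  integral_nonneg fun _ => mul_nonneg (M.p_nonneg _ _ _) (M.avgS_nonneg hpos _)

/-- Tower property; it makes the tilted covariate law a probability measure. -/
theorem lintegral_avgX (hL : Measurable L) (hb : ∀ v, |L v - a| ≤ ε) (hpos : ∀ v, 0 ≤ L v) :
    ∫⁻ x, ENNReal.ofReal (M.avgX L x) ∂M.PX = ∫⁻ v, ENNReal.ofReal (L v) ∂M.law := by
  rw [M.lintegral_law hL.ennreal_ofReal]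
  have h : ∀ z, ∫⁻ u, ENNReal.ofReal (M.propZ z u.1.1) * ENNReal.ofReal (L (obsOf z u))
      ∂(M.full z) = ∫⁻ x, ENNReal.ofReal (M.propZ z x * M.avgZ L z x) ∂M.PX := by
    intro z
    have hm : Measurable fun u : (𝒳 × ℝ) × ℝ =>
        ENNReal.ofReal (M.propZ z u.1.1) * ENNReal.ofReal (L (obsOf z u)) :=
      (((M.measurable_propZ z).comp (by fun_prop)).ennreal_ofReal).mul
        (hL.comp (measurable_obsOf z)).ennreal_ofReal
    rw [M.lintegral_full z hm]
    refine lintegral_congr fun x => ?_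
    rw [ENNReal.ofReal_mul (M.propZ_pos z x).le, M.ofReal_avgZ hL hb hpos,
      ← lintegral_const_mul' _ _ ENNReal.ofReal_ne_top]
    refine lintegral_congr fun s => ?_
    rw [M.ofReal_avgS hL hb hpos]
    change _ * ∫⁻ y, ENNReal.ofReal (M.propZ z x) * ENNReal.ofReal (L (y, s, z, x)) ∂_ = _
    rw [lintegral_const_mul' _ _ ENNReal.ofReal_ne_top]
    ring
  have hpA : Measurable fun x => ENNReal.ofReal (M.propZ true x * M.avgZ L true x) :=
    ((M.measurable_propZ true).mul (M.measurable_avgZ hL true)).ennreal_ofReal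
  rw [Fintype.sum_bool, h, h, ← lintegral_add_left hpA]
  refine lintegral_congr fun x => ?_
  rw [avgX, ENNReal.ofReal_add (mul_nonneg (M.propZ_pos _ x).le (M.avgZ_nonneg hpos _ _))
    (mul_nonneg (M.propZ_pos _ x).le (M.avgZ_nonneg hpos _ _))]

/-- The threshold `1 / 2` bounds the likelihood ratio and all its conditional averages away from
zero at every point, so the tilted factors can be divided without exceptional sets. -/
theorem half_le_of_abs_sub_one_le {u : ℝ} (h : |u - 1| ≤ 1 / 2) : 1 / 2 ≤ u := by
  have := (abs_le.1 h).1
  linarith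

theorem pos_of_abs_sub_one_le {u : ℝ} (h : |u - 1| ≤ 1 / 2) : 0 < u := by
  have := half_le_of_abs_sub_one_le h
  linarith

variable (L)

/-- The density of `S` given `Z = z`, `X = x` under the law with likelihood ratio `L`. -/
def tiltP (z : Bool) (s : ℝ) (x : 𝒳) : ℝ := M.p z s x * M.avgS L (s, z, x) / M.avgZ L z x

/-- The distribution function of `S` given `Z = z`, `X = x` under the law with likelihood ratio
`L`. -/
def tiltF (z : Bool) (s : ℝ) (x : 𝒳) : ℝ :=
  (∫ t in Iic s, M.p z t x * M.avgS L (t, z, x)) / M.avgZ L z x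

/-- The treated outcome mean under the law with likelihood ratio `L`. -/
def tiltMu (s : ℝ) (x : 𝒳) : ℝ :=
  (∫ y, y * L (y, s, true, x) ∂(M.κ (s, true, x))) / M.avgS L (s, true, x)

/-- The outcome kernel under the law with likelihood ratio `L`. -/
def tiltKernel : Kernel (ℝ × Bool × 𝒳) ℝ :=
  M.κ.withDensity fun t y => ENNReal.ofReal (L (y, t) / M.avgS L t)

variable {L}

theorem measurable_tiltKernel_density (hL : Measurable L) :
    Measurable (Function.uncurry fun (t : ℝ × Bool × 𝒳) (y : ℝ) =>
      ENNReal.ofReal (L (y, t) / M.avgS L t)) :=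
  ((hL.comp measurable_swap).div ((M.measurable_avgS hL).comp measurable_fst)).ennreal_ofReal

/-- The observed-data law with likelihood ratio `L` with respect to `M.law`, factorized. -/
def tilt (hL : Measurable L) (hb : ∀ v, |L v - 1| ≤ 1 / 2)
    (hone : ∫⁻ v, ENNReal.ofReal (L v) ∂M.law = 1) : ObsModel 𝒳 where
  PX := M.PX.withDensity fun x => ENNReal.ofReal (M.avgX L x)
  isProb := by
    constructor
    rw [withDensity_apply _ MeasurableSet.univ, Measure.restrict_univ,
      M.lintegral_avgX hL hb fun v => (pos_of_abs_sub_one_le (hb v)).le, hone]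
  prop x := M.prop x * M.avgZ L true x / M.avgX L x
  prop_meas := (M.prop_meas.mul (M.measurable_avgZ hL true)).div (M.measurable_avgX hL)
  prop_pos x := div_pos (mul_pos (M.prop_pos x)
    (pos_of_abs_sub_one_le (M.abs_avgZ_sub_le hL hb true x)))
    (pos_of_abs_sub_one_le (M.abs_avgX_sub_le hL hb x))
  prop_lt_one x := by
    rw [div_lt_one (pos_of_abs_sub_one_le (M.abs_avgX_sub_le hL hb x)), avgX]
    have := mul_pos (M.propZ_pos false x)
      (pos_of_abs_sub_one_le (M.abs_avgZ_sub_le hL hb false x))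
    have h : M.propZ true x = M.prop x := rfl
    rw [h]
    linarith
  p := M.tiltP L
  p_meas z := by
    have h := (M.measurable_p_mul_avgS hL z).div ((M.measurable_avgZ hL z).comp measurable_fst)
    exact h.comp measurable_swap
  p_nonneg z s x := div_nonneg (mul_nonneg (M.p_nonneg _ _ _)
    (pos_of_abs_sub_one_le (M.abs_avgS_sub_le hL hb _)).le)
    (pos_of_abs_sub_one_le (M.abs_avgZ_sub_le hL hb z x)).le
  p_lintegral z x := by
    have hz := pos_of_abs_sub_one_le (M.abs_avgZ_sub_le hL hb z x)
    have h : ∀ s, ENNReal.ofReal (M.tiltP L z s x) = (ENNReal.ofReal (M.avgZ L z x))⁻¹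
        * (ENNReal.ofReal (M.p z s x) * ENNReal.ofReal (M.avgS L (s, z, x))) := by
      intro s
      rw [tiltP, ENNReal.ofReal_div_of_pos hz, ENNReal.ofReal_mul (M.p_nonneg _ _ _),
        ENNReal.div_eq_inv_mul]
    simp only [h]
    have hne : ENNReal.ofReal (M.avgZ L z x) ≠ 0 := by simpa using hz
    rw [lintegral_const_mul' _ _ (ENNReal.inv_ne_top.2 hne),
      ← M.ofReal_avgZ hL hb fun v => (pos_of_abs_sub_one_le (hb v)).le]
    exact ENNReal.inv_mul_cancel hne ENNReal.ofReal_ne_top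
  κ := M.tiltKernel L
  isMarkov := by
    constructor
    intro t
    constructor
    have hz := pos_of_abs_sub_one_le (M.abs_avgS_sub_le hL hb t)
    have hne : ENNReal.ofReal (M.avgS L t) ≠ 0 := by simpa using hz
    rw [tiltKernel, Kernel.withDensity_apply _ (M.measurable_tiltKernel_density hL),
      withDensity_apply _ MeasurableSet.univ, Measure.restrict_univ]
    simp only [ENNReal.ofReal_div_of_pos hz, ENNReal.div_eq_inv_mul]
    rw [lintegral_const_mul' _ _ (ENNReal.inv_ne_top.2 hne),
      ← M.ofReal_avgS hL hb fun v => (pos_of_abs_sub_one_le (hb v)).le]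
    exact ENNReal.inv_mul_cancel hne ENNReal.ofReal_ne_top

variable (hL : Measurable L) (hb : ∀ v, |L v - 1| ≤ 1 / 2)
    (hone : ∫⁻ v, ENNReal.ofReal (L v) ∂M.law = 1)

theorem tilt_propZ (z : Bool) (x : 𝒳) : (M.tilt hL hb hone).propZ z x
    = M.propZ z x * M.avgZ L z x / M.avgX L x := by
  cases z
  · have hx := (pos_of_abs_sub_one_le (M.abs_avgX_sub_le hL hb x)).ne'
    change 1 - M.prop x * M.avgZ L true x / M.avgX L x = _
    rw [eq_div_iff hx, sub_mul, div_mul_cancel₀ _ hx, one_mul]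
    simp [avgX, propZ]
  · rfl

theorem lintegral_tiltKernel (hL : Measurable L) (t : ℝ × Bool × 𝒳) {g : ℝ → ℝ≥0∞}
    (hg : Measurable g) : ∫⁻ y, g y ∂(M.tiltKernel L t)
      = ∫⁻ y, ENNReal.ofReal (L (y, t) / M.avgS L t) * g y ∂(M.κ t) := by
  rw [tiltKernel, Kernel.lintegral_withDensity _ (M.measurable_tiltKernel_density hL) t hg]

/-- The normalizations telescope: in the product of the four tilted factors the averages over `X`,
over `(Z, X)` and over `(S, Z, X)` cancel, and only `L` times the original factors remains. -/
theorem tilt_law : (M.tilt hL hb hone).law = M.law.withDensity fun v => ENNReal.ofReal (L v) := by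
  ext A hA
  have hk : Measurable (A.indicator (1 : Obs 𝒳 → ℝ≥0∞)) := measurable_one.indicator hA
  set k := A.indicator (1 : Obs 𝒳 → ℝ≥0∞) with hkdef
  rw [← lintegral_indicator_one hA, ← lintegral_indicator_one hA, ← hkdef, lintegral_law _ hk,
    lintegral_withDensity_eq_lintegral_mul _ hL.ennreal_ofReal hk,
    lintegral_law _ (hL.ennreal_ofReal.mul hk)]
  refine Finset.sum_congr rfl fun z _ => ?_
  have hm1 : Measurable fun u : (𝒳 × ℝ) × ℝ =>
      ENNReal.ofReal ((M.tilt hL hb hone).propZ z u.1.1) * k (obsOf z u) :=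
    ((((M.tilt hL hb hone).measurable_propZ z).comp (by fun_prop)).ennreal_ofReal).mul
      (hk.comp (measurable_obsOf z))
  have hm2 : Measurable fun u : (𝒳 × ℝ) × ℝ => ENNReal.ofReal (M.propZ z u.1.1)
      * ((fun v => ENNReal.ofReal (L v)) * k) (obsOf z u) :=
    (((M.measurable_propZ z).comp (by fun_prop)).ennreal_ofReal).mul
      ((hL.ennreal_ofReal.mul hk).comp (measurable_obsOf z))
  rw [lintegral_full _ z hm1, lintegral_full _ z hm2]
  have hin : Measurable fun x => ∫⁻ s, ENNReal.ofReal ((M.tilt hL hb hone).p z s x)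
      * ∫⁻ y, ENNReal.ofReal ((M.tilt hL hb hone).propZ z ((x, s), y).1.1)
        * k (obsOf z ((x, s), y)) ∂((M.tilt hL hb hone).κ (s, z, x)) := by
    have h1 : Measurable fun t : 𝒳 × ℝ =>
        ∫⁻ y, ENNReal.ofReal ((M.tilt hL hb hone).propZ z (t, y).1.1)
          * k (obsOf z (t, y)) ∂((M.tilt hL hb hone).outcome z t) :=
      Measurable.lintegral_kernel_prod_right' hm1
    have h2 := ((M.tilt hL hb hone).measurable_p_swap z).ennreal_ofReal.mul h1
    exact Measurable.lintegral_prod_right' h2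
  have hPX : (M.tilt hL hb hone).PX = M.PX.withDensity fun x => ENNReal.ofReal (M.avgX L x) := rfl
  rw [hPX, lintegral_withDensity_eq_lintegral_mul _ (M.measurable_avgX hL).ennreal_ofReal hin]
  refine lintegral_congr fun x => ?_
  rw [Pi.mul_apply, ← lintegral_const_mul' _ _ ENNReal.ofReal_ne_top]
  refine lintegral_congr fun s => ?_
  have hky : Measurable fun y => ENNReal.ofReal ((M.tilt hL hb hone).propZ z x)
      * k (y, s, z, x) := (hk.comp measurable_prodMk_right).const_mul _
  have hker : (M.tilt hL hb hone).κ = M.tiltKernel L := rfl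
  have hp : (M.tilt hL hb hone).p z s x = M.tiltP L z s x := rfl
  rw [hker, hp]
  change ENNReal.ofReal (M.avgX L x) * (ENNReal.ofReal (M.tiltP L z s x)
      * ∫⁻ y, ENNReal.ofReal ((M.tilt hL hb hone).propZ z x) * k (y, s, z, x)
        ∂(M.tiltKernel L (s, z, x)))
    = ENNReal.ofReal (M.p z s x) * ∫⁻ y, ENNReal.ofReal (M.propZ z x)
        * (ENNReal.ofReal (L (y, s, z, x)) * k (y, s, z, x)) ∂(M.κ (s, z, x))
  rw [M.lintegral_tiltKernel hL _ hky, ← lintegral_const_mul' _ _ ENNReal.ofReal_ne_top,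
    ← lintegral_const_mul' _ _ ENNReal.ofReal_ne_top,
    ← lintegral_const_mul' _ _ ENNReal.ofReal_ne_top]
  refine lintegral_congr fun y => ?_
  have hx := pos_of_abs_sub_one_le (M.abs_avgX_sub_le hL hb x)
  have hz := pos_of_abs_sub_one_le (M.abs_avgZ_sub_le hL hb z x)
  have hs := pos_of_abs_sub_one_le (M.abs_avgS_sub_le hL hb (s, z, x))
  have hLp := pos_of_abs_sub_one_le (hb (y, s, z, x))
  have hpp := M.p_nonneg z s x
  have hpz := (M.propZ_pos z x).le
  have hreal : M.avgX L x * (M.tiltP L z s x * (L (y, s, z, x) / M.avgS L (s, z, x)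
      * (M.tilt hL hb hone).propZ z x)) = M.p z s x * (M.propZ z x * L (y, s, z, x)) := by
    rw [M.tilt_propZ hL hb hone, tiltP]
    field_simp
  have h1 := congrArg ENNReal.ofReal hreal
  rw [ENNReal.ofReal_mul hx.le, ENNReal.ofReal_mul (by rw [tiltP]; positivity),
    ENNReal.ofReal_mul (by positivity), ENNReal.ofReal_mul hpp, ENNReal.ofReal_mul hpz] at h1
  simp only [← mul_assoc] at h1 ⊢
  rw [h1]

theorem tilt_F (z : Bool) (s : ℝ) (x : 𝒳) : (M.tilt hL hb hone).F z s x = M.tiltF L z s x := by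
  change ∫ t in Iic s, M.tiltP L z t x = _
  simp only [tiltP, tiltF]
  rw [integral_div]

theorem tilt_mu1 (s : ℝ) (x : 𝒳) : (M.tilt hL hb hone).mu1 s x = M.tiltMu L s x := by
  have hz := pos_of_abs_sub_one_le (M.abs_avgS_sub_le hL hb (s, true, x))
  have hd : Measurable fun y => ENNReal.ofReal (L (y, s, true, x) / M.avgS L (s, true, x)) :=
    (M.measurable_tiltKernel_density hL).comp measurable_prodMk_left
  change ∫ y, y ∂(M.tiltKernel L (s, true, x)) = _
  rw [tiltKernel, Kernel.withDensity_apply _ (M.measurable_tiltKernel_density hL),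
    integral_withDensity_eq_integral_toReal_smul hd
      (ae_of_all _ fun _ => ENNReal.ofReal_lt_top), tiltMu, ← integral_div]
  refine integral_congr_ae (ae_of_all _ fun y => ?_)
  have hLp := pos_of_abs_sub_one_le (hb (y, s, true, x))
  simp only [smul_eq_mul]
  rw [ENNReal.toReal_ofReal (by positivity)]
  ring

end tilt

section bounds

variable (hL : Measurable L) (hb : ∀ v, |L v - 1| ≤ ε) (hε : ε ≤ 1 / 2)
include hL hb hε

/-- With tilted lower and upper masses `A` and `B`, the error is `((1 - F)(A - F) - F(B - (1 - F)))
/ (A + B)`. Since `|A - F| ≤ ε F` and `|B - (1 - F)| ≤ ε (1 - F)`, the factor `F (1 - F)` comes out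
and the change dies in both tails. A denominator of at least `1 / 2` turns the constant `2` into
`4`. -/
theorem abs_tiltF_sub_le (z : Bool) (s : ℝ) (x : 𝒳) :
    |M.tiltF L z s x - M.F z s x| ≤ 4 * ε * (M.F z s x * (1 - M.F z s x)) := by
  have hg := M.integrable_p_mul_avgS hL hb z x
  have hm := (M.measurable_avgS_left hL z x).aestronglyMeasurable (μ := volume)
  have h1 := abs_integral_mul_sub_le (M.integrable_p z x).integrableOn
    (hm.restrict (s := Iic s)) fun _ => M.abs_avgS_sub_le hL hb _
  have h2 := abs_integral_mul_sub_le (M.integrable_p z x).integrableOn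
    (hm.restrict (s := Ioi s)) fun _ => M.abs_avgS_sub_le hL hb _
  have hsum : (∫ t in Iic s, M.p z t x * M.avgS L (t, z, x))
      + (∫ t in Ioi s, M.p z t x * M.avgS L (t, z, x)) = M.avgZ L z x := by
    rw [avgZ, ← integral_add_compl measurableSet_Iic hg, compl_Iic]
  have hFc : ∫ t in Ioi s, M.p z t x = 1 - M.F z s x := by
    rw [← M.integral_p z x, ← integral_add_compl (measurableSet_Iic (a := s)) (M.integrable_p z x),
      compl_Iic, F]
    ring
  have hF : ∫ t in Iic s, M.p z t x = M.F z s x := rfl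
  simp only [abs_of_nonneg (M.p_nonneg _ _ _), hFc, hF, one_mul] at h1 h2
  have hz := half_le_of_abs_sub_one_le ((M.abs_avgZ_sub_le hL hb z x).trans hε)
  have hF0 := M.F_nonneg z s x
  have hF1 := M.F_le_one z s x
  rw [tiltF]
  set A := ∫ t in Iic s, M.p z t x * M.avgS L (t, z, x)
  set B := ∫ t in Ioi s, M.p z t x * M.avgS L (t, z, x)
  set Fx := M.F z s x
  have hzpos : 0 < M.avgZ L z x := by linarith
  have e1 : A / M.avgZ L z x - Fx = ((1 - Fx) * (A - Fx) - Fx * (B - (1 - Fx))) / M.avgZ L z x := by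
    field_simp
    rw [← hsum]
    ring
  rw [e1, abs_div, abs_of_pos hzpos, div_le_iff₀ hzpos]
  have hε0 : 0 ≤ ε := (abs_nonneg _).trans (M.abs_avgZ_sub_le hL hb z x)
  have h3 : |(1 - Fx) * (A - Fx) - Fx * (B - (1 - Fx))| ≤ 2 * ε * (Fx * (1 - Fx)) := by
    refine (abs_sub _ _).trans ?_
    rw [abs_mul, abs_mul, abs_of_nonneg hF0, abs_of_nonneg (sub_nonneg.2 hF1)]
    have := mul_le_mul_of_nonneg_left h1 (sub_nonneg.2 hF1)
    have := mul_le_mul_of_nonneg_left h2 hF0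
    linarith
  have h4 : 0 ≤ ε * (Fx * (1 - Fx)) :=
    mul_nonneg hε0 (mul_nonneg hF0 (sub_nonneg.2 hF1))
  nlinarith

/-- The error is measured relative to the mean of `|Y|`, the quantity that the envelope controls;
numerator and normalization each contribute one `ε`, doubled by the denominator. -/
theorem abs_tiltMu_sub_le {s : ℝ} {x : 𝒳} (hi : Integrable (fun y : ℝ => y) (M.κ (s, true, x))) :
    |M.tiltMu L s x - M.mu1 s x| ≤ 4 * ε * ∫ y, |y| ∂(M.κ (s, true, x)) := by
  have hm : AEStronglyMeasurable (fun y => L (y, s, true, x)) (M.κ (s, true, x)) :=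
    (hL.comp measurable_prodMk_right).aestronglyMeasurable
  have h1 := abs_integral_mul_sub_le hi hm fun _ => hb _
  have h2 := M.abs_avgS_sub_le hL hb (s, true, x)
  have hz := half_le_of_abs_sub_one_le (h2.trans hε)
  have hmu : |M.mu1 s x| ≤ ∫ y, |y| ∂(M.κ (s, true, x)) := abs_integral_le_integral_abs
  have hzpos : 0 < M.avgS L (s, true, x) := by linarith
  rw [tiltMu, mu1] at *
  set A := ∫ y, y * L (y, s, true, x) ∂(M.κ (s, true, x))
  set m := ∫ y, y ∂(M.κ (s, true, x))
  set c := ∫ y, |y| ∂(M.κ (s, true, x))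
  set l := M.avgS L (s, true, x)
  have e1 : A / l - m = ((A - 1 * m) - m * (l - 1)) / l := by
    field_simp
    ring
  have hε0 : 0 ≤ ε := (abs_nonneg _).trans h2
  have hc : 0 ≤ c := (abs_nonneg _).trans hmu
  rw [e1, abs_div, abs_of_pos hzpos, div_le_iff₀ hzpos]
  have h3 : |(A - 1 * m) - m * (l - 1)| ≤ ε * c + c * ε := by
    refine (abs_sub _ _).trans ?_
    rw [abs_mul]
    gcongr
  have h4 : 0 ≤ ε * c := mul_nonneg hε0 hc
  nlinarith

theorem abs_tiltMu_le {s : ℝ} {x : 𝒳} (hi : Integrable (fun y : ℝ => y) (M.κ (s, true, x))) :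
    |M.tiltMu L s x| ≤ 3 * ∫ y, |y| ∂(M.κ (s, true, x)) := by
  have h1 := M.abs_tiltMu_sub_le hL hb hε hi
  have hmu : |M.mu1 s x| ≤ ∫ y, |y| ∂(M.κ (s, true, x)) := abs_integral_le_integral_abs
  have h2 := abs_sub_abs_le_abs_sub (M.tiltMu L s x) (M.mu1 s x)
  have hc : 0 ≤ ∫ y, |y| ∂(M.κ (s, true, x)) := (abs_nonneg _).trans hmu
  nlinarith

end bounds
end ObsModel

/-! ### Implicit differentiation and strongly convex minimization -/

section optimization

variable {E : Type*} [NormedAddCommGroup E] [InnerProductSpace ℝ E]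

/-- A root that is continuous in the parameter is differentiable in it, with the derivative given
by implicit differentiation. -/
theorem hasDerivAt_of_implicit {Φ : ℝ × E → E} {η₁ d : E} {A Ainv : E →L[ℝ] E} {Φ' : ℝ × E →L[ℝ] E}
    (hΦ : HasFDerivAt Φ Φ' (0, η₁)) (hΦ' : ∀ t v, Φ' (t, v) = t • d - A v)
    (h0 : Φ (0, η₁) = 0) (hinv : ∀ v, Ainv (A v) = v) {ηθ : ℝ → E} (hη0 : ηθ 0 = η₁)
    (hcont : ContinuousAt ηθ 0) (hroot : ∀ᶠ θ in 𝓝 0, Φ (θ, ηθ θ) = 0) :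
    HasDerivAt ηθ (Ainv d) 0 := by
  rw [hasDerivAt_iff_isLittleO, hη0]
  simp only [sub_zero]
  set e : ℝ → E := fun θ => ηθ θ - η₁ - θ • Ainv d with he
  have hpair : Tendsto (fun θ => (θ, ηθ θ)) (𝓝 0) (𝓝 ((0 : ℝ), η₁)) := by
    rw [← hη0]
    exact continuousAt_id.prodMk hcont
  have h1 := (hΦ.isLittleO).comp_tendsto hpair
  have h2 : e =o[𝓝 0] fun θ => ((θ, ηθ θ) - ((0 : ℝ), η₁)) := by
    -- At a root the linearization itself is of smaller order than the displacement. Applying `Ainv`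
    -- to it isolates minus the remainder `e`.
    have h3 := (Ainv.isBigO_comp (fun θ => Φ' ((θ, ηθ θ) - (0, η₁))) (𝓝 (0 : ℝ)))
    have h4 : (fun θ => Φ' ((θ, ηθ θ) - (0, η₁))) =o[𝓝 0]
        fun θ => ((θ, ηθ θ) - ((0 : ℝ), η₁)) := by
      refine h1.neg_left.congr' ?_ (by rfl)
      filter_upwards [hroot] with θ hθ
      simp only [Function.comp_apply, hθ, h0, sub_zero, zero_sub, neg_neg]
    refine (h3.trans_isLittleO h4).neg_left.congr_left fun θ => ?_
    simp only [Prod.mk_sub_mk, sub_zero, hΦ', map_sub, map_smul, hinv, he]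
    abel
  -- The displacement contains the unknown `e`, so the estimate so far is circular: `e` is small
  -- relative to the pair `(θ, e)`.
  have h5 : (fun θ => ((θ, ηθ θ) - ((0 : ℝ), η₁))) =O[𝓝 0] fun θ => (θ, e θ) := by
    refine Asymptotics.IsBigO.of_bound (1 + ‖Ainv d‖) (Eventually.of_forall fun θ => ?_)
    have hx : ‖θ‖ ≤ ‖(θ, e θ)‖ := norm_fst_le (θ, e θ)
    have hy : ‖e θ‖ ≤ ‖(θ, e θ)‖ := norm_snd_le (θ, e θ)
    have hn := norm_nonneg (Ainv d)
    have hn2 := norm_nonneg (θ, e θ)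
    have hd : ηθ θ - η₁ = e θ + θ • Ainv d := by simp [he]
    rw [Prod.mk_sub_mk, sub_zero, hd]
    refine max_le (by nlinarith) ?_
    refine (norm_add_le _ _).trans ?_
    rw [norm_smul]
    nlinarith [norm_nonneg θ]
  have h6 := h2.trans_isBigO h5
  rw [Asymptotics.isLittleO_iff] at h6 ⊢
  intro c hc
  -- Capping the constant at `1 / 2` breaks the circle: if `e` dominated `θ`, it would be at most
  -- half of itself, hence zero. No Lipschitz property of the root is needed.
  have hc' : 0 < min c (1 / 2) := lt_min hc (by norm_num)
  filter_upwards [h6 hc'] with θ hθ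
  rw [Prod.norm_mk] at hθ
  rcases le_total ‖e θ‖ ‖θ‖ with h | h
  · rw [max_eq_left h] at hθ
    exact hθ.trans (mul_le_mul_of_nonneg_right (min_le_left _ _) (norm_nonneg _))
  · rw [max_eq_right h] at hθ
    have h7 : ‖e θ‖ ≤ 1 / 2 * ‖e θ‖ :=
      hθ.trans (mul_le_mul_of_nonneg_right (min_le_right _ _) (norm_nonneg _))
    have h8 : ‖e θ‖ = 0 := le_antisymm (by linarith) (norm_nonneg _)
    rw [h8]
    positivity

section line

variable {G : E → ℝ} {Ψ : E → E} {A : E → E →L[ℝ] E} {η v : E} {t : ℝ}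

theorem hasDerivAt_inner_line (hΨ : HasFDerivAt Ψ (-A (η + t • v)) (η + t • v)) :
    HasDerivAt (fun t : ℝ => -2 * inner ℝ (Ψ (η + t • v)) v)
      (2 * inner ℝ (A (η + t • v) v) v) t := by
  have h1 : HasDerivAt (fun t : ℝ => η + t • v) v t := by
    simpa using ((hasDerivAt_id t).smul_const v).const_add η
  have h2 := ((hΨ.comp_hasDerivAt t h1).inner ℝ (hasDerivAt_const t v)).const_mul (-2)
  refine h2.congr_deriv ?_
  simp [inner_neg_left]

variable [CompleteSpace E]

theorem hasDerivAt_line (hG : HasGradientAt G ((-2 : ℝ) • Ψ (η + t • v)) (η + t • v)) :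
    HasDerivAt (fun t : ℝ => G (η + t • v)) (-2 * inner ℝ (Ψ (η + t • v)) v) t := by
  have h1 : HasDerivAt (fun t : ℝ => η + t • v) v t := by
    simpa using ((hasDerivAt_id t).smul_const v).const_add η
  have h2 : HasDerivAt (fun t : ℝ => G (η + t • v)) _ t := hG.hasFDerivAt.comp_hasDerivAt t h1
  refine h2.congr_deriv ?_
  simp

/-- First and second order necessary conditions at a minimum. -/
theorem necessary_conditions {U : Set E} (hU : U ∈ 𝓝 η)
    (hG : ∀ η' ∈ U, HasGradientAt G ((-2 : ℝ) • Ψ η') η') (hΨ : HasFDerivAt Ψ (-A η) η)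
    (hmin : ∀ η' ∈ U, G η ≤ G η') : Ψ η = 0 ∧ ∀ v, 0 ≤ inner ℝ (A η v) v := by
  have hΨ0 : Ψ η = 0 := by
    have hl : IsLocalMin G η := by
      filter_upwards [hU] with η' h using hmin η' h
    have h := hl.hasFDerivAt_eq_zero (hG η (mem_of_mem_nhds hU)).hasFDerivAt
    simpa using h
  refine ⟨hΨ0, fun v => ?_⟩
  by_contra hneg
  rw [not_le] at hneg
  have hline : Tendsto (fun t : ℝ => η + t • v) (𝓝 0) (𝓝 η) := by
    have : Continuous fun t : ℝ => η + t • v := by fun_prop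
    simpa using this.tendsto 0
  have hd1 : ∀ᶠ t : ℝ in 𝓝 0, HasDerivAt (fun t : ℝ => G (η + t • v))
      (-2 * inner ℝ (Ψ (η + t • v)) v) t := by
    filter_upwards [hline.eventually hU] with t ht
    exact hasDerivAt_line (hG _ ht)
  have hderiv : deriv (fun t : ℝ => G (η + t • v))
      =ᶠ[𝓝 0] fun t => -2 * inner ℝ (Ψ (η + t • v)) v := hd1.mono fun t ht => ht.deriv
  have hd2 : HasDerivAt (fun t : ℝ => -2 * inner ℝ (Ψ (η + t • v)) v)
      (2 * inner ℝ (A η v) v) 0 := by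
    have h : HasFDerivAt Ψ (-A (η + (0 : ℝ) • v)) (η + (0 : ℝ) • v) := by simpa using hΨ
    simpa using hasDerivAt_inner_line h
  have hdd : deriv (deriv fun t : ℝ => G (η + t • v)) 0 = 2 * inner ℝ (A η v) v := by
    rw [hderiv.deriv_eq, hd2.deriv]
  -- A negative second derivative would make the line restriction a local maximum as well as a
  -- minimum, hence locally constant, and its second derivative would be zero.
  have hmax : IsLocalMax (fun t : ℝ => G (η + t • v)) 0 := by
    refine isLocalMax_of_deriv_deriv_neg (by rw [hdd]; linarith) ?_
      (hd1.self_of_nhds.continuousAt)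
    rw [hderiv.self_of_nhds]
    simp [hΨ0]
  have hconst : (fun t : ℝ => G (η + t • v)) =ᶠ[𝓝 0] fun _ => G η := by
    filter_upwards [hmax, hline.eventually hU] with t h1 h2
    refine le_antisymm ?_ (hmin _ h2)
    simpa using h1
  have : deriv (deriv fun t : ℝ => G (η + t • v)) 0 = 0 := by
    rw [hconst.deriv.deriv_eq]
    simp
  linarith

/-- Strong convexity of a function whose second derivative is bounded below. -/
theorem strong_convexity {K : Set E} (hK : Convex ℝ K)
    (hG : ∀ η ∈ K, HasGradientAt G ((-2 : ℝ) • Ψ η) η) (hΨ : ∀ η ∈ K, HasFDerivAt Ψ (-A η) η)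
    {l : ℝ} (hA : ∀ η ∈ K, ∀ v, l * ‖v‖ ^ 2 ≤ inner ℝ (A η v) v) {η η' : E} (hη : η ∈ K)
    (hη' : η' ∈ K) :
    G η - 2 * inner ℝ (Ψ η) (η' - η) + l * ‖η' - η‖ ^ 2 ≤ G η' := by
  set v := η' - η with hv
  have hmem : ∀ t ∈ Icc (0 : ℝ) 1, η + t • v ∈ K := fun t ht => by
    have := hK.add_smul_sub_mem hη hη' ht
    exact this
  set φ' : ℝ → ℝ := fun t => -2 * inner ℝ (Ψ (η + t • v)) v with hφ'
  have h1 : ∀ t ∈ Icc (0 : ℝ) 1, HasDerivAt (fun t : ℝ => G (η + t • v)) (φ' t) t := fun t ht =>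
    hasDerivAt_line (hG _ (hmem t ht))
  have h2 : ∀ t ∈ Icc (0 : ℝ) 1, HasDerivAt φ' (2 * inner ℝ (A (η + t • v) v) v) t := fun t ht =>
    hasDerivAt_inner_line (hΨ _ (hmem t ht))
  -- The second derivative along the segment is twice the quadratic form, so it is at least `2 l
  -- ‖v‖²`. Two successive monotonicity arguments integrate it to a gain of `l ‖v‖²`.
  have hmono1 : MonotoneOn (fun t => φ' t - 2 * (l * ‖v‖ ^ 2) * t) (Icc 0 1) := by
    have hd : ∀ t ∈ Icc (0 : ℝ) 1, HasDerivAt (fun t => φ' t - 2 * (l * ‖v‖ ^ 2) * t)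
        (2 * inner ℝ (A (η + t • v) v) v - 2 * (l * ‖v‖ ^ 2)) t := fun t ht => by
      have h3 : HasDerivAt (fun t => φ' t - 2 * (l * ‖v‖ ^ 2) * t) _ t :=
        (h2 t ht).sub ((hasDerivAt_id t).const_mul (2 * (l * ‖v‖ ^ 2)))
      exact h3.congr_deriv (by simp)
    refine monotoneOn_of_deriv_nonneg (convex_Icc 0 1)
      (fun t ht => (hd t ht).continuousAt.continuousWithinAt)
      (fun t ht => (hd t (interior_subset ht)).differentiableAt.differentiableWithinAt)
      fun t ht => ?_
    rw [(hd t (interior_subset ht)).deriv]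
    have := hA _ (hmem t (interior_subset ht)) v
    linarith
  have hmono2 : MonotoneOn (fun t => G (η + t • v) - φ' 0 * t - l * ‖v‖ ^ 2 * t ^ 2) (Icc 0 1) := by
    have hd : ∀ t ∈ Icc (0 : ℝ) 1, HasDerivAt
        (fun t => G (η + t • v) - φ' 0 * t - l * ‖v‖ ^ 2 * t ^ 2)
        (φ' t - φ' 0 - l * ‖v‖ ^ 2 * (2 * t)) t := fun t ht => by
      have h3 : HasDerivAt (fun t => G (η + t • v) - φ' 0 * t - l * ‖v‖ ^ 2 * t ^ 2) _ t :=
        ((h1 t ht).sub ((hasDerivAt_id t).const_mul (φ' 0))).sub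
          (((hasDerivAt_id t).pow 2).const_mul (l * ‖v‖ ^ 2))
      exact h3.congr_deriv (by simp)
    refine monotoneOn_of_deriv_nonneg (convex_Icc 0 1)
      (fun t ht => (hd t ht).continuousAt.continuousWithinAt)
      (fun t ht => (hd t (interior_subset ht)).differentiableAt.differentiableWithinAt)
      fun t ht => ?_
    have ht' := interior_subset ht
    rw [(hd t ht').deriv]
    have := hmono1 (left_mem_Icc.2 zero_le_one) ht' ht'.1
    simp only [mul_zero, sub_zero] at this
    linarith
  have h3 := hmono2 (left_mem_Icc.2 zero_le_one) (right_mem_Icc.2 zero_le_one) zero_le_one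
  have h4 : φ' 0 = -2 * inner ℝ (Ψ η) v := by simp [hφ']
  have h5 : η + v = η' := by simp [hv]
  simp only [zero_smul, add_zero, mul_zero, sub_zero, one_smul, mul_one, h5, h4] at h3
  norm_num at h3
  linarith

/-- Existence, uniqueness and localization of the minimizer of a strongly convex function over a
compact convex set. -/
theorem exists_unique_minimizer {K : Set E} (hK : Convex ℝ K) (hKc : IsCompact K)
    (hG : ∀ η ∈ K, HasGradientAt G ((-2 : ℝ) • Ψ η) η) (hΨ : ∀ η ∈ K, HasFDerivAt Ψ (-A η) η)
    {l : ℝ} (hl : 0 < l) (hA : ∀ η ∈ K, ∀ v, l * ‖v‖ ^ 2 ≤ inner ℝ (A η v) v) (hη : η ∈ K) :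
    ∃ η' ∈ K, (∀ η'' ∈ K, η'' ≠ η' → G η' < G η'') ∧ ‖η' - η‖ ≤ 2 / l * ‖Ψ η‖ := by
  obtain ⟨m, hm, hmin⟩ := hKc.exists_isMinOn ⟨η, hη⟩
    fun η hη => (hG η hη).continuousAt.continuousWithinAt
  refine ⟨m, hm, fun η'' hη'' hne => ?_, ?_⟩
  · have hmid : midpoint ℝ m η'' ∈ K := hK.midpoint_mem hm hη''
    have h1 := strong_convexity hK hG hΨ hA hmid hm
    have h2 := strong_convexity hK hG hΨ hA hmid hη''
    have h3 : G m ≤ G (midpoint ℝ m η'') := hmin hmid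
    have e1 : m - midpoint ℝ m η'' = -(η'' - midpoint ℝ m η'') := by
      rw [left_sub_midpoint, right_sub_midpoint, ← smul_neg, neg_sub]
    have hpos : 0 < ‖η'' - midpoint ℝ m η''‖ := by
      rw [right_sub_midpoint, norm_smul]
      exact mul_pos (by simp) (norm_pos_iff.2 (sub_ne_zero.2 hne))
    rw [e1, inner_neg_right, norm_neg] at h1
    have : 0 < l * ‖η'' - midpoint ℝ m η''‖ ^ 2 := by positivity
    linarith
  · have h1 := strong_convexity hK hG hΨ hA hη hm
    have h2 : G m ≤ G η := hmin hη
    have h3 := real_inner_le_norm (Ψ η) (m - η)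
    rcases (norm_nonneg (m - η)).eq_or_lt with h0 | h0
    · rw [← h0]; positivity
    · have h4 : l * ‖m - η‖ * ‖m - η‖ ≤ 2 * ‖Ψ η‖ * ‖m - η‖ := by nlinarith
      have h5 := le_of_mul_le_mul_right h4 h0
      rw [div_mul_eq_mul_div, le_div_iff₀ hl]
      linarith

end line

/-- An injective symmetric positive semidefinite operator is coercive. -/
theorem exists_coercive [FiniteDimensional ℝ E] {A : E →L[ℝ] E}
    (hsymm : ∀ u v, inner ℝ (A u) v = inner ℝ (A v) u) (hpos : ∀ v, 0 ≤ inner ℝ (A v) v)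
    (hinj : ∀ v, A v = 0 → v = 0) : ∃ l > 0, ∀ v, l * ‖v‖ ^ 2 ≤ inner ℝ (A v) v := by
  have hdef : ∀ v, inner ℝ (A v) v = 0 → v = 0 := by
    intro v hv
    refine hinj v ?_
    -- Positivity along `v + s • A v` is a quadratic in `s` without constant term, so its
    -- discriminant `4 ‖A v‖⁴` cannot be positive.
    have h : ∀ s : ℝ, 0 ≤ inner ℝ (A (A v)) (A v) * (s * s) + 2 * ‖A v‖ ^ 2 * s + 0 := by
      intro s
      have h1 := hpos (v + s • A v)
      simp only [map_add, map_smul, inner_add_left, inner_add_right, inner_smul_left,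
        inner_smul_right, hv, hsymm (A v) v, real_inner_self_eq_norm_sq] at h1
      simp only [conj_trivial] at h1
      linarith
    have h2 := discrim_le_zero h
    rw [discrim] at h2
    have h3 : ‖A v‖ ^ 2 = 0 := by nlinarith [sq_nonneg (‖A v‖ ^ 2)]
    simpa using h3
  -- The unit sphere is empty when the space is trivial, which happens for `q = 0`.
  rcases (Metric.sphere (0 : E) 1).eq_empty_or_nonempty with hem | hne
  · refine ⟨1, one_pos, fun v => ?_⟩
    have hv : v = 0 := by
      by_contra h
      have : ‖v‖⁻¹ • v ∈ Metric.sphere (0 : E) 1 := by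
        rw [mem_sphere_zero_iff_norm, norm_smul, norm_inv, norm_norm,
          inv_mul_cancel₀ (norm_ne_zero_iff.2 h)]
      rw [hem] at this
      exact this
    simp [hv]
  · have hcont : Continuous fun v => inner ℝ (A v) v := A.continuous.inner continuous_id
    obtain ⟨u, hu, hmin⟩ := (isCompact_sphere (0 : E) 1).exists_isMinOn hne hcont.continuousOn
    have hu0 : u ≠ 0 := by
      rintro rfl
      simp at hu
    refine ⟨inner ℝ (A u) u, lt_of_le_of_ne (hpos u) fun h => hu0 (hdef u h.symm), fun v => ?_⟩
    by_cases hv : v = 0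
    · simp [hv]
    have hn := norm_pos_iff.2 hv
    have hmem : ‖v‖⁻¹ • v ∈ Metric.sphere (0 : E) 1 := by
      rw [mem_sphere_zero_iff_norm, norm_smul, norm_inv, norm_norm,
        inv_mul_cancel₀ (norm_ne_zero_iff.2 hv)]
    have h1 : inner ℝ (A u) u ≤ inner ℝ (A (‖v‖⁻¹ • v)) (‖v‖⁻¹ • v) := hmin hmem
    rw [map_smul, inner_smul_left, inner_smul_right, conj_trivial] at h1
    calc inner ℝ (A u) u * ‖v‖ ^ 2 ≤ (‖v‖⁻¹ * (‖v‖⁻¹ * inner ℝ (A v) v)) * ‖v‖ ^ 2 := by gcongr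
      _ = inner ℝ (A v) v := by field_simp

theorem coercive_of_norm_sub_le {A B : E →L[ℝ] E} {l : ℝ}
    (hA : ∀ v, l * ‖v‖ ^ 2 ≤ inner ℝ (A v) v) (hB : ‖B - A‖ ≤ l / 2) (v : E) :
    l / 2 * ‖v‖ ^ 2 ≤ inner ℝ (B v) v := by
  have h1 : inner ℝ (B v) v = inner ℝ (A v) v + inner ℝ ((B - A) v) v := by
    rw [← inner_add_left]; simp
  have h2 := (abs_le.1 ((abs_real_inner_le_norm ((B - A) v) v).trans
    (mul_le_mul_of_nonneg_right ((B - A).le_of_opNorm_le hB v) (norm_nonneg v)))).1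
  have := hA v
  rw [h1]
  nlinarith

end optimization

/-! ### The nonparametric tangent space -/

section tangent

variable {V : Type*} [MeasurableSpace V] {P : Measure V} [IsProbabilityMeasure P]

/-- A bounded mean-zero function is the score of the submodel with likelihood ratio `1 + θ g`. -/
theorem exists_regularSubmodel {g : V → ℝ} (hg : Measurable g) {B : ℝ} (hB : ∀ v, |g v| ≤ B)
    (h0 : ∫ v, g v ∂P = 0) : ∃ Pθ : ℝ → Measure V, IsRegularSubmodel P Pθ g := by
  have hgi : Integrable g P := Integrable.of_bound hg.aestronglyMeasurable B (ae_of_all _ hB)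
  obtain ⟨v0⟩ := nonempty_of_isProbabilityMeasure P
  have hB0 : 0 ≤ B := (abs_nonneg _).trans (hB v0)
  -- For `|θ| < 1 / (B + 1)` the product `θ g` is at most `1` in absolute value, so `1 + θ g` stays
  -- nonnegative.
  have hpos : 0 < 1 / (B + 1) := by positivity
  have hsmall : ∀ θ : ℝ, |θ| < 1 / (B + 1) → ∀ v, 0 ≤ 1 + θ * g v := by
    intro θ hθ v
    have h1 : |θ * g v| ≤ 1 := by
      rw [abs_mul]
      rw [lt_div_iff₀ (by positivity)] at hθ
      have := mul_le_mul_of_nonneg_left (hB v) (abs_nonneg θ)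
      nlinarith [abs_nonneg θ]
    have := (abs_le.1 h1).1
    linarith
  refine ⟨fun θ => P.withDensity fun v => ENNReal.ofReal (1 + θ * g v),
    fun θ v => 1 + θ * g v, 1 / (B + 1), B, hpos, fun θ hθ => ⟨?_, by fun_prop, hsmall θ hθ, rfl,
      fun v => ?_⟩, fun v => ?_⟩
  · have hi : Integrable (fun v => 1 + θ * g v) P := (integrable_const 1).add (hgi.const_mul θ)
    constructor
    rw [withDensity_apply _ MeasurableSet.univ, Measure.restrict_univ,
      ← ofReal_integral_eq_lintegral_ofReal hi
        (ae_of_all _ (hsmall θ hθ)), integral_add (integrable_const 1) (hgi.const_mul θ),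
      integral_const_mul, h0]
    simp
  · rw [add_sub_cancel_left, abs_mul, mul_comm]
    exact mul_le_mul_of_nonneg_right (hB v) (abs_nonneg _)
  · simpa using ((hasDerivAt_id (0 : ℝ)).mul_const (g v)).const_add 1

/-- The nonparametric tangent space contains every square integrable mean-zero function. -/
theorem mem_tangentSpace_of_integral_eq_zero (g : Lp ℝ 2 P) (h0 : ∫ v, g v ∂P = 0) :
    g ∈ tangentSpace P := by
  rw [tangentSpace, ← SetLike.mem_coe, Submodule.topologicalClosure_coe, Metric.mem_closure_iff]
  intro ε hε
  have hg2 := Lp.memLp g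
  have hε2 : ENNReal.ofReal (ε / 4) ≠ 0 := by simpa using (by positivity : 0 < ε / 4)
  -- A simple function within `ε / 4` in `L²` is bounded but need not be centered. Its mean `c` is
  -- also at most `ε / 4`, since `g` has mean zero and the `L¹` norm is below the `L²` norm;
  -- recentering costs at most that much.
  obtain ⟨k, hk, hkm⟩ := hg2.exists_simpleFunc_eLpNorm_sub_lt (by norm_num) hε2
  have hki : Integrable k P := hkm.integrable (by norm_num)
  set c : ℝ := ∫ v, k v ∂P with hc
  obtain ⟨B, hB⟩ := k.exists_forall_norm_le
  obtain ⟨Pθ, hPθ⟩ := exists_regularSubmodel (P := P) (g := fun v => k v - c)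
    (k.measurable.sub_const c) (B := B + |c|)
    (fun v => (abs_sub _ _).trans (add_le_add_left (hB v) _))
    (by rw [integral_sub hki (integrable_const c)]; simp [hc])
  have hkc : MemLp (fun v => k v - c) 2 P := hkm.sub (memLp_const c)
  refine ⟨hkc.toLp _, Submodule.subset_span ⟨Pθ, _, hPθ, hkc.coeFn_toLp⟩, ?_⟩
  have hcb : |c| ≤ ε / 4 := by
    have h1 : c = ∫ v, (k v - g v) ∂P := by
      rw [integral_sub hki (hg2.integrable (by norm_num)), h0, sub_zero]
    have h2 : eLpNorm (fun v => k v - g v) 1 P ≤ ENNReal.ofReal (ε / 4) := by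
      refine (eLpNorm_le_eLpNorm_of_exponent_le (p := 1) (q := 2) (by norm_num)
        (hkm.sub hg2).aestronglyMeasurable).trans ?_
      rw [← eLpNorm_neg]
      refine le_of_eq_of_le ?_ hk.le
      congr 1
      ext v; simp
    rw [h1, ← Real.norm_eq_abs]
    refine (norm_integral_le_lintegral_norm _).trans ?_
    refine ENNReal.toReal_le_of_le_ofReal (by positivity) ?_
    rw [eLpNorm_one_eq_lintegral_enorm] at h2
    simpa only [ofReal_norm] using h2
  rw [dist_eq_norm, Lp.norm_def]
  have hae : ⇑(g - hkc.toLp _) =ᵐ[P] (fun v => (g v - k v) + c) := by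
    filter_upwards [Lp.coeFn_sub g (hkc.toLp _), hkc.coeFn_toLp] with v h1 h2
    rw [h1, Pi.sub_apply, h2]
    ring
  rw [eLpNorm_congr_ae hae]
  have h3 : eLpNorm (fun v => (g v - k v) + c) 2 P ≤ ENNReal.ofReal (ε / 2) := by
    refine (eLpNorm_add_le (f := fun v => g v - k v) (g := fun _ => c)
      (hg2.sub hkm).aestronglyMeasurable aestronglyMeasurable_const (by norm_num)).trans ?_
    have h4 : eLpNorm (fun _ : V => c) 2 P ≤ ENNReal.ofReal (ε / 4) := by
      rw [eLpNorm_const _ (by norm_num) (IsProbabilityMeasure.ne_zero P)]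
      simp only [measure_univ, ENNReal.one_rpow, mul_one]
      rw [← ofReal_norm]
      exact ENNReal.ofReal_le_ofReal hcb
    calc _ ≤ ENNReal.ofReal (ε / 4) + ENNReal.ofReal (ε / 4) := add_le_add hk.le h4
      _ = ENNReal.ofReal (ε / 2) := by
        rw [← ENNReal.ofReal_add (by positivity) (by positivity)]; congr 1; ring
  exact (ENNReal.toReal_le_of_le_ofReal (by positivity) h3).trans_lt (by linarith)

end tangent

/-! ### Perturbations of the law and their pathwise derivatives -/

/-- A family of likelihood ratios `L_θ`, uniformly close to `1` for `θ` near `0`, and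
differentiable at `0`. -/
structure IsPerturbation {α : Type*} [MeasurableSpace α] (L : ℝ → α → ℝ) (s : α → ℝ) (δ B : ℝ) :
    Prop where
  pos : 0 < δ
  meas : ∀ θ, |θ| < δ → Measurable (L θ)
  bound : ∀ θ, |θ| < δ → ∀ v, |L θ v - 1| ≤ B * |θ|
  deriv : ∀ v, HasDerivAt (fun θ => L θ v) (s v) 0

theorem eventually_abs_lt {δ : ℝ} (hδ : 0 < δ) : ∀ᶠ θ : ℝ in 𝓝 0, |θ| < δ := by
  have h : Tendsto (fun θ : ℝ => |θ|) (𝓝 0) (𝓝 |0|) := continuous_abs.tendsto 0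
  rw [abs_zero] at h
  exact h.eventually_lt_const hδ

namespace IsPerturbation

variable {α β : Type*} [MeasurableSpace α] [MeasurableSpace β] {L : ℝ → α → ℝ} {s : α → ℝ}
  {δ B : ℝ}

theorem zero (h : IsPerturbation L s δ B) (v : α) : L 0 v = 1 := by
  have := h.bound 0 (by simpa using h.pos) v
  rw [abs_zero, mul_zero] at this
  linarith [abs_nonpos_iff.1 this]

theorem comp (h : IsPerturbation L s δ B) {g : β → α} (hg : Measurable g) :
    IsPerturbation (fun θ b => L θ (g b)) (fun b => s (g b)) δ B :=
  ⟨h.pos, fun θ hθ => (h.meas θ hθ).comp hg, fun θ hθ _ => h.bound θ hθ _, fun _ => h.deriv _⟩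

/-- Scores inherit the bound on the difference quotients; a score times an integrable kernel is
therefore integrable. -/
theorem abs_score_le (h : IsPerturbation L s δ B) (v : α) : |s v| ≤ B := by
  have hlim := (hasDerivAt_iff_tendsto_slope.1 (h.deriv v)).abs
  refine le_of_tendsto hlim ?_
  filter_upwards [nhdsWithin_le_nhds (eventually_abs_lt h.pos), self_mem_nhdsWithin] with θ hθ hne
  have hpos : 0 < |θ| := abs_pos.2 hne
  rw [slope_def_field, h.zero, sub_zero, abs_div, div_le_iff₀ hpos]
  exact h.bound θ hθ v

theorem measurable_score (h : IsPerturbation L s δ B) : Measurable s := by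
  have hlim : Tendsto (fun n : ℕ => (n : ℝ)⁻¹) atTop (𝓝 0) := tendsto_inv_atTop_nhds_zero_nat
  obtain ⟨N, hN⟩ := eventually_atTop.1 (hlim.eventually (eventually_abs_lt h.pos))
  refine measurable_of_tendsto_metrizable
    (f := fun (n : ℕ) v => ((n + N : ℕ) : ℝ) * (L (((n + N : ℕ) : ℝ)⁻¹) v - L 0 v))
    (fun n => ((h.meas _ (hN _ (Nat.le_add_left _ _))).sub
      (h.meas 0 (by simpa using h.pos))).const_mul _) ?_
  rw [tendsto_pi_nhds]
  intro v
  have h1 := ((h.deriv v).hasFDerivAt.lim_real 1).comp (tendsto_natCast_atTop_atTop (R := ℝ))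
  have h2 := h1.comp (tendsto_add_atTop_nat N)
  refine (h2.congr fun n => ?_).trans_eq ?_
  · simp
  · simp

/-- The likelihood ratio is differentiable only at `0`, so the dominated differentiation used is the
one that compares with the base point alone. -/
theorem hasDerivAt_integral (h : IsPerturbation L s δ B) {ν : Measure α} {k : α → ℝ}
    (hk : Integrable k ν) : HasDerivAt (fun θ => ∫ v, k v * L θ v ∂ν) (∫ v, k v * s v ∂ν) 0 := by
  have hs : {θ : ℝ | |θ| < δ} ∈ 𝓝 (0 : ℝ) := eventually_abs_lt h.pos
  have hks : AEStronglyMeasurable (fun v => k v * s v) ν :=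
    hk.aestronglyMeasurable.mul h.measurable_score.aestronglyMeasurable
  have hmain := hasFDerivAt_integral_of_dominated_loc_of_lip' (μ := ν)
    (F := fun θ v => k v * L θ v) (x₀ := (0 : ℝ)) (bound := fun v => |k v| * B)
    (F' := fun v => ContinuousLinearMap.smulRightL ℝ ℝ ℝ (1 : ℝ →L[ℝ] ℝ) (k v * s v)) hs
    (fun θ hθ => hk.aestronglyMeasurable.mul (h.meas θ hθ).aestronglyMeasurable) ?_
    ((ContinuousLinearMap.continuous _).comp_aestronglyMeasurable hks)
    (ae_of_all _ fun v θ hθ => ?_) (hk.abs.mul_const B) (ae_of_all _ fun v => ?_)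
  · have h1 := hmain.2.hasDerivAt
    rw [ContinuousLinearMap.integral_apply hmain.1] at h1
    simpa using h1
  · simpa [h.zero] using hk
  · rw [h.zero, mul_one, sub_zero, Real.norm_eq_abs, Real.norm_eq_abs,
      show k v * L θ v - k v = k v * (L θ v - 1) by ring, abs_mul, mul_assoc]
    exact mul_le_mul_of_nonneg_left (h.bound θ hθ v) (abs_nonneg _)
  · have h1 := ((h.deriv v).const_mul (k v)).hasFDerivAt
    refine h1.congr_fderiv ?_
    ext
    simp

end IsPerturbation

namespace ObsModel

variable {𝒳 : Type*} [MeasurableSpace 𝒳] (M : ObsModel 𝒳) {L : ℝ → Obs 𝒳 → ℝ} {sc : Obs 𝒳 → ℝ}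
  {δ B : ℝ}

/-- Perturbations are closed under conditioning, with the score averaged accordingly. All tilted
components are quotients of such averages, so the quotient rule differentiates them. -/
theorem isPerturbation_avgS (h : IsPerturbation L sc δ B) :
    IsPerturbation (fun θ => M.avgS (L θ)) (M.avgS sc) δ B where
  pos := h.pos
  meas θ hθ := M.measurable_avgS (h.meas θ hθ)
  bound θ hθ t := M.abs_avgS_sub_le (h.meas θ hθ) (h.bound θ hθ) t
  deriv t := by
    have h1 := (h.comp (g := fun y : ℝ => (y, t)) measurable_prodMk_right).hasDerivAt_integral
      (ν := M.κ t) (integrable_const (1 : ℝ))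
    simpa [avgS] using h1

theorem hasDerivAt_integral_p (h : IsPerturbation L sc δ B) (z : Bool) (x : 𝒳) (A : Set ℝ) :
    HasDerivAt (fun θ => ∫ s in A, M.p z s x * M.avgS (L θ) (s, z, x))
      (∫ s in A, M.p z s x * M.avgS sc (s, z, x)) 0 :=
  ((M.isPerturbation_avgS h).comp (g := fun s : ℝ => (s, z, x)) (by fun_prop)).hasDerivAt_integral
    (M.integrable_p z x).integrableOn

theorem isPerturbation_avgZ (h : IsPerturbation L sc δ B) (z : Bool) :
    IsPerturbation (fun θ => M.avgZ (L θ) z) (M.avgZ sc z) δ B where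
  pos := h.pos
  meas θ hθ := M.measurable_avgZ (h.meas θ hθ) z
  bound θ hθ x := M.abs_avgZ_sub_le (h.meas θ hθ) (h.bound θ hθ) z x
  deriv x := by
    have h1 := M.hasDerivAt_integral_p h z x univ
    simpa [avgZ] using h1

theorem isPerturbation_avgX (h : IsPerturbation L sc δ B) :
    IsPerturbation (fun θ => M.avgX (L θ)) (M.avgX sc) δ B where
  pos := h.pos
  meas θ hθ := M.measurable_avgX (h.meas θ hθ)
  bound θ hθ x := M.abs_avgX_sub_le (h.meas θ hθ) (h.bound θ hθ) x
  deriv x := (((M.isPerturbation_avgZ h true).deriv x).const_mul _).add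
    (((M.isPerturbation_avgZ h false).deriv x).const_mul _)

/-- The derivative of the conditional distribution function along a perturbation with score
`sc`. -/
def dotF (sc : Obs 𝒳 → ℝ) (z : Bool) (s : ℝ) (x : 𝒳) : ℝ :=
  (∫ t in Iic s, M.p z t x * M.avgS sc (t, z, x)) - M.F z s x * M.avgZ sc z x

/-- The derivative of the treated outcome mean along a perturbation with score `sc`. -/
def dotMu (sc : Obs 𝒳 → ℝ) (s : ℝ) (x : 𝒳) : ℝ :=
  (∫ y, y * sc (y, s, true, x) ∂(M.κ (s, true, x))) - M.mu1 s x * M.avgS sc (s, true, x)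

theorem tiltF_zero (h : IsPerturbation L sc δ B) (z : Bool) (s : ℝ) (x : 𝒳) :
    M.tiltF (L 0) z s x = M.F z s x := by
  simp [tiltF, (M.isPerturbation_avgS h).zero, (M.isPerturbation_avgZ h z).zero, F]

theorem tiltMu_zero (h : IsPerturbation L sc δ B) (s : ℝ) (x : 𝒳) :
    M.tiltMu (L 0) s x = M.mu1 s x := by
  simp [tiltMu, (M.isPerturbation_avgS h).zero, h.zero, mu1]

theorem tiltP_zero (h : IsPerturbation L sc δ B) (z : Bool) (s : ℝ) (x : 𝒳) :
    M.tiltP (L 0) z s x = M.p z s x := by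
  simp [tiltP, (M.isPerturbation_avgS h).zero, (M.isPerturbation_avgZ h z).zero]

theorem hasDerivAt_tiltF (h : IsPerturbation L sc δ B) (z : Bool) (s : ℝ) (x : 𝒳) :
    HasDerivAt (fun θ => M.tiltF (L θ) z s x) (M.dotF sc z s x) 0 := by
  have h1 := (M.hasDerivAt_integral_p h z x (Iic s)).div ((M.isPerturbation_avgZ h z).deriv x)
    (by rw [(M.isPerturbation_avgZ h z).zero]; exact one_ne_zero)
  refine h1.congr_deriv ?_
  simp [(M.isPerturbation_avgS h).zero, (M.isPerturbation_avgZ h z).zero, dotF, F]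

theorem hasDerivAt_tiltP (h : IsPerturbation L sc δ B) (z : Bool) (s : ℝ) (x : 𝒳) :
    HasDerivAt (fun θ => M.tiltP (L θ) z s x)
      (M.p z s x * (M.avgS sc (s, z, x) - M.avgZ sc z x)) 0 := by
  have h1 := (((M.isPerturbation_avgS h).deriv (s, z, x)).const_mul (M.p z s x)).div
    ((M.isPerturbation_avgZ h z).deriv x)
    (by rw [(M.isPerturbation_avgZ h z).zero]; exact one_ne_zero)
  refine h1.congr_deriv ?_
  simp [(M.isPerturbation_avgS h).zero, (M.isPerturbation_avgZ h z).zero]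
  ring

theorem hasDerivAt_tiltMu (h : IsPerturbation L sc δ B) {s : ℝ} {x : 𝒳}
    (hi : Integrable (fun y : ℝ => y) (M.κ (s, true, x))) :
    HasDerivAt (fun θ => M.tiltMu (L θ) s x) (M.dotMu sc s x) 0 := by
  have h0 := (h.comp (g := fun y : ℝ => (y, s, true, x)) measurable_prodMk_right).hasDerivAt_integral
      (ν := M.κ (s, true, x)) hi
  have h1 := h0.div ((M.isPerturbation_avgS h).deriv (s, true, x))
    (by rw [(M.isPerturbation_avgS h).zero]; exact one_ne_zero)
  refine h1.congr_deriv ?_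
  simp [(M.isPerturbation_avgS h).zero, h.zero, dotMu, mu1]

end ObsModel

/-! ### Local domination of the copula density -/

section copula

/-- The local domination condition on a copula density. -/
structure CopulaBound (c cbar : ℝ → ℝ → ℝ) (δ : ℝ) : Prop where
  pos : 0 < δ
  lt_one : δ < 1
  smooth : ContDiffOn ℝ 1 (Function.uncurry c) (Ioo 0 1 ×ˢ Ioo 0 1)
  nonneg : ∀ u ∈ Ioo (0 : ℝ) 1, ∀ v ∈ Ioo (0 : ℝ) 1, 0 ≤ c u v
  bound : ∀ u ∈ Ioo (0 : ℝ) 1, ∀ v ∈ Ioo (0 : ℝ) 1, ∀ u' v' : ℝ,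
    |u' - u| ≤ δ * (u * (1 - u)) → |v' - v| ≤ δ * (v * (1 - v)) →
      c u' v' ≤ cbar u v ∧
      u * (1 - u) * |deriv (fun t => c t v') u'| ≤ cbar u v ∧
      v * (1 - v) * |deriv (fun t => c u' t) v'| ≤ cbar u v

namespace CopulaBound

variable {c cbar : ℝ → ℝ → ℝ} {δ : ℝ}

/-- The half-width `δ u (1 - u)` with `δ < 1` is smaller than the distance from `u` to either
endpoint. -/
theorem mem_Ioo_of_abs_sub_le (h : CopulaBound c cbar δ) {u u' : ℝ} (hu : u ∈ Ioo (0 : ℝ) 1)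
    (hb : |u' - u| ≤ δ * (u * (1 - u))) : u' ∈ Ioo (0 : ℝ) 1 := by
  have h1 := abs_le.1 hb
  have h2 : 0 < u * (1 - u) := mul_pos hu.1 (by linarith [hu.2])
  have h3 : δ * (u * (1 - u)) < u * (1 - u) := by nlinarith [h.lt_one]
  constructor
  · nlinarith [hu.1, hu.2]
  · nlinarith [hu.1, hu.2]

theorem hasFDerivAt (h : CopulaBound c cbar δ) {u v : ℝ} (hu : u ∈ Ioo (0 : ℝ) 1)
    (hv : v ∈ Ioo (0 : ℝ) 1) :
    HasFDerivAt (Function.uncurry c) (fderiv ℝ (Function.uncurry c) (u, v)) (u, v) :=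
  ((h.smooth.contDiffAt ((isOpen_Ioo.prod isOpen_Ioo).mem_nhds ⟨hu, hv⟩)).differentiableAt
    (by norm_num)).hasFDerivAt

theorem hasDerivAt_left (h : CopulaBound c cbar δ) {u v : ℝ} (hu : u ∈ Ioo (0 : ℝ) 1)
    (hv : v ∈ Ioo (0 : ℝ) 1) :
    HasDerivAt (fun t => c t v) (fderiv ℝ (Function.uncurry c) (u, v) (1, 0)) u :=
  HasFDerivAt.comp_hasDerivAt (l := Function.uncurry c) (f := fun t => (t, v)) u
    (h.hasFDerivAt hu hv) ((hasDerivAt_id' u).prodMk (hasDerivAt_const u v))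

theorem hasDerivAt_right (h : CopulaBound c cbar δ) {u v : ℝ} (hu : u ∈ Ioo (0 : ℝ) 1)
    (hv : v ∈ Ioo (0 : ℝ) 1) :
    HasDerivAt (fun t => c u t) (fderiv ℝ (Function.uncurry c) (u, v) (0, 1)) v :=
  HasFDerivAt.comp_hasDerivAt (l := Function.uncurry c) (f := fun t => (u, t)) v
    (h.hasFDerivAt hu hv) ((hasDerivAt_const v u).prodMk (hasDerivAt_id' v))

theorem hasDerivAt_comp (h : CopulaBound c cbar δ) {U V : ℝ → ℝ} {U' V' x : ℝ}
    (hu : U x ∈ Ioo (0 : ℝ) 1) (hv : V x ∈ Ioo (0 : ℝ) 1) (hU : HasDerivAt U U' x)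
    (hV : HasDerivAt V V' x) :
    HasDerivAt (fun θ => c (U θ) (V θ))
      (deriv (fun t => c t (V x)) (U x) * U' + deriv (fun t => c (U x) t) (V x) * V') x := by
  have h1 := (h.hasFDerivAt hu hv).comp_hasDerivAt x (hU.prodMk hV)
  refine h1.congr_deriv ?_
  rw [(h.hasDerivAt_left hu hv).deriv, (h.hasDerivAt_right hu hv).deriv]
  have : ((U', V') : ℝ × ℝ) = U' • ((1 : ℝ), (0 : ℝ)) + V' • ((0 : ℝ), (1 : ℝ)) := by simp
  rw [this, map_add, map_smul, map_smul, smul_eq_mul, smul_eq_mul]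
  ring

theorem abs_le (h : CopulaBound c cbar δ) {u v u' v' : ℝ} (hu : u ∈ Ioo (0 : ℝ) 1)
    (hv : v ∈ Ioo (0 : ℝ) 1) (hu' : |u' - u| ≤ δ * (u * (1 - u)))
    (hv' : |v' - v| ≤ δ * (v * (1 - v))) : |c u' v'| ≤ cbar u v := by
  rw [abs_of_nonneg (h.nonneg _ (h.mem_Ioo_of_abs_sub_le hu hu') _ (h.mem_Ioo_of_abs_sub_le hv hv'))]
  exact (h.bound u hu v hv u' v' hu' hv').1

/-- Mean value inequality in one variable at a time: a derivative of order `cbar / (u (1 - u))`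
meets a displacement of order `ε u (1 - u)`, and the boundary weights cancel. -/
theorem abs_sub_le (h : CopulaBound c cbar δ) {u v u' v' ε : ℝ} (hu : u ∈ Ioo (0 : ℝ) 1)
    (hv : v ∈ Ioo (0 : ℝ) 1) (hε : ε ≤ δ) (hu' : |u' - u| ≤ ε * (u * (1 - u)))
    (hv' : |v' - v| ≤ ε * (v * (1 - v))) : |c u' v' - c u v| ≤ 2 * ε * cbar u v := by
  have hpu : 0 < u * (1 - u) := mul_pos hu.1 (by linarith [hu.2])
  have hpv : 0 < v * (1 - v) := mul_pos hv.1 (by linarith [hv.2])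
  have hu2 : |u' - u| ≤ δ * (u * (1 - u)) := hu'.trans (by gcongr)
  have hv2 : |v' - v| ≤ δ * (v * (1 - v)) := hv'.trans (by gcongr)
  have hz : |(0 : ℝ)| ≤ δ * (u * (1 - u)) := by
    rw [abs_zero]; exact mul_nonneg h.pos.le hpu.le
  have hc0 : 0 ≤ cbar u v := (abs_nonneg _).trans (h.abs_le hu hv hu2 hv2)
  have hseg : ∀ {a a' b : ℝ}, |a' - a| ≤ b → ∀ ξ ∈ uIcc a a', |ξ - a| ≤ b := by
    intro a a' b hb ξ hξ
    exact (abs_sub_left_of_mem_uIcc hξ).trans hb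
  have h1 : |c u' v' - c u v'| ≤ ε * cbar u v := by
    have hd : ∀ ξ ∈ uIcc u u', DifferentiableAt ℝ (fun t => c t v') ξ := fun ξ hξ =>
      (h.hasDerivAt_left (h.mem_Ioo_of_abs_sub_le hu (hseg hu2 ξ hξ))
        (h.mem_Ioo_of_abs_sub_le hv hv2)).differentiableAt
    have hb : ∀ ξ ∈ uIcc u u', ‖deriv (fun t => c t v') ξ‖ ≤ cbar u v / (u * (1 - u)) := by
      intro ξ hξ
      rw [le_div_iff₀ hpu, Real.norm_eq_abs, mul_comm]
      exact (h.bound u hu v hv ξ v' (hseg hu2 ξ hξ) hv2).2.1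
    have := (convex_uIcc u u').norm_image_sub_le_of_norm_deriv_le hd hb left_mem_uIcc right_mem_uIcc
    rw [Real.norm_eq_abs, Real.norm_eq_abs] at this
    refine this.trans ?_
    rw [div_mul_eq_mul_div, div_le_iff₀ hpu]
    calc cbar u v * |u' - u| ≤ cbar u v * (ε * (u * (1 - u))) := by gcongr
      _ = ε * cbar u v * (u * (1 - u)) := by ring
  have h2 : |c u v' - c u v| ≤ ε * cbar u v := by
    have hd : ∀ ξ ∈ uIcc v v', DifferentiableAt ℝ (fun t => c u t) ξ := fun ξ hξ =>
      (h.hasDerivAt_right hu (h.mem_Ioo_of_abs_sub_le hv (hseg hv2 ξ hξ))).differentiableAt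
    have hb : ∀ ξ ∈ uIcc v v', ‖deriv (fun t => c u t) ξ‖ ≤ cbar u v / (v * (1 - v)) := by
      intro ξ hξ
      rw [le_div_iff₀ hpv, Real.norm_eq_abs, mul_comm]
      exact (h.bound u hu v hv u ξ (by simpa using hz) (hseg hv2 ξ hξ)).2.2
    have := (convex_uIcc v v').norm_image_sub_le_of_norm_deriv_le hd hb left_mem_uIcc right_mem_uIcc
    rw [Real.norm_eq_abs, Real.norm_eq_abs] at this
    refine this.trans ?_
    rw [div_mul_eq_mul_div, div_le_iff₀ hpv]
    calc cbar u v * |v' - v| ≤ cbar u v * (ε * (v * (1 - v))) := by gcongr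
      _ = ε * cbar u v * (v * (1 - v)) := by ring
  calc |c u' v' - c u v| ≤ |c u' v' - c u v'| + |c u v' - c u v| := _root_.abs_sub_le _ _ _
    _ ≤ ε * cbar u v + ε * cbar u v := add_le_add h1 h2
    _ = 2 * ε * cbar u v := by ring

end CopulaBound
end copula

/-! ### The weighted principal density under a tilted law -/

namespace ObsModel

variable {𝒳 : Type*} [MeasurableSpace 𝒳] (M : ObsModel 𝒳)

/-- The points `(x, s₁, s₀)` at which the pathwise derivatives are computed. -/
structure IsInterior (t : 𝒳 × ℝ × ℝ) : Prop where
  left : M.F true t.2.1 t.1 ∈ Ioo (0 : ℝ) 1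
  right : M.F false t.2.2 t.1 ∈ Ioo (0 : ℝ) 1
  outcome : Integrable (fun y : ℝ => y) (M.κ (t.2.1, true, t.1))

theorem quasiMeasurePreserving_left :
    Measure.QuasiMeasurePreserving (fun t : 𝒳 × ℝ × ℝ => (t.1, t.2.1)) M.base
      (M.PX.prod volume) :=
  MeasureTheory.QuasiMeasurePreserving.prodMap (.id _) Measure.quasiMeasurePreserving_fst

theorem quasiMeasurePreserving_right :
    Measure.QuasiMeasurePreserving (fun t : 𝒳 × ℝ × ℝ => (t.1, t.2.2)) M.base
      (M.PX.prod volume) :=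
  MeasureTheory.QuasiMeasurePreserving.prodMap (.id _) Measure.quasiMeasurePreserving_snd

theorem ae_prod_F_mem_Ioo (z : Bool) :
    ∀ᵐ t ∂(M.PX.prod volume), M.p z t.2 t.1 ≠ 0 → M.F z t.2 t.1 ∈ Ioo (0 : ℝ) 1 := by
  refine (Measure.ae_prod_iff_ae_ae ?_).2 (ae_of_all _ fun x => M.ae_F_mem_Ioo z x)
  have h1 : MeasurableSet {t : 𝒳 × ℝ | M.p z t.2 t.1 = 0} :=
    M.measurable_p_swap z (measurableSet_singleton 0)
  have h2 : MeasurableSet {t : 𝒳 × ℝ | M.F z t.2 t.1 ∈ Ioo (0 : ℝ) 1} :=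
    M.measurable_F z measurableSet_Ioo
  have h3 : {t : 𝒳 × ℝ | M.p z t.2 t.1 ≠ 0 → M.F z t.2 t.1 ∈ Ioo (0 : ℝ) 1}
      = {t : 𝒳 × ℝ | M.p z t.2 t.1 = 0} ∪ {t : 𝒳 × ℝ | M.F z t.2 t.1 ∈ Ioo (0 : ℝ) 1} := by
    ext t
    simp only [mem_ofPred_eq, mem_union]
    tauto
  rw [h3]
  exact h1.union h2

/-- Interior points are needed only where both densities are nonzero. Elsewhere `tiltK`, its
envelope and its derivative are zero, which is why later lemmas assume interiority in this
implication form. -/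
theorem ae_isInterior
    (hout : ∀ᵐ t ∂(M.jointXS true), Integrable (fun y : ℝ => y) (M.outcome true t)) :
    ∀ᵐ t ∂M.base, M.p true t.2.1 t.1 * M.p false t.2.2 t.1 ≠ 0 → M.IsInterior t := by
  rw [jointXS, ae_withDensity_iff (M.measurable_p_swap true).ennreal_ofReal] at hout
  filter_upwards [M.quasiMeasurePreserving_left.ae (M.ae_prod_F_mem_Ioo true),
    M.quasiMeasurePreserving_right.ae (M.ae_prod_F_mem_Ioo false),
    M.quasiMeasurePreserving_left.ae hout] with t h1 h0 h2 hp
  have hp1 := left_ne_zero_of_mul hp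
  refine ⟨h1 hp1, h0 (right_ne_zero_of_mul hp), h2 ?_⟩
  simpa using lt_of_le_of_ne (M.p_nonneg true t.2.1 t.1) hp1.symm

variable {L : Obs 𝒳 → ℝ}

theorem measurable_tiltP (hL : Measurable L) (z : Bool) :
    Measurable fun t : 𝒳 × ℝ => M.tiltP L z t.2 t.1 :=
  (M.measurable_p_mul_avgS hL z).div ((M.measurable_avgZ hL z).comp measurable_fst)

theorem measurable_setIntegral_avgS (hL : Measurable L) (z : Bool) :
    Measurable fun t : 𝒳 × ℝ => ∫ s in Iic t.2, M.p z s t.1 * M.avgS L (s, z, t.1) := by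
  have h : StronglyMeasurable fun u : (𝒳 × ℝ) × ℝ =>
      {u : (𝒳 × ℝ) × ℝ | u.2 ≤ u.1.2}.indicator
        (fun u => M.p z u.2 u.1.1 * M.avgS L (u.2, z, u.1.1)) u := by
    refine (Measurable.indicator ?_ ?_).stronglyMeasurable
    · exact (M.measurable_p_mul_avgS hL z).comp
        ((measurable_fst.comp measurable_fst).prodMk measurable_snd)
    · exact measurableSet_le measurable_snd (measurable_snd.comp measurable_fst)
  have heq : (fun t : 𝒳 × ℝ => ∫ s in Iic t.2, M.p z s t.1 * M.avgS L (s, z, t.1))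
      = fun t => ∫ s, {u : (𝒳 × ℝ) × ℝ | u.2 ≤ u.1.2}.indicator
        (fun u => M.p z u.2 u.1.1 * M.avgS L (u.2, z, u.1.1)) (t, s) := by
    funext t
    rw [← integral_indicator measurableSet_Iic]
    rfl
  rw [heq]
  exact (h.integral_prod_right' (ν := volume)).measurable

theorem measurable_tiltF (hL : Measurable L) (z : Bool) :
    Measurable fun t : 𝒳 × ℝ => M.tiltF L z t.2 t.1 :=
  (M.measurable_setIntegral_avgS hL z).div ((M.measurable_avgZ hL z).comp measurable_fst)

theorem measurable_integral_outcome (hL : Measurable L) {g : ℝ → ℝ} (hg : Measurable g) :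
    Measurable fun t : 𝒳 × ℝ => ∫ y, g y * L (y, t.2, true, t.1) ∂(M.κ (t.2, true, t.1)) := by
  have h : StronglyMeasurable fun u : (𝒳 × ℝ) × ℝ => g u.2 * L (u.2, u.1.2, true, u.1.1) :=
    ((hg.comp measurable_snd).mul (hL.comp (by fun_prop))).stronglyMeasurable
  exact (h.integral_kernel_prod_right' (κ := M.outcome true)).measurable

theorem measurable_tiltMu (hL : Measurable L) :
    Measurable fun t : 𝒳 × ℝ => M.tiltMu L t.2 t.1 :=
  (M.measurable_integral_outcome hL measurable_id).div ((M.measurable_avgS hL).comp (by fun_prop))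

/-- `E(|Y| ∣ Z = 1, S = s, X = x)`, as a real number. -/
def absMu (s : ℝ) (x : 𝒳) : ℝ := ∫ y, |y| ∂(M.κ (s, true, x))

theorem measurable_absMu : Measurable fun t : 𝒳 × ℝ => M.absMu t.2 t.1 := by
  have h := M.measurable_integral_outcome (L := fun _ => 1) measurable_const
    (g := fun y => |y|) (by fun_prop)
  simp only [mul_one] at h
  exact h

theorem absMu_nonneg (s : ℝ) (x : 𝒳) : 0 ≤ M.absMu s x := integral_nonneg fun _ => abs_nonneg _

theorem abs_mu1_le (s : ℝ) (x : 𝒳) : |M.mu1 s x| ≤ M.absMu s x := abs_integral_le_integral_abs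

/-- The density of `(X, S₁, S₀)` with respect to `M.base`, times the weight, under the law with
likelihood ratio `L`. -/
def tiltK (c w : ℝ → ℝ → ℝ) (L : Obs 𝒳 → ℝ) (t : 𝒳 × ℝ × ℝ) : ℝ :=
  M.avgX L t.1 * (w t.2.1 t.2.2 * (c (M.tiltF L true t.2.1 t.1) (M.tiltF L false t.2.2 t.1)
    * M.tiltP L true t.2.1 t.1 * M.tiltP L false t.2.2 t.1))

/-- The envelope of the weighted density. -/
def envK (cbar w : ℝ → ℝ → ℝ) (t : 𝒳 × ℝ × ℝ) : ℝ :=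
  w t.2.1 t.2.2 * cbar (M.F true t.2.1 t.1) (M.F false t.2.2 t.1)
    * (M.p true t.2.1 t.1 * M.p false t.2.2 t.1)

theorem measurable_tiltK {c w : ℝ → ℝ → ℝ} (hc : Measurable (Function.uncurry c))
    (hw : Measurable (Function.uncurry w)) (hL : Measurable L) : Measurable (M.tiltK c w L) := by
  have hl : Measurable fun t : 𝒳 × ℝ × ℝ => (t.1, t.2.1) := by fun_prop
  have hr : Measurable fun t : 𝒳 × ℝ × ℝ => (t.1, t.2.2) := by fun_prop
  have hcF : Measurable fun t : 𝒳 × ℝ × ℝ =>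
      c (M.tiltF L true t.2.1 t.1) (M.tiltF L false t.2.2 t.1) :=
    hc.comp (((M.measurable_tiltF hL true).comp hl).prodMk ((M.measurable_tiltF hL false).comp hr))
  have hw' : Measurable fun t : 𝒳 × ℝ × ℝ => w t.2.1 t.2.2 := hw.comp measurable_snd
  exact ((M.measurable_avgX hL).comp measurable_fst).mul (hw'.mul
    ((hcF.mul ((M.measurable_tiltP hL true).comp hl)).mul ((M.measurable_tiltP hL false).comp hr)))

theorem tiltK_eq_zero {c w : ℝ → ℝ → ℝ} {t : 𝒳 × ℝ × ℝ}
    (hp : M.p true t.2.1 t.1 * M.p false t.2.2 t.1 = 0) : M.tiltK c w L t = 0 := by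
  rcases mul_eq_zero.1 hp with h | h <;> simp [tiltK, tiltP, h]

theorem envK_eq_zero {cbar w : ℝ → ℝ → ℝ} {t : 𝒳 × ℝ × ℝ}
    (hp : M.p true t.2.1 t.1 * M.p false t.2.2 t.1 = 0) : M.envK cbar w t = 0 := by
  simp [envK, hp]

theorem abs_div_sub_one_le {s z ε : ℝ} (hε : ε ≤ 1 / 2) (hs : |s - 1| ≤ ε) (hz : |z - 1| ≤ ε) :
    |s / z - 1| ≤ 4 * ε ∧ |s / z| ≤ 3 := by
  have hs' := abs_le.1 hs
  have hz' := abs_le.1 hz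
  have hzp : 1 / 2 ≤ z := half_le_of_abs_sub_one_le (hz.trans hε)
  have hz0 : 0 < z := by linarith
  constructor
  · rw [div_sub_one hz0.ne', abs_div, abs_of_pos hz0, div_le_iff₀ hz0, abs_le]
    constructor <;> nlinarith
  · rw [abs_div, abs_of_pos hz0, div_le_iff₀ hz0, abs_le]
    constructor <;> nlinarith

variable {ε : ℝ} {c cbar w : ℝ → ℝ → ℝ} {δ : ℝ}

/-- The weighted density under a law close to the reference law. -/
theorem abs_tiltK_le (hcop : CopulaBound c cbar δ) (hw : ∀ s1 s0, 0 ≤ w s1 s0) (hL : Measurable L)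
    (hb : ∀ v, |L v - 1| ≤ ε) (hε : 4 * ε ≤ δ) {t : 𝒳 × ℝ × ℝ}
    (ht : M.IsInterior t) : |M.tiltK c w L t| ≤ 14 * M.envK cbar w t ∧
      |M.tiltK c w L t - w t.2.1 t.2.2 * M.e c t.2.1 t.2.2 t.1| ≤ 33 * ε * M.envK cbar w t := by
  have hε2 : ε ≤ 1 / 2 := by linarith [hcop.lt_one]
  have hX := M.abs_avgX_sub_le hL hb t.1
  have hX2 : |M.avgX L t.1| ≤ 3 / 2 := by
    rw [abs_le]; constructor <;> linarith [(abs_le.1 hX).1, (abs_le.1 hX).2]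
  obtain ⟨h1, h1'⟩ := abs_div_sub_one_le hε2 (M.abs_avgS_sub_le hL hb (t.2.1, true, t.1))
    (M.abs_avgZ_sub_le hL hb true t.1)
  obtain ⟨h0, h0'⟩ := abs_div_sub_one_le hε2 (M.abs_avgS_sub_le hL hb (t.2.2, false, t.1))
    (M.abs_avgZ_sub_le hL hb false t.1)
  have hu := M.abs_tiltF_sub_le hL hb hε2 true t.2.1 t.1
  have hv := M.abs_tiltF_sub_le hL hb hε2 false t.2.2 t.1
  have hpu : 0 < M.F true t.2.1 t.1 * (1 - M.F true t.2.1 t.1) :=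
    mul_pos ht.left.1 (by linarith [ht.left.2])
  have hpv : 0 < M.F false t.2.2 t.1 * (1 - M.F false t.2.2 t.1) :=
    mul_pos ht.right.1 (by linarith [ht.right.2])
  -- The distribution functions move by at most `4 ε F (1 - F)`, so `4 * ε ≤ δ` is what keeps the
  -- copula arguments in the dominated box.
  have hc1 := hcop.abs_le ht.left ht.right (hu.trans (by gcongr)) (hv.trans (by gcongr))
  have hc2 := hcop.abs_sub_le ht.left ht.right hε hu hv
  set X := M.avgX L t.1
  set q1 := M.avgS L (t.2.1, true, t.1) / M.avgZ L true t.1 with hq1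
  set q0 := M.avgS L (t.2.2, false, t.1) / M.avgZ L false t.1 with hq0
  set c' := c (M.tiltF L true t.2.1 t.1) (M.tiltF L false t.2.2 t.1)
  set cb := cbar (M.F true t.2.1 t.1) (M.F false t.2.2 t.1) with hcb
  set k := w t.2.1 t.2.2 * (M.p true t.2.1 t.1 * M.p false t.2.2 t.1) with hk
  have hk0 : 0 ≤ k := mul_nonneg (hw _ _) (mul_nonneg (M.p_nonneg _ _ _) (M.p_nonneg _ _ _))
  have hcb0 : 0 ≤ cb := (abs_nonneg _).trans hc1
  have hε0 : 0 ≤ ε := (abs_nonneg _).trans hX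
  have hE : M.envK cbar w t = k * cb := by rw [envK, ← hcb, hk]; ring
  have hK : M.tiltK c w L t = k * (c' * (X * q1 * q0)) := by
    rw [tiltK, tiltP, tiltP, hk, hq1, hq0]; ring
  have he : w t.2.1 t.2.2 * M.e c t.2.1 t.2.2 t.1
      = k * c (M.F true t.2.1 t.1) (M.F false t.2.2 t.1) := by rw [e, hk]; ring
  -- The bound `14` rounds up `3 / 2 * 3 * 3`.
  have hq : |X * q1 * q0| ≤ 14 := by
    rw [abs_mul, abs_mul]
    calc |X| * |q1| * |q0| ≤ 3 / 2 * 3 * 3 := by gcongr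
      _ ≤ 14 := by norm_num
  -- Telescoping one factor at a time gives `9 + 12 + 4 = 25`; the movement of the copula density
  -- adds `8`, whence the `33` in the conclusion.
  have hq' : |X * q1 * q0 - 1| ≤ 25 * ε := by
    have h2 : X * q1 * q0 - 1 = (X - 1) * (q1 * q0) + (q1 - 1) * q0 + (q0 - 1) := by ring
    rw [h2]
    calc |(X - 1) * (q1 * q0) + (q1 - 1) * q0 + (q0 - 1)|
        ≤ |X - 1| * (|q1| * |q0|) + |q1 - 1| * |q0| + |q0 - 1| := by
          rw [← abs_mul, ← abs_mul, ← abs_mul]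
          exact (abs_add_le _ _).trans (by gcongr; exact abs_add_le _ _)
      _ ≤ ε * (3 * 3) + 4 * ε * 3 + 4 * ε := by gcongr
      _ = 25 * ε := by ring
  rw [hE, hK, he]
  constructor
  · rw [abs_mul, abs_of_nonneg hk0, abs_mul]
    calc k * (|c'| * |X * q1 * q0|) ≤ k * (cb * 14) := by gcongr
      _ = 14 * (k * cb) := by ring
  · rw [← mul_sub, abs_mul, abs_of_nonneg hk0]
    have h3 : c' * (X * q1 * q0) - c (M.F true t.2.1 t.1) (M.F false t.2.2 t.1)
        = c' * (X * q1 * q0 - 1) + (c' - c (M.F true t.2.1 t.1) (M.F false t.2.2 t.1)) := by ring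
    rw [h3]
    calc k * |c' * (X * q1 * q0 - 1) + (c' - c (M.F true t.2.1 t.1) (M.F false t.2.2 t.1))|
        ≤ k * (cb * (25 * ε) + 2 * (4 * ε) * cb) := by
          gcongr
          refine (abs_add_le _ _).trans (add_le_add ?_ hc2)
          rw [abs_mul]
          gcongr
      _ = 33 * ε * (k * cb) := by ring

end ObsModel

/-! ### Joint differentiability of the expected score in the law and the parameter -/

/-- The regularity conditions, with the integrability of the envelope in terms of `M.base`. -/
structure IsRegular {𝒳 : Type*} [MeasurableSpace 𝒳] {q : ℕ} (M : ObsModel 𝒳)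
    (c w : ℝ → ℝ → ℝ) (f : ℝ → ℝ → EuclideanSpace ℝ (Fin q) → ℝ) (η₁ : EuclideanSpace ℝ (Fin q))
    (r δ : ℝ) (b cbar : ℝ → ℝ → ℝ) : Prop where
  r_pos : 0 < r
  copula : CopulaBound c cbar δ
  c_meas : Measurable (Function.uncurry c)
  w_meas : Measurable (Function.uncurry w)
  b_meas : Measurable (Function.uncurry b)
  w_nonneg : ∀ s1 s0, 0 ≤ w s1 s0
  f_meas : ∀ η, Measurable fun s : ℝ × ℝ => f s.1 s.2 η
  smooth : ∀ s1 s0, ContDiffOn ℝ 2 (f s1 s0) (Metric.ball η₁ r)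
  bound : ∀ s1 s0, ∀ η ∈ Metric.ball η₁ r, ∀ k ≤ 2, ‖iteratedFDeriv ℝ k (f s1 s0) η‖ ≤ b s1 s0
  outcome : ∀ᵐ t ∂(M.jointXS true), Integrable (fun y : ℝ => y) (M.outcome true t)
  integrable : Integrable
    (fun t => M.envK cbar w t * (b t.2.1 t.2.2 + M.absMu t.2.1 t.1) ^ 2) M.base

namespace IsRegular

variable {𝒳 : Type*} [MeasurableSpace 𝒳] {q : ℕ} {M : ObsModel 𝒳}
    {c w : ℝ → ℝ → ℝ} {f : ℝ → ℝ → EuclideanSpace ℝ (Fin q) → ℝ} {η₁ : EuclideanSpace ℝ (Fin q)}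
    {r δ ε : ℝ} {b cbar : ℝ → ℝ → ℝ} {L : Obs 𝒳 → ℝ}

theorem b_nonneg (h : IsRegular M c w f η₁ r δ b cbar) (s1 s0 : ℝ) : 0 ≤ b s1 s0 :=
  (norm_nonneg _).trans (h.bound s1 s0 η₁ (Metric.mem_ball_self h.r_pos) 0 (by norm_num))

theorem envK_nonneg (h : IsRegular M c w f η₁ r δ b cbar) {t : 𝒳 × ℝ × ℝ}
    (ht : M.p true t.2.1 t.1 * M.p false t.2.2 t.1 ≠ 0 → M.IsInterior t) :
    0 ≤ M.envK cbar w t := by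
  by_cases hp : M.p true t.2.1 t.1 * M.p false t.2.2 t.1 = 0
  · rw [M.envK_eq_zero hp]
  · have hi := ht hp
    have hδ := h.copula.pos
    have h1 := h.copula.abs_le hi.left hi.right (u' := M.F true t.2.1 t.1)
      (v' := M.F false t.2.2 t.1)
      (by rw [sub_self, abs_zero]
          exact mul_nonneg hδ.le (mul_nonneg hi.left.1.le (by linarith [hi.left.2])))
      (by rw [sub_self, abs_zero]
          exact mul_nonneg hδ.le (mul_nonneg hi.right.1.le (by linarith [hi.right.2])))
    exact mul_nonneg (mul_nonneg (h.w_nonneg _ _) ((abs_nonneg _).trans h1))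
      (mul_nonneg (M.p_nonneg _ _ _) (M.p_nonneg _ _ _))

/-- The factor `14` comes from the density, and `9 = 3²` from the tilted outcome mean. -/
theorem abs_tiltK_mul_sq_le (h : IsRegular M c w f η₁ r δ b cbar) (hL : Measurable L)
    (hb : ∀ v, |L v - 1| ≤ ε) (hε : 4 * ε ≤ δ) {t : 𝒳 × ℝ × ℝ}
    (ht : M.p true t.2.1 t.1 * M.p false t.2.2 t.1 ≠ 0 → M.IsInterior t) :
    |M.tiltK c w L t| * (b t.2.1 t.2.2 + |M.tiltMu L t.2.1 t.1|) ^ 2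
      ≤ 14 * 9 * (M.envK cbar w t * (b t.2.1 t.2.2 + M.absMu t.2.1 t.1) ^ 2) := by
  by_cases hp : M.p true t.2.1 t.1 * M.p false t.2.2 t.1 = 0
  · simp [M.tiltK_eq_zero hp, M.envK_eq_zero hp]
  · have hi := ht hp
    have hε2 : ε ≤ 1 / 2 := by linarith [h.copula.lt_one]
    have h1 := (M.abs_tiltK_le h.copula h.w_nonneg hL hb hε hi).1
    have h2 : |M.tiltMu L t.2.1 t.1| ≤ 3 * M.absMu t.2.1 t.1 :=
      M.abs_tiltMu_le hL hb hε2 hi.outcome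
    have h3 := h.b_nonneg t.2.1 t.2.2
    have h4 := M.absMu_nonneg t.2.1 t.1
    have h5 := h.envK_nonneg ht
    calc |M.tiltK c w L t| * (b t.2.1 t.2.2 + |M.tiltMu L t.2.1 t.1|) ^ 2
        ≤ (14 * M.envK cbar w t) * (3 * (b t.2.1 t.2.2 + M.absMu t.2.1 t.1)) ^ 2 := by
          gcongr
          linarith
      _ = _ := by ring

/-- One envelope, up to a constant, serves all laws close to the reference law; this uniformity lets
the law vary under the integral sign. -/
theorem leastSquaresData (h : IsRegular M c w f η₁ r δ b cbar) (hL : Measurable L)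
    (hb : ∀ v, |L v - 1| ≤ ε) (hε : 4 * ε ≤ δ) :
    LeastSquaresData M.base (M.tiltK c w L) (fun t => M.tiltMu L t.2.1 t.1)
      (fun t => b t.2.1 t.2.2) (fun t => f t.2.1 t.2.2) η₁ r := by
  have hm : Measurable fun t : 𝒳 × ℝ × ℝ => M.tiltMu L t.2.1 t.1 :=
    (M.measurable_tiltMu hL).comp (measurable_fst.prodMk (measurable_fst.comp measurable_snd))
  have hbm : Measurable fun t : 𝒳 × ℝ × ℝ => b t.2.1 t.2.2 := h.b_meas.comp measurable_snd
  have hk := M.measurable_tiltK h.c_meas h.w_meas hL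
  refine ⟨hk, hm.aestronglyMeasurable, fun η => (h.f_meas η).comp measurable_snd,
    fun _ => h.smooth _ _, fun _ => h.bound _ _, ?_⟩
  refine (h.integrable.const_mul (14 * 9)).mono'
    (hk.abs.mul ((hbm.add hm.abs).pow_const 2)).aestronglyMeasurable ?_
  filter_upwards [M.ae_isInterior h.outcome] with t ht
  rw [Real.norm_of_nonneg (by positivity)]
  exact h.abs_tiltK_mul_sq_le hL hb hε ht

end IsRegular

namespace ObsModel

variable {𝒳 : Type*} [MeasurableSpace 𝒳] (M : ObsModel 𝒳) {L : ℝ → Obs 𝒳 → ℝ} {sc : Obs 𝒳 → ℝ}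
  {δ B : ℝ} {c w cbar : ℝ → ℝ → ℝ}

/-- The derivative, along a perturbation with score `sc`, of `c(F₁, F₀)` relative to the densities
and of the densities themselves, without the weight. -/
def dotC (c : ℝ → ℝ → ℝ) (sc : Obs 𝒳 → ℝ) (t : 𝒳 × ℝ × ℝ) : ℝ :=
  M.avgX sc t.1 * c (M.F true t.2.1 t.1) (M.F false t.2.2 t.1)
    + (deriv (fun u => c u (M.F false t.2.2 t.1)) (M.F true t.2.1 t.1) * M.dotF sc true t.2.1 t.1
      + deriv (fun v => c (M.F true t.2.1 t.1) v) (M.F false t.2.2 t.1) * M.dotF sc false t.2.2 t.1)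
    + c (M.F true t.2.1 t.1) (M.F false t.2.2 t.1)
      * ((M.avgS sc (t.2.1, true, t.1) - M.avgZ sc true t.1)
        + (M.avgS sc (t.2.2, false, t.1) - M.avgZ sc false t.1))

/-- The derivative of the weighted density `M.tiltK` along a perturbation with score `sc`. -/
def dotK (c w : ℝ → ℝ → ℝ) (sc : Obs 𝒳 → ℝ) (t : 𝒳 × ℝ × ℝ) : ℝ :=
  w t.2.1 t.2.2 * (M.p true t.2.1 t.1 * M.p false t.2.2 t.1) * M.dotC c sc t

theorem tiltK_zero (h : IsPerturbation L sc δ B) (t : 𝒳 × ℝ × ℝ) :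
    M.tiltK c w (L 0) t = w t.2.1 t.2.2 * M.e c t.2.1 t.2.2 t.1 := by
  rw [tiltK, M.tiltF_zero h, M.tiltF_zero h, M.tiltP_zero h, M.tiltP_zero h,
    (M.isPerturbation_avgX h).zero, one_mul, e]

theorem hasDerivAt_tiltK {δc : ℝ} (hcop : CopulaBound c cbar δc) (h : IsPerturbation L sc δ B)
    {t : 𝒳 × ℝ × ℝ} (ht : M.p true t.2.1 t.1 * M.p false t.2.2 t.1 ≠ 0 → M.IsInterior t) :
    HasDerivAt (fun θ => M.tiltK c w (L θ) t) (M.dotK c w sc t) 0 := by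
  by_cases hp : M.p true t.2.1 t.1 * M.p false t.2.2 t.1 = 0
  · simp only [M.tiltK_eq_zero hp, dotK, hp, mul_zero, zero_mul]
    exact hasDerivAt_const _ _
  · have hi := ht hp
    have hc := hcop.hasDerivAt_comp (x := 0) (by rw [M.tiltF_zero h]; exact hi.left)
      (by rw [M.tiltF_zero h]; exact hi.right) (M.hasDerivAt_tiltF h true t.2.1 t.1)
      (M.hasDerivAt_tiltF h false t.2.2 t.1)
    have h1 := ((M.isPerturbation_avgX h).deriv t.1).mul (((hc.mul
      (M.hasDerivAt_tiltP h true t.2.1 t.1)).mul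
        (M.hasDerivAt_tiltP h false t.2.2 t.1)).const_mul (w t.2.1 t.2.2))
    refine h1.congr_deriv ?_
    simp only [M.tiltF_zero h, M.tiltP_zero h, (M.isPerturbation_avgX h).zero, dotK, dotC,
      Pi.mul_apply]
    ring

end ObsModel

namespace IsRegular

variable {𝒳 : Type*} [MeasurableSpace 𝒳] {q : ℕ} {M : ObsModel 𝒳}
    {c w : ℝ → ℝ → ℝ} {f : ℝ → ℝ → EuclideanSpace ℝ (Fin q) → ℝ}
    {η₁ η : EuclideanSpace ℝ (Fin q)}
    {r δ ε : ℝ} {b cbar : ℝ → ℝ → ℝ} {L : ℝ → Obs 𝒳 → ℝ} {sc : Obs 𝒳 → ℝ} {δL B : ℝ}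

/-- Near `θ = 0`, a perturbation is within the range of the domination conditions. -/
theorem eventually_close (h : IsRegular M c w f η₁ r δ b cbar) (hL : IsPerturbation L sc δL B) :
    ∀ᶠ θ in 𝓝 0, Measurable (L θ) ∧ (∀ v, |L θ v - 1| ≤ B * |θ|) ∧ 4 * (B * |θ|) ≤ δ := by
  have h1 : Tendsto (fun θ : ℝ => 4 * (B * |θ|)) (𝓝 0) (𝓝 (4 * (B * |0|))) :=
    ((continuous_abs.tendsto 0).const_mul B).const_mul 4
  rw [abs_zero, mul_zero, mul_zero] at h1
  filter_upwards [eventually_abs_lt hL.pos, h1.eventually_le_const h.copula.pos] with θ hθ h2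
  exact ⟨hL.meas θ hθ, hL.bound θ hθ, h2⟩

/-- The derivative of the score at `t` along a perturbation with score `sc`. -/
def dotScore (M : ObsModel 𝒳) (c w : ℝ → ℝ → ℝ) (f : ℝ → ℝ → EuclideanSpace ℝ (Fin q) → ℝ)
    (η : EuclideanSpace ℝ (Fin q)) (sc : Obs 𝒳 → ℝ) (t : 𝒳 × ℝ × ℝ) : EuclideanSpace ℝ (Fin q) :=
  (M.dotK c w sc t * (M.mu1 t.2.1 t.1 - f t.2.1 t.2.2 η)
    + w t.2.1 t.2.2 * M.e c t.2.1 t.2.2 t.1 * M.dotMu sc t.2.1 t.1) • gradient (f t.2.1 t.2.2) η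

/-- Product and chain rule at a single point: the direction of the law contributes `dotScore`, the
direction of `η` minus the weighted `residualHess`. Where a density vanishes both sides are zero. -/
theorem hasFDerivAt_tilt_score (h : IsRegular M c w f η₁ r δ b cbar)
    (hL : IsPerturbation L sc δL B) (hη : η ∈ Metric.ball η₁ r) {t : 𝒳 × ℝ × ℝ}
    (ht : M.p true t.2.1 t.1 * M.p false t.2.2 t.1 ≠ 0 → M.IsInterior t) :
    HasFDerivAt (fun z : ℝ × EuclideanSpace ℝ (Fin q) =>
        (M.tiltK c w (L z.1) t * (M.tiltMu (L z.1) t.2.1 t.1 - f t.2.1 t.2.2 z.2))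
          • gradient (f t.2.1 t.2.2) z.2)
      ((ContinuousLinearMap.fst ℝ ℝ (EuclideanSpace ℝ (Fin q))).smulRight
          (dotScore M c w f η sc t)
        - (M.tiltK c w (L 0) t • residualHess (M.tiltMu (L 0) t.2.1 t.1) (f t.2.1 t.2.2) η).comp
          (ContinuousLinearMap.snd ℝ ℝ (EuclideanSpace ℝ (Fin q)))) (0, η) := by
  by_cases hp : M.p true t.2.1 t.1 * M.p false t.2.2 t.1 = 0
  · have he : w t.2.1 t.2.2 * M.e c t.2.1 t.2.2 t.1 = 0 := by
      rw [← M.tiltK_zero hL, M.tiltK_eq_zero hp]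
    have h0 : dotScore M c w f η sc t = 0 := by
      simp [dotScore, he, ObsModel.dotK, hp]
    simp only [M.tiltK_eq_zero hp, zero_mul, zero_smul, h0]
    refine (hasFDerivAt_const _ _).congr_fderiv ?_
    ext <;> simp
  · have hi := ht hp
    set g := f t.2.1 t.2.2 with hg
    have hsm : ContDiffOn ℝ 2 g (Metric.ball η₁ r) := h.smooth _ _
    have hK : HasFDerivAt (fun z : ℝ × EuclideanSpace ℝ (Fin q) => M.tiltK c w (L z.1) t) _ (0, η) :=
      HasFDerivAt.comp (g := fun θ => M.tiltK c w (L θ) t) ((0 : ℝ), η)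
        (M.hasDerivAt_tiltK h.copula hL ht).hasFDerivAt
        (hasFDerivAt_fst (𝕜 := ℝ) (E := ℝ) (F := EuclideanSpace ℝ (Fin q)))
    have hm : HasFDerivAt (fun z : ℝ × EuclideanSpace ℝ (Fin q) =>
        M.tiltMu (L z.1) t.2.1 t.1) _ (0, η) :=
      HasFDerivAt.comp (g := fun θ => M.tiltMu (L θ) t.2.1 t.1) ((0 : ℝ), η)
        (M.hasDerivAt_tiltMu hL hi.outcome).hasFDerivAt
        (hasFDerivAt_fst (𝕜 := ℝ) (E := ℝ) (F := EuclideanSpace ℝ (Fin q)))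
    have hf : HasFDerivAt (fun z : ℝ × EuclideanSpace ℝ (Fin q) => g z.2) _ (0, η) :=
      HasFDerivAt.comp (g := g) ((0 : ℝ), η)
        (hasGradientAt_of_contDiffOn hsm Metric.isOpen_ball hη).hasFDerivAt
        (hasFDerivAt_snd (𝕜 := ℝ) (E := ℝ) (F := EuclideanSpace ℝ (Fin q)))
    have hgr : HasFDerivAt (fun z : ℝ × EuclideanSpace ℝ (Fin q) => gradient g z.2) _ (0, η) :=
      HasFDerivAt.comp (g := gradient g) ((0 : ℝ), η)
        (hasFDerivAt_gradient hsm Metric.isOpen_ball hη)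
        (hasFDerivAt_snd (𝕜 := ℝ) (E := ℝ) (F := EuclideanSpace ℝ (Fin q)))
    refine ((hK.mul (hm.sub hf)).smul hgr).congr_fderiv ?_
    refine ContinuousLinearMap.ext fun z => ?_
    obtain ⟨τ, v⟩ := z
    have he := M.tiltK_zero (c := c) (w := w) hL t
    simp [residualHess, dotScore, ← he, M.tiltMu_zero hL, ← hg]
    module

/-- The increment splits into the change of the density, of the outcome mean and of `η`. The first
two give `33 * 3 + 14 * 4 = 155`, the last `14 * 2 = 28` by the mean value inequality. This is the
domination needed to differentiate the expected score. -/
theorem norm_tilt_score_sub_le (h : IsRegular M c w f η₁ r δ b cbar)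
    (hL : IsPerturbation L sc δL B) {θ : ℝ} (hm : Measurable (L θ))
    (hb : ∀ v, |L θ v - 1| ≤ ε) (hε : 4 * ε ≤ δ) (hη : η ∈ Metric.ball η₁ r) {t : 𝒳 × ℝ × ℝ}
    (ht : M.p true t.2.1 t.1 * M.p false t.2.2 t.1 ≠ 0 → M.IsInterior t) :
    ‖(M.tiltK c w (L θ) t * (M.tiltMu (L θ) t.2.1 t.1 - f t.2.1 t.2.2 η))
          • gradient (f t.2.1 t.2.2) η
        - (M.tiltK c w (L 0) t * (M.tiltMu (L 0) t.2.1 t.1 - f t.2.1 t.2.2 η₁))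
          • gradient (f t.2.1 t.2.2) η₁‖
      ≤ (155 * ε + 28 * ‖η - η₁‖)
        * (M.envK cbar w t * (b t.2.1 t.2.2 + M.absMu t.2.1 t.1) ^ 2) := by
  by_cases hp : M.p true t.2.1 t.1 * M.p false t.2.2 t.1 = 0
  · simp [M.tiltK_eq_zero hp, M.envK_eq_zero hp]
  have hi := ht hp
  have hε2 : ε ≤ 1 / 2 := by linarith [h.copula.lt_one]
  obtain ⟨hK, hKd⟩ := M.abs_tiltK_le h.copula h.w_nonneg hm hb hε hi
  have hK0 := (M.abs_tiltK_le h.copula h.w_nonneg (hL.meas 0 (by simpa using hL.pos)) (ε := 0)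
    (fun v => by rw [hL.zero]; simp) (by linarith [h.copula.pos]) hi).1
  rw [← M.tiltK_zero hL] at hKd
  have h2 : |M.tiltMu (L θ) t.2.1 t.1| ≤ 3 * M.absMu t.2.1 t.1 :=
    M.abs_tiltMu_le hm hb hε2 hi.outcome
  have h2d : |M.tiltMu (L θ) t.2.1 t.1 - M.mu1 t.2.1 t.1| ≤ 4 * ε * M.absMu t.2.1 t.1 :=
    M.abs_tiltMu_sub_le hm hb hε2 hi.outcome
  have hmu := M.abs_mu1_le t.2.1 t.1
  have ha := M.absMu_nonneg t.2.1 t.1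
  have hbn := h.b_nonneg t.2.1 t.2.2
  have hE := h.envK_nonneg ht
  rw [M.tiltMu_zero hL]
  have hbd := h.bound t.2.1 t.2.2
  have hsm := h.smooth t.2.1 t.2.2
  set g := f t.2.1 t.2.2
  set bb := b t.2.1 t.2.2
  set a := M.absMu t.2.1 t.1
  set m := M.tiltMu (L θ) t.2.1 t.1
  set m₀ := M.mu1 t.2.1 t.1
  set K := M.tiltK c w (L θ) t
  set K₀ := M.tiltK c w (L 0) t
  set E := M.envK cbar w t
  have hgb := norm_gradient_le (hbd η hη)
  have hfb := abs_le_of_iteratedFDeriv (hbd η hη)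
  have hε0 : 0 ≤ ε := (abs_nonneg _).trans (hb (0, 0, true, t.1))
  have h3 : ‖(K₀ * (m₀ - g η)) • gradient g η - (K₀ * (m₀ - g η₁)) • gradient g η₁‖
      ≤ 28 * (E * (bb + a) ^ 2) * ‖η - η₁‖ := by
    refine (convex_ball η₁ r).norm_image_sub_le_of_norm_hasFDerivWithin_le
      (f := fun η => (K₀ * (m₀ - g η)) • gradient g η)
      (f' := fun η => -(K₀ • residualHess m₀ g η))
      (fun η' hη' => (hasFDerivAt_score hsm Metric.isOpen_ball hη').hasFDerivWithinAt)
      (fun η' hη' => ?_) (Metric.mem_ball_self h.r_pos) hη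
    have h4 := norm_residualHess_le (y := m₀) hsm Metric.isOpen_ball hη' (hbd η' hη')
    rw [norm_neg, norm_smul, Real.norm_eq_abs]
    calc |K₀| * ‖residualHess m₀ g η'‖ ≤ (14 * E) * (2 * (bb + a) ^ 2) := by
          gcongr
          refine h4.trans ?_
          gcongr
      _ = 28 * (E * (bb + a) ^ 2) := by ring
  have h5 : (K * (m - g η)) • gradient g η - (K₀ * (m₀ - g η₁)) • gradient g η₁
      = ((K - K₀) * (m - g η)) • gradient g η + (K₀ * (m - m₀)) • gradient g η
        + ((K₀ * (m₀ - g η)) • gradient g η - (K₀ * (m₀ - g η₁)) • gradient g η₁) := by module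
  have h6 : |m - g η| ≤ 3 * (bb + a) := (abs_sub _ _).trans (by linarith)
  rw [h5]
  refine (norm_add₃_le).trans ?_
  rw [norm_smul, norm_smul, Real.norm_eq_abs, Real.norm_eq_abs, abs_mul, abs_mul]
  have hbb : bb ≤ bb + a := by linarith
  have hab : a ≤ bb + a := by linarith
  calc |K - K₀| * |m - g η| * ‖gradient g η‖ + |K₀| * |m - m₀| * ‖gradient g η‖
        + ‖(K₀ * (m₀ - g η)) • gradient g η - (K₀ * (m₀ - g η₁)) • gradient g η₁‖
      ≤ (33 * ε * E) * (3 * (bb + a)) * (bb + a) + (14 * E) * (4 * ε * (bb + a)) * (bb + a)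
        + 28 * (E * (bb + a) ^ 2) * ‖η - η₁‖ := by
        gcongr
        · exact hgb.trans hbb
        · exact h2d.trans (by gcongr)
        · exact hgb.trans hbb
    _ = _ := by ring

/-- The derivative is an almost everywhere limit of difference quotients of measurable scores, so
its explicit formula need not be analyzed. -/
theorem aestronglyMeasurable_dotScore (h : IsRegular M c w f η₁ r δ b cbar)
    (hL : IsPerturbation L sc δL B) (hη : η ∈ Metric.ball η₁ r) :
    AEStronglyMeasurable (dotScore M c w f η sc) M.base := by
  obtain ⟨N, hN⟩ := eventually_atTop.1
    ((tendsto_inv_atTop_nhds_zero_nat (𝕜 := ℝ)).eventually (h.eventually_close hL))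
  set Ψ : ℝ → 𝒳 × ℝ × ℝ → EuclideanSpace ℝ (Fin q) := fun θ t =>
    (M.tiltK c w (L θ) t * (M.tiltMu (L θ) t.2.1 t.1 - f t.2.1 t.2.2 η))
      • gradient (f t.2.1 t.2.2) η with hΨ
  have hm : ∀ θ, (Measurable (L θ) ∧ (∀ v, |L θ v - 1| ≤ B * |θ|) ∧ 4 * (B * |θ|) ≤ δ) →
      AEStronglyMeasurable (Ψ θ) M.base := fun θ hθ =>
    (h.leastSquaresData hθ.1 hθ.2.1 hθ.2.2).aestronglyMeasurable_score hη
  have h0 := hm 0 (h.eventually_close hL).self_of_nhds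
  refine aestronglyMeasurable_of_tendsto_ae atTop
    (f := fun (n : ℕ) t => ((n + N : ℕ) : ℝ) • (Ψ (((n + N : ℕ) : ℝ)⁻¹) t - Ψ 0 t))
    (fun n => ((hm _ (hN (n + N) (Nat.le_add_left _ _))).sub h0).const_smul ((n + N : ℕ) : ℝ)) ?_
  filter_upwards [M.ae_isInterior h.outcome] with t ht
  have h1 : HasDerivAt (fun θ => Ψ θ t) (dotScore M c w f η sc t) 0 := by
    have h2 : HasDerivAt (fun θ : ℝ => (θ, η)) ((1 : ℝ), (0 : EuclideanSpace ℝ (Fin q))) 0 :=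
      (hasDerivAt_id' 0).prodMk (hasDerivAt_const _ _)
    refine (HasFDerivAt.comp_hasDerivAt (f := fun θ : ℝ => (θ, η)) 0
      (h.hasFDerivAt_tilt_score hL hη ht) h2).congr_deriv ?_
    simp
  have h2 := ((h1.hasFDerivAt.lim_real 1).comp (tendsto_natCast_atTop_atTop (R := ℝ))).comp
    (tendsto_add_atTop_nat N)
  refine (h2.congr fun n => ?_).trans_eq ?_
  · simp
  · simp

theorem eventually_mem_prod (h : IsRegular M c w f η₁ r δ b cbar) (hL : IsPerturbation L sc δL B)
    (hη : η ∈ Metric.ball η₁ r) : ∀ᶠ z : ℝ × EuclideanSpace ℝ (Fin q) in 𝓝 (0, η),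
      (Measurable (L z.1) ∧ (∀ v, |L z.1 v - 1| ≤ B * |z.1|) ∧ 4 * (B * |z.1|) ≤ δ)
        ∧ z.2 ∈ Metric.ball η₁ r := by
  rw [nhds_prod_eq]
  exact (h.eventually_close hL).prod_mk (Metric.isOpen_ball.mem_nhds hη)

/-- The expected score is differentiable jointly in the law and the parameter. -/
theorem hasFDerivAt_expected_score (h : IsRegular M c w f η₁ r δ b cbar)
    (hL : IsPerturbation L sc δL B) :
    Integrable (dotScore M c w f η₁ sc) M.base ∧ ∃ Φ' : ℝ × EuclideanSpace ℝ (Fin q) →L[ℝ]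
        EuclideanSpace ℝ (Fin q),
      HasFDerivAt (fun z : ℝ × EuclideanSpace ℝ (Fin q) => ∫ t, (M.tiltK c w (L z.1) t
        * (M.tiltMu (L z.1) t.2.1 t.1 - f t.2.1 t.2.2 z.2)) • gradient (f t.2.1 t.2.2) z.2 ∂M.base)
        Φ' (0, η₁) ∧
      ∀ τ v, Φ' (τ, v) = τ • (∫ t, dotScore M c w f η₁ sc t ∂M.base)
        - (∫ t, M.tiltK c w (L 0) t
          • residualHess (M.tiltMu (L 0) t.2.1 t.1) (f t.2.1 t.2.2) η₁ ∂M.base) v := by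
  have hη₁ := Metric.mem_ball_self (x := η₁) h.r_pos
  have h0 := (h.eventually_close hL).self_of_nhds
  have hlsd := h.leastSquaresData h0.1 h0.2.1 h0.2.2
  have hT := h.aestronglyMeasurable_dotScore hL hη₁
  let Efst := ContinuousLinearMap.smulRightL ℝ (ℝ × EuclideanSpace ℝ (Fin q))
    (EuclideanSpace ℝ (Fin q)) (ContinuousLinearMap.fst ℝ ℝ (EuclideanSpace ℝ (Fin q)))
  -- Only increments from `(0, η₁)` are controlled, because away from `θ = 0` the submodel need not
  -- be differentiable; `B` converts `ε` into `|θ|`.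
  have hmain := hasFDerivAt_integral_of_dominated_loc_of_lip' (μ := M.base)
    (F := fun (z : ℝ × EuclideanSpace ℝ (Fin q)) t => (M.tiltK c w (L z.1) t
        * (M.tiltMu (L z.1) t.2.1 t.1 - f t.2.1 t.2.2 z.2)) • gradient (f t.2.1 t.2.2) z.2)
    (F' := fun t => (ContinuousLinearMap.fst ℝ ℝ (EuclideanSpace ℝ (Fin q))).smulRight
          (dotScore M c w f η₁ sc t)
        - (M.tiltK c w (L 0) t • residualHess (M.tiltMu (L 0) t.2.1 t.1) (f t.2.1 t.2.2) η₁).comp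
          (ContinuousLinearMap.snd ℝ ℝ (EuclideanSpace ℝ (Fin q))))
    (bound := fun t => (155 * |B| + 28)
        * (M.envK cbar w t * (b t.2.1 t.2.2 + M.absMu t.2.1 t.1) ^ 2))
    (x₀ := (0, η₁)) (h.eventually_mem_prod hL hη₁)
    (fun z hz => (h.leastSquaresData hz.1.1 hz.1.2.1 hz.1.2.2).aestronglyMeasurable_score hz.2)
    (hlsd.integrable_score hη₁) ?_ ?_ (h.integrable.const_mul _) ?_
  · have happ := fun z => ContinuousLinearMap.integral_apply hmain.1 z
    have hfst : Integrable (dotScore M c w f η₁ sc) M.base := by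
      refine (hmain.1.apply_continuousLinearMap (1, 0)).congr (ae_of_all _ fun t => ?_)
      simp
    refine ⟨hfst, _, hmain.2, fun τ v => ?_⟩
    rw [happ, ContinuousLinearMap.integral_apply (hlsd.integrable_hess hη₁), ← integral_smul]
    exact integral_sub (hfst.smul τ) ((hlsd.integrable_hess hη₁).apply_continuousLinearMap v)
  · refine AEStronglyMeasurable.sub (Efst.continuous.comp_aestronglyMeasurable hT) ?_
    exact (((ContinuousLinearMap.compL ℝ (ℝ × EuclideanSpace ℝ (Fin q)) (EuclideanSpace ℝ (Fin q))
      (EuclideanSpace ℝ (Fin q))).flip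
        (ContinuousLinearMap.snd ℝ ℝ (EuclideanSpace ℝ (Fin q)))).continuous).comp_aestronglyMeasurable
          (hlsd.aestronglyMeasurable_hess hη₁)
  · filter_upwards [M.ae_isInterior h.outcome] with t ht z hz
    refine (h.norm_tilt_score_sub_le hL hz.1.1 hz.1.2.1 hz.1.2.2 hz.2 ht).trans ?_
    have hE : 0 ≤ M.envK cbar w t * (b t.2.1 t.2.2 + M.absMu t.2.1 t.1) ^ 2 :=
      mul_nonneg (h.envK_nonneg ht) (sq_nonneg _)
    have h1 : |z.1| ≤ ‖z - (0, η₁)‖ := by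
      have h3 := norm_fst_le (z - (0, η₁))
      rwa [Prod.fst_sub, sub_zero, Real.norm_eq_abs] at h3
    have h2 : ‖z.2 - η₁‖ ≤ ‖z - (0, η₁)‖ := norm_snd_le (z - (0, η₁))
    rw [mul_right_comm]
    gcongr
    calc 155 * (B * |z.1|) + 28 * ‖z.2 - η₁‖
        ≤ 155 * (|B| * ‖z - (0, η₁)‖) + 28 * ‖z - (0, η₁)‖ := by
          gcongr
          exact le_abs_self B
      _ = _ := by ring
  · filter_upwards [M.ae_isInterior h.outcome] with t ht
    exact h.hasFDerivAt_tilt_score hL hη₁ ht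

/-- The expected second derivative is continuous jointly in the law and the parameter. -/
theorem continuousAt_expected_hess (h : IsRegular M c w f η₁ r δ b cbar)
    (hL : IsPerturbation L sc δL B) (hη : η ∈ Metric.ball η₁ r) :
    ContinuousAt (fun z : ℝ × EuclideanSpace ℝ (Fin q) => ∫ t, M.tiltK c w (L z.1) t
      • residualHess (M.tiltMu (L z.1) t.2.1 t.1) (f t.2.1 t.2.2) z.2 ∂M.base) (0, η) := by
  refine continuousAt_of_dominated
    (bound := fun t => 2 * (14 * 9 * (M.envK cbar w t * (b t.2.1 t.2.2 + M.absMu t.2.1 t.1) ^ 2)))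
    ?_ ?_ ((h.integrable.const_mul _).const_mul _) ?_
  · filter_upwards [h.eventually_mem_prod hL hη] with z hz
    exact (h.leastSquaresData hz.1.1 hz.1.2.1 hz.1.2.2).aestronglyMeasurable_hess hz.2
  · filter_upwards [h.eventually_mem_prod hL hη] with z hz
    filter_upwards [M.ae_isInterior h.outcome] with t ht
    refine ((h.leastSquaresData hz.1.1 hz.1.2.1 hz.1.2.2).norm_hess_le hz.2 t).trans ?_
    exact mul_le_mul_of_nonneg_left (h.abs_tiltK_mul_sq_le hz.1.1 hz.1.2.1 hz.1.2.2 ht) (by norm_num)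
  · filter_upwards [M.ae_isInterior h.outcome] with t ht
    by_cases hp : M.p true t.2.1 t.1 * M.p false t.2.2 t.1 = 0
    · refine (continuousAt_const (y := 0)).congr (Eventually.of_forall fun z => ?_)
      simp only [M.tiltK_eq_zero hp]
      exact (zero_smul ℝ (residualHess (M.tiltMu (L z.1) t.2.1 t.1) (f t.2.1 t.2.2) z.2)).symm
    · have hK : ContinuousAt (fun z : ℝ × EuclideanSpace ℝ (Fin q) => M.tiltK c w (L z.1) t) (0, η) :=
        ContinuousAt.comp' (f := fun z : ℝ × EuclideanSpace ℝ (Fin q) => z.1)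
          (g := fun θ => M.tiltK c w (L θ) t)
          (M.hasDerivAt_tiltK h.copula hL ht).continuousAt continuousAt_fst
      have hm : ContinuousAt (fun z : ℝ × EuclideanSpace ℝ (Fin q) =>
          M.tiltMu (L z.1) t.2.1 t.1) (0, η) :=
        ContinuousAt.comp' (f := fun z : ℝ × EuclideanSpace ℝ (Fin q) => z.1)
          (g := fun θ => M.tiltMu (L θ) t.2.1 t.1)
          (M.hasDerivAt_tiltMu hL (ht hp).outcome).continuousAt continuousAt_fst
      have hm2 := hm.prodMk (continuousAt_snd (p := ((0 : ℝ), η)))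
      refine hK.smul ?_
      have hR := continuousAt_residualHess (y := M.tiltMu (L 0) t.2.1 t.1)
        (h.smooth t.2.1 t.2.2) Metric.isOpen_ball hη
      exact ContinuousAt.comp' (f := fun z : ℝ × EuclideanSpace ℝ (Fin q) =>
        (M.tiltMu (L z.1) t.2.1 t.1, z.2))
        (g := fun y : ℝ × EuclideanSpace ℝ (Fin q) => residualHess y.1 (f t.2.1 t.2.2) y.2) hR hm2

end IsRegular

/-! ### Reduction of full-data expectations to the observed-data law -/

section strata

variable {𝒳 : Type*} [MeasurableSpace 𝒳] {Q : Measure (FullData 𝒳)}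
  [IsProbabilityMeasure Q] {M : ObsModel 𝒳} {C : Copula} {c : ℝ → ℝ → ℝ} {L : Obs 𝒳 → ℝ}
  {F : Type*} [NormedAddCommGroup F] [NormedSpace ℝ F]

theorem lintegral_eq_one_of_map_observe
    (hM : Q.map observe = M.law.withDensity fun v => ENNReal.ofReal (L v)) :
    ∫⁻ v, ENNReal.ofReal (L v) ∂M.law = 1 := by
  have h : IsProbabilityMeasure (Q.map observe) :=
    Measure.isProbabilityMeasure_map measurable_observe.aemeasurable
  have h1 := h.measure_univ
  rwa [hM, withDensity_apply _ MeasurableSet.univ, Measure.restrict_univ] at h1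

/-- Nonnegativity of the copula density is known only on the open square; almost everywhere outside
it one of the density factors is zero. -/
theorem ObsModel.ae_e_nonneg (M : ObsModel 𝒳) (hc : IsCopulaDensity C c) :
    ∀ᵐ t ∂M.base, 0 ≤ M.e c t.2.1 t.2.2 t.1 := by
  filter_upwards [M.quasiMeasurePreserving_left.ae (M.ae_prod_F_mem_Ioo true),
    M.quasiMeasurePreserving_right.ae (M.ae_prod_F_mem_Ioo false)] with t h1 h0
  by_cases hp1 : M.p true t.2.1 t.1 = 0
  · simp [ObsModel.e, hp1]
  by_cases hp0 : M.p false t.2.2 t.1 = 0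
  · simp [ObsModel.e, hp0]
  exact mul_nonneg (mul_nonneg (hc.nonneg _ (h1 hp1) _ (h0 hp0)) (M.p_nonneg _ _ _))
    (M.p_nonneg _ _ _)

/-- The law of `(X, S₁, S₀)` under a causal law with observed-data likelihood ratio `L`. -/
theorem map_strataData_tilt [StandardBorelSpace 𝒳] (hc : IsCopulaDensity C c)
    (hQ : IsCausalModel C Q) (hM : Q.map observe = M.law.withDensity fun v => ENNReal.ofReal (L v))
    (hL : Measurable L) (hb : ∀ v, |L v - 1| ≤ 1 / 2) :
    Q.map strataData = M.base.withDensity fun t => ENNReal.ofReal (M.avgX L t.1 *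
      (M.tilt hL hb (lintegral_eq_one_of_map_observe hM)).e c t.2.1 t.2.2 t.1) := by
  set M' := M.tilt hL hb (lintegral_eq_one_of_map_observe hM) with hM'def
  have hM' : Q.map observe = M'.law := by rw [hM, M.tilt_law]
  rw [map_strataData_eq hc hQ hM']
  have hbase : M'.base = M.base.withDensity fun t => ENNReal.ofReal (M.avgX L t.1) := by
    change (M.PX.withDensity fun x => ENNReal.ofReal (M.avgX L x)).prod _ = _
    exact prod_withDensity_left (M.measurable_avgX hL).ennreal_ofReal
  have hm : Measurable fun t : 𝒳 × ℝ × ℝ => ENNReal.ofReal (M.avgX L t.1) :=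
    ((M.measurable_avgX hL).comp measurable_fst).ennreal_ofReal
  rw [hbase, ← withDensity_mul _ hm (M'.measurable_e hc).ennreal_ofReal]
  congr 1
  funext t
  rw [Pi.mul_apply, ENNReal.ofReal_mul (ObsModel.pos_of_abs_sub_one_le (M.abs_avgX_sub_le hL hb _)).le]

theorem ae_tilt_density_nonneg (hc : IsCopulaDensity C c) (hL : Measurable L)
    (hb : ∀ v, |L v - 1| ≤ 1 / 2) (hone : ∫⁻ v, ENNReal.ofReal (L v) ∂M.law = 1) :
    ∀ᵐ t ∂M.base, 0 ≤ M.avgX L t.1 * (M.tilt hL hb hone).e c t.2.1 t.2.2 t.1 := by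
  have hbase : (M.tilt hL hb hone).base
      = M.base.withDensity fun t => ENNReal.ofReal (M.avgX L t.1) := by
    change (M.PX.withDensity fun x => ENNReal.ofReal (M.avgX L x)).prod _ = _
    exact prod_withDensity_left (M.measurable_avgX hL).ennreal_ofReal
  have hm : Measurable fun t : 𝒳 × ℝ × ℝ => ENNReal.ofReal (M.avgX L t.1) :=
    ((M.measurable_avgX hL).comp measurable_fst).ennreal_ofReal
  have h := (M.tilt hL hb hone).ae_e_nonneg hc
  rw [hbase, ae_withDensity_iff hm] at h
  filter_upwards [h] with t ht
  have hpos := ObsModel.pos_of_abs_sub_one_le (M.abs_avgX_sub_le hL hb t.1)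
  exact mul_nonneg hpos.le (ht (by simpa using hpos))

theorem integrable_strataData_iff [StandardBorelSpace 𝒳] (hc : IsCopulaDensity C c)
    (hQ : IsCausalModel C Q) (hM : Q.map observe = M.law.withDensity fun v => ENNReal.ofReal (L v))
    (hL : Measurable L) (hb : ∀ v, |L v - 1| ≤ 1 / 2) {G : 𝒳 × ℝ × ℝ → F} (hG : StronglyMeasurable G) :
    Integrable (fun ω => G (strataData ω)) Q ↔ Integrable (fun t => (M.avgX L t.1 *
      (M.tilt hL hb (lintegral_eq_one_of_map_observe hM)).e c t.2.1 t.2.2 t.1) • G t) M.base := by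
  set M' := M.tilt hL hb (lintegral_eq_one_of_map_observe hM) with hM'def
  have hm : Measurable fun t : 𝒳 × ℝ × ℝ =>
      ENNReal.ofReal (M.avgX L t.1 * M'.e c t.2.1 t.2.2 t.1) :=
    (((M.measurable_avgX hL).comp measurable_fst).mul (M'.measurable_e hc)).ennreal_ofReal
  have h1 := integrable_map_measure (f := strataData) (μ := Q) hG.aestronglyMeasurable
    measurable_strataData.aemeasurable
  rw [map_strataData_tilt hc hQ hM hL hb, integrable_withDensity_iff_integrable_smul' hm
    (ae_of_all _ fun _ => ENNReal.ofReal_lt_top)] at h1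
  refine h1.symm.trans (integrable_congr ?_)
  filter_upwards [ae_tilt_density_nonneg hc hL hb (lintegral_eq_one_of_map_observe hM)] with t ht
  rw [ENNReal.toReal_ofReal ht]

theorem integral_strataData [StandardBorelSpace 𝒳] (hc : IsCopulaDensity C c)
    (hQ : IsCausalModel C Q) (hM : Q.map observe = M.law.withDensity fun v => ENNReal.ofReal (L v))
    (hL : Measurable L) (hb : ∀ v, |L v - 1| ≤ 1 / 2) {G : 𝒳 × ℝ × ℝ → F} (hG : StronglyMeasurable G) :
    ∫ ω, G (strataData ω) ∂Q = ∫ t, (M.avgX L t.1 *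
      (M.tilt hL hb (lintegral_eq_one_of_map_observe hM)).e c t.2.1 t.2.2 t.1) • G t ∂M.base := by
  set M' := M.tilt hL hb (lintegral_eq_one_of_map_observe hM) with hM'def
  have hm : Measurable fun t : 𝒳 × ℝ × ℝ =>
      ENNReal.ofReal (M.avgX L t.1 * M'.e c t.2.1 t.2.2 t.1) :=
    (((M.measurable_avgX hL).comp measurable_fst).mul (M'.measurable_e hc)).ennreal_ofReal
  have h1 := integral_map (μ := Q) measurable_strataData.aemeasurable hG.aestronglyMeasurable
  rw [map_strataData_tilt hc hQ hM hL hb, integral_withDensity_eq_integral_toReal_smul hm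
    (ae_of_all _ fun _ => ENNReal.ofReal_lt_top)] at h1
  refine h1.symm.trans (integral_congr_ae ?_)
  filter_upwards [ae_tilt_density_nonneg hc hL hb (lintegral_eq_one_of_map_observe hM)] with t ht
  rw [ENNReal.toReal_ofReal ht]

theorem weight_mul_tilt_density (hL : Measurable L) (hb : ∀ v, |L v - 1| ≤ 1 / 2)
    (hone : ∫⁻ v, ENNReal.ofReal (L v) ∂M.law = 1) (w : ℝ → ℝ → ℝ)
    (t : 𝒳 × ℝ × ℝ) :
    (M.avgX L t.1 * (M.tilt hL hb hone).e c t.2.1 t.2.2 t.1) * w t.2.1 t.2.2 = M.tiltK c w L t := by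
  rw [ObsModel.e, M.tilt_F, M.tilt_F, ObsModel.tiltK]
  change (M.avgX L t.1 * (_ * M.tiltP L true _ _ * M.tiltP L false _ _)) * _ = _
  ring

end strata

/-- The working model as a family of functions of the principal stratum. -/
theorem IsRegular.leastSquaresData_model {𝒳 : Type*} [MeasurableSpace 𝒳] {q : ℕ} {M : ObsModel 𝒳}
    {c w : ℝ → ℝ → ℝ} {f : ℝ → ℝ → EuclideanSpace ℝ (Fin q) → ℝ} {η₁ : EuclideanSpace ℝ (Fin q)}
    {r δ : ℝ} {b cbar : ℝ → ℝ → ℝ} (h : IsRegular M c w f η₁ r δ b cbar) :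
    LeastSquaresData (0 : Measure (ℝ × ℝ)) (fun _ => 0) (fun _ => 0) (fun u => b u.1 u.2)
      (fun u => f u.1 u.2) η₁ r :=
  ⟨measurable_const, aestronglyMeasurable_const, h.f_meas, fun _ => h.smooth _ _,
    fun _ => h.bound _ _, integrable_zero_measure⟩

namespace IsRegular

variable {𝒳 : Type*} [MeasurableSpace 𝒳] [StandardBorelSpace 𝒳] {q : ℕ} {M : ObsModel 𝒳}
    {C : Copula} {c w : ℝ → ℝ → ℝ} {f : ℝ → ℝ → EuclideanSpace ℝ (Fin q) → ℝ}
    {η₁ η : EuclideanSpace ℝ (Fin q)}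
    {r δ ε : ℝ} {b cbar : ℝ → ℝ → ℝ} {L : Obs 𝒳 → ℝ} {Q : Measure (FullData 𝒳)}
    [IsProbabilityMeasure Q]
    {F : Type*} [NormedAddCommGroup F] [NormedSpace ℝ F]

theorem integrable_weight_sq (h : IsRegular M c w f η₁ r δ b cbar) (hc : IsCopulaDensity C c)
    (hQ : IsCausalModel C Q) (hM : Q.map observe = M.law.withDensity fun v => ENNReal.ofReal (L v))
    (hL : Measurable L) (hb : ∀ v, |L v - 1| ≤ ε) (hε : 4 * ε ≤ δ) :
    Integrable (fun ω => w (S1 ω) (S0 ω) * (b (S1 ω) (S0 ω) + |M.tiltMu L (S1 ω) (Xv ω)|) ^ 2) Q := by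
  have hb' : ∀ v, |L v - 1| ≤ 1 / 2 := fun v => (hb v).trans (by linarith [h.copula.lt_one])
  have hm : Measurable fun t : 𝒳 × ℝ × ℝ => M.tiltMu L t.2.1 t.1 :=
    (M.measurable_tiltMu hL).comp (measurable_fst.prodMk (measurable_fst.comp measurable_snd))
  have hbm : Measurable fun t : 𝒳 × ℝ × ℝ => b t.2.1 t.2.2 := h.b_meas.comp measurable_snd
  have hwm : Measurable fun t : 𝒳 × ℝ × ℝ => w t.2.1 t.2.2 := h.w_meas.comp measurable_snd
  have hG : StronglyMeasurable fun t : 𝒳 × ℝ × ℝ =>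
      w t.2.1 t.2.2 * (b t.2.1 t.2.2 + |M.tiltMu L t.2.1 t.1|) ^ 2 :=
    (hwm.mul ((hbm.add hm.abs).pow_const 2)).stronglyMeasurable
  refine (integrable_strataData_iff hc hQ hM hL hb' hG).2 ?_
  refine (h.leastSquaresData hL hb hε).integrable.congr ?_
  filter_upwards [ae_tilt_density_nonneg hc hL hb' (lintegral_eq_one_of_map_observe hM)] with t ht
  have h1 := weight_mul_tilt_density (c := c) hL hb' (lintegral_eq_one_of_map_observe hM) w t
  rw [← h1, abs_of_nonneg (mul_nonneg ht (h.w_nonneg _ _)), smul_eq_mul, mul_assoc]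

/-- The regression problem of the principal strata under a causal law close to the reference
law. -/
theorem leastSquaresData_full (h : IsRegular M c w f η₁ r δ b cbar) (hc : IsCopulaDensity C c)
    (hQ : IsCausalModel C Q) (hM : Q.map observe = M.law.withDensity fun v => ENNReal.ofReal (L v))
    (hL : Measurable L) (hb : ∀ v, |L v - 1| ≤ ε) (hε : 4 * ε ≤ δ) :
    LeastSquaresData Q (fun ω => w (S1 ω) (S0 ω)) (m1 Q) (fun ω => b (S1 ω) (S0 ω))
      (fun ω => f (S1 ω) (S0 ω)) η₁ r := by
  have hb' : ∀ v, |L v - 1| ≤ 1 / 2 := fun v => (hb v).trans (by linarith [h.copula.lt_one])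
  set M' := M.tilt hL hb' (lintegral_eq_one_of_map_observe hM) with hM'def
  have hM' : Q.map observe = M'.law := by rw [hM, M.tilt_law]
  have hU : Measurable fun ω : FullData 𝒳 => (S1 ω, S0 ω) := measurable_S1.prodMk measurable_S0
  refine ⟨h.w_meas.comp hU, (stronglyMeasurable_condExp.mono sigmaU_le).aestronglyMeasurable,
    fun η => (h.f_meas η).comp hU, fun _ => h.smooth _ _, fun _ => h.bound _ _, ?_⟩
  have h1 := h.integrable_weight_sq hc hQ hM hL hb hε
  simp only [← M.tilt_mu1 hL hb' (lintegral_eq_one_of_map_observe hM)] at h1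
  refine (integrable_sq_m1 hQ hM' h.w_meas h.b_meas h.w_nonneg h.b_nonneg h1).congr
    (ae_of_all _ fun ω => ?_)
  simp only [abs_of_nonneg (h.w_nonneg _ _)]

/-- Replacing `m1` by the outcome mean is legitimate only for expressions affine in `m1` with
coefficients depending on the stratum. The score and the second derivative are of this form, with
the stated bounds; the loss is not. -/
theorem integral_affine_m1 [FiniteDimensional ℝ F] (h : IsRegular M c w f η₁ r δ b cbar)
    (hc : IsCopulaDensity C c)
    (hQ : IsCausalModel C Q) (hM : Q.map observe = M.law.withDensity fun v => ENNReal.ofReal (L v))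
    (hL : Measurable L) (hb : ∀ v, |L v - 1| ≤ ε) (hε : 4 * ε ≤ δ) {h0 h1 : ℝ × ℝ → F}
    (hh0 : StronglyMeasurable h0) (hh1 : StronglyMeasurable h1)
    (hn0 : ∀ u, ‖h0 u‖ ≤ 2 * b u.1 u.2 ^ 2) (hn1 : ∀ u, ‖h1 u‖ ≤ b u.1 u.2) :
    ∫ ω, w (S1 ω) (S0 ω) • (h0 (S1 ω, S0 ω) + m1 Q ω • h1 (S1 ω, S0 ω)) ∂Q
      = ∫ t, M.tiltK c w L t • (h0 t.2 + M.tiltMu L t.2.1 t.1 • h1 t.2) ∂M.base := by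
  have hb' : ∀ v, |L v - 1| ≤ 1 / 2 := fun v => (hb v).trans (by linarith [h.copula.lt_one])
  have hone := lintegral_eq_one_of_map_observe hM
  set M' := M.tilt hL hb' hone with hM'def
  have hM' : Q.map observe = M'.law := by rw [hM, M.tilt_law]
  have hU : Measurable fun ω : FullData 𝒳 => (S1 ω, S0 ω) := measurable_S1.prodMk measurable_S0
  have hm : Measurable fun t : 𝒳 × ℝ × ℝ => M.tiltMu L t.2.1 t.1 :=
    (M.measurable_tiltMu hL).comp (measurable_fst.prodMk (measurable_fst.comp measurable_snd))
  have hsq := h.integrable_weight_sq hc hQ hM hL hb hε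
  have hw0 : StronglyMeasurable fun u : ℝ × ℝ => w u.1 u.2 • h0 u :=
    h.w_meas.stronglyMeasurable.smul hh0
  have hw1 : StronglyMeasurable fun u : ℝ × ℝ => w u.1 u.2 • h1 u :=
    h.w_meas.stronglyMeasurable.smul hh1
  have hi0 : Integrable (fun ω => w (S1 ω) (S0 ω) • h0 (S1 ω, S0 ω)) Q := by
    refine (hsq.const_mul 2).mono' (hw0.comp_measurable hU).aestronglyMeasurable
      (ae_of_all _ fun ω => ?_)
    rw [norm_smul, Real.norm_of_nonneg (h.w_nonneg _ _), mul_left_comm]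
    refine mul_le_mul_of_nonneg_left ((hn0 _).trans ?_) (h.w_nonneg _ _)
    have := h.b_nonneg (S1 ω) (S0 ω)
    have h2 := abs_nonneg (M.tiltMu L (S1 ω) (Xv ω))
    simp only
    gcongr
    linarith
  have hmS : Measurable fun ω : FullData 𝒳 => M.tiltMu L (S1 ω) (Xv ω) :=
    hm.comp measurable_strataData
  have hi1 : Integrable (fun ω => M.tiltMu L (S1 ω) (Xv ω) • w (S1 ω) (S0 ω) • h1 (S1 ω, S0 ω)) Q := by
    refine hsq.mono' (hmS.stronglyMeasurable.smul (hw1.comp_measurable hU)).aestronglyMeasurable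
      (ae_of_all _ fun ω => ?_)
    rw [norm_smul, norm_smul, Real.norm_of_nonneg (h.w_nonneg _ _), mul_left_comm]
    refine mul_le_mul_of_nonneg_left ?_ (h.w_nonneg _ _)
    have h2 := h.b_nonneg (S1 ω) (S0 ω)
    have h3 := abs_nonneg (M.tiltMu L (S1 ω) (Xv ω))
    have h4 := hn1 (S1 ω, S0 ω)
    rw [Real.norm_eq_abs, sq]
    gcongr
    · linarith
    · exact h4.trans (by simp only; linarith)
  have hi1' := hi1
  simp only [← M.tilt_mu1 hL hb' hone] at hi1'
  obtain ⟨hi2, heq⟩ := integral_m1_smul hQ hM' hw1 hi1'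
  have hG : StronglyMeasurable fun t : 𝒳 × ℝ × ℝ =>
      w t.2.1 t.2.2 • (h0 t.2 + M.tiltMu L t.2.1 t.1 • h1 t.2) :=
    (h.w_meas.comp measurable_snd).stronglyMeasurable.smul ((hh0.comp_measurable measurable_snd).add
      (hm.stronglyMeasurable.smul (hh1.comp_measurable measurable_snd)))
  calc ∫ ω, w (S1 ω) (S0 ω) • (h0 (S1 ω, S0 ω) + m1 Q ω • h1 (S1 ω, S0 ω)) ∂Q
      = ∫ ω, w (S1 ω) (S0 ω) • h0 (S1 ω, S0 ω) ∂Q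
        + ∫ ω, m1 Q ω • w (S1 ω) (S0 ω) • h1 (S1 ω, S0 ω) ∂Q := by
        rw [← integral_add hi0 hi2]
        refine integral_congr_ae (ae_of_all _ fun ω => ?_)
        simp only [smul_add, smul_comm (w _ _)]
    _ = ∫ ω, w (S1 ω) (S0 ω) • (h0 (S1 ω, S0 ω)
          + M.tiltMu L (S1 ω) (Xv ω) • h1 (S1 ω, S0 ω)) ∂Q := by
        rw [heq]
        simp only [M.tilt_mu1 hL hb' hone, hM'def]
        rw [← integral_add hi0 hi1]
        refine integral_congr_ae (ae_of_all _ fun ω => ?_)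
        simp only [smul_add, smul_comm (w _ _)]
    _ = _ := by
        refine (integral_strataData hc hQ hM hL hb' hG).trans (integral_congr_ae (ae_of_all _ fun t => ?_))
        simp only
        rw [smul_smul, weight_mul_tilt_density]

/-- The expected score of the principal strata regression in terms of the observed-data law. -/
theorem integral_score_full (h : IsRegular M c w f η₁ r δ b cbar) (hc : IsCopulaDensity C c)
    (hQ : IsCausalModel C Q) (hM : Q.map observe = M.law.withDensity fun v => ENNReal.ofReal (L v))
    (hL : Measurable L) (hb : ∀ v, |L v - 1| ≤ ε) (hε : 4 * ε ≤ δ) (hη : η ∈ Metric.ball η₁ r) :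
    ∫ ω, (w (S1 ω) (S0 ω) * (m1 Q ω - f (S1 ω) (S0 ω) η)) • gradient (f (S1 ω) (S0 ω)) η ∂Q
      = ∫ t, (M.tiltK c w L t * (M.tiltMu L t.2.1 t.1 - f t.2.1 t.2.2 η))
        • gradient (f t.2.1 t.2.2) η ∂M.base := by
  have hg := h.leastSquaresData_model.stronglyMeasurable_gradient hη
  have key := h.integral_affine_m1 hc hQ hM hL hb hε
    (h0 := fun u => (-f u.1 u.2 η) • gradient (f u.1 u.2) η) (h1 := fun u => gradient (f u.1 u.2) η)
    ((h.f_meas η).neg.stronglyMeasurable.smul hg) hg (fun u => ?_)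
    (fun u => norm_gradient_le (h.bound _ _ η hη))
  · refine Eq.trans (integral_congr_ae (ae_of_all _ fun ω => ?_)) (key.trans
      (integral_congr_ae (ae_of_all _ fun t => ?_))) <;> simp only <;> module
  · have h1 := norm_gradient_le (h.bound u.1 u.2 η hη)
    have h2 := abs_le_of_iteratedFDeriv (h.bound u.1 u.2 η hη)
    have h3 := h.b_nonneg u.1 u.2
    rw [norm_smul, norm_neg, Real.norm_eq_abs]
    calc |f u.1 u.2 η| * ‖gradient (f u.1 u.2) η‖ ≤ b u.1 u.2 * b u.1 u.2 := by gcongr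
      _ ≤ 2 * b u.1 u.2 ^ 2 := by nlinarith

/-- The expected second derivative in terms of the observed-data law. -/
theorem integral_hess_full (h : IsRegular M c w f η₁ r δ b cbar) (hc : IsCopulaDensity C c)
    (hQ : IsCausalModel C Q) (hM : Q.map observe = M.law.withDensity fun v => ENNReal.ofReal (L v))
    (hL : Measurable L) (hb : ∀ v, |L v - 1| ≤ ε) (hε : 4 * ε ≤ δ) (hη : η ∈ Metric.ball η₁ r) :
    ∫ ω, w (S1 ω) (S0 ω) • residualHess (m1 Q ω) (f (S1 ω) (S0 ω)) η ∂Q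
      = ∫ t, M.tiltK c w L t • residualHess (M.tiltMu L t.2.1 t.1) (f t.2.1 t.2.2) η ∂M.base := by
  have hg := h.leastSquaresData_model.stronglyMeasurable_fderiv_gradient hη
  have hg0 : StronglyMeasurable fun u : ℝ × ℝ => residualHess 0 (f u.1 u.2) η := by
    have h1 := h.leastSquaresData_model
    have hgr := h1.stronglyMeasurable_gradient hη
    refine StronglyMeasurable.sub ?_ ((((h.f_meas η).const_sub 0).stronglyMeasurable).smul hg)
    exact stronglyMeasurable_clm (A := fun u : ℝ × ℝ =>
      (innerSL ℝ (gradient (f u.1 u.2) η)).smulRight (gradient (f u.1 u.2) η)) fun v =>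
        (hgr.inner (𝕜 := ℝ) (stronglyMeasurable_const (b := v))).smul hgr
  -- The second derivative of the loss is affine in the outcome value, with `y = 0` as constant
  -- term.
  have hres : ∀ (y : ℝ) (g : EuclideanSpace ℝ (Fin q) → ℝ),
      residualHess y g η = residualHess 0 g η + y • (-fderiv ℝ (gradient g) η) := by
    intro y g
    simp only [residualHess]
    module
  have key := h.integral_affine_m1 hc hQ hM hL hb hε
    (h0 := fun u => residualHess 0 (f u.1 u.2) η) (h1 := fun u => -fderiv ℝ (gradient (f u.1 u.2)) η)
    hg0 hg.neg (fun u => ?_) (fun u => ?_)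
  · simp only [hres (m1 Q _), hres (M.tiltMu L _ _)]
    exact key
  · have := norm_residualHess_le (y := 0) (h.smooth u.1 u.2) Metric.isOpen_ball hη (h.bound u.1 u.2 η hη)
    simpa using this
  · rw [norm_neg]
    exact norm_fderiv_gradient_le (h.smooth u.1 u.2) Metric.isOpen_ball hη (h.bound u.1 u.2 η hη)

end IsRegular

/-! ### Fubini identities pairing bounded functions with influence functions -/

namespace ObsModel

variable {𝒳 : Type*} [MeasurableSpace 𝒳] (M : ObsModel 𝒳) {h : Obs 𝒳 → ℝ} {B : ℝ}
  {E : Type*} [NormedAddCommGroup E] [NormedSpace ℝ E]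

section kernel

variable {z : Bool} {x : 𝒳}

/-- The indicator of `S ≤ a`, centered. -/
def centered (z : Bool) (x : 𝒳) (a S : ℝ) : ℝ := (if S ≤ a then 1 else 0) - M.F z a x

theorem integrable_p_mul_bounded {g : ℝ → ℝ} (hg : Measurable g) (hB : ∀ s, |g s| ≤ B) :
    Integrable fun s => M.p z s x * g s :=
  integrable_mul_of_close (M.integrable_p z x) hg.aestronglyMeasurable (a := 0) (ε := B)
    fun s => by rw [sub_zero]; exact hB s

theorem measurable_centered (a : ℝ) : Measurable (M.centered z x a) :=
  (Measurable.ite measurableSet_Iic measurable_const measurable_const).sub_const _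

theorem abs_centered_le (a S : ℝ) : |M.centered z x a S| ≤ 1 := by
  have h0 := M.F_nonneg z a x
  have h1 := M.F_le_one z a x
  unfold centered
  split_ifs <;> rw [abs_le] <;> constructor <;> linarith

theorem integral_mul_centered {g : ℝ → ℝ} (hg : Integrable g) (a : ℝ) :
    ∫ S, g S * M.centered z x a S = (∫ S in Iic a, g S) - M.F z a x * ∫ S, g S := by
  have h1 : ∀ S, g S * M.centered z x a S = (Iic a).indicator g S - M.F z a x * g S := by
    intro S
    by_cases hS : S ≤ a
    · simp [centered, hS, mul_sub, mul_comm]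
    · simp [centered, hS, mul_comm]
  simp only [h1]
  rw [integral_sub (hg.indicator measurableSet_Iic) (hg.const_mul _),
    integral_indicator measurableSet_Iic, integral_const_mul]

/-- Mean absolute deviation of a Bernoulli variable. It produces the weight `F (1 - F)`, the only
one under which the kernels with a copula derivative are integrable by assumption. -/
theorem integral_p_mul_abs_centered (a : ℝ) :
    ∫ S, M.p z S x * |M.centered z x a S| = 2 * (M.F z a x * (1 - M.F z a x)) := by
  have hp := M.integrable_p z x
  have h0 := M.F_nonneg z a x
  have h1 := M.F_le_one z a x
  have h2 : ∀ S, M.p z S x * |M.centered z x a S|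
      = (1 - 2 * M.F z a x) * (Iic a).indicator (fun S => M.p z S x) S
        + M.F z a x * M.p z S x := by
    intro S
    by_cases hS : S ≤ a
    · simp only [centered, if_pos hS]
      rw [abs_of_nonneg (by linarith)]
      simp [hS]
      ring
    · simp [centered, hS, abs_of_nonneg h0, mul_comm]
  simp only [h2]
  rw [integral_add ((hp.indicator measurableSet_Iic).const_mul _) (hp.const_mul _),
    integral_const_mul, integral_const_mul, integral_indicator measurableSet_Iic, M.integral_p]
  rw [← F]
  ring

end kernel

theorem measurePreserving_rearrange :
    MeasurePreserving (fun u : (𝒳 × ℝ) × (ℝ × ℝ) => ((u.1.1, u.2), u.1.2))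
      ((M.PX.prod volume).prod (volume.prod volume)) (M.base.prod volume) := by
  have h1 := measurePreserving_prodAssoc M.PX (volume : Measure ℝ)
    ((volume : Measure ℝ).prod (volume : Measure ℝ))
  have h2 := (MeasurePreserving.id M.PX).prod (Measure.measurePreserving_swap
    (μ := (volume : Measure ℝ)) (ν := (volume : Measure ℝ).prod (volume : Measure ℝ)))
  have h3 := (measurePreserving_prodAssoc M.PX ((volume : Measure ℝ).prod (volume : Measure ℝ))
    (volume : Measure ℝ)).symm
  exact h3.comp (h2.comp h1)

theorem measurable_F_comp (z : Bool) {j : ℝ × ℝ → ℝ} (hj : Measurable j) :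
    Measurable fun t : 𝒳 × ℝ × ℝ => M.F z (j t.2) t.1 :=
  (M.measurable_F z).comp (measurable_fst.prodMk (hj.comp measurable_snd))

/-- The mean of a bounded function times an influence function of the conditional distribution
function, in terms of the derivative of the conditional distribution function. -/
theorem integral_residual [CompleteSpace E] (hh : Measurable h) (hB : ∀ v, |h v| ≤ B) (z : Bool)
    {j : ℝ × ℝ → ℝ} (hj : Measurable j) {ν ν' : 𝒳 × ℝ × ℝ → E} (hν : Integrable ν M.base)
    (hm : AEStronglyMeasurable ν' M.base)
    (hν' : Integrable (fun t => (M.F z (j t.2) t.1 * (1 - M.F z (j t.2) t.1)) • ν' t) M.base) :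
    Integrable (fun u : (𝒳 × ℝ) × (ℝ × ℝ) => (M.p z u.1.2 u.1.1 * M.avgS h (u.1.2, z, u.1.1)) •
        (ν (u.1.1, u.2) - M.centered z u.1.1 (j u.2) u.1.2 • ν' (u.1.1, u.2)))
      ((M.PX.prod volume).prod (volume.prod volume)) ∧
    Integrable (fun t => M.avgZ h z t.1 • ν t
      - ((∫ S in Iic (j t.2), M.p z S t.1 * M.avgS h (S, z, t.1))
        - M.F z (j t.2) t.1 * M.avgZ h z t.1) • ν' t) M.base ∧
    ∫ u, (M.p z u.1.2 u.1.1 * M.avgS h (u.1.2, z, u.1.1)) •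
        (ν (u.1.1, u.2) - M.centered z u.1.1 (j u.2) u.1.2 • ν' (u.1.1, u.2))
      ∂((M.PX.prod volume).prod (volume.prod volume))
      = ∫ t, (M.avgZ h z t.1 • ν t
      - ((∫ S in Iic (j t.2), M.p z S t.1 * M.avgS h (S, z, t.1))
        - M.F z (j t.2) t.1 * M.avgZ h z t.1) • ν' t) ∂M.base := by
  set N : (𝒳 × ℝ × ℝ) × ℝ → E := fun u => (M.p z u.2 u.1.1 * M.avgS h (u.2, z, u.1.1)) •
    (ν u.1 - M.centered z u.1.1 (j u.1.2) u.2 • ν' u.1) with hN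
  have hs3 : ∀ t, |M.avgS h t| ≤ B := fun t => by
    simpa using M.abs_avgS_sub_le hh (a := 0) (ε := B) (by simpa using hB) t
  have hph : ∀ x, Integrable fun S => M.p z S x * M.avgS h (S, z, x) := fun x =>
    M.integrable_p_mul_bounded (M.measurable_avgS_left hh z x) fun _ => hs3 _
  have hphk : ∀ x a, Integrable fun S =>
      (M.p z S x * M.avgS h (S, z, x)) * M.centered z x a S := fun x a => by
    have h1 := M.integrable_p_mul_bounded (z := z) (x := x) (B := B)
      ((M.measurable_avgS_left hh z x).mul (M.measurable_centered (z := z) (x := x) a)) fun S => by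
        rw [Pi.mul_apply, abs_mul]
        calc |M.avgS h (S, z, x)| * |M.centered z x a S| ≤ B * 1 :=
              mul_le_mul (hs3 _) (M.abs_centered_le _ _) (abs_nonneg _)
                ((abs_nonneg _).trans (hs3 (S, z, x)))
          _ = B := mul_one B
    simpa [mul_assoc] using h1
  have hcm : Measurable fun u : (𝒳 × ℝ × ℝ) × ℝ => M.centered z u.1.1 (j u.1.2) u.2 := by
    refine Measurable.sub (Measurable.ite (measurableSet_le measurable_snd ?_) measurable_const
      measurable_const) ((M.measurable_F_comp z hj).comp measurable_fst)
    exact hj.comp (measurable_snd.comp measurable_fst)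
  have hNm : AEStronglyMeasurable N (M.base.prod volume) := by
    refine AEStronglyMeasurable.smul ?_ (hν.aestronglyMeasurable.comp_fst.sub
      (hcm.aestronglyMeasurable.smul hm.comp_fst))
    exact ((M.measurable_p_mul_avgS hh z).comp (g := fun u : 𝒳 × ℝ => _)
      (f := fun u : (𝒳 × ℝ × ℝ) × ℝ => (u.1.1, u.2)) (by fun_prop)).aestronglyMeasurable
  have hNexp : ∀ t S, N (t, S) = (M.p z S t.1 * M.avgS h (S, z, t.1)) • ν t
      - ((M.p z S t.1 * M.avgS h (S, z, t.1)) * M.centered z t.1 (j t.2) S) • ν' t := by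
    intro t S
    simp only [hN]
    module
  have hNi : ∀ t, Integrable fun S => N (t, S) := fun t => by
    simp only [hNexp]
    exact ((hph t.1).smul_const _).sub ((hphk t.1 _).smul_const _)
  have hNint : ∀ t, ∫ S, N (t, S) = M.avgZ h z t.1 • ν t
      - ((∫ S in Iic (j t.2), M.p z S t.1 * M.avgS h (S, z, t.1))
        - M.F z (j t.2) t.1 * M.avgZ h z t.1) • ν' t := by
    intro t
    simp only [hNexp]
    rw [integral_sub ((hph t.1).smul_const _) ((hphk t.1 _).smul_const _), integral_smul_const,
      integral_smul_const, M.integral_mul_centered (hph t.1)]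
    rfl
  -- The kernel `ν'` alone need not be integrable. Integrating over `S` first replaces the centered
  -- indicator by `2 F (1 - F)`, and the weighted kernel is integrable.
  have hNprod : Integrable N (M.base.prod volume) := by
    refine (integrable_prod_iff hNm).2 ⟨ae_of_all _ hNi, ?_⟩
    refine ((hν.norm.const_mul B).add (hν'.norm.const_mul (2 * B))).mono'
      hNm.norm.integral_prod_right' (ae_of_all _ fun t => ?_)
    have hB0 : 0 ≤ B := (abs_nonneg _).trans (hB (0, 0, true, t.1))
    have hF : 0 ≤ M.F z (j t.2) t.1 * (1 - M.F z (j t.2) t.1) :=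
      mul_nonneg (M.F_nonneg _ _ _) (by linarith [M.F_le_one z (j t.2) t.1])
    have hpk : Integrable fun S => M.p z S t.1 * |M.centered z t.1 (j t.2) S| :=
      M.integrable_p_mul_bounded (B := 1) (M.measurable_centered _).abs fun S => by
        rw [abs_abs]; exact M.abs_centered_le _ _
    rw [Real.norm_of_nonneg (integral_nonneg fun _ => norm_nonneg _)]
    calc ∫ S, ‖N (t, S)‖ ≤ ∫ S, (B * ‖ν t‖) * M.p z S t.1
          + (B * ‖ν' t‖) * (M.p z S t.1 * |M.centered z t.1 (j t.2) S|) := by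
          refine integral_mono (hNi t).norm (((M.integrable_p z t.1).const_mul _).add
            (hpk.const_mul _)) fun S => ?_
          simp only [hN, norm_smul, norm_mul, Real.norm_eq_abs, abs_of_nonneg (M.p_nonneg _ _ _)]
          have hp := M.p_nonneg z S t.1
          calc M.p z S t.1 * |M.avgS h (S, z, t.1)| * ‖ν t - M.centered z t.1 (j t.2) S • ν' t‖
              ≤ M.p z S t.1 * B * (‖ν t‖ + |M.centered z t.1 (j t.2) S| * ‖ν' t‖) := by
                gcongr
                · exact hs3 _
                · refine (norm_sub_le _ _).trans ?_
                  rw [norm_smul, Real.norm_eq_abs]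
            _ = _ := by ring
      _ = B * ‖ν t‖ + 2 * B * ‖(M.F z (j t.2) t.1 * (1 - M.F z (j t.2) t.1)) • ν' t‖ := by
          rw [integral_add ((M.integrable_p z t.1).const_mul _) (hpk.const_mul _),
            integral_const_mul, integral_const_mul, M.integral_p, M.integral_p_mul_abs_centered,
            norm_smul, Real.norm_of_nonneg hF]
          ring
      _ = _ := by simp
  have hmp := M.measurePreserving_rearrange
  refine ⟨hmp.integrable_comp_of_integrable hNprod, ?_, ?_⟩
  · exact hNprod.integral_prod_left.congr (ae_of_all _ hNint)
  · have h1 := integral_map (μ := (M.PX.prod volume).prod (volume.prod volume))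
      hmp.measurable.aemeasurable (f := N) (by rw [hmp.map_eq]; exact hNm)
    rw [hmp.map_eq, integral_prod _ hNprod] at h1
    simp only [hNint] at h1
    exact h1.symm

/-- Integrals over `(X, S₁, S₀)` with the last coordinate integrated out first. -/
theorem integral_partial {ν : 𝒳 × ℝ × ℝ → E} (hν : Integrable ν M.base) :
    Integrable (fun t : 𝒳 × ℝ => ∫ s, ν (t.1, t.2, s)) (M.PX.prod volume) ∧
    ∫ t : 𝒳 × ℝ, (∫ s, ν (t.1, t.2, s)) ∂(M.PX.prod volume) = ∫ t, ν t ∂M.base := by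
  have hmp := measurePreserving_prodAssoc M.PX (volume : Measure ℝ) (volume : Measure ℝ)
  have h1 : Integrable (fun u : (𝒳 × ℝ) × ℝ => ν (u.1.1, u.1.2, u.2))
    ((M.PX.prod volume).prod volume) := hmp.integrable_comp_of_integrable hν
  refine ⟨h1.integral_prod_left, ?_⟩
  have h4 := integral_map (μ := (M.PX.prod volume).prod volume) hmp.measurable.aemeasurable
    (f := ν) (by rw [hmp.map_eq]; exact hν.aestronglyMeasurable)
  rw [hmp.map_eq] at h4
  rw [h4]
  exact (integral_prod _ h1).symm

theorem measurePreserving_swap_base :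
    MeasurePreserving (fun t : 𝒳 × ℝ × ℝ => (t.1, t.2.2, t.2.1)) M.base M.base :=
  (MeasurePreserving.id M.PX).prod Measure.measurePreserving_swap

theorem integral_swap_base {ν : 𝒳 × ℝ × ℝ → E} (hν : Integrable ν M.base) :
    ∫ t, ν (t.1, t.2.2, t.2.1) ∂M.base = ∫ t, ν t ∂M.base := by
  have hmp := M.measurePreserving_swap_base
  have h := integral_map (μ := M.base) hmp.measurable.aemeasurable
    (f := ν) (by rw [hmp.map_eq]; exact hν.aestronglyMeasurable)
  rw [hmp.map_eq] at h
  exact h.symm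

theorem measurePreserving_fst_jointXS (z : Bool) :
    MeasurePreserving Prod.fst (M.jointXS z) M.PX := by
  refine ⟨measurable_fst, ?_⟩
  ext A hA
  have hm : Measurable fun t : 𝒳 × ℝ => A.indicator (1 : 𝒳 → ℝ≥0∞) t.1 :=
    (measurable_one.indicator hA).comp measurable_fst
  rw [← lintegral_indicator_one hA, ← lintegral_indicator_one hA,
    lintegral_map (measurable_one.indicator hA) measurable_fst, M.lintegral_jointXS z hm]
  refine lintegral_congr fun x => ?_
  simp only
  rw [lintegral_mul_const _ (M.measurable_p_left z x).ennreal_ofReal, M.p_lintegral, one_mul]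

theorem measurePreserving_fst_full (z : Bool) :
    MeasurePreserving Prod.fst (M.full z) (M.jointXS z) :=
  ⟨measurable_fst, Measure.fst_compProd _ _⟩

theorem integrable_jointXS_iff (z : Bool) {φ : 𝒳 × ℝ → E} :
    Integrable φ (M.jointXS z) ↔ Integrable (fun t => M.p z t.2 t.1 • φ t) (M.PX.prod volume) := by
  rw [jointXS, integrable_withDensity_iff_integrable_smul' (M.measurable_p_swap z).ennreal_ofReal
    (ae_of_all _ fun _ => ENNReal.ofReal_lt_top)]
  simp only [ENNReal.toReal_ofReal (M.p_nonneg _ _ _)]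

theorem integral_jointXS (z : Bool) (φ : 𝒳 × ℝ → E) :
    ∫ t, φ t ∂(M.jointXS z) = ∫ t, M.p z t.2 t.1 • φ t ∂(M.PX.prod volume) := by
  rw [jointXS, integral_withDensity_eq_integral_toReal_smul (M.measurable_p_swap z).ennreal_ofReal
    (ae_of_all _ fun _ => ENNReal.ofReal_lt_top)]
  simp only [ENNReal.toReal_ofReal (M.p_nonneg _ _ _)]

/-- Integrals with respect to the observed-data law, by treatment arm. -/
theorem integral_law_eq {k : Obs 𝒳 → E} (hk : Integrable k M.law) :
    ∫ v, k v ∂M.law = ∫ u, M.propZ true u.1.1 • k (obsOf true u) ∂(M.full true)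
      + ∫ u, M.propZ false u.1.1 • k (obsOf false u) ∂(M.full false) := by
  have hm : ∀ z, Measurable fun u : (𝒳 × ℝ) × ℝ => ENNReal.ofReal (M.propZ z u.1.1) := fun z =>
    ((M.measurable_propZ z).comp (by fun_prop)).ennreal_ofReal
  have harm : ∀ z, Integrable k
      (((M.full z).withDensity fun u => ENNReal.ofReal (M.propZ z u.1.1)).map (obsOf z)) →
      ∫ v, k v ∂(((M.full z).withDensity fun u => ENNReal.ofReal (M.propZ z u.1.1)).map (obsOf z))
        = ∫ u, M.propZ z u.1.1 • k (obsOf z u) ∂(M.full z) := by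
    intro z hz
    rw [integral_map (measurable_obsOf z).aemeasurable hz.aestronglyMeasurable,
      integral_withDensity_eq_integral_toReal_smul (hm z)
        (ae_of_all _ fun _ => ENNReal.ofReal_lt_top)]
    simp only [ENNReal.toReal_ofReal (M.propZ_pos _ _).le]
  rw [M.law_eq_sum, Fintype.sum_bool] at hk ⊢
  have hk1 := hk.left_of_add_measure
  have hk0 := hk.right_of_add_measure
  rw [integral_add_measure hk1 hk0, harm true hk1, harm false hk0]

/-- Averaging over the outcome. -/
theorem integral_full_of_integrable [CompleteSpace E] (hh : Measurable h) (hB : ∀ v, |h v| ≤ B)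
    (z : Bool) {Ψ : 𝒳 × ℝ → E} (hΨ : Integrable Ψ (M.jointXS z)) :
    Integrable (fun u => h (obsOf z u) • Ψ u.1) (M.full z) ∧
    ∫ u, h (obsOf z u) • Ψ u.1 ∂(M.full z)
      = ∫ t, M.avgS h (t.2, z, t.1) • Ψ t ∂(M.jointXS z) := by
  have h1 : Integrable (fun u : (𝒳 × ℝ) × ℝ => Ψ u.1) (M.full z) :=
    (M.measurePreserving_fst_full z).integrable_comp_of_integrable hΨ
  have h2 : Integrable (fun u => h (obsOf z u) • Ψ u.1) (M.full z) :=
    h1.bdd_smul B (hh.comp (measurable_obsOf z)).aestronglyMeasurable (ae_of_all _ fun _ => hB _)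
  refine ⟨h2, ?_⟩
  rw [full, Measure.integral_compProd h2]
  simp only [integral_smul_const]
  rfl

theorem abs_avgS_le (hh : Measurable h) (hB : ∀ v, |h v| ≤ B) (t : ℝ × Bool × 𝒳) :
    |M.avgS h t| ≤ B := by
  simpa using M.abs_avgS_sub_le hh (a := 0) (ε := B) (by simpa using hB) t

theorem abs_avgZ_le (hh : Measurable h) (hB : ∀ v, |h v| ≤ B) (z : Bool) (x : 𝒳) :
    |M.avgZ h z x| ≤ B := by
  simpa using M.abs_avgZ_sub_le hh (a := 0) (ε := B) (by simpa using hB) z x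

/-- Functions of the covariates in treatment arm `z`. -/
theorem integral_full_covariate [CompleteSpace E] (hh : Measurable h) (hB : ∀ v, |h v| ≤ B)
    (z : Bool) {ψ : 𝒳 → E} (hψ : Integrable ψ M.PX) :
    Integrable (fun u => h (obsOf z u) • M.propZ z u.1.1 • ψ u.1.1) (M.full z) ∧
    Integrable (fun x => (M.propZ z x * M.avgZ h z x) • ψ x) M.PX ∧
    ∫ u, h (obsOf z u) • M.propZ z u.1.1 • ψ u.1.1 ∂(M.full z)
      = ∫ x, (M.propZ z x * M.avgZ h z x) • ψ x ∂M.PX := by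
  have h1 : Integrable (fun x => M.propZ z x • ψ x) M.PX :=
    hψ.bdd_smul 1 (M.measurable_propZ z).aestronglyMeasurable (ae_of_all _ fun x => by
      rw [Real.norm_of_nonneg (M.propZ_pos z x).le]; exact M.propZ_le_one z x)
  have h2 : Integrable (fun t : 𝒳 × ℝ => M.propZ z t.1 • ψ t.1) (M.jointXS z) :=
    MeasurePreserving.integrable_comp_of_integrable (f := (Prod.fst : 𝒳 × ℝ → 𝒳))
      (g := fun x => M.propZ z x • ψ x) (M.measurePreserving_fst_jointXS z) h1
  obtain ⟨h3, h4⟩ := M.integral_full_of_integrable hh hB z h2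
  have h6 : Integrable (fun x => M.avgZ h z x • M.propZ z x • ψ x) M.PX :=
    h1.bdd_smul B (M.measurable_avgZ hh z).aestronglyMeasurable
      (ae_of_all _ fun _ => M.abs_avgZ_le hh hB z _)
  have h7 : ∀ x, M.avgZ h z x • M.propZ z x • ψ x = (M.propZ z x * M.avgZ h z x) • ψ x := fun x => by
    rw [smul_smul, mul_comm]
  refine ⟨h3, h6.congr (ae_of_all _ h7), ?_⟩
  rw [h4, M.integral_jointXS]
  have hSm : Measurable fun t : 𝒳 × ℝ => M.avgS h (t.2, z, t.1) :=
    (M.measurable_avgS hh).comp (measurable_snd.prodMk (measurable_const.prodMk measurable_fst))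
  have h5 : Integrable (fun t : 𝒳 × ℝ => M.avgS h (t.2, z, t.1) • M.propZ z t.1 • ψ t.1)
      (M.jointXS z) :=
    h2.bdd_smul B hSm.aestronglyMeasurable (ae_of_all _ fun t => M.abs_avgS_le hh hB (t.2, z, t.1))
  rw [M.integrable_jointXS_iff] at h5
  rw [integral_prod _ h5]
  refine integral_congr_ae (ae_of_all _ fun x => ?_)
  simp only [smul_smul (M.p _ _ _), integral_smul_const]
  exact h7 x

/-- The first part of the influence function of a conditional density. -/
theorem integral_full_density [CompleteSpace E] (hh : Measurable h) (hB : ∀ v, |h v| ≤ B)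
    (z : Bool) {ν : 𝒳 × ℝ × ℝ → E} (hν : Integrable ν M.base)
    (h0 : ∀ x S s, M.p z S x = 0 → ν (x, S, s) = 0) :
    Integrable (fun t : 𝒳 × ℝ => (M.p z t.2 t.1)⁻¹ • ∫ s, ν (t.1, t.2, s)) (M.jointXS z) ∧
    Integrable (fun t => M.avgS h (t.2.1, z, t.1) • ν t) M.base ∧
    ∫ t, M.avgS h (t.2, z, t.1) • (M.p z t.2 t.1)⁻¹ • (∫ s, ν (t.1, t.2, s)) ∂(M.jointXS z)
      = ∫ t, M.avgS h (t.2.1, z, t.1) • ν t ∂M.base := by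
  -- Dividing by the density is harmless where it vanishes, because the kernel vanishes there too.
  have hp : ∀ t : 𝒳 × ℝ, M.p z t.2 t.1 • (M.p z t.2 t.1)⁻¹ • (∫ s, ν (t.1, t.2, s))
      = ∫ s, ν (t.1, t.2, s) := by
    intro t
    by_cases h : M.p z t.2 t.1 = 0
    · simp [h, h0 _ _ _ h]
    · rw [smul_smul, mul_inv_cancel₀ h, one_smul]
  have h2 : Integrable (fun t : 𝒳 × ℝ × ℝ => M.avgS h (t.2.1, z, t.1) • ν t) M.base :=
    hν.bdd_smul B ((M.measurable_avgS hh).comp (by fun_prop)).aestronglyMeasurable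
      (ae_of_all _ fun _ => M.abs_avgS_le hh hB _)
  refine ⟨?_, h2, ?_⟩
  · rw [M.integrable_jointXS_iff]
    exact (M.integral_partial hν).1.congr (ae_of_all _ fun t => (hp t).symm)
  · rw [M.integral_jointXS, ← (M.integral_partial h2).2]
    refine integral_congr_ae (ae_of_all _ fun t => ?_)
    simp only
    rw [smul_comm, hp, integral_smul]

/-- The second part of the influence function of a conditional density, acting through its
distribution function. -/
theorem integral_full_residual [CompleteSpace E] (hh : Measurable h) (hB : ∀ v, |h v| ≤ B)
    (z : Bool) {j : ℝ × ℝ → ℝ} (hj : Measurable j) {ν ν' : 𝒳 × ℝ × ℝ → E}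
    (hν : Integrable ν M.base) (hm : AEStronglyMeasurable ν' M.base)
    (hν' : Integrable (fun t => (M.F z (j t.2) t.1 * (1 - M.F z (j t.2) t.1)) • ν' t) M.base)
    {R : 𝒳 × ℝ → E} (hR : ∀ x S, Integrable
      (fun s : ℝ × ℝ => ν (x, s) - M.centered z x (j s) S • ν' (x, s)) (volume.prod volume) →
      R (x, S) = ∫ s, (ν (x, s) - M.centered z x (j s) S • ν' (x, s)) ∂(volume.prod volume)) :
    Integrable R (M.jointXS z) ∧
    ∫ t, M.avgS h (t.2, z, t.1) • R t ∂(M.jointXS z)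
      = ∫ t, (M.avgZ h z t.1 • ν t
      - ((∫ S in Iic (j t.2), M.p z S t.1 * M.avgS h (S, z, t.1))
        - M.F z (j t.2) t.1 * M.avgZ h z t.1) • ν' t) ∂M.base := by
  -- With the constant function `1` this gives, for almost every point with `p ≠ 0`, integrability
  -- over the plane of strata, which is the case in which `R` is known to be the planar integral.
  have h1 := (M.integral_residual (h := fun _ => 1) (B := 1) measurable_const (by simp) z hj hν hm
    hν').1
  have havg : ∀ t, M.avgS (fun _ => (1 : ℝ)) t = 1 := fun t => by simp [avgS]
  simp only [havg, mul_one] at h1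
  have hae : ∀ᵐ t ∂(M.PX.prod volume), M.p z t.2 t.1 • R t = ∫ s, M.p z t.2 t.1 •
      (ν (t.1, s) - M.centered z t.1 (j s) t.2 • ν' (t.1, s)) ∂(volume.prod volume) := by
    filter_upwards [h1.prod_right_ae] with t ht
    rw [integral_smul]
    by_cases hp : M.p z t.2 t.1 = 0
    · rw [hp, zero_smul, zero_smul]
    · rw [hR t.1 t.2]
      refine (ht.smul (M.p z t.2 t.1)⁻¹).congr (ae_of_all _ fun s => ?_)
      simp only [Pi.smul_apply]
      rw [smul_smul, inv_mul_cancel₀ hp, one_smul]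
  obtain ⟨h2, -, h3⟩ := M.integral_residual hh hB z hj hν hm hν'
  refine ⟨?_, ?_⟩
  · rw [M.integrable_jointXS_iff]
    exact h1.integral_prod_left.congr (hae.mono fun t ht => ht.symm)
  · rw [M.integral_jointXS, ← h3, integral_prod _ h2]
    refine integral_congr_ae (hae.mono fun t ht => ?_)
    simp only
    rw [smul_comm, ht, ← integral_smul]
    simp only [smul_smul, mul_comm]

end ObsModel

/-- The constant submodel lets statements about perturbations be applied to the reference law
itself. -/
theorem isPerturbation_one {α : Type*} [MeasurableSpace α] :
    IsPerturbation (fun (_ : ℝ) (_ : α) => (1 : ℝ)) (fun _ => 0) 1 0 :=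
  ⟨one_pos, fun _ _ => measurable_const, fun _ _ _ => by simp, fun _ => hasDerivAt_const _ _⟩

/-! ### The kernels of the influence function -/

namespace CopulaBound

variable {c cbar : ℝ → ℝ → ℝ} {δ u v : ℝ}

/-- An interior zero of a nonnegative function is a minimum. Hence the ratio of derivative to
density, with division by zero equal to zero, times the density always returns the derivative, and
no positivity of the copula density is required. -/
theorem deriv_left_eq_zero (h : CopulaBound c cbar δ) (hu : u ∈ Ioo (0 : ℝ) 1)
    (hv : v ∈ Ioo (0 : ℝ) 1) (h0 : c u v = 0) : deriv (fun t => c t v) u = 0 := by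
  refine IsLocalMin.deriv_eq_zero ?_
  filter_upwards [isOpen_Ioo.mem_nhds hu] with u' hu'
  simp only [h0]
  exact h.nonneg u' hu' v hv

theorem deriv_right_eq_zero (h : CopulaBound c cbar δ) (hu : u ∈ Ioo (0 : ℝ) 1)
    (hv : v ∈ Ioo (0 : ℝ) 1) (h0 : c u v = 0) : deriv (fun t => c u t) v = 0 := by
  refine IsLocalMin.deriv_eq_zero ?_
  filter_upwards [isOpen_Ioo.mem_nhds hv] with v' hv'
  simp only [h0]
  exact h.nonneg u hu v' hv'

theorem center_bound (h : CopulaBound c cbar δ) (hu : u ∈ Ioo (0 : ℝ) 1)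
    (hv : v ∈ Ioo (0 : ℝ) 1) : c u v ≤ cbar u v ∧
      u * (1 - u) * |deriv (fun t => c t v) u| ≤ cbar u v ∧
      v * (1 - v) * |deriv (fun t => c u t) v| ≤ cbar u v := by
  refine h.bound u hu v hv u v ?_ ?_ <;> rw [sub_self, abs_zero]
  · exact mul_nonneg h.pos.le (mul_nonneg hu.1.le (by linarith [hu.2]))
  · exact mul_nonneg h.pos.le (mul_nonneg hv.1.le (by linarith [hv.2]))

end CopulaBound

namespace IsRegular

variable {𝒳 : Type*} [MeasurableSpace 𝒳] {q : ℕ} {M : ObsModel 𝒳}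
    {c w : ℝ → ℝ → ℝ} {f : ℝ → ℝ → EuclideanSpace ℝ (Fin q) → ℝ}
    {η₁ : EuclideanSpace ℝ (Fin q)}
    {r δ B : ℝ} {b cbar : ℝ → ℝ → ℝ} {h : Obs 𝒳 → ℝ}

/-- `ν₁` as a function of `(x, s₁, s₀)`. -/
def nuAt (M : ObsModel 𝒳) (c w : ℝ → ℝ → ℝ) (f : ℝ → ℝ → EuclideanSpace ℝ (Fin q) → ℝ)
    (η : EuclideanSpace ℝ (Fin q)) (t : 𝒳 × ℝ × ℝ) : EuclideanSpace ℝ (Fin q) :=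
  nu1 M c w f η t.2.1 t.2.2 t.1

/-- `ν₁` without the copula density. -/
def nuFree (M : ObsModel 𝒳) (w : ℝ → ℝ → ℝ) (f : ℝ → ℝ → EuclideanSpace ℝ (Fin q) → ℝ)
    (η : EuclideanSpace ℝ (Fin q)) (t : 𝒳 × ℝ × ℝ) : EuclideanSpace ℝ (Fin q) :=
  (w t.2.1 t.2.2 * (M.p true t.2.1 t.1 * M.p false t.2.2 t.1)
    * (M.mu1 t.2.1 t.1 - f t.2.1 t.2.2 η)) • gradient (f t.2.1 t.2.2) η

theorem nuAt_eq (η : EuclideanSpace ℝ (Fin q)) (t : 𝒳 × ℝ × ℝ) : nuAt M c w f η t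
    = c (M.F true t.2.1 t.1) (M.F false t.2.2 t.1) • nuFree M w f η t := by
  rw [nuAt, nuFree, nu1, smul_smul, ObsModel.e]
  congr 1
  ring

theorem nuAt_eq_zero {η : EuclideanSpace ℝ (Fin q)} {t : 𝒳 × ℝ × ℝ}
    (hp : M.p true t.2.1 t.1 * M.p false t.2.2 t.1 = 0) :
    nuFree M w f η t = 0 ∧ nuAt M c w f η t = 0 := by
  have h1 : nuFree M w f η t = 0 := by rw [nuFree, hp]; simp
  exact ⟨h1, by rw [nuAt_eq, h1, smul_zero]⟩

/-- `(ċᵤ / c) ν₁`. -/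
def nuU (M : ObsModel 𝒳) (c w : ℝ → ℝ → ℝ) (f : ℝ → ℝ → EuclideanSpace ℝ (Fin q) → ℝ)
    (η : EuclideanSpace ℝ (Fin q)) (t : 𝒳 × ℝ × ℝ) : EuclideanSpace ℝ (Fin q) :=
  (deriv (fun u => c u (M.F false t.2.2 t.1)) (M.F true t.2.1 t.1)
    / c (M.F true t.2.1 t.1) (M.F false t.2.2 t.1)) • nuAt M c w f η t

/-- `(ċᵥ / c) ν₁`. -/
def nuV (M : ObsModel 𝒳) (c w : ℝ → ℝ → ℝ) (f : ℝ → ℝ → EuclideanSpace ℝ (Fin q) → ℝ)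
    (η : EuclideanSpace ℝ (Fin q)) (t : 𝒳 × ℝ × ℝ) : EuclideanSpace ℝ (Fin q) :=
  (deriv (fun v => c (M.F true t.2.1 t.1) v) (M.F false t.2.2 t.1)
    / c (M.F true t.2.1 t.1) (M.F false t.2.2 t.1)) • nuAt M c w f η t

theorem nuU_eq (hr : IsRegular M c w f η₁ r δ b cbar) {t : 𝒳 × ℝ × ℝ}
    (ht : M.p true t.2.1 t.1 * M.p false t.2.2 t.1 ≠ 0 → M.IsInterior t) :
    nuU M c w f η₁ t
      = deriv (fun u => c u (M.F false t.2.2 t.1)) (M.F true t.2.1 t.1) • nuFree M w f η₁ t := by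
  by_cases hp : M.p true t.2.1 t.1 * M.p false t.2.2 t.1 = 0
  · rw [nuU, (nuAt_eq_zero (c := c) hp).1, (nuAt_eq_zero hp).2, smul_zero, smul_zero]
  · rw [nuU, nuAt_eq, smul_smul]
    by_cases h0 : c (M.F true t.2.1 t.1) (M.F false t.2.2 t.1) = 0
    · rw [hr.copula.deriv_left_eq_zero (ht hp).left (ht hp).right h0, zero_div, zero_mul]
    · rw [div_mul_cancel₀ _ h0]

theorem nuV_eq (hr : IsRegular M c w f η₁ r δ b cbar) {t : 𝒳 × ℝ × ℝ}
    (ht : M.p true t.2.1 t.1 * M.p false t.2.2 t.1 ≠ 0 → M.IsInterior t) :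
    nuV M c w f η₁ t
      = deriv (fun v => c (M.F true t.2.1 t.1) v) (M.F false t.2.2 t.1) • nuFree M w f η₁ t := by
  by_cases hp : M.p true t.2.1 t.1 * M.p false t.2.2 t.1 = 0
  · rw [nuV, (nuAt_eq_zero (c := c) hp).1, (nuAt_eq_zero hp).2, smul_zero, smul_zero]
  · rw [nuV, nuAt_eq, smul_smul]
    by_cases h0 : c (M.F true t.2.1 t.1) (M.F false t.2.2 t.1) = 0
    · rw [hr.copula.deriv_right_eq_zero (ht hp).left (ht hp).right h0, zero_div, zero_mul]
    · rw [div_mul_cancel₀ _ h0]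

theorem measurable_F_left (M : ObsModel 𝒳) :
    Measurable fun t : 𝒳 × ℝ × ℝ => M.F true t.2.1 t.1 := M.measurable_F_comp true measurable_fst

theorem measurable_F_right (M : ObsModel 𝒳) :
    Measurable fun t : 𝒳 × ℝ × ℝ => M.F false t.2.2 t.1 := M.measurable_F_comp false measurable_snd

theorem stronglyMeasurable_gradient_base (hr : IsRegular M c w f η₁ r δ b cbar) :
    StronglyMeasurable fun t : 𝒳 × ℝ × ℝ => gradient (f t.2.1 t.2.2) η₁ :=
  (hr.leastSquaresData_model.stronglyMeasurable_gradient
    (Metric.mem_ball_self hr.r_pos)).comp_measurable measurable_snd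

theorem measurable_mu1_base (M : ObsModel 𝒳) :
    Measurable fun t : 𝒳 × ℝ × ℝ => M.mu1 t.2.1 t.1 :=
  (measurable_mu1 M).comp (measurable_fst.prodMk (measurable_fst.comp measurable_snd))

theorem measurable_p_mul_p (M : ObsModel 𝒳) :
    Measurable fun t : 𝒳 × ℝ × ℝ => M.p true t.2.1 t.1 * M.p false t.2.2 t.1 :=
  ((M.measurable_p_swap true).comp (measurable_fst.prodMk (measurable_fst.comp measurable_snd))).mul
    ((M.measurable_p_swap false).comp (measurable_fst.prodMk (measurable_snd.comp measurable_snd)))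

theorem stronglyMeasurable_nuFree (hr : IsRegular M c w f η₁ r δ b cbar) :
    StronglyMeasurable (nuFree M w f η₁) := by
  have hw : Measurable fun t : 𝒳 × ℝ × ℝ => w t.2.1 t.2.2 := hr.w_meas.comp measurable_snd
  have hf : Measurable fun t : 𝒳 × ℝ × ℝ => f t.2.1 t.2.2 η₁ := (hr.f_meas η₁).comp measurable_snd
  exact ((hw.mul (measurable_p_mul_p M)).mul
    ((measurable_mu1_base M).sub hf)).stronglyMeasurable.smul hr.stronglyMeasurable_gradient_base

theorem norm_nuFree_le (hr : IsRegular M c w f η₁ r δ b cbar) (t : 𝒳 × ℝ × ℝ) :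
    ‖nuFree M w f η₁ t‖ ≤ w t.2.1 t.2.2 * (M.p true t.2.1 t.1 * M.p false t.2.2 t.1)
      * (b t.2.1 t.2.2 + M.absMu t.2.1 t.1) ^ 2 := by
  have hη₁ := Metric.mem_ball_self (x := η₁) hr.r_pos
  have h1 := norm_gradient_le (hr.bound t.2.1 t.2.2 η₁ hη₁)
  have h2 := abs_le_of_iteratedFDeriv (hr.bound t.2.1 t.2.2 η₁ hη₁)
  have h3 := M.abs_mu1_le t.2.1 t.1
  have h4 := M.absMu_nonneg t.2.1 t.1
  have h5 := hr.b_nonneg t.2.1 t.2.2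
  have h6 : 0 ≤ w t.2.1 t.2.2 * (M.p true t.2.1 t.1 * M.p false t.2.2 t.1) :=
    mul_nonneg (hr.w_nonneg _ _) (mul_nonneg (M.p_nonneg _ _ _) (M.p_nonneg _ _ _))
  have h7 : |M.mu1 t.2.1 t.1 - f t.2.1 t.2.2 η₁| ≤ b t.2.1 t.2.2 + M.absMu t.2.1 t.1 :=
    (abs_sub _ _).trans (by linarith)
  rw [nuFree, norm_smul, norm_mul, Real.norm_of_nonneg h6, Real.norm_eq_abs, sq, mul_assoc]
  gcongr
  linarith

theorem integrable_smul_nuFree (hr : IsRegular M c w f η₁ r δ b cbar) {k : 𝒳 × ℝ × ℝ → ℝ}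
    (hk : AEStronglyMeasurable (fun t => k t • nuFree M w f η₁ t) M.base)
    (hle : ∀ t, M.IsInterior t → |k t| ≤ cbar (M.F true t.2.1 t.1) (M.F false t.2.2 t.1)) :
    Integrable (fun t => k t • nuFree M w f η₁ t) M.base := by
  refine hr.integrable.mono' hk ?_
  filter_upwards [M.ae_isInterior hr.outcome] with t ht
  by_cases hp : M.p true t.2.1 t.1 * M.p false t.2.2 t.1 = 0
  · rw [(nuAt_eq_zero (c := c) hp).1, smul_zero, norm_zero, M.envK_eq_zero hp, zero_mul]
  · rw [norm_smul, Real.norm_eq_abs]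
    have h6 : 0 ≤ w t.2.1 t.2.2 * (M.p true t.2.1 t.1 * M.p false t.2.2 t.1) :=
      mul_nonneg (hr.w_nonneg _ _) (mul_nonneg (M.p_nonneg _ _ _) (M.p_nonneg _ _ _))
    calc |k t| * ‖nuFree M w f η₁ t‖
        ≤ cbar (M.F true t.2.1 t.1) (M.F false t.2.2 t.1)
          * (w t.2.1 t.2.2 * (M.p true t.2.1 t.1 * M.p false t.2.2 t.1)
            * (b t.2.1 t.2.2 + M.absMu t.2.1 t.1) ^ 2) :=
          mul_le_mul (hle t (ht hp)) (hr.norm_nuFree_le t) (norm_nonneg _)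
            ((abs_nonneg _).trans (hle t (ht hp)))
      _ = _ := by rw [ObsModel.envK]; ring

theorem integrable_nuAt (hr : IsRegular M c w f η₁ r δ b cbar) :
    Integrable (nuAt M c w f η₁) M.base := by
  have h1 : nuAt M c w f η₁ = fun t =>
      c (M.F true t.2.1 t.1) (M.F false t.2.2 t.1) • nuFree M w f η₁ t := funext (nuAt_eq η₁)
  have hcm : Measurable fun t : 𝒳 × ℝ × ℝ => c (M.F true t.2.1 t.1) (M.F false t.2.2 t.1) :=
    hr.c_meas.comp ((measurable_F_left M).prodMk (measurable_F_right M))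
  rw [h1]
  refine hr.integrable_smul_nuFree
    (hcm.stronglyMeasurable.smul hr.stronglyMeasurable_nuFree).aestronglyMeasurable fun t ht => ?_
  rw [abs_of_nonneg (hr.copula.nonneg _ ht.left _ ht.right)]
  exact (hr.copula.center_bound ht.left ht.right).1

/-- The partial derivatives are replaced by the Fréchet derivative in a fixed direction, which is
measurable in its base point; the two agree on the open square. -/
theorem aestronglyMeasurable_fderiv_smul (hr : IsRegular M c w f η₁ r δ b cbar) (d : ℝ × ℝ) :
    AEStronglyMeasurable (fun t => fderiv ℝ (Function.uncurry c)
      (M.F true t.2.1 t.1, M.F false t.2.2 t.1) d • nuFree M w f η₁ t) M.base := by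
  have h1 : Measurable fun x : ℝ × ℝ => fderiv ℝ (Function.uncurry c) x d :=
    measurable_fderiv_apply_const ℝ (Function.uncurry c) d
  exact ((h1.comp ((measurable_F_left M).prodMk
    (measurable_F_right M))).stronglyMeasurable.smul
      hr.stronglyMeasurable_nuFree).aestronglyMeasurable

theorem nuU_ae_eq (hr : IsRegular M c w f η₁ r δ b cbar) :
    nuU M c w f η₁ =ᵐ[M.base] fun t => fderiv ℝ (Function.uncurry c)
      (M.F true t.2.1 t.1, M.F false t.2.2 t.1) (1, 0) • nuFree M w f η₁ t := by
  filter_upwards [M.ae_isInterior hr.outcome] with t ht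
  rw [hr.nuU_eq ht]
  by_cases hp : M.p true t.2.1 t.1 * M.p false t.2.2 t.1 = 0
  · rw [(nuAt_eq_zero (c := c) hp).1, smul_zero, smul_zero]
  · rw [(hr.copula.hasDerivAt_left (ht hp).left (ht hp).right).deriv]

theorem nuV_ae_eq (hr : IsRegular M c w f η₁ r δ b cbar) :
    nuV M c w f η₁ =ᵐ[M.base] fun t => fderiv ℝ (Function.uncurry c)
      (M.F true t.2.1 t.1, M.F false t.2.2 t.1) (0, 1) • nuFree M w f η₁ t := by
  filter_upwards [M.ae_isInterior hr.outcome] with t ht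
  rw [hr.nuV_eq ht]
  by_cases hp : M.p true t.2.1 t.1 * M.p false t.2.2 t.1 = 0
  · rw [(nuAt_eq_zero (c := c) hp).1, smul_zero, smul_zero]
  · rw [(hr.copula.hasDerivAt_right (ht hp).left (ht hp).right).deriv]

theorem aestronglyMeasurable_nuU (hr : IsRegular M c w f η₁ r δ b cbar) :
    AEStronglyMeasurable (nuU M c w f η₁) M.base :=
  (hr.aestronglyMeasurable_fderiv_smul (1, 0)).congr hr.nuU_ae_eq.symm

theorem aestronglyMeasurable_nuV (hr : IsRegular M c w f η₁ r δ b cbar) :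
    AEStronglyMeasurable (nuV M c w f η₁) M.base :=
  (hr.aestronglyMeasurable_fderiv_smul (0, 1)).congr hr.nuV_ae_eq.symm

/-- The factor `F (1 - F)` is essential: the derivative of the copula density is dominated only
after this weighting. -/
theorem integrable_nuU (hr : IsRegular M c w f η₁ r δ b cbar) :
    Integrable (fun t => (M.F true t.2.1 t.1 * (1 - M.F true t.2.1 t.1)) • nuU M c w f η₁ t)
      M.base := by
  have hm : Measurable fun t : 𝒳 × ℝ × ℝ => M.F true t.2.1 t.1 * (1 - M.F true t.2.1 t.1) :=
    (measurable_F_left M).mul ((measurable_F_left M).const_sub 1)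
  have heq : (fun t => (M.F true t.2.1 t.1 * (1 - M.F true t.2.1 t.1)) • nuU M c w f η₁ t)
      =ᵐ[M.base] fun t => (M.F true t.2.1 t.1 * (1 - M.F true t.2.1 t.1)
        * deriv (fun u => c u (M.F false t.2.2 t.1)) (M.F true t.2.1 t.1)) • nuFree M w f η₁ t := by
    filter_upwards [M.ae_isInterior hr.outcome] with t ht
    rw [hr.nuU_eq ht, smul_smul]
  refine (hr.integrable_smul_nuFree
    ((hm.aestronglyMeasurable.smul hr.aestronglyMeasurable_nuU).congr heq) fun t ht => ?_).congr
      heq.symm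
  rw [abs_mul, abs_of_nonneg (mul_nonneg ht.left.1.le (by linarith [ht.left.2]))]
  exact (hr.copula.center_bound ht.left ht.right).2.1

theorem integrable_nuV (hr : IsRegular M c w f η₁ r δ b cbar) :
    Integrable (fun t => (M.F false t.2.2 t.1 * (1 - M.F false t.2.2 t.1)) • nuV M c w f η₁ t)
      M.base := by
  have hm : Measurable fun t : 𝒳 × ℝ × ℝ => M.F false t.2.2 t.1 * (1 - M.F false t.2.2 t.1) :=
    (measurable_F_right M).mul ((measurable_F_right M).const_sub 1)
  have heq : (fun t => (M.F false t.2.2 t.1 * (1 - M.F false t.2.2 t.1)) • nuV M c w f η₁ t)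
      =ᵐ[M.base] fun t => (M.F false t.2.2 t.1 * (1 - M.F false t.2.2 t.1)
        * deriv (fun v => c (M.F true t.2.1 t.1) v) (M.F false t.2.2 t.1)) • nuFree M w f η₁ t := by
    filter_upwards [M.ae_isInterior hr.outcome] with t ht
    rw [hr.nuV_eq ht, smul_smul]
  refine (hr.integrable_smul_nuFree
    ((hm.aestronglyMeasurable.smul hr.aestronglyMeasurable_nuV).congr heq) fun t ht => ?_).congr
      heq.symm
  rw [abs_mul, abs_of_nonneg (mul_nonneg ht.right.1.le (by linarith [ht.right.2]))]
  exact (hr.copula.center_bound ht.left ht.right).2.2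

/-- The weighted density times the gradient, the kernel of `ℓ₃`. -/
def outcomeAt (M : ObsModel 𝒳) (c w : ℝ → ℝ → ℝ) (f : ℝ → ℝ → EuclideanSpace ℝ (Fin q) → ℝ)
    (η : EuclideanSpace ℝ (Fin q)) (t : 𝒳 × ℝ × ℝ) : EuclideanSpace ℝ (Fin q) :=
  (w t.2.1 t.2.2 * M.e c t.2.1 t.2.2 t.1) • gradient (f t.2.1 t.2.2) η

theorem outcomeAt_eq_zero {η : EuclideanSpace ℝ (Fin q)} {t : 𝒳 × ℝ × ℝ}
    (hp : M.p true t.2.1 t.1 * M.p false t.2.2 t.1 = 0) : outcomeAt M c w f η t = 0 := by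
  rw [outcomeAt, ObsModel.e, mul_assoc (c _ _), hp]
  simp

theorem stronglyMeasurable_outcomeAt (hr : IsRegular M c w f η₁ r δ b cbar) :
    StronglyMeasurable (outcomeAt M c w f η₁) := by
  have hw : Measurable fun t : 𝒳 × ℝ × ℝ => w t.2.1 t.2.2 := hr.w_meas.comp measurable_snd
  have hcm : Measurable fun t : 𝒳 × ℝ × ℝ => c (M.F true t.2.1 t.1) (M.F false t.2.2 t.1) :=
    hr.c_meas.comp ((measurable_F_left M).prodMk (measurable_F_right M))
  have hem : Measurable fun t : 𝒳 × ℝ × ℝ => w t.2.1 t.2.2 * M.e c t.2.1 t.2.2 t.1 := by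
    simp only [ObsModel.e, mul_assoc (c _ _)]
    exact hw.mul (hcm.mul (measurable_p_mul_p M))
  exact hem.stronglyMeasurable.smul hr.stronglyMeasurable_gradient_base

/-- The envelope controls products such as `b * absMu`, but not `b` alone; the multiplier must
therefore supply the mean of `|Y|`. -/
theorem integrable_smul_outcomeAt (hr : IsRegular M c w f η₁ r δ b cbar) {k : 𝒳 × ℝ × ℝ → ℝ}
    (hk : Measurable k) {A : ℝ} (hA1 : 0 ≤ A) (hle : ∀ t, M.IsInterior t → |k t| ≤ A * M.absMu t.2.1 t.1) :
    Integrable (fun t => k t • outcomeAt M c w f η₁ t) M.base := by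
  refine (hr.integrable.const_mul A).mono'
    (hk.stronglyMeasurable.smul hr.stronglyMeasurable_outcomeAt).aestronglyMeasurable ?_
  filter_upwards [M.ae_isInterior hr.outcome] with t ht
  by_cases hp : M.p true t.2.1 t.1 * M.p false t.2.2 t.1 = 0
  · rw [outcomeAt_eq_zero hp, smul_zero, norm_zero, M.envK_eq_zero hp, zero_mul, mul_zero]
  · have hi := ht hp
    have h6 : 0 ≤ w t.2.1 t.2.2 * (M.p true t.2.1 t.1 * M.p false t.2.2 t.1) :=
      mul_nonneg (hr.w_nonneg _ _) (mul_nonneg (M.p_nonneg _ _ _) (M.p_nonneg _ _ _))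
    have hc0 := hr.copula.nonneg _ hi.left _ hi.right
    have hcb := (hr.copula.center_bound hi.left hi.right).1
    have h1 := norm_gradient_le (hr.bound t.2.1 t.2.2 η₁ (Metric.mem_ball_self hr.r_pos))
    have h4 := M.absMu_nonneg t.2.1 t.1
    have h5 := hr.b_nonneg t.2.1 t.2.2
    have hA := hle t hi
    have hE : w t.2.1 t.2.2 * M.e c t.2.1 t.2.2 t.1
        = c (M.F true t.2.1 t.1) (M.F false t.2.2 t.1)
          * (w t.2.1 t.2.2 * (M.p true t.2.1 t.1 * M.p false t.2.2 t.1)) := by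
      rw [ObsModel.e]; ring
    rw [outcomeAt, norm_smul, norm_smul, hE, Real.norm_eq_abs, Real.norm_of_nonneg
      (mul_nonneg hc0 h6)]
    have hA0 : 0 ≤ A * M.absMu t.2.1 t.1 := (abs_nonneg _).trans hA
    calc |k t| * (c (M.F true t.2.1 t.1) (M.F false t.2.2 t.1)
          * (w t.2.1 t.2.2 * (M.p true t.2.1 t.1 * M.p false t.2.2 t.1))
          * ‖gradient (f t.2.1 t.2.2) η₁‖)
        ≤ (A * M.absMu t.2.1 t.1) * (cbar (M.F true t.2.1 t.1) (M.F false t.2.2 t.1)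
          * (w t.2.1 t.2.2 * (M.p true t.2.1 t.1 * M.p false t.2.2 t.1))
          * b t.2.1 t.2.2) := by gcongr; exact mul_nonneg (hc0.trans hcb) h6
      _ = A * (M.absMu t.2.1 t.1 * b t.2.1 t.2.2) * M.envK cbar w t := by
          rw [ObsModel.envK]; ring
      _ ≤ _ := by
          have hE0 := hr.envK_nonneg ht
          calc A * (M.absMu t.2.1 t.1 * b t.2.1 t.2.2) * M.envK cbar w t
              ≤ A * (b t.2.1 t.2.2 + M.absMu t.2.1 t.1) ^ 2 * M.envK cbar w t := by
                gcongr
                nlinarith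
            _ = _ := by ring

end IsRegular

theorem integrable_bounded_smul {α E : Type*} [MeasurableSpace α] {μ : Measure α}
    [NormedAddCommGroup E] [NormedSpace ℝ E] {g : α → E} {φ : α → ℝ} {B : ℝ} (hg : Integrable g μ)
    (hφ : AEStronglyMeasurable φ μ) (hB : ∀ᵐ a ∂μ, ‖φ a‖ ≤ B) :
    Integrable (fun a => φ a • g a) μ :=
  hg.bdd_smul B hφ hB

/-- Differentiating a normalized mean gives the mean of the score times the residual. The bound is
of the form required for pairing with `outcomeAt`. -/
theorem ObsModel.dotMu_eq {𝒳 : Type*} [MeasurableSpace 𝒳] (M : ObsModel 𝒳) {h : Obs 𝒳 → ℝ} {B : ℝ}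
    (hh : Measurable h) (hB : ∀ v, |h v| ≤ B) {s : ℝ} {x : 𝒳}
    (hi : Integrable (fun y : ℝ => y) (M.κ (s, true, x))) :
    ∫ y, h (y, s, true, x) * (y - M.mu1 s x) ∂(M.κ (s, true, x)) = M.dotMu h s x ∧
    |M.dotMu h s x| ≤ 2 * B * M.absMu s x := by
  have hm : AEStronglyMeasurable (fun y => h (y, s, true, x)) (M.κ (s, true, x)) :=
    (hh.comp measurable_prodMk_right).aestronglyMeasurable
  have hb : ∀ᵐ y ∂(M.κ (s, true, x)), ‖h (y, s, true, x)‖ ≤ B := ae_of_all _ fun _ => hB _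
  have h1 : Integrable (fun y => y * h (y, s, true, x)) (M.κ (s, true, x)) := hi.mul_bdd (c := B) hm hb
  have h2 : Integrable (fun y => h (y, s, true, x)) (M.κ (s, true, x)) := by
    simpa using (integrable_const (1 : ℝ)).mul_bdd (c := B) hm hb
  constructor
  · rw [dotMu, avgS, ← integral_const_mul, ← integral_sub h1 (h2.const_mul _)]
    congr 1
    funext y
    ring
  · have hB0 : 0 ≤ B := (abs_nonneg _).trans (hB (0, 0, true, x))
    have h3 : |∫ y, y * h (y, s, true, x) ∂(M.κ (s, true, x))| ≤ B * M.absMu s x := by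
      rw [absMu, ← integral_const_mul, ← Real.norm_eq_abs]
      refine norm_integral_le_of_norm_le (hi.abs.const_mul B) (ae_of_all _ fun y => ?_)
      rw [norm_mul, mul_comm, Real.norm_eq_abs, Real.norm_eq_abs]
      exact mul_le_mul_of_nonneg_right (hB _) (abs_nonneg _)
    have h4 : |M.mu1 s x * M.avgS h (s, true, x)| ≤ M.absMu s x * B := by
      rw [abs_mul]
      exact mul_le_mul (M.abs_mu1_le s x) (M.abs_avgS_le hh hB _) (abs_nonneg _)
        (M.absMu_nonneg s x)
    rw [dotMu]
    exact (abs_sub _ _).trans (by linarith)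

/-! ### The mean of a bounded function times `D` -/

namespace IsRegular

variable {𝒳 : Type*} [MeasurableSpace 𝒳] {q : ℕ} {M : ObsModel 𝒳}
    {c w : ℝ → ℝ → ℝ} {f : ℝ → ℝ → EuclideanSpace ℝ (Fin q) → ℝ}
    {η₁ : EuclideanSpace ℝ (Fin q)}
    {r δ B : ℝ} {b cbar : ℝ → ℝ → ℝ} {h : Obs 𝒳 → ℝ}

theorem integral_ell1 (hr : IsRegular M c w f η₁ r δ b cbar) {k : 𝒳 → ℝ} (hk : Measurable k)
    (hB : ∀ x, |k x| ≤ B) :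
    Integrable (ell1 M c w f η₁) M.PX ∧ Integrable (fun t => k t.1 • nuAt M c w f η₁ t) M.base ∧
    ∫ x, k x • ell1 M c w f η₁ x ∂M.PX = ∫ t, k t.1 • nuAt M c w f η₁ t ∂M.base := by
  have hν := hr.integrable_nuAt
  have hae : ∀ᵐ x ∂M.PX, ∫ s, nuAt M c w f η₁ (x, s) ∂(volume.prod volume)
      = ell1 M c w f η₁ x := by
    filter_upwards [hν.prod_right_ae] with x hx
    exact integral_prod _ hx
  have h2 : Integrable (fun t : 𝒳 × ℝ × ℝ => k t.1 • nuAt M c w f η₁ t) M.base :=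
    hν.bdd_smul B (hk.comp measurable_fst).aestronglyMeasurable (ae_of_all _ fun _ => hB _)
  refine ⟨hν.integral_prod_left.congr hae, h2, ?_⟩
  rw [integral_prod _ h2]
  refine integral_congr_ae (hae.mono fun x hx => ?_)
  simp only
  rw [integral_smul, hx]

/-- The residual part of `ℓ₂` in the treated arm. -/
def resid1 (M : ObsModel 𝒳) (c w : ℝ → ℝ → ℝ) (f : ℝ → ℝ → EuclideanSpace ℝ (Fin q) → ℝ)
    (η : EuclideanSpace ℝ (Fin q)) (t : 𝒳 × ℝ) : EuclideanSpace ℝ (Fin q) :=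
  ∫ s1, ∫ s0, M.ru c s1 s0 t.2 t.1 • nu1 M c w f η s1 s0 t.1

/-- The residual part of `ℓ₂` in the control arm. -/
def resid0 (M : ObsModel 𝒳) (c w : ℝ → ℝ → ℝ) (f : ℝ → ℝ → EuclideanSpace ℝ (Fin q) → ℝ)
    (η : EuclideanSpace ℝ (Fin q)) (t : 𝒳 × ℝ) : EuclideanSpace ℝ (Fin q) :=
  ∫ s1, ∫ s0, M.rv c s1 s0 t.2 t.1 • nu1 M c w f η s1 s0 t.1

/-- The kernel of `ℓ₃`, integrated over `s₀`. -/
def outcomeW (M : ObsModel 𝒳) (c w : ℝ → ℝ → ℝ) (f : ℝ → ℝ → EuclideanSpace ℝ (Fin q) → ℝ)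
    (η : EuclideanSpace ℝ (Fin q)) (t : 𝒳 × ℝ) : EuclideanSpace ℝ (Fin q) :=
  (M.p true t.2 t.1)⁻¹ • ∫ s0, outcomeAt M c w f η (t.1, t.2, s0)

/-- The arm probability from the law cancels the inverse weight in `ℓ₂` and `ℓ₃`; only `ℓ₁` keeps
it. -/
theorem propZ_smul_D_true (u : (𝒳 × ℝ) × ℝ) :
    M.propZ true u.1.1 • D M c w f η₁ (ObsModel.obsOf true u)
      = M.propZ true u.1.1 • ell1 M c w f η₁ u.1.1
        + ((M.p true u.1.2 u.1.1)⁻¹ • (∫ s0, nuAt M c w f η₁ (u.1.1, u.1.2, s0))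
          - resid1 M c w f η₁ u.1)
        + (u.2 - M.mu1 u.1.2 u.1.1) • outcomeW M c w f η₁ u.1 := by
  have hp := (M.prop_pos u.1.1).ne'
  simp only [D, ell2, ell3, ObsModel.obsOf, ObsModel.propZ, if_true, zero_div, zero_smul, add_zero,
    smul_add, smul_smul]
  rw [mul_one_div_cancel hp, one_smul, ← mul_assoc (M.prop u.1.1), ← mul_assoc (M.prop u.1.1),
    mul_one_div_cancel hp, one_mul, mul_smul]
  rfl

theorem propZ_smul_D_false (u : (𝒳 × ℝ) × ℝ) :
    M.propZ false u.1.1 • D M c w f η₁ (ObsModel.obsOf false u)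
      = M.propZ false u.1.1 • ell1 M c w f η₁ u.1.1
        + ((M.p false u.1.2 u.1.1)⁻¹ • (∫ s1, nuAt M c w f η₁ (u.1.1, s1, u.1.2))
          - resid0 M c w f η₁ u.1) := by
  have hp : 1 - M.prop u.1.1 ≠ 0 := by linarith [M.prop_lt_one u.1.1]
  simp only [D, ell2, ell3, ObsModel.obsOf, ObsModel.propZ, Bool.false_eq_true, if_false, zero_div,
    zero_smul, zero_mul, zero_add, add_zero, smul_add, smul_smul]
  rw [mul_one_div_cancel hp, one_smul]
  rfl

/-- In `r_u`, the term `1` averages to `avgZ`, and the centered indicator averages to `dotF`, the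
derivative of the distribution function, multiplied by the relative derivative of the copula
density. -/
theorem integral_resid1 (hr : IsRegular M c w f η₁ r δ b cbar) (hh : Measurable h)
    (hB : ∀ v, |h v| ≤ B) : Integrable (resid1 M c w f η₁) (M.jointXS true) ∧
    Integrable (fun t => M.avgZ h true t.1 • nuAt M c w f η₁ t
      - M.dotF h true t.2.1 t.1 • nuU M c w f η₁ t) M.base ∧
    ∫ t, M.avgS h (t.2, true, t.1) • resid1 M c w f η₁ t ∂(M.jointXS true)
      = ∫ t, (M.avgZ h true t.1 • nuAt M c w f η₁ t
        - M.dotF h true t.2.1 t.1 • nuU M c w f η₁ t) ∂M.base := by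
  have h1 := M.integral_full_residual hh hB true measurable_fst hr.integrable_nuAt
    hr.aestronglyMeasurable_nuU hr.integrable_nuU (R := resid1 M c w f η₁) fun x S hi => by
      rw [integral_prod _ hi, resid1]
      refine integral_congr_ae (ae_of_all _ fun s1 => integral_congr_ae (ae_of_all _ fun s0 => ?_))
      simp only [ObsModel.ru, nuU, ObsModel.centered, nuAt]
      module
  have h2 := (M.integral_residual hh hB true measurable_fst hr.integrable_nuAt
    hr.aestronglyMeasurable_nuU hr.integrable_nuU).2.1
  exact ⟨h1.1, h2, h1.2⟩

theorem integral_resid0 (hr : IsRegular M c w f η₁ r δ b cbar) (hh : Measurable h)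
    (hB : ∀ v, |h v| ≤ B) : Integrable (resid0 M c w f η₁) (M.jointXS false) ∧
    Integrable (fun t => M.avgZ h false t.1 • nuAt M c w f η₁ t
      - M.dotF h false t.2.2 t.1 • nuV M c w f η₁ t) M.base ∧
    ∫ t, M.avgS h (t.2, false, t.1) • resid0 M c w f η₁ t ∂(M.jointXS false)
      = ∫ t, (M.avgZ h false t.1 • nuAt M c w f η₁ t
        - M.dotF h false t.2.2 t.1 • nuV M c w f η₁ t) ∂M.base := by
  have h1 := M.integral_full_residual hh hB false measurable_snd hr.integrable_nuAt
    hr.aestronglyMeasurable_nuV hr.integrable_nuV (R := resid0 M c w f η₁) fun x S hi => by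
      rw [integral_prod _ hi, resid0]
      refine integral_congr_ae (ae_of_all _ fun s1 => integral_congr_ae (ae_of_all _ fun s0 => ?_))
      simp only [ObsModel.rv, nuV, ObsModel.centered, nuAt]
      module
  have h2 := (M.integral_residual hh hB false measurable_snd hr.integrable_nuAt
    hr.aestronglyMeasurable_nuV hr.integrable_nuV).2.1
  exact ⟨h1.1, h2, h1.2⟩

theorem nuAt_eq_zero_left (x : 𝒳) (S s : ℝ) (hp : M.p true S x = 0) :
    nuAt M c w f η₁ (x, S, s) = 0 :=
  (nuAt_eq_zero (t := (x, S, s)) (by simp [hp])).2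

theorem nuAt_eq_zero_right (x : 𝒳) (S s : ℝ) (hp : M.p false S x = 0) :
    nuAt M c w f η₁ (x, s, S) = 0 :=
  (nuAt_eq_zero (t := (x, s, S)) (by simp [hp])).2

theorem integral_density0 (hr : IsRegular M c w f η₁ r δ b cbar) (hh : Measurable h)
    (hB : ∀ v, |h v| ≤ B) :
    Integrable (fun t : 𝒳 × ℝ => (M.p false t.2 t.1)⁻¹ • ∫ s, nuAt M c w f η₁ (t.1, s, t.2))
      (M.jointXS false) ∧
    Integrable (fun t => M.avgS h (t.2.2, false, t.1) • nuAt M c w f η₁ t) M.base ∧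
    ∫ t, M.avgS h (t.2, false, t.1) • (M.p false t.2 t.1)⁻¹
        • (∫ s, nuAt M c w f η₁ (t.1, s, t.2)) ∂(M.jointXS false)
      = ∫ t, M.avgS h (t.2.2, false, t.1) • nuAt M c w f η₁ t ∂M.base := by
  have hν : Integrable (fun t : 𝒳 × ℝ × ℝ => nuAt M c w f η₁ (t.1, t.2.2, t.2.1)) M.base :=
    M.measurePreserving_swap_base.integrable_comp_of_integrable hr.integrable_nuAt
  obtain ⟨h1, h2, h3⟩ := M.integral_full_density hh hB false hν
    fun x S s hp => nuAt_eq_zero_right x S s hp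
  have hm : Measurable fun t : 𝒳 × ℝ × ℝ => M.avgS h (t.2.2, false, t.1) :=
    (M.measurable_avgS hh).comp (by fun_prop)
  have h4 : Integrable (fun t : 𝒳 × ℝ × ℝ => M.avgS h (t.2.2, false, t.1) • nuAt M c w f η₁ t)
      M.base := hr.integrable_nuAt.bdd_smul B hm.aestronglyMeasurable
        (ae_of_all _ fun t => M.abs_avgS_le hh hB (t.2.2, false, t.1))
  refine ⟨h1, h4, h3.trans ?_⟩
  rw [← M.integral_swap_base h4]

theorem measurable_dotMu (M : ObsModel 𝒳) (hh : Measurable h) :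
    Measurable fun t : 𝒳 × ℝ × ℝ => M.dotMu h t.2.1 t.1 := by
  have hp : Measurable fun t : 𝒳 × ℝ × ℝ => (t.1, t.2.1) := by fun_prop
  have hq : Measurable fun t : 𝒳 × ℝ × ℝ => (t.2.1, true, t.1) := by fun_prop
  exact ((M.measurable_integral_outcome hh measurable_id).comp hp).sub
    ((measurable_mu1_base M).mul ((M.measurable_avgS hh).comp hq))

theorem integral_outcomeW (hr : IsRegular M c w f η₁ r δ b cbar) (hh : Measurable h)
    (hB : ∀ v, |h v| ≤ B) :
    Integrable (fun u => h (ObsModel.obsOf true u) • (u.2 - M.mu1 u.1.2 u.1.1)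
      • outcomeW M c w f η₁ u.1) (M.full true) ∧
    Integrable (fun t => M.dotMu h t.2.1 t.1 • outcomeAt M c w f η₁ t) M.base ∧
    ∫ u, h (ObsModel.obsOf true u) • (u.2 - M.mu1 u.1.2 u.1.1)
      • outcomeW M c w f η₁ u.1 ∂(M.full true)
      = ∫ t, M.dotMu h t.2.1 t.1 • outcomeAt M c w f η₁ t ∂M.base := by
  -- The sign of `B` is read off at a point of the covariate space, which is nonempty because it
  -- carries a probability measure.
  have hB0 : 0 ≤ B ∨ IsEmpty 𝒳 := by
    rcases isEmpty_or_nonempty 𝒳 with he | ⟨⟨x⟩⟩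
    · exact Or.inr he
    · exact Or.inl ((abs_nonneg _).trans (hB (0, 0, true, x)))
  have hB0 : 0 ≤ B := by
    rcases hB0 with h0 | h0
    · exact h0
    · have := M.isProb.measure_univ
      simp [Subsingleton.elim M.PX 0] at this
  have ha : Measurable fun t : 𝒳 × ℝ × ℝ => M.absMu t.2.1 t.1 :=
    M.measurable_absMu.comp (measurable_fst.prodMk (measurable_fst.comp measurable_snd))
  have hia := hr.integrable_smul_outcomeAt ha zero_le_one (fun t _ => by
    rw [abs_of_nonneg (M.absMu_nonneg _ _), one_mul])
  have hid := hr.integrable_smul_outcomeAt (measurable_dotMu M hh) (A := 2 * B) (by positivity)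
    (fun t ht => (M.dotMu_eq hh hB ht.outcome).2)
  have hp : ∀ t : 𝒳 × ℝ, M.p true t.2 t.1 • outcomeW M c w f η₁ t
      = ∫ s, outcomeAt M c w f η₁ (t.1, t.2, s) := by
    intro t
    by_cases h0 : M.p true t.2 t.1 = 0
    · have : ∀ s, outcomeAt M c w f η₁ (t.1, t.2, s) = 0 := fun s =>
        outcomeAt_eq_zero (t := (t.1, t.2, s)) (by simp [h0])
      simp [outcomeW, this]
    · rw [outcomeW, smul_smul, mul_inv_cancel₀ h0, one_smul]
  have hWa : Integrable (fun t : 𝒳 × ℝ => M.absMu t.2 t.1 • outcomeW M c w f η₁ t)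
      (M.jointXS true) := by
    rw [M.integrable_jointXS_iff]
    refine (M.integral_partial hia).1.congr (ae_of_all _ fun t => ?_)
    simp only
    rw [integral_smul, ← hp, smul_comm]
  have hWm : StronglyMeasurable (outcomeW M c w f η₁) := by
    have h1 : StronglyMeasurable fun u : (𝒳 × ℝ) × ℝ => outcomeAt M c w f η₁ (u.1.1, u.1.2, u.2) :=
      hr.stronglyMeasurable_outcomeAt.comp_measurable (by fun_prop)
    exact (M.measurable_p_swap true).inv.stronglyMeasurable.smul
      (h1.integral_prod_right' (ν := volume))
  have hym : Measurable fun u : (𝒳 × ℝ) × ℝ => u.2 - M.mu1 u.1.2 u.1.1 :=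
    measurable_snd.sub ((measurable_mu1 M).comp measurable_fst)
  have hYm : StronglyMeasurable fun u : (𝒳 × ℝ) × ℝ => (u.2 - M.mu1 u.1.2 u.1.1)
      • outcomeW M c w f η₁ u.1 :=
    hym.stronglyMeasurable.smul (hWm.comp_measurable measurable_fst)
  -- Integrability is checked on the outcome first: the conditional mean of the absolute residual is
  -- at most `2 * absMu`, which the kernel tolerates.
  have hY : Integrable (fun u : (𝒳 × ℝ) × ℝ => (u.2 - M.mu1 u.1.2 u.1.1)
      • outcomeW M c w f η₁ u.1) (M.full true) := by
    rw [ObsModel.full, Measure.integrable_compProd_iff hYm.aestronglyMeasurable]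
    constructor
    · filter_upwards [hr.outcome] with t ht
      exact (ht.sub (integrable_const _)).smul_const _
    · refine (hWa.norm.const_mul 2).mono' (StronglyMeasurable.integral_kernel_prod_right'
        (κ := M.outcome true) hYm.norm).aestronglyMeasurable ?_
      filter_upwards [hr.outcome] with t ht
      rw [Real.norm_of_nonneg (integral_nonneg fun _ => norm_nonneg _)]
      simp only [norm_smul, Real.norm_eq_abs]
      rw [integral_mul_const, ← mul_assoc, abs_of_nonneg (M.absMu_nonneg _ _)]
      gcongr
      calc ∫ y, |y - M.mu1 t.2 t.1| ∂(M.outcome true t)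
          ≤ ∫ y, (|y| + |M.mu1 t.2 t.1|) ∂(M.outcome true t) :=
            integral_mono (ht.sub (integrable_const _)).abs (ht.abs.add (integrable_const _))
              fun y => abs_sub _ _
        _ = M.absMu t.2 t.1 + |M.mu1 t.2 t.1| := by
            rw [integral_add ht.abs (integrable_const _)]
            simp [ObsModel.absMu, ObsModel.outcome]
        _ ≤ 2 * M.absMu t.2 t.1 := by linarith [M.abs_mu1_le t.2 t.1]
  have hhY : Integrable (fun u => h (ObsModel.obsOf true u) • (u.2 - M.mu1 u.1.2 u.1.1)
      • outcomeW M c w f η₁ u.1) (M.full true) :=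
    hY.bdd_smul B (hh.comp (ObsModel.measurable_obsOf true)).aestronglyMeasurable
      (ae_of_all _ fun _ => hB _)
  refine ⟨hhY, hid, ?_⟩
  have h1 : ∫ u, h (ObsModel.obsOf true u) • (u.2 - M.mu1 u.1.2 u.1.1)
      • outcomeW M c w f η₁ u.1 ∂(M.full true)
      = ∫ t, M.dotMu h t.2 t.1 • outcomeW M c w f η₁ t ∂(M.jointXS true) := by
    rw [ObsModel.full, Measure.integral_compProd hhY]
    refine integral_congr_ae ?_
    filter_upwards [hr.outcome] with t ht
    simp only [smul_smul, integral_smul_const]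
    rw [← (M.dotMu_eq hh hB ht).1]
    rfl
  rw [h1, M.integral_jointXS, ← (M.integral_partial hid).2]
  refine integral_congr_ae (ae_of_all _ fun t => ?_)
  simp only
  rw [smul_comm, hp, integral_smul]

/-- The product rule regrouped by arm. The covariate law contributes `propZ * avgZ`, summed over
arms; each density contributes `avgS - avgZ`; each distribution function contributes `dotF` through
the copula; the outcome mean contributes `dotMu`. -/
theorem dotScore_ae_eq (hr : IsRegular M c w f η₁ r δ b cbar) (h : Obs 𝒳 → ℝ) :
    dotScore M c w f η₁ h =ᵐ[M.base] fun t =>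
      (M.propZ true t.1 * M.avgZ h true t.1) • nuAt M c w f η₁ t
      + (M.avgS h (t.2.1, true, t.1) • nuAt M c w f η₁ t
        - (M.avgZ h true t.1 • nuAt M c w f η₁ t - M.dotF h true t.2.1 t.1 • nuU M c w f η₁ t))
      + M.dotMu h t.2.1 t.1 • outcomeAt M c w f η₁ t
      + ((M.propZ false t.1 * M.avgZ h false t.1) • nuAt M c w f η₁ t
      + (M.avgS h (t.2.2, false, t.1) • nuAt M c w f η₁ t
        - (M.avgZ h false t.1 • nuAt M c w f η₁ t
          - M.dotF h false t.2.2 t.1 • nuV M c w f η₁ t))) := by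
  filter_upwards [M.ae_isInterior hr.outcome] with t ht
  rw [hr.nuU_eq ht, hr.nuV_eq ht, nuAt_eq]
  simp only [dotScore, ObsModel.dotK, ObsModel.dotC, outcomeAt, nuFree, ObsModel.avgX]
  module

/-- The representation of the pathwise derivative of the expected score by the influence
function. -/
theorem integral_smul_D (hr : IsRegular M c w f η₁ r δ b cbar) (hh : Measurable h)
    (hB : ∀ v, |h v| ≤ B) (hD : Integrable (D M c w f η₁) M.law) :
    ∫ v, h v • D M c w f η₁ v ∂M.law = ∫ t, dotScore M c w f η₁ h t ∂M.base := by
  have hhD : Integrable (fun v => h v • D M c w f η₁ v) M.law :=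
    hD.bdd_smul B hh.aestronglyMeasurable (ae_of_all _ fun _ => hB _)
  have hk : ∀ z, Measurable fun x => M.propZ z x * M.avgZ h z x := fun z =>
    (M.measurable_propZ z).mul (M.measurable_avgZ hh z)
  have hkB : ∀ z x, |M.propZ z x * M.avgZ h z x| ≤ B := fun z x => by
    have h2 := M.abs_avgZ_le hh hB z x
    rw [abs_mul, abs_of_nonneg (M.propZ_pos z x).le]
    calc M.propZ z x * |M.avgZ h z x| ≤ 1 * B :=
          mul_le_mul (M.propZ_le_one z x) h2 (abs_nonneg _) zero_le_one
      _ = B := one_mul B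
  obtain ⟨e1, e2, e3⟩ := hr.integral_ell1 (hk true) (hkB true)
  obtain ⟨-, g2, g3⟩ := hr.integral_ell1 (hk false) (hkB false)
  obtain ⟨a1, -, a3⟩ := M.integral_full_covariate hh hB true e1
  obtain ⟨b1, -, b3⟩ := M.integral_full_covariate hh hB false e1
  obtain ⟨i1, i2, i3⟩ := M.integral_full_density hh hB true hr.integrable_nuAt nuAt_eq_zero_left
  obtain ⟨j1, j2, j3⟩ := hr.integral_density0 hh hB
  obtain ⟨k1, k2, k3⟩ := hr.integral_resid1 hh hB
  obtain ⟨l1, l2, l3⟩ := hr.integral_resid0 hh hB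
  obtain ⟨o1, o2, o3⟩ := hr.integral_outcomeW hh hB
  have ik : Integrable (fun t : 𝒳 × ℝ => (M.p true t.2 t.1)⁻¹
        • (∫ s, nuAt M c w f η₁ (t.1, t.2, s)) - resid1 M c w f η₁ t) (M.jointXS true) := i1.sub k1
  have jl : Integrable (fun t : 𝒳 × ℝ => (M.p false t.2 t.1)⁻¹
        • (∫ s, nuAt M c w f η₁ (t.1, s, t.2)) - resid0 M c w f η₁ t) (M.jointXS false) :=
    j1.sub l1
  obtain ⟨m1, m2⟩ := M.integral_full_of_integrable hh hB true ik
  obtain ⟨n1, n2⟩ := M.integral_full_of_integrable hh hB false jl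
  have hS : ∀ z, AEStronglyMeasurable (fun t : 𝒳 × ℝ => M.avgS h (t.2, z, t.1)) (M.jointXS z) :=
    fun z => ((M.measurable_avgS hh).comp (by fun_prop)).aestronglyMeasurable
  have hSB : ∀ z, ∀ᵐ t : 𝒳 × ℝ ∂(M.jointXS z), ‖M.avgS h (t.2, z, t.1)‖ ≤ B := fun z =>
    ae_of_all _ fun t => M.abs_avgS_le hh hB (t.2, z, t.1)
  have m3 : ∫ t, M.avgS h (t.2, true, t.1) • ((M.p true t.2 t.1)⁻¹
        • (∫ s, nuAt M c w f η₁ (t.1, t.2, s)) - resid1 M c w f η₁ t) ∂(M.jointXS true)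
      = ∫ t, M.avgS h (t.2.1, true, t.1) • nuAt M c w f η₁ t ∂M.base
        - ∫ t, (M.avgZ h true t.1 • nuAt M c w f η₁ t
          - M.dotF h true t.2.1 t.1 • nuU M c w f η₁ t) ∂M.base := by
    have x1 : Integrable (fun t : 𝒳 × ℝ => M.avgS h (t.2, true, t.1) • (M.p true t.2 t.1)⁻¹
        • (∫ s, nuAt M c w f η₁ (t.1, t.2, s))) (M.jointXS true) :=
      integrable_bounded_smul i1 (hS true) (hSB true)
    have x2 : Integrable (fun t : 𝒳 × ℝ => M.avgS h (t.2, true, t.1) • resid1 M c w f η₁ t)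
        (M.jointXS true) := integrable_bounded_smul k1 (hS true) (hSB true)
    rw [← i3, ← k3, ← integral_sub x1 x2]
    simp only [smul_sub]
  have n3 : ∫ t, M.avgS h (t.2, false, t.1) • ((M.p false t.2 t.1)⁻¹
        • (∫ s, nuAt M c w f η₁ (t.1, s, t.2)) - resid0 M c w f η₁ t) ∂(M.jointXS false)
      = ∫ t, M.avgS h (t.2.2, false, t.1) • nuAt M c w f η₁ t ∂M.base
        - ∫ t, (M.avgZ h false t.1 • nuAt M c w f η₁ t
          - M.dotF h false t.2.2 t.1 • nuV M c w f η₁ t) ∂M.base := by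
    have x1 : Integrable (fun t : 𝒳 × ℝ => M.avgS h (t.2, false, t.1) • (M.p false t.2 t.1)⁻¹
        • (∫ s, nuAt M c w f η₁ (t.1, s, t.2))) (M.jointXS false) :=
      integrable_bounded_smul j1 (hS false) (hSB false)
    have x2 : Integrable (fun t : 𝒳 × ℝ => M.avgS h (t.2, false, t.1) • resid0 M c w f η₁ t)
        (M.jointXS false) := integrable_bounded_smul l1 (hS false) (hSB false)
    rw [← j3, ← l3, ← integral_sub x1 x2]
    simp only [smul_sub]
  have htrue : ∫ u, M.propZ true u.1.1 • h (ObsModel.obsOf true u)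
        • D M c w f η₁ (ObsModel.obsOf true u) ∂(M.full true)
      = ∫ t, (M.propZ true t.1 * M.avgZ h true t.1) • nuAt M c w f η₁ t ∂M.base
        + (∫ t, M.avgS h (t.2.1, true, t.1) • nuAt M c w f η₁ t ∂M.base
        - ∫ t, (M.avgZ h true t.1 • nuAt M c w f η₁ t
          - M.dotF h true t.2.1 t.1 • nuU M c w f η₁ t) ∂M.base)
        + ∫ t, M.dotMu h t.2.1 t.1 • outcomeAt M c w f η₁ t ∂M.base := by
    have x1 : Integrable (fun u => h (ObsModel.obsOf true u) • M.propZ true u.1.1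
          • ell1 M c w f η₁ u.1.1
        + h (ObsModel.obsOf true u) • ((M.p true u.1.2 u.1.1)⁻¹
          • (∫ s, nuAt M c w f η₁ (u.1.1, u.1.2, s)) - resid1 M c w f η₁ u.1)) (M.full true) :=
      a1.add m1
    rw [← o3, ← m3, ← m2, ← e3, ← a3, ← integral_add a1 m1, ← integral_add x1 o1]
    refine integral_congr_ae (ae_of_all _ fun u => ?_)
    simp only
    rw [smul_comm (M.propZ true u.1.1), propZ_smul_D_true, smul_add, smul_add]
  have hfalse : ∫ u, M.propZ false u.1.1 • h (ObsModel.obsOf false u)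
        • D M c w f η₁ (ObsModel.obsOf false u) ∂(M.full false)
      = ∫ t, (M.propZ false t.1 * M.avgZ h false t.1) • nuAt M c w f η₁ t ∂M.base
        + (∫ t, M.avgS h (t.2.2, false, t.1) • nuAt M c w f η₁ t ∂M.base
        - ∫ t, (M.avgZ h false t.1 • nuAt M c w f η₁ t
          - M.dotF h false t.2.2 t.1 • nuV M c w f η₁ t) ∂M.base) := by
    rw [← n3, ← n2, ← g3, ← b3, ← integral_add b1 n1]
    refine integral_congr_ae (ae_of_all _ fun u => ?_)
    simp only
    rw [smul_comm (M.propZ false u.1.1), propZ_smul_D_false, smul_add]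
  have y1 : Integrable (fun t => M.avgS h (t.2.1, true, t.1) • nuAt M c w f η₁ t
      - (M.avgZ h true t.1 • nuAt M c w f η₁ t
        - M.dotF h true t.2.1 t.1 • nuU M c w f η₁ t)) M.base := i2.sub k2
  have y2 : Integrable (fun t => (M.propZ true t.1 * M.avgZ h true t.1) • nuAt M c w f η₁ t
      + (M.avgS h (t.2.1, true, t.1) • nuAt M c w f η₁ t
        - (M.avgZ h true t.1 • nuAt M c w f η₁ t
          - M.dotF h true t.2.1 t.1 • nuU M c w f η₁ t))) M.base := e2.add y1
  have y3 : Integrable (fun t => (M.propZ true t.1 * M.avgZ h true t.1) • nuAt M c w f η₁ t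
      + (M.avgS h (t.2.1, true, t.1) • nuAt M c w f η₁ t
        - (M.avgZ h true t.1 • nuAt M c w f η₁ t
          - M.dotF h true t.2.1 t.1 • nuU M c w f η₁ t))
      + M.dotMu h t.2.1 t.1 • outcomeAt M c w f η₁ t) M.base := y2.add o2
  have y4 : Integrable (fun t => M.avgS h (t.2.2, false, t.1) • nuAt M c w f η₁ t
      - (M.avgZ h false t.1 • nuAt M c w f η₁ t
        - M.dotF h false t.2.2 t.1 • nuV M c w f η₁ t)) M.base := j2.sub l2
  have y5 : Integrable (fun t => (M.propZ false t.1 * M.avgZ h false t.1) • nuAt M c w f η₁ t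
      + (M.avgS h (t.2.2, false, t.1) • nuAt M c w f η₁ t
        - (M.avgZ h false t.1 • nuAt M c w f η₁ t
          - M.dotF h false t.2.2 t.1 • nuV M c w f η₁ t))) M.base := g2.add y4
  -- Each arm of `D` has been matched with its group of terms, so linearity of the integral
  -- finishes.
  rw [M.integral_law_eq hhD, htrue, hfalse, integral_congr_ae (hr.dotScore_ae_eq h),
    integral_add y3 y5, integral_add y2 o2, integral_add e2 y1, integral_sub i2 k2,
    integral_add g2 y4, integral_sub j2 l2]

end IsRegular

/-! ### From the stated regularity conditions to their working form -/

theorem ObsModel.absMean1_eq {𝒳 : Type*} [MeasurableSpace 𝒳] (M : ObsModel 𝒳) {s : ℝ} {x : 𝒳}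
    (hi : Integrable (fun y : ℝ => y) (M.κ (s, true, x))) :
    M.absMean1 s x = ENNReal.ofReal (M.absMu s x) :=
  (ofReal_integral_norm_eq_lintegral_enorm hi).symm

theorem RegularityConditions.exists_isRegular {𝒳 : Type*} [MeasurableSpace 𝒳]
    {q : ℕ} {M : ObsModel 𝒳} {C : Copula} {c w : ℝ → ℝ → ℝ}
    {f : ℝ → ℝ → EuclideanSpace ℝ (Fin q) → ℝ} {η₁ : EuclideanSpace ℝ (Fin q)}
    (hreg : RegularityConditions M c w f η₁) (hc : IsCopulaDensity C c)
    (hout : ∀ᵐ t ∂(M.jointXS true), Integrable (fun y : ℝ => y) (M.outcome true t))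
    (hw_meas : Measurable (Function.uncurry w)) (hw : ∀ s1 s0, 0 ≤ w s1 s0)
    (hf_meas : ∀ η, Measurable fun s : ℝ × ℝ => f s.1 s.2 η) :
    ∃ r δ b cbar, IsRegular M c w f η₁ r δ b cbar := by
  obtain ⟨r, δ, b, cbar, hr, hδ, hδ1, hb, hcbar, hf, hfb, hcs, hcb, hint⟩ := hreg
  have hb0 : ∀ s1 s0, 0 ≤ b s1 s0 := fun s1 s0 =>
    (norm_nonneg _).trans (hfb s1 s0 η₁ (Metric.mem_ball_self hr) 0 (by norm_num))
  refine ⟨r, δ, b, cbar, hr, ⟨hδ, hδ1, hcs, hc.nonneg, hcb⟩, hc.measurable, hw_meas, hb, hw,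
    hf_meas, hf, hfb, hout, ?_⟩
  have hl : Measurable fun t : 𝒳 × ℝ × ℝ => (t.1, t.2.1) := by fun_prop
  have hr : Measurable fun t : 𝒳 × ℝ × ℝ => (t.1, t.2.2) := by fun_prop
  have hcm : Measurable fun t : 𝒳 × ℝ × ℝ => cbar (M.F true t.2.1 t.1) (M.F false t.2.2 t.1) :=
    hcbar.comp (((M.measurable_F true).comp hl).prodMk ((M.measurable_F false).comp hr))
  have hwm : Measurable fun t : 𝒳 × ℝ × ℝ => w t.2.1 t.2.2 := hw_meas.comp measurable_snd
  have hbm : Measurable fun t : 𝒳 × ℝ × ℝ => b t.2.1 t.2.2 := hb.comp measurable_snd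
  have hm : Measurable fun t => M.envK cbar w t * (b t.2.1 t.2.2 + M.absMu t.2.1 t.1) ^ 2 :=
    ((hwm.mul hcm).mul (((M.measurable_p_swap true).comp hl).mul
      ((M.measurable_p_swap false).comp hr))).mul
      ((hbm.add (M.measurable_absMu.comp hl)).pow_const 2)
  refine ⟨hm.aestronglyMeasurable, lt_of_le_of_lt ?_ hint⟩
  calc ∫⁻ t, ‖M.envK cbar w t * (b t.2.1 t.2.2 + M.absMu t.2.1 t.1) ^ 2‖ₑ ∂M.base
      ≤ ∫⁻ t : 𝒳 × ℝ × ℝ, ENNReal.ofReal (w t.2.1 t.2.2)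
        * (ENNReal.ofReal (b t.2.1 t.2.2) + M.absMean1 t.2.1 t.1) ^ 2
        * ENNReal.ofReal (cbar (M.F true t.2.1 t.1) (M.F false t.2.2 t.1))
        * ENNReal.ofReal (M.p true t.2.1 t.1 * M.p false t.2.2 t.1) ∂M.base := by
        refine lintegral_mono_ae ?_
        filter_upwards [M.ae_isInterior hout] with t ht
        by_cases hp : M.p true t.2.1 t.1 * M.p false t.2.2 t.1 = 0
        · simp [M.envK_eq_zero hp]
        have hi := ht hp
        have hpn : 0 ≤ M.p true t.2.1 t.1 * M.p false t.2.2 t.1 :=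
          mul_nonneg (M.p_nonneg _ _ _) (M.p_nonneg _ _ _)
        have hu : 0 ≤ M.F true t.2.1 t.1 * (1 - M.F true t.2.1 t.1) :=
          mul_nonneg hi.left.1.le (by linarith [hi.left.2])
        have hv : 0 ≤ M.F false t.2.2 t.1 * (1 - M.F false t.2.2 t.1) :=
          mul_nonneg hi.right.1.le (by linarith [hi.right.2])
        have hcb0 : 0 ≤ cbar (M.F true t.2.1 t.1) (M.F false t.2.2 t.1) :=
          (mul_nonneg hu (abs_nonneg _)).trans (hcb _ hi.left _ hi.right _ _
            (by rw [sub_self, abs_zero]; positivity) (by rw [sub_self, abs_zero]; positivity)).2.1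
        have hba : 0 ≤ b t.2.1 t.2.2 + M.absMu t.2.1 t.1 :=
          add_nonneg (hb0 _ _) (M.absMu_nonneg _ _)
        rw [ObsModel.envK, M.absMean1_eq hi.outcome, ← ENNReal.ofReal_add (hb0 _ _) (M.absMu_nonneg _ _),
          ← ENNReal.ofReal_pow hba, ← ENNReal.ofReal_mul (hw _ _), ← ENNReal.ofReal_mul
            (mul_nonneg (hw _ _) (by positivity)), ← ENNReal.ofReal_mul
            (mul_nonneg (mul_nonneg (hw _ _) (by positivity)) hcb0), Real.enorm_of_nonneg
            (mul_nonneg (mul_nonneg (mul_nonneg (hw _ _) hcb0) hpn) (by positivity))]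
        refine le_of_eq (congrArg _ ?_)
        ring
    -- Only the inequality between product and iterated lower integrals is needed, so measurability
    -- of the integrand plays no role.
    _ ≤ _ := (lintegral_prod_le _).trans (lintegral_mono fun x => lintegral_prod_le _)

/-- For the constant function `1` all averages are `1` and the centered derivatives vanish. This
converts the representation of the derivative into a formula for the mean of `D`. -/
theorem ObsModel.dotScore_one {𝒳 : Type*} [MeasurableSpace 𝒳] {q : ℕ} (M : ObsModel 𝒳)
    (c w : ℝ → ℝ → ℝ) (f : ℝ → ℝ → EuclideanSpace ℝ (Fin q) → ℝ) (η : EuclideanSpace ℝ (Fin q))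
    (t : 𝒳 × ℝ × ℝ) : IsRegular.dotScore M c w f η (fun _ => 1) t
      = (w t.2.1 t.2.2 * M.e c t.2.1 t.2.2 t.1 * (M.mu1 t.2.1 t.1 - f t.2.1 t.2.2 η))
        • gradient (f t.2.1 t.2.2) η := by
  have h1 := isPerturbation_one (α := Obs 𝒳)
  have hS : ∀ t, M.avgS (fun _ => 1) t = 1 := fun t => (M.isPerturbation_avgS h1).zero t
  have hZ : ∀ z x, M.avgZ (fun _ => 1) z x = 1 := fun z x => (M.isPerturbation_avgZ h1 z).zero x
  have hX : ∀ x, M.avgX (fun _ => 1) x = 1 := fun x => (M.isPerturbation_avgX h1).zero x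
  have hF : ∀ z s x, M.dotF (fun _ => 1) z s x = 0 := fun z s x => by
    simp [dotF, hS, hZ, F]
  have hmu : ∀ s x, M.dotMu (fun _ => 1) s x = 0 := fun s x => by
    simp [dotMu, hS, mu1]
  simp only [IsRegular.dotScore, dotK, dotC, hS, hZ, hX, hF, hmu, e]
  congr 1
  ring

/-! ### The projection objective, its minimizers and the matrix `H1` -/

section objective

variable {𝒳 : Type*} [MeasurableSpace 𝒳] {q : ℕ} {Q : Measure (FullData 𝒳)} {w b : ℝ → ℝ → ℝ}
  {f : ℝ → ℝ → EuclideanSpace ℝ (Fin q) → ℝ} {η₁ η η' : EuclideanSpace ℝ (Fin q)} {r : ℝ}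

theorem loss_nonneg (hw : ∀ s1 s0, 0 ≤ w s1 s0) :
    0 ≤ ∫ ω, w (S1 ω) (S0 ω) * (m1 Q ω - f (S1 ω) (S0 ω) η) ^ 2 ∂Q :=
  integral_nonneg fun _ => mul_nonneg (hw _ _) (sq_nonneg _)

/-- The extended-valued objective may be infinite far from `η₁`; on the ball of domination it is a
finite integral, and only there is it differentiated. -/
theorem objective_eq (h : LeastSquaresData Q (fun ω => w (S1 ω) (S0 ω)) (m1 Q)
    (fun ω => b (S1 ω) (S0 ω)) (fun ω => f (S1 ω) (S0 ω)) η₁ r) (hw : ∀ s1 s0, 0 ≤ w s1 s0)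
    (hη : η ∈ Metric.ball η₁ r) : objective Q w f η
      = ENNReal.ofReal (∫ ω, w (S1 ω) (S0 ω) * (m1 Q ω - f (S1 ω) (S0 ω) η) ^ 2 ∂Q) :=
  (ofReal_integral_eq_lintegral_ofReal (h.integrable_loss hη)
    (ae_of_all _ fun _ => mul_nonneg (hw _ _) (sq_nonneg _))).symm

theorem objective_toReal_eventuallyEq (h : LeastSquaresData Q (fun ω => w (S1 ω) (S0 ω)) (m1 Q)
    (fun ω => b (S1 ω) (S0 ω)) (fun ω => f (S1 ω) (S0 ω)) η₁ r) (hw : ∀ s1 s0, 0 ≤ w s1 s0)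
    (hr : 0 < r) : (fun η => (objective Q w f η).toReal) =ᶠ[𝓝 η₁]
      fun η => ∫ ω, w (S1 ω) (S0 ω) * (m1 Q ω - f (S1 ω) (S0 ω) η) ^ 2 ∂Q := by
  filter_upwards [Metric.ball_mem_nhds η₁ hr] with η hη
  rw [objective_eq h hw hη, ENNReal.toReal_ofReal (loss_nonneg hw)]

theorem IsProjection.loss_le (h : LeastSquaresData Q (fun ω => w (S1 ω) (S0 ω)) (m1 Q)
    (fun ω => b (S1 ω) (S0 ω)) (fun ω => f (S1 ω) (S0 ω)) η₁ r) (hw : ∀ s1 s0, 0 ≤ w s1 s0)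
    {K : Set (EuclideanSpace ℝ (Fin q))} (hp : IsProjection Q w f K η) (hη : η ∈ Metric.ball η₁ r)
    (hη' : η' ∈ K ∩ Metric.ball η₁ r) :
    ∫ ω, w (S1 ω) (S0 ω) * (m1 Q ω - f (S1 ω) (S0 ω) η) ^ 2 ∂Q
      ≤ ∫ ω, w (S1 ω) (S0 ω) * (m1 Q ω - f (S1 ω) (S0 ω) η') ^ 2 ∂Q := by
  by_cases he : η' = η
  · rw [he]
  have h1 := (hp.2 η' hη'.1 he).le
  rwa [objective_eq h hw hη, objective_eq h hw hη'.2,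
    ENNReal.ofReal_le_ofReal_iff (loss_nonneg hw)] at h1

theorem H1_eq (h : LeastSquaresData Q (fun ω => w (S1 ω) (S0 ω)) (m1 Q)
    (fun ω => b (S1 ω) (S0 ω)) (fun ω => f (S1 ω) (S0 ω)) η₁ r) (hη : η ∈ Metric.ball η₁ r)
    (i j : Fin q) : H1 Q w f η i j
      = (∫ ω, w (S1 ω) (S0 ω) • residualHess (m1 Q ω) (f (S1 ω) (S0 ω)) η ∂Q)
        (EuclideanSpace.single i 1) j :=
  (h.integral_hess_apply hη i j).symm

theorem H1_isHermitian (h : LeastSquaresData Q (fun ω => w (S1 ω) (S0 ω)) (m1 Q)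
    (fun ω => b (S1 ω) (S0 ω)) (fun ω => f (S1 ω) (S0 ω)) η₁ r) (hη : η ∈ Metric.ball η₁ r) :
    (H1 Q w f η).IsHermitian := by
  ext i j
  simp only [Matrix.conjTranspose_apply, star_trivial, H1, Matrix.of_apply]
  congr 1
  funext ω
  rw [hessian_symm (h.smooth ω) Metric.isOpen_ball hη i j]
  ring

/-- The matrix entries list the images of basis vectors by rows, whereas matrix-vector
multiplication needs columns; symmetry of the Hessian reconciles the two. -/
theorem toEuclideanLin_H1 (h : LeastSquaresData Q (fun ω => w (S1 ω) (S0 ω)) (m1 Q)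
    (fun ω => b (S1 ω) (S0 ω)) (fun ω => f (S1 ω) (S0 ω)) η₁ r) (hη : η ∈ Metric.ball η₁ r)
    (v : EuclideanSpace ℝ (Fin q)) : Matrix.toEuclideanLin (H1 Q w f η) v
      = (∫ ω, w (S1 ω) (S0 ω) • residualHess (m1 Q ω) (f (S1 ω) (S0 ω)) η ∂Q) v := by
  set A := ∫ ω, w (S1 ω) (S0 ω) • residualHess (m1 Q ω) (f (S1 ω) (S0 ω)) η ∂Q
  have hv : v = ∑ i, v i • EuclideanSpace.single i (1 : ℝ) := by
    simpa using ((EuclideanSpace.basisFun (Fin q) ℝ).sum_repr v).symm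
  have hsymm := H1_isHermitian h hη
  ext j
  conv_rhs => rw [hv, map_sum]
  simp only [map_smul, WithLp.ofLp_sum, WithLp.ofLp_smul, Finset.sum_apply, Pi.smul_apply,
    smul_eq_mul, A, ← H1_eq h hη]
  rw [Matrix.toLpLin_apply]
  change ∑ i, H1 Q w f η j i * v i = _
  refine Finset.sum_congr rfl fun i _ => ?_
  rw [← hsymm.apply i j, star_trivial, mul_comm]

theorem toEuclideanLin_inv_apply {H : Matrix (Fin q) (Fin q) ℝ} (hH : IsUnit H.det)
    (v : EuclideanSpace ℝ (Fin q)) :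
    Matrix.toEuclideanLin H⁻¹ (Matrix.toEuclideanLin H v) = v := by
  simp [Matrix.toLpLin_apply, Matrix.mulVec_mulVec, Matrix.nonsing_inv_mul _ hH]

/-- The second derivative of the projection objective. -/
theorem contDiffAt_objective (h : LeastSquaresData Q (fun ω => w (S1 ω) (S0 ω)) (m1 Q)
    (fun ω => b (S1 ω) (S0 ω)) (fun ω => f (S1 ω) (S0 ω)) η₁ r) (hw : ∀ s1 s0, 0 ≤ w s1 s0)
    (hr : 0 < r) : ContDiffAt ℝ 2 (fun η => (objective Q w f η).toReal) η₁ ∧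
      hessian (fun η => (objective Q w f η).toReal) η₁ = (2 : ℝ) • H1 Q w f η₁ := by
  have heq := objective_toReal_eventuallyEq h hw hr
  refine ⟨(h.contDiffOn_integral_loss.contDiffAt (Metric.ball_mem_nhds η₁ hr)).congr_of_eventuallyEq
    heq, ?_⟩
  ext i j
  rw [Matrix.smul_apply, H1_eq h (Metric.mem_ball_self hr), smul_eq_mul,
    ← h.hessian_integral_loss (Metric.mem_ball_self hr)]
  simp only [hessian, Matrix.of_apply]
  rw [(heq.iteratedFDeriv ℝ 2).self_of_nhds]

end objective

theorem IsPerturbation.zero_eq {α : Type*} [MeasurableSpace α] {L : ℝ → α → ℝ} {s : α → ℝ}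
    {δ B : ℝ} (h : IsPerturbation L s δ B) : L 0 = fun _ => 1 := funext h.zero

/-- A regular submodel is given by a perturbation of the likelihood ratio. -/
theorem IsRegularSubmodel.exists_isPerturbation {V : Type*} [MeasurableSpace V] {P : Measure V}
    {Pθ : ℝ → Measure V} {s : V → ℝ} (h : IsRegularSubmodel P Pθ s) :
    ∃ (L : ℝ → V → ℝ) (δ B : ℝ), IsPerturbation L s δ B ∧
      ∀ᶠ θ in 𝓝 0, Pθ θ = P.withDensity fun v => ENNReal.ofReal (L θ v) := by
  obtain ⟨L, δ, B, hδ, hL, hd⟩ := h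
  refine ⟨L, δ, B, ⟨hδ, fun θ hθ => (hL θ hθ).2.1, fun θ hθ => (hL θ hθ).2.2.2.2, hd⟩, ?_⟩
  filter_upwards [eventually_abs_lt hδ] with θ hθ using (hL θ hθ).2.2.2.1

/-! ### The projection parameter along submodels -/

section expected

variable {𝒳 : Type*} [MeasurableSpace 𝒳] {q : ℕ} (M : ObsModel 𝒳)
  (c w : ℝ → ℝ → ℝ) (f : ℝ → ℝ → EuclideanSpace ℝ (Fin q) → ℝ)

/-- The expected score of the projection problem at the law with likelihood ratio `L`. -/
def expScore (L : Obs 𝒳 → ℝ) (η : EuclideanSpace ℝ (Fin q)) : EuclideanSpace ℝ (Fin q) :=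
  ∫ t, (M.tiltK c w L t * (M.tiltMu L t.2.1 t.1 - f t.2.1 t.2.2 η))
    • gradient (f t.2.1 t.2.2) η ∂M.base

/-- The negative derivative of the expected score at the law with likelihood ratio `L`. -/
def expHess (L : Obs 𝒳 → ℝ) (η : EuclideanSpace ℝ (Fin q)) :
    EuclideanSpace ℝ (Fin q) →L[ℝ] EuclideanSpace ℝ (Fin q) :=
  ∫ t, M.tiltK c w L t • residualHess (M.tiltMu L t.2.1 t.1) (f t.2.1 t.2.2) η ∂M.base

end expected

namespace IsRegular

variable {𝒳 : Type*} [MeasurableSpace 𝒳] {q : ℕ} {M : ObsModel 𝒳}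
  {C : Copula} {c w : ℝ → ℝ → ℝ} {f : ℝ → ℝ → EuclideanSpace ℝ (Fin q) → ℝ}
  {η₁ : EuclideanSpace ℝ (Fin q)}
  {r δ δL B : ℝ} {b cbar : ℝ → ℝ → ℝ} {Q : Measure (FullData 𝒳)}
  {L : ℝ → Obs 𝒳 → ℝ} {sc : Obs 𝒳 → ℝ}

/-- The derivative of the root of the expected score. -/
theorem hasDerivAt_root (h : IsRegular M c w f η₁ r δ b cbar) (hL : IsPerturbation L sc δL B)
    (h0 : expScore M c w f (fun _ => 1) η₁ = 0)
    {Ainv : EuclideanSpace ℝ (Fin q) →L[ℝ] EuclideanSpace ℝ (Fin q)}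
    (hinv : ∀ v, Ainv (expHess M c w f (fun _ => 1) η₁ v) = v) {ηθ : ℝ → EuclideanSpace ℝ (Fin q)}
    (hη0 : ηθ 0 = η₁) (hcont : ContinuousAt ηθ 0)
    (hroot : ∀ᶠ θ in 𝓝 0, expScore M c w f (L θ) (ηθ θ) = 0) :
    HasDerivAt ηθ (Ainv (∫ t, dotScore M c w f η₁ sc t ∂M.base)) 0 := by
  obtain ⟨-, Φ', hΦ, hΦ'⟩ := h.hasFDerivAt_expected_score hL
  refine hasDerivAt_of_implicit (Φ := fun z => expScore M c w f (L z.1) z.2)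
    (A := expHess M c w f (L 0) η₁) hΦ hΦ' ?_ ?_ hη0 hcont hroot
  · rw [hL.zero_eq]; exact h0
  · rw [hL.zero_eq]; exact hinv

theorem tendsto_expScore (h : IsRegular M c w f η₁ r δ b cbar) (hL : IsPerturbation L sc δL B) :
    Tendsto (fun θ => expScore M c w f (L θ) η₁) (𝓝 0)
      (𝓝 (expScore M c w f (fun _ => 1) η₁)) := by
  obtain ⟨-, Φ', hΦ, -⟩ := h.hasFDerivAt_expected_score hL
  have h1 : ContinuousAt (fun θ : ℝ => (θ, η₁)) 0 := by fun_prop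
  have h2 := hΦ.continuousAt.tendsto.comp h1.tendsto
  rw [← hL.zero_eq]
  exact h2

/-- The closed balls over which the second derivative of the objective stays definite. -/
theorem exists_radius (h : IsRegular M c w f η₁ r δ b cbar) {l : ℝ} (hl : 0 < l) :
    ∃ ρ₀ : ℝ, 0 < ρ₀ ∧ ρ₀ ≤ r ∧ ∀ η ∈ Metric.ball η₁ ρ₀,
      ‖expHess M c w f (fun _ => 1) η - expHess M c w f (fun _ => 1) η₁‖ < l / 2 := by
  have h1 := h.continuousAt_expected_hess (isPerturbation_one (α := Obs 𝒳))
    (Metric.mem_ball_self h.r_pos)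
  have h2 : ContinuousAt (fun η : EuclideanSpace ℝ (Fin q) => ((0 : ℝ), η)) η₁ := by fun_prop
  have h3 : ContinuousAt (expHess M c w f fun _ => 1) η₁ :=
    ContinuousAt.comp_of_eq (f := fun η : EuclideanSpace ℝ (Fin q) => ((0 : ℝ), η))
      (g := fun z : ℝ × EuclideanSpace ℝ (Fin q) => expHess M c w f (fun _ => 1) z.2) h1 h2 rfl
  obtain ⟨ε, hε, hε'⟩ := Metric.continuousAt_iff.1 h3 (l / 2) (by positivity)
  refine ⟨min ε r, lt_min hε h.r_pos, min_le_right _ _, fun η hη => ?_⟩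
  rw [← dist_eq_norm]
  exact hε' (lt_of_lt_of_le hη (min_le_left _ _))

/-- Joint continuity gives the bound near each point of `{0} × K`; compactness makes it uniform over
`K` for all small `θ`. -/
theorem eventually_norm_expHess_sub_lt (h : IsRegular M c w f η₁ r δ b cbar)
    (hL : IsPerturbation L sc δL B) {l : ℝ} {K : Set (EuclideanSpace ℝ (Fin q))}
    (hK : IsCompact K) (hKr : K ⊆ Metric.ball η₁ r)
    (hKl : ∀ η ∈ K, ‖expHess M c w f (fun _ => 1) η - expHess M c w f (fun _ => 1) η₁‖ < l / 2) :
    ∀ᶠ θ in 𝓝 0, ∀ η ∈ K,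
      ‖expHess M c w f (L θ) η - expHess M c w f (fun _ => 1) η₁‖ < l / 2 := by
  refine hK.eventually_forall_of_forall_eventually fun η hη => ?_
  have h1 : ContinuousAt (fun z : ℝ × EuclideanSpace ℝ (Fin q) =>
      ‖expHess M c w f (L z.1) z.2 - expHess M c w f (fun _ => 1) η₁‖) (0, η) :=
    ((h.continuousAt_expected_hess hL (hKr hη)).sub continuousAt_const).norm
  refine h1.eventually_lt_const ?_
  simp only [hL.zero_eq]
  exact hKl η hη

/-- The representation identity applied to the constant function `1`; the mean of `D` is the left
side of the normal equation. -/
theorem integral_D_eq_expScore (h : IsRegular M c w f η₁ r δ b cbar)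
    (hD : Integrable (D M c w f η₁) M.law) :
    ∫ v, D M c w f η₁ v ∂M.law = expScore M c w f (fun _ => 1) η₁ := by
  have h1 := h.integral_smul_D (h := fun _ => 1) (B := 1) measurable_const (by simp) hD
  simp only [one_smul] at h1
  have hp := isPerturbation_one (α := Obs 𝒳)
  rw [h1, expScore]
  congr 1
  funext t
  rw [M.dotScore_one]
  have hK : M.tiltK c w (fun _ => 1) t = w t.2.1 t.2.2 * M.e c t.2.1 t.2.2 t.1 := M.tiltK_zero hp t
  have hmu : M.tiltMu (fun _ => 1) t.2.1 t.1 = M.mu1 t.2.1 t.1 := M.tiltMu_zero hp _ _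
  rw [hK, hmu]

variable [StandardBorelSpace 𝒳] [IsProbabilityMeasure Q] {ℓ : Obs 𝒳 → ℝ} {ε : ℝ}
  {η : EuclideanSpace ℝ (Fin q)}

/-- At a projection parameter in the interior of the parameter space, the expected score
vanishes. -/
theorem expScore_eq_zero (h : IsRegular M c w f η₁ r δ b cbar) (hc : IsCopulaDensity C c)
    (hQ : IsCausalModel C Q) (hM : Q.map observe = M.law.withDensity fun v => ENNReal.ofReal (ℓ v))
    (hm : Measurable ℓ) (hb : ∀ v, |ℓ v - 1| ≤ ε) (hε : 4 * ε ≤ δ)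
    {K : Set (EuclideanSpace ℝ (Fin q))} (hK : K ∈ 𝓝 η) (hη : η ∈ Metric.ball η₁ r)
    (hp : IsProjection Q w f K η) : expScore M c w f ℓ η = 0 ∧
      ∀ v, 0 ≤ inner ℝ (expHess M c w f ℓ η v) v := by
  have hlsd := h.leastSquaresData_full hc hQ hM hm hb hε
  have h1 := necessary_conditions (U := K ∩ Metric.ball η₁ r)
    (A := fun η => ∫ ω, w (S1 ω) (S0 ω) • residualHess (m1 Q ω) (f (S1 ω) (S0 ω)) η ∂Q)
    (inter_mem hK (Metric.isOpen_ball.mem_nhds hη))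
    (fun η' hη' => hlsd.hasGradientAt_integral_loss hη'.2) (hlsd.hasFDerivAt_integral_score hη)
    (fun η' hη' => hp.loss_le hlsd h.w_nonneg hη hη')
  simp only [h.integral_score_full hc hQ hM hm hb hε hη,
    h.integral_hess_full hc hQ hM hm hb hε hη] at h1
  exact h1

/-- Existence of the projection parameter over a compact convex set, near the reference law. -/
theorem exists_isProjection (h : IsRegular M c w f η₁ r δ b cbar) (hc : IsCopulaDensity C c)
    (hQ : IsCausalModel C Q) (hM : Q.map observe = M.law.withDensity fun v => ENNReal.ofReal (ℓ v))
    (hm : Measurable ℓ) (hb : ∀ v, |ℓ v - 1| ≤ ε) (hε : 4 * ε ≤ δ)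
    {K : Set (EuclideanSpace ℝ (Fin q))} (hK : IsCompact K) (hKc : Convex ℝ K)
    (hKr : K ⊆ Metric.ball η₁ r) (hη₁ : η₁ ∈ K) {l : ℝ} (hl : 0 < l)
    (hA : ∀ η ∈ K, ∀ v, l * ‖v‖ ^ 2 ≤ inner ℝ (expHess M c w f ℓ η v) v) :
    ∃ η, IsProjection Q w f K η ∧ ‖η - η₁‖ ≤ 2 / l * ‖expScore M c w f ℓ η₁‖ := by
  have hlsd := h.leastSquaresData_full hc hQ hM hm hb hε
  obtain ⟨η, hη, hmin, hbound⟩ := exists_unique_minimizer (η := η₁)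
    (A := fun η => ∫ ω, w (S1 ω) (S0 ω) • residualHess (m1 Q ω) (f (S1 ω) (S0 ω)) η ∂Q) hKc hK
    (fun η' hη' => hlsd.hasGradientAt_integral_loss (hKr hη'))
    (fun η' hη' => hlsd.hasFDerivAt_integral_score (hKr hη')) hl
    (fun η' hη' v => by
      rw [h.integral_hess_full hc hQ hM hm hb hε (hKr hη')]
      exact hA η' hη' v) hη₁
  rw [h.integral_score_full hc hQ hM hm hb hε (hKr hη₁)] at hbound
  refine ⟨η, ⟨hη, fun η' hη' hne => ?_⟩, hbound⟩
  rw [objective_eq hlsd h.w_nonneg (hKr hη), objective_eq hlsd h.w_nonneg (hKr hη')]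
  exact (ENNReal.ofReal_lt_ofReal_iff_of_nonneg (loss_nonneg h.w_nonneg)).2 (hmin η' hη' hne)

/-- The local projection parameter along a regular submodel of full-data laws. -/
theorem exists_local_projection (h : IsRegular M c w f η₁ r δ b cbar) (hc : IsCopulaDensity C c)
    (h0 : expScore M c w f (fun _ => 1) η₁ = 0) {l : ℝ} (hl : 0 < l)
    (hA : ∀ v, l * ‖v‖ ^ 2 ≤ inner ℝ (expHess M c w f (fun _ => 1) η₁ v) v)
    {K : Set (EuclideanSpace ℝ (Fin q))} (hK : IsCompact K) (hKc : Convex ℝ K)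
    (hKr : K ⊆ Metric.ball η₁ r) (hη₁ : η₁ ∈ K)
    (hKl : ∀ η ∈ K, ‖expHess M c w f (fun _ => 1) η - expHess M c w f (fun _ => 1) η₁‖ < l / 2)
    {Pθ : ℝ → Measure (Obs 𝒳)} (hP : IsRegularSubmodel M.law Pθ sc)
    {Qθ : ℝ → ProbabilityMeasure (FullData 𝒳)}
    (hQ : ∀ᶠ θ in 𝓝 0, IsCausalModel C (Qθ θ : Measure (FullData 𝒳)) ∧
      (Qθ θ : Measure (FullData 𝒳)).map observe = Pθ θ) :
    ∃ ηθ : ℝ → EuclideanSpace ℝ (Fin q), ηθ 0 = η₁ ∧ ContinuousAt ηθ 0 ∧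
      ∀ᶠ θ in 𝓝 0, IsProjection (Qθ θ : Measure (FullData 𝒳)) w f K (ηθ θ) := by
  classical
  obtain ⟨L, δL, B, hL, hPL⟩ := hP.exists_isPerturbation
  have hev : ∀ᶠ θ in 𝓝 0, ∃ η, IsProjection (Qθ θ : Measure (FullData 𝒳)) w f K η ∧
      ‖η - η₁‖ ≤ 2 / (l / 2) * ‖expScore M c w f (L θ) η₁‖ := by
    filter_upwards [hQ, hPL, h.eventually_close hL,
      h.eventually_norm_expHess_sub_lt hL hK hKr hKl] with θ h1 h2 h3 h4
    exact h.exists_isProjection hc h1.1 (h1.2.trans h2) h3.1 h3.2.1 h3.2.2 hK hKc hKr hη₁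
      (by positivity) fun η hη => coercive_of_norm_sub_le hA (h4 η hη).le
  have hch : ∀ θ, ∃ m, (∃ η, IsProjection (Qθ θ : Measure (FullData 𝒳)) w f K η ∧
      ‖η - η₁‖ ≤ 2 / (l / 2) * ‖expScore M c w f (L θ) η₁‖) →
      IsProjection (Qθ θ : Measure (FullData 𝒳)) w f K m ∧
      ‖m - η₁‖ ≤ 2 / (l / 2) * ‖expScore M c w f (L θ) η₁‖ := fun θ => by
    by_cases hex : ∃ η, IsProjection (Qθ θ : Measure (FullData 𝒳)) w f K η ∧
      ‖η - η₁‖ ≤ 2 / (l / 2) * ‖expScore M c w f (L θ) η₁‖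
    · exact ⟨hex.choose, fun _ => hex.choose_spec⟩
    -- The default value is irrelevant: minimizers exist for all `θ` near `0`.
    · exact ⟨η₁, fun he => absurd he hex⟩
  choose ηθ hηθ using hch
  have hspec := hev.mono hηθ
  have hzero : ηθ 0 = η₁ := by
    -- At `θ = 0` the score vanishes at `η₁`, so the distance bound forces the minimizer to be `η₁`;
    -- the same bound gives continuity.
    have h1 := hspec.self_of_nhds.2
    rw [hL.zero_eq, h0, norm_zero, mul_zero] at h1
    exact sub_eq_zero.1 (norm_le_zero_iff.1 h1)
  refine ⟨ηθ, hzero, ?_, hspec.mono fun θ hθ => hθ.1⟩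
  rw [ContinuousAt, hzero, tendsto_iff_norm_sub_tendsto_zero]
  have hlim := (h.tendsto_expScore hL).norm.const_mul (2 / (l / 2))
  rw [h0, norm_zero, mul_zero] at hlim
  exact squeeze_zero' (Eventually.of_forall fun _ => norm_nonneg _)
    (hspec.mono fun θ hθ => hθ.2) hlim

/-- The efficient influence function of the projection parameter. -/
theorem isEIF (h : IsRegular M c w f η₁ r δ b cbar) (hc : IsCopulaDensity C c)
    (h0 : expScore M c w f (fun _ => 1) η₁ = 0)
    {Ainv : EuclideanSpace ℝ (Fin q) →L[ℝ] EuclideanSpace ℝ (Fin q)}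
    (hinv : ∀ v, Ainv (expHess M c w f (fun _ => 1) η₁ v) = v)
    (hD : MemLp (D M c w f η₁) 2 M.law) {K : Set (EuclideanSpace ℝ (Fin q))} (hK : K ∈ 𝓝 η₁)
    (hval : IsProjectionParameter C w f K M.law η₁) :
    IsEIF (IsProjectionParameter C w f K) M.law η₁ (fun v => Ainv (D M c w f η₁ v)) := by
  have hDi : Integrable (D M c w f η₁) M.law := hD.integrable (by norm_num)
  have hφ : MemLp (fun v => Ainv (D M c w f η₁ v)) 2 M.law := Ainv.comp_memLp' hD
  have hmean : ∫ v, Ainv (D M c w f η₁ v) ∂M.law = 0 := by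
    rw [Ainv.integral_comp_comm hDi, h.integral_D_eq_expScore hDi, h0, map_zero]
  refine ⟨hval, hφ, hmean, fun i => ?_, fun Pθ s hP ηθ hη0 hcont hψ => ?_⟩
  · let pr : EuclideanSpace ℝ (Fin q) →L[ℝ] ℝ := EuclideanSpace.proj i
    have hφi : MemLp (fun v => Ainv (D M c w f η₁ v) i) 2 M.law := pr.comp_memLp' hφ
    refine ⟨hφi.toLp _, mem_tangentSpace_of_integral_eq_zero _ ?_, hφi.coeFn_toLp⟩
    rw [integral_congr_ae hφi.coeFn_toLp]
    have h1 := pr.integral_comp_comm (hφ.integrable (by norm_num))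
    rw [hmean, map_zero] at h1
    exact h1
  · obtain ⟨L, δL, B, hL, hPL⟩ := hP.exists_isPerturbation
    -- Continuity keeps the parameter in the interior of `K` and in the ball of domination, so the
    -- first order condition applies. The full-data law may be a different one for each `θ`; the
    -- score sees only the observed law.
    have hroot : ∀ᶠ θ in 𝓝 0, expScore M c w f (L θ) (ηθ θ) = 0 := by
      rw [← hη0] at hK
      have hr : Metric.ball η₁ r ∈ 𝓝 (ηθ 0) := by
        rw [hη0]; exact Metric.ball_mem_nhds η₁ h.r_pos
      filter_upwards [hψ, hPL, h.eventually_close hL, hcont.eventually hr,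
        hcont.eventually (eventually_mem_nhds_iff.2 hK)] with θ h1 h2 h3 h4 h5
      obtain ⟨Q', hQ', hQP, hproj⟩ := h1
      exact (h.expScore_eq_zero hc hQ' (hQP.trans h2) h3.1 h3.2.1 h3.2.2 h5 h4 hproj).1
    have hd := h.hasDerivAt_root hL h0 hinv hη0 hcont hroot
    rw [← h.integral_smul_D hL.measurable_score hL.abs_score_le hDi] at hd
    refine hd.congr_deriv ?_
    rw [← Ainv.integral_comp_comm (integrable_bounded_smul hDi
      hL.measurable_score.aestronglyMeasurable (ae_of_all _ hL.abs_score_le))]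
    simp only [map_smul]

end IsRegular

end ProjEIF

end

/-! ### Assembly -/

theorem theorem3 {𝒳 : Type*} [MeasurableSpace 𝒳] [StandardBorelSpace 𝒳] {q : ℕ}
    -- the known copula and its density
    (C : ProjEIF.Copula) (c : ℝ → ℝ → ℝ) (hc : ProjEIF.IsCopulaDensity C c)
    -- the true full-data law, in the causal model
    (Q : Measure (ProjEIF.FullData 𝒳)) [IsProbabilityMeasure Q] (hQ : ProjEIF.IsCausalModel C Q)
    -- the true observed-data law, with its factorization
    (M : ProjEIF.ObsModel 𝒳) (hM : Q.map ProjEIF.observe = M.law)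
    -- the weight function and the working model
    (w : ℝ → ℝ → ℝ) (hw_meas : Measurable (Function.uncurry w)) (hw : ∀ s1 s0, 0 ≤ w s1 s0)
    (f : ℝ → ℝ → EuclideanSpace ℝ (Fin q) → ℝ)
    (hf_meas : ∀ η, Measurable fun s : ℝ × ℝ => f s.1 s.2 η)
    -- the projection parameter
    (η₁ : EuclideanSpace ℝ (Fin q)) (hη₁ : ProjEIF.IsProjection Q w f Set.univ η₁)
    -- regularity
    (hreg : ProjEIF.RegularityConditions M c w f η₁)
    (hH : IsUnit (ProjEIF.H1 Q w f η₁).det)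
    (hD : MemLp (ProjEIF.D M c w f η₁) 2 M.law) :
    -- `2 H₁` is the Hessian at `η₁` of the projection objective
    (ContDiffAt ℝ 2 (fun η => (ProjEIF.objective Q w f η).toReal) η₁ ∧
      ProjEIF.hessian (fun η => (ProjEIF.objective Q w f η).toReal) η₁
        = (2 : ℝ) • ProjEIF.H1 Q w f η₁) ∧
    -- the efficient influence function of the projection parameter
    ProjEIF.IsEIF (ProjEIF.IsProjectionParameter C w f Set.univ) M.law η₁
      (fun v => Matrix.toEuclideanLin (ProjEIF.H1 Q w f η₁)⁻¹ (ProjEIF.D M c w f η₁ v)) ∧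
    -- the same for minimization over small closed balls around `η₁`, where the parameter exists
    -- along every regular submodel of full-data laws
    ∃ ρ₀ : ℝ, 0 < ρ₀ ∧ ∀ ρ : ℝ, 0 < ρ → ρ < ρ₀ →
      ProjEIF.IsEIF (ProjEIF.IsProjectionParameter C w f (Metric.closedBall η₁ ρ)) M.law η₁
        (fun v => Matrix.toEuclideanLin (ProjEIF.H1 Q w f η₁)⁻¹ (ProjEIF.D M c w f η₁ v)) ∧
      ∀ (Pθ : ℝ → Measure (ProjEIF.Obs 𝒳)) (s : ProjEIF.Obs 𝒳 → ℝ),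
        ProjEIF.IsRegularSubmodel M.law Pθ s →
        ∀ Qθ : ℝ → ProbabilityMeasure (ProjEIF.FullData 𝒳),
          (∀ᶠ θ in 𝓝 0, ProjEIF.IsCausalModel C (Qθ θ : Measure (ProjEIF.FullData 𝒳)) ∧
            (Qθ θ : Measure (ProjEIF.FullData 𝒳)).map ProjEIF.observe = Pθ θ) →
          ∃ ηθ : ℝ → EuclideanSpace ℝ (Fin q), ηθ 0 = η₁ ∧ ContinuousAt ηθ 0 ∧
            ∀ᶠ θ in 𝓝 0, ProjEIF.IsProjection (Qθ θ : Measure (ProjEIF.FullData 𝒳)) w f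
              (Metric.closedBall η₁ ρ) (ηθ θ) := by
  obtain ⟨r, δ, b, cbar, h⟩ := hreg.exists_isRegular hc
    (ProjEIF.ae_integrable_outcome hQ hM) hw_meas hw hf_meas
  have hr := Metric.mem_ball_self (x := η₁) h.r_pos
  -- The reference law is treated as the tilt with likelihood ratio `1` and `ε = 0`, so the general
  -- lemmas apply to it.
  have hM1 : Q.map ProjEIF.observe = M.law.withDensity fun _ => ENNReal.ofReal 1 := by
    rw [hM, ENNReal.ofReal_one]
    exact withDensity_one.symm
  have hm1 : Measurable fun _ : ProjEIF.Obs 𝒳 => (1 : ℝ) := measurable_const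
  have hb1 : ∀ v : ProjEIF.Obs 𝒳, |(fun _ => 1 : ProjEIF.Obs 𝒳 → ℝ) v - 1| ≤ 0 := by simp
  have hε : 4 * (0 : ℝ) ≤ δ := by linarith [h.copula.pos]
  have hlsd := h.leastSquaresData_full hc hQ hM1 hm1 hb1 hε
  obtain ⟨h0, hpos⟩ := h.expScore_eq_zero hc hQ hM1 hm1 hb1 hε Filter.univ_mem hr hη₁
  have hA : ∀ v, ProjEIF.expHess M c w f (fun _ => 1) η₁ v
      = Matrix.toEuclideanLin (ProjEIF.H1 Q w f η₁) v := fun v => by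
    rw [ProjEIF.toEuclideanLin_H1 hlsd hr, h.integral_hess_full hc hQ hM1 hm1 hb1 hε hr,
      ProjEIF.expHess]
  have hinv : ∀ v, (Matrix.toEuclideanLin (ProjEIF.H1 Q w f η₁)⁻¹).toContinuousLinearMap
      (ProjEIF.expHess M c w f (fun _ => 1) η₁ v) = v := fun v => by
    rw [hA]
    exact ProjEIF.toEuclideanLin_inv_apply hH v
  have hsymm : ∀ u v, inner ℝ (ProjEIF.expHess M c w f (fun _ => 1) η₁ u) v
      = inner ℝ (ProjEIF.expHess M c w f (fun _ => 1) η₁ v) u := fun u v => by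
    rw [hA, hA, Matrix.isSymmetric_toEuclideanLin_iff.2 (ProjEIF.H1_isHermitian hlsd hr) u v,
      real_inner_comm]
  -- The second order condition at the global minimizer gives semidefiniteness only; invertibility
  -- of `H1` upgrades it to coercivity.
  obtain ⟨l, hl, hcoer⟩ := ProjEIF.exists_coercive hsymm hpos fun v hv => by
    rw [← hinv v, hv, map_zero]
  refine ⟨ProjEIF.contDiffAt_objective hlsd hw h.r_pos,
    h.isEIF hc h0 hinv hD Filter.univ_mem ⟨⟨Q, inferInstance⟩, hQ, hM, hη₁⟩, ?_⟩
  obtain ⟨ρ₀, hρ₀, hρr, hρ⟩ := h.exists_radius hl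
  refine ⟨ρ₀, hρ₀, fun ρ hρ0 hρ1 => ⟨h.isEIF hc h0 hinv hD (Metric.closedBall_mem_nhds η₁ hρ0)
    ⟨⟨Q, inferInstance⟩, hQ, hM, Metric.mem_closedBall_self hρ0.le,
      fun η' _ hne => hη₁.2 η' (mem_univ _) hne⟩, fun Pθ s hP Qθ hQθ => ?_⟩⟩
  exact h.exists_local_projection hc h0 hl hcoer (isCompact_closedBall η₁ ρ)
    (convex_closedBall η₁ ρ) (Metric.closedBall_subset_ball (hρ1.trans_le hρr))
    (Metric.mem_closedBall_self hρ0.le)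
    (fun η hη => hρ η (Metric.closedBall_subset_ball hρ1 hη)) hP hQθ
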